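/- Let $k=\mathbb F_3$ and let $P=k[\xi_1,\xi_2,\dots]$ be the Hopf algebra of dual reduced powers at the prime $3$, with $\Delta\xi_n=\sum_{i+j=n}\xi_i\otimes\xi_j^{3^i}$ and $\xi_0=1$ (so $\xi_n$ is the antipode of Milnor's generator), and let $D=k[\xi_1]/\xi_1^3$. Let $C=\bigoplus_n\bar P^{\otimes n}$ be the normalized cobar complex of $P$, with $d[a_1|\dots|a_n]=\sum_i(-1)^{i+1}[a_1|\dots|a_i'|a_i''|\dots|a_n]$, where $\sum a_i'\otimes a_i''$ is the reduced coproduct of $a_i$, and with concatenation as product. Filter $C$ by letting $F^sC$ be the span of the words $[a_1|\dots|a_n]$ in which at least $s$ of the $a_i$ lie in $\ker(P\to D)$. Let $h_{10}=[\xi_1]$ and $b_{10}=[\xi_1|\xi_1^2]+[\xi_1^2|\xi_1]$. Let $(E_r,d_r)$ be the $b_{10}$-localized spectral sequence of this filtered complex (each page is localized at $b_{10}$); this is the $K(\xi_1)$-based Margolis–Palmieri Adams spectral sequence for $b_{10}^{-1}\operatorname{Ext}_P(k,k)$. Write $d_r:E_r^{s,t}\to E_r^{s+r,t-r+1}$,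 where $s$ is the filtration and $s+t=n$ is the cohomological degree, and $E_r^s=\bigoplus_tE_r^{s,t}$. Let $W_+\subseteq E_2$ be the sum of the $E_2^{s,t}$ with $s+t$ even. An equation between classes of $E_2$ that is asserted "in $E_r$" includes the assertion that both classes survive to $E_r$; in particular $d_r(\bar x)=\bar v$ in $E_r$, for $\bar x,\bar v\in E_2$, means that both survive to $E_r$ and the equation holds for their classes there. **Proposition.** (1) Let $r\ge2$ and $\bar x\in E_2^s$, and suppose that $d_{r'}(\bar x)=0$ for $2\le r'<r$. Let $\bar y\in W_+\cap E_2^{s+r}$ and $\bar z\in W_+\cap E_2^{s+r+4}$ be such that $$d_r(\bar x)=h_{10}\bar y\ \text{ in } E_r,\qquad d_4(\bar y)=h_{10}\bar z\ \text{ in } E_4 .$$ Then $$d_{r+4}(h_{10}\bar x)=b_{10}\bar z\ \text{ in } E_{r+4}.$$ (2) Consequently the differentials $d_2,\dots,d_8$, hence the spectral sequence through $E_9$, are determined by $d_4$ on $W_+$. Precisely: $d_r=0$ for $r=2,3,5,6,7$; every class in $E_2^s$ is uniquely of the form $\bar x+h_{10}\bar x'$ with $\bar x,\bar x'\in W_+\cap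 E_2^s$; and for $\bar x\in W_+\cap E_2^s$ one has $d_4(h_{10}\bar x)=0$; if $d_4(\bar x)=0$ then $d_8(\bar x)=0$; there is a unique $\bar y\in W_+\cap E_2^{s+4}$ with $d_4(\bar x)=h_{10}\bar y$; and if moreover $\bar z\in W_+\cap E_2^{s+8}$ and $d_4(\bar y)=h_{10}\bar z$, then $d_8(h_{10}\bar x)=b_{10}\bar z$. -/

import Mathlib

open scoped TensorProduct

noncomputable section

namespace MPASS

/-! The Hopf algebra of dual reduced powers at the prime 3. -/

/-- The ground field `k = 𝔽₃`. -/
abbrev k : Type := ZMod 3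

/-- `P = k[ξ₁, ξ₂, …]`; the variable with index `n` is `ξ_{n+1}`. -/
abbrev P : Type := MvPolynomial ℕ k

/-- The element `ξ_n`, with the convention `ξ₀ = 1`. -/
def xi : ℕ → P
  | 0 => 1
  | n + 1 => MvPolynomial.X n

/-- The coproduct `Δ ξ_n = ∑_{i+j=n} ξ_i ⊗ ξ_j^(3^i)`. (The symbol `ξ_n` denotes the antipode of
Milnor's generator.) -/
def comul : P →ₐ[k] P ⊗[k] P :=
  MvPolynomial.aeval fun n =>
    ∑ ij ∈ Finset.HasAntidiagonal.antidiagonal (n + 1),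
      xi ij.1 ⊗ₜ[k] (xi ij.2 ^ 3 ^ ij.1)

/-- The counit, `ξ_n ↦ 0` for `n ≥ 1`. -/
def counit : P →ₐ[k] k := MvPolynomial.aeval fun _ => 0

/-- The augmentation ideal `P̄`, as a `k`-vector space. -/
abbrev Pbar : Submodule k P := LinearMap.ker counit.toLinearMap

/-- The projection `p ↦ p - ε(p)` of `P` onto `P̄`. -/
def proj : P →ₗ[k] Pbar :=
  LinearMap.codRestrict Pbar
    (LinearMap.id - (Algebra.linearMap k P).comp counit.toLinearMap) fun p => by
      simp [LinearMap.mem_ker]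

lemma proj_coe (p : P) : ((proj p : Pbar) : P) = p - algebraMap k P (counit p) := rfl

/-- The kernel of the surjection of Hopf algebras `P → D = k[ξ₁]/ξ₁³`. -/
def kerD : Ideal P :=
  Ideal.span ({MvPolynomial.X 0 ^ 3} ∪ Set.range fun n : ℕ => MvPolynomial.X (n + 1))

/-! The normalized cobar complex. -/

/-- The normalized cobar complex `C = ⨁ₙ P̄^{⊗n}` with its concatenation product. -/
def Cobar : Type := TensorAlgebra k Pbar

instance : Ring Cobar := inferInstanceAs (Ring (TensorAlgebra k Pbar))
instance : Algebra k Cobar := inferInstanceAs (Algebra k (TensorAlgebra k Pbar))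

/-- The one-letter word `[a]`. -/
def letter : Pbar →ₗ[k] Cobar := TensorAlgebra.ι k

/-- `[p - ε(p)]` for `p ∈ P`; for `p ∈ P̄` this is `[p]`. -/
def bar : P →ₗ[k] Cobar := letter.comp proj

/-- The linear map `p ⊗ q ↦ [p | q]`. -/
def bar₂ : P ⊗[k] P →ₗ[k] Cobar := (LinearMap.mul' k Cobar).comp (TensorProduct.map bar bar)

/-- The algebra map whose values are the triangular matrices `(σ x, d x; 0, x)`, where `σ` is the
sign automorphism. It encodes that `d` is a derivation: `d (x y) = d x · y + σ x · d y`. -/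
def dMat : Cobar →ₐ[k] Matrix (Fin 2) (Fin 2) Cobar :=
  TensorAlgebra.lift k
    { toFun := fun a => !![-letter a, bar₂ (comul a); 0, letter a]
      map_add' := fun a b => by
        ext i j; fin_cases i <;> fin_cases j <;> simp [add_comm]
      map_smul' := fun c a => by
        ext i j; fin_cases i <;> fin_cases j <;> simp }

/-- The cobar differential
`d [a₁|…|aₙ] = ∑ᵢ (-1)^(i+1) [a₁|…|aᵢ'|aᵢ''|…|aₙ]`, with `∑ aᵢ' ⊗ aᵢ''` the reduced coproduct. -/
def d : Cobar →ₗ[k] Cobar where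
  toFun x := dMat x 0 1
  map_add' x y := by simp
  map_smul' c x := by simp

lemma cobar_induction {C : Cobar → Prop} (h1 : C 1) (hl : ∀ a x, C x → C (letter a * x))
    (hadd : ∀ x y, C x → C y → C (x + y)) (hs : ∀ (c : k) x, C x → C (c • x)) (x : Cobar) :
    C x := by
  suffices h : ∀ x y : Cobar, C y → C (x * y) by simpa using h x 1 h1
  intro x
  refine TensorAlgebra.induction (R := k) (M := Pbar)
    (C := fun x : TensorAlgebra k Pbar => ∀ y : Cobar, C y → C (HMul.hMul (α := Cobar) (β := Cobar) x y))
    ?_ ?_ ?_ ?_ x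
  · intro c y hy
    have := hs c y hy
    rwa [Algebra.smul_def] at this
  · exact fun a y hy => hl a y hy
  · intro a b ha hb y hy
    have := ha _ (hb y hy)
    exact (mul_assoc (G := Cobar) a b y).symm ▸ this
  · intro a b ha hb y hy
    have := hadd _ _ (ha y hy) (hb y hy)
    exact (add_mul (R := Cobar) a b y).symm ▸ this

lemma dMat_letter (a : Pbar) : dMat (letter a) = !![-letter a, bar₂ (comul a); 0, letter a] :=
  TensorAlgebra.lift_ι_apply _ _

lemma dMat_lower (x : Cobar) : dMat x 1 0 = 0 ∧ dMat x 1 1 = x := by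
  induction x using cobar_induction with
  | h1 => simp
  | hl a x hx => simp [dMat_letter, Matrix.mul_apply, hx.1, hx.2]
  | hadd x y hx hy => simp [hx.1, hx.2, hy.1, hy.2]
  | hs c x hx => simp [hx.1, hx.2]

lemma d_one : d 1 = 0 := by simp [d]

lemma d_mul (x y : Cobar) : d (x * y) = d x * y + dMat x 0 0 * d y := by
  simp [d, Matrix.mul_apply, (dMat_lower y).2, add_comm]

lemma d_letter (a : Pbar) : d (letter a) = bar₂ (comul a) := by
  simp [d, dMat_letter]

lemma d_letter_mul (a : Pbar) (x : Cobar) :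
    d (letter a * x) = bar₂ (comul a) * x - letter a * d x := by
  rw [d_mul, d_letter, dMat_letter]
  simp [sub_eq_add_neg]

lemma bar_one : bar 1 = 0 := by
  have : proj 1 = 0 := Subtype.ext (by rw [proj_coe]; simp)
  simp [bar, this]

lemma d_bar (p : P) : d (bar p) = bar₂ (comul p) := by
  have h1 : bar₂ (1 : P ⊗[k] P) = 0 := by
    rw [Algebra.TensorProduct.one_def]; simp [bar₂, bar_one]
  rw [bar, LinearMap.comp_apply, d_letter, proj_coe, map_sub, AlgHom.commutes, map_sub,
    Algebra.algebraMap_eq_smul_one, map_smul, h1]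
  simp

lemma d_bar_mul (p : P) (x : Cobar) : d (bar p * x) = bar₂ (comul p) * x - bar p * d x := by
  rw [← d_bar]
  exact (d_letter_mul (proj p) x).trans (by rw [← d_letter]; rfl)

instance : Nontrivial (P ⊗[k] P) :=
  (Algebra.TensorProduct.lmul' (S := P) k).toRingHom.domain_nontrivial

instance : CharP (P ⊗[k] P) 3 :=
  charP_of_injective_algebraMap (algebraMap k (P ⊗[k] P)).injective 3

lemma comul_xi (n : ℕ) :
    comul (xi n) = ∑ ij ∈ Finset.HasAntidiagonal.antidiagonal n,
      xi ij.1 ⊗ₜ[k] (xi ij.2 ^ 3 ^ ij.1) := by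
  cases n with
  | zero => simp [xi, Algebra.TensorProduct.one_def]
  | succ n => simp [xi, comul]

lemma coassoc (p : P) :
    Algebra.TensorProduct.assoc k k k P P P
      (Algebra.TensorProduct.map comul (AlgHom.id k P) (comul p)) =
    Algebra.TensorProduct.map (AlgHom.id k P) comul (comul p) := by
  suffices h : ((Algebra.TensorProduct.assoc k k k P P P).toAlgHom.comp
      (Algebra.TensorProduct.map comul (AlgHom.id k P))).comp comul =
      (Algebra.TensorProduct.map (AlgHom.id k P) comul).comp comul from
    DFunLike.congr_fun h p
  refine MvPolynomial.algHom_ext fun n => ?_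
  change Algebra.TensorProduct.assoc k k k P P P
      (Algebra.TensorProduct.map comul (AlgHom.id k P) (comul (xi (n + 1)))) =
    Algebra.TensorProduct.map (AlgHom.id k P) comul (comul (xi (n + 1)))
  simp only [comul_xi, map_sum, Algebra.TensorProduct.map_tmul, AlgHom.id_apply, map_pow,
    TensorProduct.sum_tmul, TensorProduct.tmul_sum, Algebra.TensorProduct.assoc_tmul,
    sum_pow_char_pow, Algebra.TensorProduct.tmul_pow]
  simp only [Finset.sum_sigma']
  refine Finset.sum_nbij' (fun q => ⟨(q.2.1, q.2.2 + q.1.2), (q.2.2, q.1.2)⟩)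
    (fun q => ⟨(q.1.1 + q.2.1, q.2.2), (q.1.1, q.2.1)⟩) ?_ ?_ ?_ ?_ ?_
  · rintro ⟨⟨i, j⟩, ⟨a, b⟩⟩ h; simp at h ⊢; omega
  · rintro ⟨⟨i, j⟩, ⟨a, b⟩⟩ h; simp at h ⊢; omega
  · rintro ⟨⟨i, j⟩, ⟨a, b⟩⟩ h; simp at h ⊢; omega
  · rintro ⟨⟨i, j⟩, ⟨a, b⟩⟩ h; simp at h ⊢; omega
  · rintro ⟨⟨i, j⟩, ⟨a, b⟩⟩ h
    simp at h ⊢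
    rw [← h.2, pow_add, mul_comm (3 ^ a), pow_mul]

lemma d_bar₂_comul (p : P) : d (bar₂ (comul p)) = 0 := by
  have key : ∀ t : P ⊗[k] P, d (bar₂ t) =
      LinearMap.mul' k Cobar (TensorProduct.map bar bar₂
        (Algebra.TensorProduct.assoc k k k P P P
          (Algebra.TensorProduct.map comul (AlgHom.id k P) t))) -
      LinearMap.mul' k Cobar (TensorProduct.map bar bar₂
        (Algebra.TensorProduct.map (AlgHom.id k P) comul t)) := by
    intro t
    induction t with
    | zero => simp
    | add x y hx hy => simp only [map_add, hx, hy]; abel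
    | tmul a b =>
      have h : ∀ u : P ⊗[k] P, LinearMap.mul' k Cobar (TensorProduct.map bar bar₂
          (Algebra.TensorProduct.assoc k k k P P P (u ⊗ₜ b))) = bar₂ u * bar b := by
        intro u
        induction u with
        | zero => simp
        | add x y hx hy => simp only [TensorProduct.add_tmul, map_add, hx, hy, add_mul]
        | tmul x y => simp [bar₂, mul_assoc]
      simp [h]
      simp [bar₂, d_bar_mul, d_bar]
  rw [key, coassoc, sub_self]

/-- `d² = 0`. -/
lemma d_d (x : Cobar) : d (d x) = 0 := by
  induction x using cobar_induction with
  | h1 => simp [d_one]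
  | hl a x hx =>
    have h2 : dMat (bar₂ (comul a)) 0 0 = bar₂ (comul a) := by
      generalize comul (a : P) = t
      induction t with
      | zero => simp
      | add x y hx hy => simp [hx, hy]
      | tmul x y => simp [bar₂, bar, dMat_letter, Matrix.mul_apply]
    rw [d_letter_mul, map_sub, d_mul, d_letter_mul, hx, d_bar₂_comul, h2]
    simp
  | hadd x y hx hy => simp [hx, hy]
  | hs c x hx => simp [hx]

/-- The cocycle `[ξ₁]` representing `h₁₀`. -/
def h10 : Cobar := bar (xi 1)

/-- The cocycle `[ξ₁|ξ₁²] + [ξ₁²|ξ₁]` representing `b₁₀`. -/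
def b10 : Cobar := bar (xi 1) * bar (xi 1 ^ 2) + bar (xi 1 ^ 2) * bar (xi 1)

lemma comul_xi_one : comul (xi 1) = xi 1 ⊗ₜ 1 + 1 ⊗ₜ xi 1 := by
  rw [comul_xi, Finset.Nat.sum_antidiagonal_eq_sum_range_succ_mk]
  simp [Finset.sum_range_succ, xi, add_comm]

lemma d_h10 : d h10 = 0 := by
  rw [h10, d_bar, comul_xi_one]
  simp [bar₂, bar_one]

lemma d_h10_mul (x : Cobar) : d (h10 * x) = -(h10 * d x) := by
  have h := d_h10
  rw [h10, d_bar] at h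
  rw [h10, d_bar_mul, h]
  simp

lemma d_bar_sq : d (bar (xi 1 ^ 2)) = (2 : k) • (h10 * h10) := by
  rw [d_bar, map_pow, comul_xi_one, sq]
  simp [bar₂, bar_one, h10, add_mul, mul_add, two_smul]

lemma d_b10_mul (x : Cobar) : d (b10 * x) = b10 * d x := by
  have h1 : ∀ y, d (bar (xi 1) * y) = -(bar (xi 1) * d y) := d_h10_mul
  have h2 : ∀ y, d (bar (xi 1 ^ 2) * y) =
      ((2 : k) • (h10 * h10)) * y - bar (xi 1 ^ 2) * d y := by
    intro y
    rw [d_bar_mul, ← d_bar, d_bar_sq]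
  simp only [b10, add_mul, map_add, mul_assoc, h1, h2]
  simp [h10, mul_sub, mul_assoc]
  abel

lemma d_b10 : d b10 = 0 := by simpa [d_one] using d_b10_mul 1

/-- Right multiplication by `b₁₀` commutes with `d`. -/
lemma d_mul_b10 (x : Cobar) : d (x * b10) = d x * b10 := by
  rw [d_mul, d_b10, mul_zero, add_zero]

/-! The action of `k[b₁₀]`. Multiplication by the powers of the polynomial variable is right
multiplication by the powers of `b₁₀` (which commutes strictly with left multiplication; left and
right multiplication by `b₁₀` agree up to a filtered homotopy). -/

/-- The polynomial ring `k[b₁₀]`. -/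
abbrev kb : Type := Polynomial k

instance : Module kb Cobar :=
  Module.compHom Cobar (Polynomial.aeval (LinearMap.mulRight k b10)).toRingHom

lemma smul_eq (p : kb) (x : Cobar) :
    p • x = Polynomial.aeval (LinearMap.mulRight k b10) p x := rfl

lemma X_smul (x : Cobar) : (Polynomial.X : kb) • x = x * b10 := by simp [smul_eq]

lemma C_smul (c : k) (x : Cobar) : (Polynomial.C c : kb) • x = c • x := by simp [smul_eq]

/-- A `k`-subspace that is stable under right multiplication by `b₁₀`, as a `k[b₁₀]`-module. -/
def toKb (N : Submodule k Cobar) (hN : ∀ x ∈ N, x * b10 ∈ N) : Submodule kb Cobar where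
  carrier := N
  add_mem' := N.add_mem
  zero_mem' := N.zero_mem
  smul_mem' p x hx := by
    induction p using Polynomial.induction_on generalizing x with
    | C c => rw [C_smul]; exact N.smul_mem c hx
    | add p q hp hq => rw [add_smul]; exact N.add_mem (hp x hx) (hq x hx)
    | monomial n c ih =>
      rw [pow_succ, ← mul_assoc, mul_smul, X_smul]
      exact ih _ (hN x hx)

/-- A `k`-linear map that commutes with right multiplication by `b₁₀`, as a `k[b₁₀]`-linear map. -/
def mapKb (f : Cobar →ₗ[k] Cobar) (hf : ∀ x, f (x * b10) = f x * b10) : Cobar →ₗ[kb] Cobar where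
  toFun := f
  map_add' := f.map_add
  map_smul' p x := by
    change f (p • x) = p • f x
    induction p using Polynomial.induction_on generalizing x with
    | C c => simp [C_smul]
    | add p q hp hq => simp [add_smul, hp, hq]
    | monomial n c ih =>
      rw [pow_succ, ← mul_assoc, mul_smul, X_smul, ih, hf, ← X_smul, ← mul_smul]

/-- The cobar differential as a `k[b₁₀]`-linear map. -/
def dKb : Cobar →ₗ[kb] Cobar := mapKb d d_mul_b10

/-- Left multiplication by `c` as a `k[b₁₀]`-linear map. -/
def mulKb (c : Cobar) : Cobar →ₗ[kb] Cobar :=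
  mapKb (LinearMap.mulLeft k c) fun x => by simp [mul_assoc]

/-! The filtration and its spectral sequence. -/

open Classical in
/-- The subspace `F^s C` spanned by the words `[a₁|…|aₙ]` in which at least `s` of the letters lie
in the kernel of `P → D`. -/
def filt (s : ℕ) : Submodule k Cobar :=
  Submodule.span k {w | ∃ l : List Pbar,
    s ≤ l.countP (fun a : Pbar => decide ((a : P) ∈ kerD)) ∧ w = (l.map letter).prod}

lemma exists_words (y : Cobar) :
    y ∈ Submodule.span k {w | ∃ l : List Pbar, w = (l.map letter).prod} := by
  induction y using cobar_induction with
  | h1 => exact Submodule.subset_span ⟨[], rfl⟩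
  | hl a x hx =>
    refine Submodule.span_induction (p := fun x _ => letter a * x ∈ Submodule.span k _)
      ?_ (by simp) ?_ ?_ hx
    · rintro _ ⟨l, rfl⟩; exact Submodule.subset_span ⟨a :: l, by simp⟩
    · intro x y _ _ hx hy; rw [mul_add]; exact Submodule.add_mem _ hx hy
    · intro c x _ hx; rw [mul_smul_comm]; exact Submodule.smul_mem _ c hx
  | hadd x y hx hy => exact Submodule.add_mem _ hx hy
  | hs c x hx => exact Submodule.smul_mem _ c hx

lemma mul_mem_filt {s t : ℕ} {x y : Cobar} (hx : x ∈ filt s) (hy : y ∈ filt t) :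
    x * y ∈ filt (s + t) := by
  have h := Submodule.mul_mem_mul hx hy
  rw [filt, filt, Submodule.span_mul_span] at h
  refine Submodule.span_mono ?_ h
  rintro _ ⟨_, ⟨l, hl, rfl⟩, _, ⟨m, hm, rfl⟩, rfl⟩
  exact ⟨l ++ m, by rw [List.countP_append]; omega, by simp⟩

lemma mem_filt_zero (x : Cobar) : x ∈ filt 0 := by
  refine Submodule.span_mono ?_ (exists_words x)
  rintro _ ⟨l, rfl⟩
  exact ⟨l, Nat.zero_le _, rfl⟩

/-- `F^s C` as a `k[b₁₀]`-submodule. -/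
def F (s : ℕ) : Submodule kb Cobar :=
  toKb (filt s) fun x hx => mul_mem_filt (s := s) (t := 0) (x := x) hx (mem_filt_zero b10)

lemma mulKb_mem_F (c : Cobar) (s : ℕ) {x : Cobar} (hx : x ∈ F s) : mulKb c x ∈ F s := by
  have h := mul_mem_filt (mem_filt_zero c) (show x ∈ filt s from hx)
  rwa [Nat.zero_add] at h

/-- The `r`-cycles `Z_r^s = {x ∈ F^s | d x ∈ F^{s+r}}`. -/
def Z (r s : ℕ) : Submodule kb Cobar := F s ⊓ (F (s + r)).comap dKb

/-- The submodule `B_r^s = Z_{r-1}^{s+1} + d Z_{r-1}^{s-r+1}` (for `r ≥ 1`). The truncated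
subtraction is harmless since `F^s = F^0 = C` for `s ≤ 0`. -/
def B (r s : ℕ) : Submodule kb Cobar :=
  (F (s + 1) ⊓ (F (s + r)).comap dKb) ⊔ ((F (s + 1 - r) ⊓ (F s).comap dKb).map dKb)

/-- The page `E_r^s = Z_r^s / B_r^s` of the spectral sequence of the filtered cobar complex; it is
the direct sum of the groups `E_r^{s,t,u}` over all internal degrees `t`, `u`. -/
abbrev Page (r s : ℕ) : Type := Z r s ⧸ (B r s).submoduleOf (Z r s)

lemma dKb_dKb (x : Cobar) : dKb (dKb x) = 0 := d_d x

lemma dKb_mem_Z {r s : ℕ} {x : Cobar} (hx : x ∈ Z r s) : dKb x ∈ Z r (s + r) :=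
  ⟨hx.2, by simp [dKb_dKb]⟩

/-- The differential `d_r : E_r^s → E_r^{s+r}`, induced by the cobar differential. -/
def dPage (r s : ℕ) : Page r s →ₗ[kb] Page r (s + r) :=
  Submodule.mapQ _ _ (dKb.restrict fun _ hx => dKb_mem_Z hx) <| by
    rintro ⟨x, hx⟩ h
    obtain ⟨a, ha, _, ⟨e, he, rfl⟩, hae⟩ := Submodule.mem_sup.1 (show x ∈ B r s from h)
    change dKb x ∈ B r (s + r)
    rw [← hae, map_add, dKb_dKb, add_zero]
    refine Submodule.mem_sup_right (Submodule.mem_map_of_mem ⟨?_, ha.2⟩)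
    rw [show s + r + 1 - r = s + 1 by omega]
    exact ha.1

/-- Multiplication on the left by a cochain `c` with `d (c x) = ε c d x`, `ε = ±1`, on the
pages. -/
def mulPage (c : Cobar) (ε : kb) (hε : ε * ε = 1)
    (hc : ∀ x, dKb (mulKb c x) = ε • mulKb c (dKb x)) (r s : ℕ) : Page r s →ₗ[kb] Page r s :=
  Submodule.mapQ _ _ ((mulKb c).restrict fun x hx =>
      (⟨mulKb_mem_F c s hx.1, by
        change dKb (mulKb c x) ∈ F (s + r)
        rw [hc]; exact Submodule.smul_mem _ _ (mulKb_mem_F c _ hx.2)⟩ : mulKb c x ∈ Z r s)) <| by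
    rintro ⟨x, hx⟩ h
    obtain ⟨a, ha, _, ⟨e, he, rfl⟩, hae⟩ := Submodule.mem_sup.1 (show x ∈ B r s from h)
    change mulKb c x ∈ B r s
    have he' : mulKb c (dKb e) = dKb (ε • mulKb c e) := by
      rw [map_smul, hc, smul_smul, hε, one_smul]
    rw [← hae, map_add, he']
    refine Submodule.add_mem_sup ⟨mulKb_mem_F c _ ha.1, ?_⟩
      (Submodule.mem_map_of_mem ⟨Submodule.smul_mem _ _ (mulKb_mem_F c _ he.1), ?_⟩)
    · change dKb (mulKb c a) ∈ F (s + r)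
      rw [hc]; exact Submodule.smul_mem _ _ (mulKb_mem_F c _ ha.2)
    · change dKb (ε • mulKb c e) ∈ F s
      rw [← he']; exact mulKb_mem_F c _ he.2

/-- Multiplication by `h₁₀` on `E_r^s`. -/
def h10Page (r s : ℕ) : Page r s →ₗ[kb] Page r s :=
  mulPage h10 (-1) (by ring) (fun x => by rw [neg_one_smul]; exact d_h10_mul x) r s

/-- Multiplication by `b₁₀` on `E_r^s`. -/
def b10Page (r s : ℕ) : Page r s →ₗ[kb] Page r s :=
  mulPage b10 1 (by ring) (fun x => by rw [one_smul]; exact d_b10_mul x) r s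

/-! The `b₁₀`-localized spectral sequence. -/

/-- The powers of `b₁₀`. -/
abbrev bPow : Submonoid kb := Submonoid.powers (Polynomial.X : kb)

/-- The page `b₁₀⁻¹ E_r^s` of the localized spectral sequence. -/
abbrev E (r s : ℕ) : Type := LocalizedModule bPow (Page r s)

/-- The localization of a map of pages. -/
def locMap {r s r' s' : ℕ} (f : Page r s →ₗ[kb] Page r' s') : E r s →ₗ[kb] E r' s' :=
  IsLocalizedModule.map bPow (LocalizedModule.mkLinearMap bPow (Page r s))
    (LocalizedModule.mkLinearMap bPow (Page r' s')) f

/-- The differential `d_r` of the localized spectral sequence. -/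
def dE (r s : ℕ) : E r s →ₗ[kb] E r (s + r) := locMap (dPage r s)

/-- Multiplication by `h₁₀` on the localized pages. -/
def hE (r s : ℕ) : E r s →ₗ[kb] E r s := locMap (h10Page r s)

/-- Multiplication by `b₁₀` on the localized pages. -/
def bE (r s : ℕ) : E r s →ₗ[kb] E r s := locMap (b10Page r s)

/-- The class `b₁₀^{-N} [c]` in the localized page, for `c ∈ Z_r^s`. -/
def cls {r s : ℕ} (c : Cobar) (hc : c ∈ Z r s) (N : ℕ) : E r s :=
  LocalizedModule.mk (Submodule.Quotient.mk ⟨c, hc⟩) ⟨Polynomial.X ^ N, N, rfl⟩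

/-- `x ∈ E_2` survives to `E_r` and its class there is `x'`: up to a power of `b₁₀` they are the
classes of one and the same cochain. -/
def Represents {s : ℕ} (r : ℕ) (x : E 2 s) (x' : E r s) : Prop :=
  ∃ (c : Cobar) (h₂ : c ∈ Z 2 s) (hr : c ∈ Z r s) (N : ℕ), x = cls c h₂ N ∧ x' = cls c hr N

/-- For `x, y ∈ E_2`: both survive to `E_r`, and `d_r(x) = y` holds in `E_r`. -/
def DiffEq {s : ℕ} (r : ℕ) (x : E 2 s) (y : E 2 (s + r)) : Prop :=
  ∃ (x' : E r s) (y' : E r (s + r)), Represents r x x' ∧ Represents r y y' ∧ dE r s x' = y'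

/-- The sum of the cochain groups `P̄^{⊗n}` with `n` even. -/
def evenCobar : Submodule k Cobar := ⨆ m : ℕ, LinearMap.range letter ^ (2 * m)

/-- The part `W₊` of the localized `E_2^s` of even total degree `s + t`. -/
def WPlus (s : ℕ) : Set (E 2 s) :=
  {x | ∃ (c : Cobar) (hc : c ∈ Z 2 s) (N : ℕ), c ∈ evenCobar ∧ x = cls c hc N}

end MPASS

end

open scoped TensorProduct

noncomputable section

namespace MPASS

/-- A filtered complex with a `ℤ/18`-grading and two operators `a`, `q` with `d q = -a²`, whose
`E₂`-page is concentrated in the degrees `4s` and `4s - 1`, multiplication by `a` being an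
isomorphism between the two. -/
structure GradedFilteredComplex (R L : Type*) [CommRing R] [AddCommGroup L] [Module R L] where
  F : ℕ → Submodule R L
  anti : Antitone F
  d : L →ₗ[R] L
  d_d : ∀ x, d (d x) = 0
  d_mem : ∀ {s x}, x ∈ F s → d x ∈ F s
  pr : ZMod 18 → L →ₗ[R] L
  pr_mem : ∀ {g s x}, x ∈ F s → pr g x ∈ F s
  pr_pr : ∀ g h x, pr g (pr h x) = if g = h then pr h x else 0
  sum_pr : ∀ x, ∑ g, pr g x = x
  d_pr : ∀ g x, d (pr g x) = pr (g - 3) (d x)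
  a : L →ₗ[R] L
  q : L →ₗ[R] L
  a_mem : ∀ {s x}, x ∈ F s → a x ∈ F s
  q_mem : ∀ {s x}, x ∈ F s → q x ∈ F s
  d_a : ∀ x, d (a x) = -a (d x)
  d_q : ∀ x, d (q x) = -a (a x) - q (d x)
  a_pr : ∀ g x, a (pr g x) = pr (g - 1) (a x)
  q_pr : ∀ g x, q (pr g x) = pr (g + 1) (q x)
  vanish : ∀ {s : ℕ} {g : ZMod 18} {c : L}, g ≠ 4 * (s : ZMod 18) → g ≠ 4 * (s : ZMod 18) - 1 → c ∈ F s → pr g c = c →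
    d c ∈ F (s + 2) → c ∈ F (s + 1) ⊔ (F (s - 1)).map d
  a_inj : ∀ {s : ℕ} {c : L}, c ∈ F s → pr (4 * (s : ZMod 18)) c = c → d c ∈ F (s + 2) →
    a c ∈ F (s + 1) ⊔ (F (s - 1)).map d → c ∈ F (s + 1) ⊔ (F (s - 1)).map d
  a_surj : ∀ {s : ℕ} {c : L}, c ∈ F s → pr (4 * (s : ZMod 18) - 1) c = c → d c ∈ F (s + 2) →
    ∃ c' ∈ F s, pr (4 * (s : ZMod 18)) c' = c' ∧ d c' ∈ F (s + 2) ∧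
      c - a c' ∈ F (s + 1) ⊔ (F (s - 1)).map d

namespace GradedFilteredComplex

variable {R L : Type*} [CommRing R] [AddCommGroup L] [Module R L]
  (K : GradedFilteredComplex R L)

/-- `x` is homogeneous of degree `g`. -/
def Hom (g : ZMod 18) (x : L) : Prop := K.pr g x = x

/-- Multiplication by `b = a q + q a`. -/
def b : L →ₗ[R] L := K.a ∘ₗ K.q + K.q ∘ₗ K.a

lemma b_apply (x : L) : K.b x = K.a (K.q x) + K.q (K.a x) := rfl

lemma b_mem {s : ℕ} {x : L} (h : x ∈ K.F s) : K.b x ∈ K.F s :=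
  add_mem (K.a_mem (K.q_mem h)) (K.q_mem (K.a_mem h))

lemma d_b (x : L) : K.d (K.b x) = K.b (K.d x) := by
  simp only [b_apply, map_add, K.d_a, K.d_q, map_sub, map_neg]
  abel

lemma le {s t : ℕ} (h : s ≤ t) {x : L} (hx : x ∈ K.F t) : x ∈ K.F s := K.anti h hx

variable {K}

lemma hom_pr (g : ZMod 18) (x : L) : K.Hom g (K.pr g x) := by simp [Hom, K.pr_pr]

lemma Hom.pr_ne {g h : ZMod 18} {x : L} (hx : K.Hom g x) (hne : h ≠ g) : K.pr h x = 0 := by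
  rw [← show K.pr g x = x from hx, K.pr_pr, if_neg hne]

lemma Hom.add {g : ZMod 18} {x y : L} (hx : K.Hom g x) (hy : K.Hom g y) : K.Hom g (x + y) := by
  simp only [Hom, map_add] at *; rw [hx, hy]

lemma Hom.sub {g : ZMod 18} {x y : L} (hx : K.Hom g x) (hy : K.Hom g y) : K.Hom g (x - y) := by
  simp only [Hom, map_sub] at *; rw [hx, hy]

lemma Hom.d {g g' : ZMod 18} {x : L} (hx : K.Hom g x) (h : g' = g - 3) : K.Hom g' (K.d x) := by
  subst h; simp only [Hom] at *; rw [← K.d_pr, hx]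

lemma Hom.a {g g' : ZMod 18} {x : L} (hx : K.Hom g x) (h : g' = g - 1) : K.Hom g' (K.a x) := by
  subst h; simp only [Hom] at *; rw [← K.a_pr, hx]

lemma Hom.q {g g' : ZMod 18} {x : L} (hx : K.Hom g x) (h : g' = g + 1) : K.Hom g' (K.q x) := by
  subst h; simp only [Hom] at *; rw [← K.q_pr, hx]

lemma Hom.eq {g g' : ZMod 18} {x : L} (hx : K.Hom g x) (h : g' = g) : K.Hom g' x := h ▸ hx

/-- Homogeneous components of a decomposition `e + d f`. -/
lemma decomp_hom {g : ZMod 18} {m n : ℕ} {x : L} (hx : K.Hom g x)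
    (h : x ∈ K.F m ⊔ (K.F n).map K.d) :
    ∃ e ∈ K.F m, ∃ f ∈ K.F n, K.Hom g e ∧ K.Hom (g + 3) f ∧ x = e + K.d f := by
  obtain ⟨e, he, _, ⟨f, hf, rfl⟩, rfl⟩ := Submodule.mem_sup.1 h
  refine ⟨_, K.pr_mem (g := g) he, _, K.pr_mem (g := g + 3) hf, hom_pr _ _, hom_pr _ _, ?_⟩
  rw [K.d_pr, add_sub_cancel_right, ← map_add]
  exact hx.symm

lemma mem_sup {m n : ℕ} {e f : L} (he : e ∈ K.F m) (hf : f ∈ K.F n) :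
    e + K.d f ∈ K.F m ⊔ (K.F n).map K.d :=
  Submodule.add_mem_sup he (Submodule.mem_map_of_mem hf)

lemma sup_mono {m n m' n' : ℕ} (hm : m' ≤ m) (hn : n' ≤ n) {x : L}
    (h : x ∈ K.F m ⊔ (K.F n).map K.d) : x ∈ K.F m' ⊔ (K.F n').map K.d :=
  sup_le_sup (K.anti hm) (Submodule.map_mono (K.anti hn)) h

lemma pr_mem_sup {m n : ℕ} {g : ZMod 18} {x : L} (h : x ∈ K.F m ⊔ (K.F n).map K.d) :
    K.pr g x ∈ K.F m ⊔ (K.F n).map K.d := by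
  obtain ⟨e, he, _, ⟨f, hf, rfl⟩, rfl⟩ := Submodule.mem_sup.1 h
  rw [map_add, show K.pr g (K.d f) = K.d (K.pr (g + 3) f) by rw [K.d_pr, add_sub_cancel_right]]
  exact mem_sup (K.pr_mem he) (K.pr_mem hf)

lemma a_mem_sup {m n : ℕ} {x : L} (h : x ∈ K.F m ⊔ (K.F n).map K.d) :
    K.a x ∈ K.F m ⊔ (K.F n).map K.d := by
  obtain ⟨e, he, _, ⟨f, hf, rfl⟩, rfl⟩ := Submodule.mem_sup.1 h
  rw [map_add, show K.a (K.d f) = K.d (-K.a f) by rw [map_neg, K.d_a, neg_neg]]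
  exact mem_sup (K.a_mem he) (neg_mem (K.a_mem hf))

lemma b_mem_sup {m n : ℕ} {x : L} (h : x ∈ K.F m ⊔ (K.F n).map K.d) :
    K.b x ∈ K.F m ⊔ (K.F n).map K.d := by
  obtain ⟨e, he, _, ⟨f, hf, rfl⟩, rfl⟩ := Submodule.mem_sup.1 h
  rw [map_add, ← K.d_b]
  exact mem_sup (K.b_mem he) (K.b_mem hf)

/-- A cochain of vanishing degrees can be pushed to higher filtration, modulo coboundaries. -/
lemma push {g : ZMod 18} (n : ℕ) : ∀ {m : ℕ} {x : L}, x ∈ K.F m → K.Hom g x →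
    (∀ j < n, g ≠ 4 * ((m + j : ℕ) : ZMod 18) ∧ g ≠ 4 * ((m + j : ℕ) : ZMod 18) - 1) →
    K.d x ∈ K.F (m + n + 1) →
    ∃ e ∈ K.F (m + n), ∃ f ∈ K.F (m - 1), K.Hom g e ∧ K.Hom (g + 3) f ∧ x = e + K.d f := by
  induction n with
  | zero => exact fun {m x} hx hg _ _ => ⟨x, hx, 0, zero_mem _, hg, by simp [Hom], by simp⟩
  | succ n ih =>
    intro m x hx hg hj hd
    obtain ⟨e, he, f, hf, hge, hgf, rfl⟩ := decomp_hom hg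
      (K.vanish (by simpa using (hj 0 (by omega)).1) (by simpa using (hj 0 (by omega)).2) hx hg
        (K.le (by omega) hd))
    obtain ⟨e', he', f', hf', hge', hgf', rfl⟩ := ih he hge
      (fun j hjn => by
        have := hj (j + 1) (by omega)
        rwa [show m + (j + 1) = m + 1 + j by omega] at this)
      (by
        rw [map_add, K.d_d, add_zero] at hd
        rwa [show m + 1 + n + 1 = m + (n + 1) + 1 by omega])
    exact ⟨e', by rwa [show m + (n + 1) = m + 1 + n by omega], f' + f,
      add_mem (K.le (by omega) hf') hf, hge', hgf'.add hgf, by rw [map_add]; abel⟩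

/-- The Massey product argument in the matching degrees. -/
lemma massey {s M : ℕ} (hsM : s + 1 ≤ M) (hdeg : 4 * (M : ZMod 18) + 2 = 4 * (s : ZMod 18))
    {x y z : L} (hx : x ∈ K.F s) (hy : y ∈ K.F M) (hz : z ∈ K.F (M + 4))
    (gx : K.Hom (4 * s) x) (gy : K.Hom (4 * M) y) (gz : K.Hom (4 * (M + 4 : ℕ)) z)
    (hdz : K.d z ∈ K.F (M + 6))
    (h₁ : K.d x - K.a y ∈ K.F (M + 1) ⊔ (K.F (s + 1)).map K.d)
    (h₂ : K.d y - K.a z ∈ K.F (M + 5) ⊔ (K.F (M + 1)).map K.d) :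
    ∃ X ∈ K.F s, X - K.a x ∈ K.F (s + 1) ∧ K.d X - K.b z ∈ K.F (M + 5) := by
  push_cast at gz
  have gay : K.Hom (4 * M - 1) (K.a y) := gy.a rfl
  have gdx : K.Hom (4 * M - 1) (K.d x) := gx.d (by rw [← hdeg]; ring)
  have g12 : (4 : ZMod 18) * (4 : ZMod 18) = -2 := by decide
  have gdy : K.Hom (4 * M - 3) (K.d y) := gy.d rfl
  have gaz : K.Hom (4 * M - 3) (K.a z) := gz.a (by linear_combination -g12)
  have gdz : K.Hom (4 * M - 5) (K.d z) := gz.d (by linear_combination -g12)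
  obtain ⟨e, he, f, hf, ge, gf, h₁⟩ := decomp_hom (gdx.sub gay) h₁
  obtain ⟨e', he', f', hf', ge', gf', h₂⟩ := decomp_hom (gdy.sub gaz) h₂
  obtain ⟨e2, he2, f2, hf2, ge2, gf2, h₃⟩ := push (n := 2) (m := M + 6) hdz gdz
    (by
      intro j hj
      push_cast
      generalize (M : ZMod 18) = t
      interval_cases j <;> revert t <;> decide)
    (by rw [K.d_d]; exact zero_mem _)
  -- corrected `z`
  have dz1 : K.d (z - f2) = e2 := by rw [map_sub, h₃]; abel
  have de' : K.d (e' + K.a f2) = K.a e2 := by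
    have h := congrArg K.d h₂
    simp only [map_add, map_sub, K.d_d, K.d_a, add_zero] at h
    rw [map_add, ← h, K.d_a, h₃, map_add]; abel
  obtain ⟨e3, he3, f3, hf3, ge3, gf3, h₄⟩ := push (K := K) (g := 4 * M - 3) (n := 1) (m := M + 5)
    (x := e' + K.a f2)
    (add_mem he' (K.a_mem (K.le (by omega) hf2))) (ge'.add (gf2.a (by ring)))
    (by
      intro j hj
      push_cast
      generalize (M : ZMod 18) = t
      interval_cases j; revert t; decide)
    (by rw [de']; exact K.a_mem (K.le (by omega) he2))
  -- corrected `y` and `x`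
  set y2 := y - f' - f3 with hy2
  set z1 := z - f2 with hz1
  have dy2 : K.d y2 = K.a z1 + e3 := by
    have h2 : K.d y = K.a z + e' + K.d f' := by rw [add_assoc, ← h₂]; abel
    have h4 : e3 = e' + K.a f2 - K.d f3 := by rw [h₄]; abel
    rw [hy2, hz1, map_sub, map_sub, h2, h4, map_sub]; abel
  set e4 := e + K.a f' + K.a f3 with he4
  have dx1 : K.d (x - f) = K.a y2 + e4 := by
    have h1 : K.d x = K.a y + e + K.d f := by rw [add_assoc, ← h₁]; abel
    rw [map_sub, h1, he4, hy2, map_sub, map_sub]; abel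
  have hw : K.d (e4 + K.q z1) = K.a e3 - K.q e2 := by
    have h := congrArg K.d dx1
    rw [K.d_d, map_add, K.d_a, dy2, map_add] at h
    have : K.d e4 = K.a (K.a z1) + K.a e3 := by
      rw [eq_comm, ← sub_eq_zero, ← neg_eq_zero, h]; abel
    rw [map_add, K.d_q, this, dz1]; abel
  obtain ⟨e5, he5, f5, hf5, ge5, gf5, h₅⟩ := push (K := K) (g := 4 * M - 1) (n := 4) (m := M + 1)
    (x := e4 + K.q z1)
    (add_mem (add_mem (add_mem he (K.a_mem hf')) (K.a_mem (K.le (by omega) hf3)))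
      (K.q_mem (sub_mem (K.le (by omega) hz) (K.le (by omega) hf2))))
    (((ge.add (gf'.a (by ring))).add (gf3.a (by ring))).add
      ((gz.sub (gf2.eq (by linear_combination g12))).q (by linear_combination -g12)))
    (by
      intro j hj
      push_cast
      generalize (M : ZMod 18) = t
      interval_cases j <;> revert t <;> decide)
    (by
      rw [hw]
      exact sub_mem (K.a_mem (K.le (by omega) he3)) (K.q_mem (K.le (by omega) he2)))
  refine ⟨K.a (x - f) - K.q y2 - K.a f5, ?_, ?_, ?_⟩
  · refine sub_mem (sub_mem (K.a_mem (sub_mem hx (K.le (by omega) hf))) (K.q_mem ?_))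
      (K.a_mem (K.le (by omega) hf5))
    exact sub_mem (sub_mem (K.le (by omega) hy) (K.le (by omega) hf')) (K.le (by omega) hf3)
  · have : K.a (x - f) - K.q y2 - K.a f5 - K.a x = -K.a f - K.q y2 - K.a f5 := by
      rw [map_sub]; abel
    rw [this]
    refine sub_mem (sub_mem (neg_mem (K.a_mem hf)) (K.q_mem ?_)) (K.a_mem (K.le (by omega) hf5))
    exact sub_mem (sub_mem (K.le (by omega) hy) (K.le (by omega) hf')) (K.le (by omega) hf3)
  · have h5 : K.a (e4 + K.q z1) = K.a e5 + K.a (K.d f5) := by rw [h₅, map_add]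
    rw [map_add] at h5
    have : K.d (K.a (x - f) - K.q y2 - K.a f5) - K.b z = -K.a e5 + K.q e3 - K.b f2 := by
      have hb : K.b z = K.a (K.q z1) + K.q (K.a z1) + K.b f2 := by
        rw [← b_apply, ← map_add, hz1]; congr 1; abel
      have h5' : K.a e5 = K.a e4 + K.a (K.q z1) - K.a (K.d f5) := by rw [h5]; abel
      rw [map_sub, map_sub, K.d_a, K.d_a, K.d_q, dx1, dy2, hb, h5']
      simp only [map_add]; abel
    rw [this]
    exact sub_mem (add_mem (neg_mem (K.a_mem (K.le (by omega) he5)))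
      (K.q_mem (K.le (by omega) he3))) (K.b_mem (K.le (by omega) hf2))

/-- If `a y` is hit, then so is `b z`. -/
lemma b_mem_of_a_mem {M s₀ : ℕ} {y z : L} (hs₀ : s₀ ≤ M + 3) (hy : y ∈ K.F M)
    (hz : z ∈ K.F (M + 4)) (gy : K.Hom (4 * M) y) (gz : K.Hom (4 * (M + 4 : ℕ)) z)
    (hdz : K.d z ∈ K.F (M + 6))
    (h₂ : K.d y - K.a z ∈ K.F (M + 5) ⊔ (K.F (M + 1)).map K.d) (n : ℕ) :
    ∀ {s : ℕ} {f : L}, M ≤ s + 1 + n → s₀ ≤ s → f ∈ K.F s → K.Hom (4 * M + 2) f →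
      K.a y - K.d f ∈ K.F (M + 1) → K.b z ∈ K.F (M + 5) ⊔ (K.F s₀).map K.d := by
  have gay : K.Hom (4 * M - 1) (K.a y) := gy.a rfl
  have gdy : K.Hom (4 * M - 3) (K.d y) := gy.d rfl
  have g12 : (4 : ZMod 18) * (4 : ZMod 18) = -2 := by decide
  have gaz : K.Hom (4 * M - 3) (K.a z) := gz.a (by push_cast; linear_combination -g12)
  obtain ⟨e', he', f', hf', ge', gf', h₂'⟩ := decomp_hom (gdy.sub gaz) h₂
  have hdy : K.d y = K.a z + e' + K.d f' := by rw [add_assoc, ← h₂']; abel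
  have final : K.a y ∈ K.F (M + 1) ⊔ (K.F (M - 1)).map K.d →
      K.b z ∈ K.F (M + 5) ⊔ (K.F s₀).map K.d := by
    intro h
    have hdy2 : K.d (y - f') ∈ K.F (M + 4) := by
      rw [map_sub, hdy, add_sub_cancel_right]
      exact add_mem (K.a_mem hz) (K.le (by omega) he')
    have gy' : K.Hom (4 * M) (y - f') := gy.sub (gf'.eq (by ring))
    have h' : y - f' ∈ K.F (M + 1) ⊔ (K.F (M - 1)).map K.d := by
      refine K.a_inj (sub_mem hy (K.le (by omega) hf')) gy' (K.le (by omega) hdy2) ?_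
      rw [map_sub]
      exact sub_mem h (Submodule.mem_sup_left (K.a_mem hf'))
    obtain ⟨e, he, g, hg, ge, gg, hyy⟩ := decomp_hom gy' h'
    have hde : K.d e = K.a z + e' := by
      have := congrArg K.d hyy
      rw [map_add, K.d_d, add_zero, map_sub, hdy, add_sub_cancel_right] at this
      exact this.symm
    obtain ⟨e6, he6, g6, hg6, _, _, h6⟩ := push (K := K) (n := 2) he ge
      (by
        intro j hj
        push_cast
        generalize (M : ZMod 18) = t
        interval_cases j <;> revert t <;> decide)
      (by
        rw [hde]
        exact add_mem (K.a_mem hz) (K.le (by omega) he'))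
    have haz : K.a z ∈ K.F (M + 4 + 1) ⊔ (K.F (M + 4 - 1)).map K.d := by
      have : K.a z = -e' + K.d e6 := by
        rw [h6, map_add, K.d_d, add_zero] at hde
        rw [hde]; abel
      rw [this]
      exact mem_sup (neg_mem he') (K.le (by omega) he6)
    exact sup_mono le_rfl (by omega) (b_mem_sup (K.a_inj hz gz hdz haz))
  induction n with
  | zero =>
    intro s f hs hs0 hf gf h
    refine final ?_
    rw [← sub_add_cancel (K.a y) (K.d f)]
    exact mem_sup h (K.le (by omega) hf)
  | succ n ih =>
    intro s f hs hs0 hf gf h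
    by_cases hsM : M ≤ s + 1
    · refine final ?_
      rw [← sub_add_cancel (K.a y) (K.d f)]
      exact mem_sup h (K.le (by omega) hf)
    by_cases hg : 4 * (M : ZMod 18) + 2 = 4 * (s : ZMod 18)
    · obtain ⟨X, hX, -, hdX⟩ := massey (by omega) hg hf hy hz (gf.eq hg.symm) gy gz hdz
        (Submodule.mem_sup_left (by rw [← neg_mem_iff, neg_sub]; exact h)) h₂
      have : K.b z = -(K.d X - K.b z) + K.d X := by abel
      rw [this]
      exact mem_sup (neg_mem hdX) (K.le hs0 hX)
    · have hdf : K.d f ∈ K.F M := by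
        rw [show K.d f = K.a y - (K.a y - K.d f) by abel]
        exact sub_mem (K.a_mem hy) (K.le (by omega) h)
      obtain ⟨e, he, g, _, ge, _, hfe⟩ := decomp_hom gf (K.vanish hg
        (by
          generalize (M : ZMod 18) = t
          generalize (s : ZMod 18) = u
          revert t u; decide) hf gf (K.le (by omega) hdf))
      refine ih (s := s + 1) (by omega) (by omega) he ge ?_
      rwa [show K.d e = K.d f by rw [hfe, map_add, K.d_d, add_zero]]

/-- `a x` survives further than `x`. -/
lemma exists_a_lift {s M : ℕ} (hsM : s + 1 ≤ M) {x : L} (hx : x ∈ K.F s)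
    (gx : K.Hom (4 * s) x) (h : K.d x ∈ K.F (M + 1) ⊔ (K.F (s + 1)).map K.d) :
    ∃ X ∈ K.F s, X - K.a x ∈ K.F (s + 1) ∧ K.d X ∈ K.F (M + 5) := by
  obtain ⟨e, he, f, hf, ge, gf, h⟩ := decomp_hom (gx.d rfl) h
  have hd : K.d (x - f) = e := by rw [map_sub, h]; abel
  have hxs : x - f ∈ K.F s := sub_mem hx (K.le (by omega) hf)
  have hxa : K.a (x - f) - K.a x ∈ K.F (s + 1) := by
    rw [← map_sub, show x - f - x = -f by abel]; exact K.a_mem (neg_mem hf)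
  by_cases hc : ∀ j < 4, (4 * s - 3 : ZMod 18) ≠ 4 * ((M + 1 + j : ℕ) : ZMod 18) ∧
      (4 * s - 3 : ZMod 18) ≠ 4 * ((M + 1 + j : ℕ) : ZMod 18) - 1
  · obtain ⟨e1, he1, f1, hf1, -, -, h1⟩ := push (K := K) 4 he ge hc (by
      rw [← hd, K.d_d]; exact zero_mem _)
    refine ⟨K.a (x - f) - K.a f1, sub_mem (K.a_mem hxs) (K.a_mem (K.le (by omega) hf1)), ?_, ?_⟩
    · rw [sub_right_comm]; exact sub_mem hxa (K.a_mem (K.le (by omega) hf1))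
    · rw [map_sub, K.d_a, K.d_a, hd, h1, map_add]
      rw [show -(K.a e1 + K.a (K.d f1)) - -K.a (K.d f1) = -K.a e1 by abel]
      exact neg_mem (K.a_mem he1)
  · have gae : K.Hom (4 * s - 4) (K.a e) := ge.a (by ring)
    obtain ⟨e1, he1, f1, hf1, -, -, h1⟩ := push (K := K) 4 (K.a_mem he) gae (by
      push Not at hc
      obtain ⟨i, hi, hci⟩ := hc
      intro j hj
      revert hci
      push_cast
      generalize (M : ZMod 18) = t
      generalize (s : ZMod 18) = u
      interval_cases i <;> interval_cases j <;> revert t u <;> decide) (by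
      rw [K.d_a, ← hd, K.d_d, map_zero, neg_zero]; exact zero_mem _)
    refine ⟨K.a (x - f) + f1, add_mem (K.a_mem hxs) (K.le (by omega) hf1), ?_, ?_⟩
    · rw [add_sub_right_comm]; exact add_mem hxa (K.le (by omega) hf1)
    · rw [map_add, K.d_a, hd, h1, show -(e1 + K.d f1) + K.d f1 = -e1 by abel]
      exact neg_mem he1

/-- Only the component of degree `4s` matters for the product with `a`. -/
lemma a_sub_mem {s : ℕ} {c : L} (hc : c ∈ K.F s) (hdc : K.d c ∈ K.F (s + 2)) :
    K.a c - K.a (K.pr (4 * s) c) ∈ K.F (s + 1) ⊔ (K.F (s - 1)).map K.d := by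
  have : K.a c - K.a (K.pr (4 * s) c) = ∑ g ∈ Finset.univ.erase (4 * (s : ZMod 18)),
      K.a (K.pr g c) := by
    conv_lhs => rw [← K.sum_pr c]
    rw [← Finset.add_sum_erase _ _ (Finset.mem_univ (4 * (s : ZMod 18)))]
    have hz : K.pr (4 * s) (∑ g ∈ Finset.univ.erase (4 * (s : ZMod 18)), K.pr g c) = 0 := by
      rw [map_sum]
      refine Finset.sum_eq_zero fun g hg => ?_
      rw [K.pr_pr, if_neg (Finset.ne_of_mem_erase hg).symm]
    simp only [map_add, hz, K.pr_pr, if_true, map_sum, add_zero]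
    abel
  rw [this]
  refine Submodule.sum_mem _ fun g hg => ?_
  have hg' := Finset.ne_of_mem_erase hg
  have hF := K.pr_mem (g := g) hc
  have hdF : K.d (K.pr g c) ∈ K.F (s + 2) := by rw [K.d_pr]; exact K.pr_mem hdc
  by_cases h1 : g = 4 * (s : ZMod 18) - 1
  · refine K.vanish (g := g - 1) ?_ ?_ (K.a_mem hF) ((hom_pr g c).a rfl) ?_
    · subst h1; generalize (s : ZMod 18) = t; revert t; decide
    · subst h1; generalize (s : ZMod 18) = t; revert t; decide
    · rw [K.d_a]; exact neg_mem (K.a_mem hdF)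
  · exact a_mem_sup (K.vanish hg' h1 hF (hom_pr g c) hdF)

/-- The differential on `a x`. -/
theorem differential_a {s r : ℕ} (hr : 2 ≤ r) {c y z : L} (hc : c ∈ K.F s)
    (hdc : K.d c ∈ K.F (s + 2)) (hy : y ∈ K.F (s + r)) (hz : z ∈ K.F (s + r + 4))
    (gy : K.Hom (4 * (s + r : ℕ)) y) (gz : K.Hom (4 * (s + r + 4 : ℕ)) z)
    (hdz : K.d z ∈ K.F (s + r + 6))
    (h₁ : K.d c - K.a y ∈ K.F (s + r + 1) ⊔ (K.F (s + 1)).map K.d)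
    (h₂ : K.d y - K.a z ∈ K.F (s + r + 5) ⊔ (K.F (s + r + 1)).map K.d) :
    ∃ X ∈ K.F s, X - K.a c ∈ K.F (s + 1) ⊔ (K.F (s - 1)).map K.d ∧
      K.d X - K.b z ∈ K.F (s + r + 5) := by
  have hac := a_sub_mem hc hdc
  suffices h : ∃ X ∈ K.F s, X - K.a (K.pr (4 * s) c) ∈ K.F (s + 1) ∧
      K.d X - K.b z ∈ K.F (s + r + 5) by
    obtain ⟨X, hX, hXa, hdX⟩ := h
    refine ⟨X, hX, ?_, hdX⟩
    rw [show X - K.a c = (X - K.a (K.pr (4 * s) c)) - (K.a c - K.a (K.pr (4 * s) c)) by abel]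
    exact sub_mem (Submodule.mem_sup_left hXa) hac
  have gay : K.Hom (4 * (s + r : ℕ) - 1) (K.a y) := gy.a rfl
  have hp (g : ZMod 18) : K.d (K.pr (g + 3) c) - K.pr g (K.a y) ∈
      K.F (s + r + 1) ⊔ (K.F (s + 1)).map K.d := by
    have := pr_mem_sup (g := g) h₁
    rwa [map_sub, show K.pr g (K.d c) = K.d (K.pr (g + 3) c) by
      rw [K.d_pr, add_sub_cancel_right]] at this
  by_cases hg : 4 * ((s + r : ℕ) : ZMod 18) + 2 = 4 * (s : ZMod 18)
  · refine massey (by omega) hg (K.pr_mem hc) hy hz (hom_pr _ _) gy gz hdz ?_ h₂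
    have := hp (4 * (s + r : ℕ) - 1)
    rw [show (4 * (s + r : ℕ) - 1 + 3 : ZMod 18) = 4 * s by rw [← hg]; ring] at this
    rwa [show K.pr _ (K.a y) = K.a y from gay] at this
  · have hx := hp (4 * s - 3)
    rw [sub_add_cancel, gay.pr_ne (by contrapose! hg; linear_combination -hg), sub_zero] at hx
    obtain ⟨X, hX, hXa, hdX⟩ := exists_a_lift (by omega) (K.pr_mem hc) (hom_pr _ _) hx
    have hay := hp (4 * (s + r : ℕ) - 1)
    rw [show K.pr _ (K.a y) = K.a y from gay,
      show (4 * (s + r : ℕ) - 1 + 3 : ZMod 18) = 4 * (s + r : ℕ) + 2 by ring] at hay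
    obtain ⟨e, he, f, hf, ge, gf, h⟩ := decomp_hom (hom_pr (4 * ((s + r : ℕ) : ZMod 18) + 2) c)
      (K.vanish hg (by
          generalize ((s + r : ℕ) : ZMod 18) = t
          generalize (s : ZMod 18) = u
          revert t u; decide) (K.pr_mem hc) (hom_pr _ _) (by
          rw [K.d_pr]; exact K.pr_mem hdc))
    rw [h, map_add, K.d_d, add_zero] at hay
    obtain ⟨e1, he1, f1, hf1, -, gf1, h1⟩ := decomp_hom
      (((ge.d (g' := 4 * ((s + r : ℕ) : ZMod 18) - 1) (by ring))).sub gay) hay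
    have hbz : K.b z ∈ K.F (s + r + 5) ⊔ (K.F (s + 1)).map K.d := by
      refine b_mem_of_a_mem (by omega) hy hz gy gz hdz h₂ r (s := s + 1) (f := e - f1) (by omega)
        le_rfl (sub_mem he hf1) (ge.sub (gf1.eq (by ring))) ?_
      rw [show K.a y - K.d (e - f1) = -e1 by
        rw [map_sub, show K.d e = K.a y + e1 + K.d f1 by rw [add_assoc, ← h1]; abel]; abel]
      exact neg_mem he1
    obtain ⟨e2, he2, _, ⟨f2, hf2, rfl⟩, h2⟩ := Submodule.mem_sup.1 hbz
    refine ⟨X + f2, add_mem hX (K.le (by omega) hf2), ?_, ?_⟩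
    · rw [add_sub_right_comm]; exact add_mem hXa hf2
    · rw [← h2, map_add, show K.d X + K.d f2 - (e2 + K.d f2) = K.d X - e2 by abel]
      exact sub_mem hdX he2

/-- The differentials `d_2, d_3, d_5, d_6, d_7` vanish. -/
theorem differential_zero {s r : ℕ} (hr : r ∈ ({2, 3, 5, 6, 7} : Set ℕ)) {c : L}
    (hc : c ∈ K.F s) (hdc : K.d c ∈ K.F (s + r)) :
    K.d c ∈ K.F (s + r + 1) ⊔ (K.F (s + 1)).map K.d := by
  have hr2 : 2 ≤ r := by
    simp only [Set.mem_insert_iff, Set.mem_singleton_iff] at hr; omega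
  rw [← K.sum_pr c, map_sum]
  refine Submodule.sum_mem _ fun g _ => ?_
  have hF := K.pr_mem (g := g) hc
  have hdF : K.d (K.pr g c) ∈ K.F (s + r) := by rw [K.d_pr]; exact K.pr_mem hdc
  by_cases h : g ≠ 4 * (s : ZMod 18) ∧ g ≠ 4 * (s : ZMod 18) - 1
  · obtain ⟨e, he, f, hf, -, -, h⟩ := decomp_hom (hom_pr g c)
      (K.vanish h.1 h.2 hF (hom_pr g c) (K.le (by omega) hdF))
    rw [h, map_add, K.d_d, add_zero]
    exact Submodule.mem_sup_right (Submodule.mem_map_of_mem he)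
  · refine sup_mono le_rfl (by omega) (K.vanish (g := g - 3) ?_ ?_ hdF ((hom_pr g c).d rfl) (by
      rw [K.d_d]; exact zero_mem _))
    all_goals
      intro h'
      apply h
      rw [sub_eq_iff_eq_add] at h'
      subst h'
      simp only [Set.mem_insert_iff, Set.mem_singleton_iff] at hr
      push_cast
      generalize (s : ZMod 18) = t
      rcases hr with rfl | rfl | rfl | rfl | rfl <;> push_cast <;> revert t <;> decide

/-- A class of degree `4s` has a representative of filtration `4` whose differential is a
cochain of higher filtration. -/
lemma exists_four {s : ℕ} {x : L} (hx : x ∈ K.F s) (gx : K.Hom (4 * s) x)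
    (hdx : K.d x ∈ K.F (s + 2)) :
    ∃ x' ∈ K.F s, K.Hom (4 * s) x' ∧ x' - x ∈ K.F (s + 1) ∧ K.d x' ∈ K.F (s + 4) := by
  obtain ⟨e, he, f, hf, ge, gf, h⟩ := push (K := K) 2 hdx (gx.d rfl) (by
      intro j hj
      push_cast
      generalize (s : ZMod 18) = t
      interval_cases j <;> revert t <;> decide) (by rw [K.d_d]; exact zero_mem _)
  refine ⟨x - f, sub_mem hx (K.le (by omega) hf), gx.sub (gf.eq (by ring)), ?_, ?_⟩
  · rw [show x - f - x = -f by abel]; exact neg_mem hf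
  · rw [map_sub, h, show e + K.d f - K.d f = e by abel]; exact he

lemma exists_eight {s : ℕ} {x : L} (hx : x ∈ K.F s) (gx : K.Hom (4 * s) x)
    (h : K.d x ∈ K.F (s + 5) ⊔ (K.F (s + 1)).map K.d) :
    ∃ x' ∈ K.F s, x' - x ∈ K.F (s + 1) ∧ K.d x' ∈ K.F (s + 9) := by
  obtain ⟨e, he, f, hf, ge, gf, h⟩ := decomp_hom (gx.d rfl) h
  have hde : K.d e = 0 := by
    have := congrArg K.d h
    rw [K.d_d, map_add, K.d_d, add_zero] at this
    exact this.symm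
  obtain ⟨e1, he1, f1, hf1, -, -, h1⟩ := push (K := K) 4 he ge (by
      intro j hj
      push_cast
      generalize (s : ZMod 18) = t
      interval_cases j <;> revert t <;> decide) (by rw [hde]; exact zero_mem _)
  refine ⟨x - f - f1, sub_mem (sub_mem hx (K.le (by omega) hf)) (K.le (by omega) hf1), ?_, ?_⟩
  · rw [show x - f - f1 - x = -f - f1 by abel]
    exact sub_mem (neg_mem hf) (K.le (by omega) hf1)
  · rw [map_sub, map_sub, h, h1, show e1 + K.d f1 + K.d f - K.d f - K.d f1 = e1 by abel]
    exact he1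

lemma exists_a_four {s : ℕ} {x : L} (hx : x ∈ K.F s) (gx : K.Hom (4 * s) x)
    (hdx : K.d x ∈ K.F (s + 4)) :
    ∃ X ∈ K.F s, X - K.a x ∈ K.F (s + 1) ∧ K.d X ∈ K.F (s + 5) := by
  obtain ⟨e, he, f, hf, -, -, h⟩ := push (K := K) 1 (K.a_mem hdx)
    ((gx.d rfl).a rfl) (by
      intro j hj
      push_cast
      generalize (s : ZMod 18) = t
      interval_cases j; revert t; decide) (by
      rw [K.d_a, K.d_d, map_zero, neg_zero]; exact zero_mem _)
  refine ⟨K.a x + f, add_mem (K.a_mem hx) (K.le (by omega) hf), ?_, ?_⟩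
  · rw [add_sub_cancel_left]; exact K.le (by omega) hf
  · rw [map_add, K.d_a, h, show -(e + K.d f) + K.d f = -e by abel]
    exact neg_mem he

lemma exists_y {s : ℕ} {x : L} (gx : K.Hom (4 * s) x) (hdx : K.d x ∈ K.F (s + 4)) :
    ∃ y ∈ K.F (s + 4), K.Hom (4 * (s + 4 : ℕ)) y ∧ K.d y ∈ K.F (s + 6) ∧
      K.d x - K.a y ∈ K.F (s + 5) ⊔ (K.F (s + 3)).map K.d :=
  K.a_surj hdx (gx.d (by
    push_cast; generalize (s : ZMod 18) = t; revert t; decide)) (by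
      rw [K.d_d]; exact zero_mem _)

lemma y_unique {s : ℕ} {y : L} (hy : y ∈ K.F (s + 4)) (gy : K.Hom (4 * (s + 4 : ℕ)) y)
    (hdy : K.d y ∈ K.F (s + 6)) (h : K.a y ∈ K.F (s + 5) ⊔ (K.F (s + 1)).map K.d) :
    y ∈ K.F (s + 5) ⊔ (K.F (s + 3)).map K.d := by
  refine K.a_inj hy gy hdy ?_
  obtain ⟨e, he, f, hf, ge, gf, h⟩ := decomp_hom (gy.a rfl) h
  have hdf : K.d f ∈ K.F (s + 4) := by
    rw [show K.d f = K.a y - e by rw [h]; abel]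
    exact sub_mem (K.a_mem hy) (K.le (by omega) he)
  obtain ⟨e1, he1, f1, hf1, -, -, h1⟩ := push (K := K) 2 hf gf (by
      intro j hj
      push_cast
      generalize (s : ZMod 18) = t
      interval_cases j <;> revert t <;> decide) hdf
  rw [h, h1, map_add, K.d_d, add_zero]
  exact mem_sup he he1

/-- Every `E₂`-cocycle is a sum of one of degree `4s` and `a` times another. -/
lemma exists_decomp {s : ℕ} {c : L} (hc : c ∈ K.F s) (hdc : K.d c ∈ K.F (s + 2)) :
    ∃ x ∈ K.F s, ∃ y ∈ K.F s, K.Hom (4 * s) x ∧ K.Hom (4 * s) y ∧ K.d x ∈ K.F (s + 2) ∧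
      K.d y ∈ K.F (s + 2) ∧ c - (x + K.a y) ∈ K.F (s + 1) ⊔ (K.F (s - 1)).map K.d := by
  have hdp (g : ZMod 18) : K.d (K.pr g c) ∈ K.F (s + 2) := by rw [K.d_pr]; exact K.pr_mem hdc
  obtain ⟨y, hy, gy, hdy, h⟩ := K.a_surj (K.pr_mem hc) (hom_pr (4 * (s : ZMod 18) - 1) c) (hdp _)
  refine ⟨K.pr (4 * s) c, K.pr_mem hc, y, hy, hom_pr _ _, gy, hdp _, hdy, ?_⟩
  have hne : 4 * (s : ZMod 18) - 1 ≠ 4 * s := by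
    generalize (s : ZMod 18) = t; revert t; decide
  have : c - (K.pr (4 * s) c + K.a y) = (K.pr (4 * s - 1) c - K.a y) +
      ∑ g ∈ (Finset.univ.erase (4 * (s : ZMod 18))).erase (4 * s - 1), K.pr g c := by
    conv_lhs => rw [← K.sum_pr c]
    rw [K.sum_pr c]
    conv_lhs => enter [1]; rw [← K.sum_pr c]
    rw [← Finset.add_sum_erase _ _ (Finset.mem_univ (4 * (s : ZMod 18))),
      ← Finset.add_sum_erase (Finset.univ.erase (4 * (s : ZMod 18))) _
        (Finset.mem_erase.2 ⟨hne, Finset.mem_univ _⟩)]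
    abel
  rw [this]
  refine add_mem h (Submodule.sum_mem _ fun g hg => ?_)
  have h1 := Finset.ne_of_mem_erase hg
  have h2 := Finset.ne_of_mem_erase (Finset.mem_of_mem_erase hg)
  exact K.vanish h2 h1 (K.pr_mem hc) (hom_pr g c) (hdp g)

lemma decomp_unique {s : ℕ} {x y : L} (hy : y ∈ K.F s) (gx : K.Hom (4 * s) x)
    (gy : K.Hom (4 * s) y) (hdy : K.d y ∈ K.F (s + 2))
    (h : x + K.a y ∈ K.F (s + 1) ⊔ (K.F (s - 1)).map K.d) :
    x ∈ K.F (s + 1) ⊔ (K.F (s - 1)).map K.d ∧ y ∈ K.F (s + 1) ⊔ (K.F (s - 1)).map K.d := by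
  have hne : 4 * (s : ZMod 18) - 1 ≠ 4 * s := by
    generalize (s : ZMod 18) = t; revert t; decide
  have gay : K.Hom (4 * s - 1) (K.a y) := gy.a rfl
  have h1 := pr_mem_sup (g := 4 * (s : ZMod 18)) h
  have h2 := pr_mem_sup (g := 4 * (s : ZMod 18) - 1) h
  rw [map_add, gay.pr_ne hne.symm, add_zero, show K.pr _ x = x from gx] at h1
  rw [map_add, gx.pr_ne hne, zero_add, show K.pr _ (K.a y) = K.a y from gay] at h2
  exact ⟨h1, K.a_inj hy gy hdy h2⟩

end GradedFilteredComplex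

section Fractions

variable {M M' : Type*} [AddCommGroup M] [Module kb M] [AddCommGroup M'] [Module kb M']

/-- The fraction `b₁₀^{-N} c`. -/
def frac (c : M) (N : ℕ) : LocalizedModule bPow M :=
  LocalizedModule.mk c ⟨Polynomial.X ^ N, N, rfl⟩

lemma exists_frac (e : LocalizedModule bPow M) : ∃ c N, e = frac c N := by
  induction e using LocalizedModule.induction_on with
  | h m s =>
    obtain ⟨_, N, rfl⟩ := s
    exact ⟨m, N, rfl⟩

lemma frac_eq_iff {c c' : M} {N N' : ℕ} : frac c N = frac c' N' ↔
    ∃ u : ℕ, (Polynomial.X ^ (u + N') : kb) • c = (Polynomial.X ^ (u + N) : kb) • c' := by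
  rw [frac, frac, LocalizedModule.mk_eq]
  constructor
  · rintro ⟨⟨_, u, rfl⟩, h⟩
    refine ⟨u, ?_⟩
    rw [pow_add, pow_add, mul_smul, mul_smul]
    exact h
  · rintro ⟨u, h⟩
    refine ⟨⟨_, u, rfl⟩, ?_⟩
    rw [pow_add, pow_add, mul_smul, mul_smul] at h
    exact h

lemma frac_smul (c : M) (N u : ℕ) : frac ((Polynomial.X ^ u : kb) • c) (N + u) = frac c N :=
  frac_eq_iff.2 ⟨0, by rw [smul_smul, ← pow_add]; congr 2; omega⟩

lemma frac_add (c c' : M) (N : ℕ) : frac c N + frac c' N = frac (c + c') N := by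
  rw [frac, frac, LocalizedModule.mk_add_mk, ← smul_add]
  exact LocalizedModule.mk_cancel_common_left _ _ _

lemma frac_zero (N : ℕ) : frac (0 : M) N = 0 := LocalizedModule.zero_mk _

lemma frac_neg (c : M) (N : ℕ) : frac (-c) N = -frac c N := by
  rw [eq_neg_iff_add_eq_zero, frac_add, neg_add_cancel, frac_zero]

lemma frac_sub (c c' : M) (N : ℕ) : frac c N - frac c' N = frac (c - c') N := by
  rw [sub_eq_add_neg, ← frac_neg, frac_add, sub_eq_add_neg]

lemma frac_sum {ι : Type*} (t : Finset ι) (c : ι → M) (N : ℕ) :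
    ∑ i ∈ t, frac (c i) N = frac (∑ i ∈ t, c i) N := by
  classical
  induction t using Finset.induction_on with
  | empty => simp [frac_zero]
  | insert a t ha ih => rw [Finset.sum_insert ha, Finset.sum_insert ha, ih, frac_add]

/-- The localization of a linear map. -/
def lmap (f : M →ₗ[kb] M') : LocalizedModule bPow M →ₗ[kb] LocalizedModule bPow M' :=
  IsLocalizedModule.map bPow (LocalizedModule.mkLinearMap bPow M)
    (LocalizedModule.mkLinearMap bPow M') f

@[simp]
lemma lmap_frac (f : M →ₗ[kb] M') (c : M) (N : ℕ) : lmap f (frac c N) = frac (f c) N := by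
  rw [lmap, frac, frac, IsLocalizedModule.mk_eq_mk', IsLocalizedModule.map_mk',
    IsLocalizedModule.mk_eq_mk']

/-- The localization of a submodule. -/
def locSub (p : Submodule kb M) : Submodule kb (LocalizedModule bPow M) :=
  p.localized₀ bPow (LocalizedModule.mkLinearMap bPow M)

lemma mem_locSub {p : Submodule kb M} {l : LocalizedModule bPow M} :
    l ∈ locSub p ↔ ∃ c ∈ p, ∃ N, l = frac c N := by
  constructor
  · rintro ⟨c, hc, ⟨_, N, rfl⟩, rfl⟩
    exact ⟨c, hc, N, (IsLocalizedModule.mk_eq_mk' _ _).symm⟩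
  · rintro ⟨c, hc, N, rfl⟩
    exact ⟨c, hc, ⟨_, N, rfl⟩, (IsLocalizedModule.mk_eq_mk' _ _).symm⟩

lemma frac_mem_locSub {p : Submodule kb M} {c : M} {N : ℕ} :
    frac c N ∈ locSub p ↔ ∃ u : ℕ, (Polynomial.X ^ u : kb) • c ∈ p := by
  rw [mem_locSub]
  constructor
  · rintro ⟨c', hc', N', h⟩
    obtain ⟨u, hu⟩ := frac_eq_iff.1 h
    exact ⟨u + N', hu ▸ p.smul_mem _ hc'⟩
  · rintro ⟨u, hu⟩
    exact ⟨_, hu, N + u, (frac_smul c N u).symm⟩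

end Fractions

/-- The localized cobar complex. -/
abbrev LC : Type := LocalizedModule bPow Cobar

lemma F_anti : Antitone F := fun s t h x hx => by
  refine Submodule.span_mono ?_ (show x ∈ filt t from hx)
  rintro _ ⟨l, hl, rfl⟩
  exact ⟨l, h.trans hl, rfl⟩

lemma Z_anti {r r' s : ℕ} (h : r ≤ r') : Z r' s ≤ Z r s :=
  inf_le_inf le_rfl (Submodule.comap_mono (F_anti (by omega)))

/-- `l ∈ LC` is a representative of the class `e` on the page `E_r^s`. -/
def Rep (r s : ℕ) (l : LC) (e : E r s) : Prop :=
  ∃ (c : Cobar) (hc : c ∈ Z r s) (N : ℕ), l = frac c N ∧ e = cls c hc N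

lemma cls_eq_frac {r s : ℕ} (c : Cobar) (hc : c ∈ Z r s) (N : ℕ) :
    cls c hc N = frac (Submodule.Quotient.mk ⟨c, hc⟩ : Page r s) N := rfl

lemma exists_cls {r s : ℕ} (e : E r s) : ∃ c, ∃ hc : c ∈ Z r s, ∃ N, e = cls c hc N := by
  obtain ⟨p, N, rfl⟩ := exists_frac e
  obtain ⟨⟨c, hc⟩, rfl⟩ := Submodule.Quotient.mk_surjective _ p
  exact ⟨c, hc, N, rfl⟩

lemma cls_eq_iff {r s : ℕ} {c c' : Cobar} (hc : c ∈ Z r s) (hc' : c' ∈ Z r s) {N N' : ℕ} :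
    cls c hc N = cls c' hc' N' ↔ frac c N - frac c' N' ∈ locSub (B r s) := by
  rw [← frac_smul c N N', ← frac_smul c' N' N, add_comm N' N, frac_sub, frac_mem_locSub,
    cls_eq_frac, cls_eq_frac, frac_eq_iff]
  refine exists_congr fun u => ?_
  rw [← Submodule.Quotient.mk_smul, ← Submodule.Quotient.mk_smul, Submodule.Quotient.eq]
  rw [smul_sub, smul_smul, smul_smul, ← pow_add, ← pow_add]
  rfl

section Model

variable (K : GradedFilteredComplex kb LC) (hF : ∀ s, K.F s = locSub (F s)) (hd : K.d = lmap dKb)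

include hF hd

lemma exists_frac_of_mem {r s : ℕ} {l : LC} (hl : l ∈ K.F s) (hdl : K.d l ∈ K.F (s + r)) :
    ∃ c ∈ Z r s, ∃ N, l = frac c N := by
  rw [hF, mem_locSub] at hl
  obtain ⟨c, hc, N, rfl⟩ := hl
  rw [hF, hd, lmap_frac, frac_mem_locSub] at hdl
  obtain ⟨u, hu⟩ := hdl
  exact ⟨_, ⟨(F s).smul_mem (Polynomial.X ^ u) hc, by
    change dKb _ ∈ F _
    rw [map_smul]; exact hu⟩, N + u, (frac_smul c N u).symm⟩

lemma frac_mem_F {r s : ℕ} {c : Cobar} (hc : c ∈ Z r s) (N : ℕ) :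
    frac c N ∈ K.F s ∧ K.d (frac c N) ∈ K.F (s + r) := by
  rw [hF, hF, hd, lmap_frac]
  exact ⟨mem_locSub.2 ⟨c, hc.1, N, rfl⟩, mem_locSub.2 ⟨_, hc.2, N, rfl⟩⟩

lemma mem_locSub_B {r s : ℕ} {c : Cobar} (hc : c ∈ Z r s) (N : ℕ) :
    frac c N ∈ locSub (B r s) ↔ frac c N ∈ K.F (s + 1) ⊔ (K.F (s + 1 - r)).map K.d := by
  constructor
  · intro h
    obtain ⟨x, hx, N', h⟩ := mem_locSub.1 h
    obtain ⟨e, he, _, ⟨f, hf, rfl⟩, rfl⟩ := Submodule.mem_sup.1 hx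
    rw [h, ← frac_add, ← lmap_frac, ← hd]
    refine K.mem_sup ?_ ?_
    · rw [hF]; exact mem_locSub.2 ⟨e, he.1, _, rfl⟩
    · rw [hF]; exact mem_locSub.2 ⟨f, hf.1, _, rfl⟩
  · intro h
    obtain ⟨e, he, _, ⟨f, hf, rfl⟩, h⟩ := Submodule.mem_sup.1 h
    rw [hF, SetLike.mem_coe, mem_locSub] at hf
    rw [hF, mem_locSub] at he
    obtain ⟨e, he, N₁, rfl⟩ := he
    obtain ⟨f, hf, N₂, rfl⟩ := hf
    rw [hd, lmap_frac, ← frac_smul e N₁ N₂, ← frac_smul (dKb f) N₂ N₁, add_comm N₂, frac_add,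
      frac_eq_iff] at h
    obtain ⟨u, hu⟩ := h
    rw [frac_mem_locSub]
    refine ⟨u + (N₁ + N₂), ?_⟩
    rw [smul_add, smul_smul, smul_smul, ← pow_add, ← pow_add, ← map_smul] at hu
    rw [← hu]
    set e' := (Polynomial.X ^ (u + N + N₂) : kb) • e with he'
    set f' := (Polynomial.X ^ (u + N + N₁) : kb) • f with hf'
    have he'' : e' ∈ F (s + 1) := Submodule.smul_mem _ _ he
    have hf'' : f' ∈ F (s + 1 - r) := Submodule.smul_mem _ _ hf
    refine Submodule.add_mem_sup ⟨he'', ?_⟩ (Submodule.mem_map_of_mem ⟨hf'', ?_⟩)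
    · have : dKb e' = (Polynomial.X ^ (u + (N₁ + N₂)) : kb) • dKb c := by
        rw [← map_smul, ← hu, map_add, dKb_dKb, add_zero]
      change dKb _ ∈ F _
      rw [this]
      exact Submodule.smul_mem _ _ hc.2
    · change dKb _ ∈ F _
      rw [← add_sub_cancel_left e' (dKb f'), hu]
      exact sub_mem (Submodule.smul_mem _ _ hc.1) (F_anti (Nat.le_succ s) he'')

lemma rep_mem {r s : ℕ} {l : LC} {e : E r s} (h : Rep r s l e) :
    l ∈ K.F s ∧ K.d l ∈ K.F (s + r) := by
  obtain ⟨c, hc, N, rfl, -⟩ := h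
  exact frac_mem_F K hF hd hc N

lemma rep_eq_iff {r s : ℕ} {l l' : LC} {e e' : E r s} (h : Rep r s l e) (h' : Rep r s l' e') :
    e = e' ↔ l - l' ∈ K.F (s + 1) ⊔ (K.F (s + 1 - r)).map K.d := by
  obtain ⟨c, hc, N, rfl, rfl⟩ := h
  obtain ⟨c', hc', N', rfl, rfl⟩ := h'
  rw [cls_eq_iff, ← frac_smul c N N', ← frac_smul c' N' N, add_comm N' N, frac_sub,
    mem_locSub_B K hF hd]
  exact sub_mem (Submodule.smul_mem _ _ hc) (Submodule.smul_mem _ _ hc')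

lemma exists_rep_of_mem {r s : ℕ} {l : LC} (hl : l ∈ K.F s) (hdl : K.d l ∈ K.F (s + r)) :
    ∃ e, Rep r s l e := by
  obtain ⟨c, hc, N, rfl⟩ := exists_frac_of_mem K hF hd hl hdl
  exact ⟨_, c, hc, N, rfl, rfl⟩

lemma rep_of_sub_mem {r s : ℕ} {l l' : LC} {e : E r s} (h : Rep r s l e) (hl : l' ∈ K.F s)
    (hdl : K.d l' ∈ K.F (s + r)) (hs : l' - l ∈ K.F (s + 1) ⊔ (K.F (s + 1 - r)).map K.d) :
    Rep r s l' e := by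
  obtain ⟨e', h'⟩ := exists_rep_of_mem K hF hd hl hdl
  rwa [(rep_eq_iff K hF hd h' h).2 hs] at h'

omit hF hd in
lemma exists_rep {r s : ℕ} (e : E r s) : ∃ l, Rep r s l e := by
  obtain ⟨c, hc, N, rfl⟩ := exists_cls e
  exact ⟨_, c, hc, N, rfl, rfl⟩

omit hF hd in
lemma rep_zero {r s : ℕ} : Rep r s 0 0 :=
  ⟨0, zero_mem _, 0, (frac_zero 0).symm, by
    rw [cls_eq_frac]; exact (frac_zero (M := Page r s) 0).symm⟩

omit K hF hd in
lemma Rep.add {r s : ℕ} {l l' : LC} {e e' : E r s} (h : Rep r s l e) (h' : Rep r s l' e') :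
    Rep r s (l + l') (e + e') := by
  obtain ⟨c, hc, N, rfl, rfl⟩ := h
  obtain ⟨c', hc', N', rfl, rfl⟩ := h'
  refine ⟨(Polynomial.X ^ N' : kb) • c + (Polynomial.X ^ N : kb) • c',
    add_mem (Submodule.smul_mem _ _ hc) (Submodule.smul_mem _ _ hc'), N + N', ?_, ?_⟩
  · rw [← frac_smul c N N', ← frac_smul c' N' N, add_comm N' N, frac_add]
  · rw [cls_eq_frac, cls_eq_frac, cls_eq_frac]
    rw [← frac_smul _ N N', ← frac_smul _ N' N, add_comm N' N, frac_add]
    rfl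

omit K hF hd in
lemma Rep.map {r s r' s' : ℕ} {f : Cobar →ₗ[kb] Cobar} {g : Page r s →ₗ[kb] Page r' s'}
    (hfg : ∀ c (hc : c ∈ Z r s), ∃ hc' : f c ∈ Z r' s',
      g (Submodule.Quotient.mk ⟨c, hc⟩) = Submodule.Quotient.mk ⟨f c, hc'⟩)
    {l : LC} {e : E r s} (h : Rep r s l e) : Rep r' s' (lmap f l) (locMap g e) := by
  obtain ⟨c, hc, N, rfl, rfl⟩ := h
  obtain ⟨hc', hg⟩ := hfg c hc
  refine ⟨f c, hc', N, lmap_frac _ _ _, ?_⟩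
  rw [cls_eq_frac, cls_eq_frac, ← hg]
  exact lmap_frac g _ N

omit hF in
lemma Rep.dE {r s : ℕ} {l : LC} {e : E r s} (h : Rep r s l e) :
    Rep r (s + r) (K.d l) (dE r s e) := by
  rw [hd]; exact h.map fun c hc => ⟨dKb_mem_Z hc, rfl⟩

lemma represents_iff {r s : ℕ} (hr : 2 ≤ r) {x : E 2 s} {x' : E r s} :
    Represents r x x' ↔ ∃ l, Rep 2 s l x ∧ Rep r s l x' := by
  constructor
  · rintro ⟨c, h2, h, N, rfl, rfl⟩
    exact ⟨frac c N, ⟨c, h2, N, rfl, rfl⟩, ⟨c, h, N, rfl, rfl⟩⟩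
  · rintro ⟨l, h2, h⟩
    obtain ⟨hl, hdl⟩ := rep_mem K hF hd h
    obtain ⟨c, hc, N, rfl⟩ := exists_frac_of_mem K hF hd hl hdl
    refine ⟨c, Z_anti hr hc, hc, N, ?_, ?_⟩
    · exact (rep_eq_iff K hF hd h2 ⟨c, Z_anti hr hc, N, rfl, rfl⟩).2 (by simp)
    · exact (rep_eq_iff K hF hd h ⟨c, hc, N, rfl, rfl⟩).2 (by simp)

lemma diffEq_of {r s : ℕ} (hr : 2 ≤ r) {x : E 2 s} {y : E 2 (s + r)} {l : LC}
    (hdl : K.d l ∈ K.F (s + r)) (hx : Rep 2 s l x) (hy : Rep 2 (s + r) (K.d l) y) :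
    DiffEq r x y := by
  obtain ⟨x', hx'⟩ := exists_rep_of_mem K hF hd (rep_mem K hF hd hx).1 hdl
  exact ⟨x', dE r s x', (represents_iff K hF hd hr).2 ⟨l, hx, hx'⟩,
    (represents_iff K hF hd hr).2 ⟨K.d l, hy, hx'.dE K hd⟩, rfl⟩

lemma exists_of_diffEq {r s : ℕ} (hr : 2 ≤ r) {x : E 2 s} {y : E 2 (s + r)} (h : DiffEq r x y) :
    ∃ l m, Rep 2 s l x ∧ Rep 2 (s + r) m y ∧ K.d l ∈ K.F (s + r) ∧
      K.d l - m ∈ K.F (s + r + 1) ⊔ (K.F (s + 1)).map K.d := by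
  obtain ⟨x', y', hx, hy, h⟩ := h
  obtain ⟨l, hl, hl'⟩ := (represents_iff K hF hd hr).1 hx
  obtain ⟨m, hm, hm'⟩ := (represents_iff K hF hd hr).1 hy
  refine ⟨l, m, hl, hm, (rep_mem K hF hd hl').2, ?_⟩
  have := (rep_eq_iff K hF hd (hl'.dE K hd) hm').1 h
  rwa [show s + r + 1 - r = s + 1 by omega] at this

variable (ha : K.a = lmap (mulKb h10)) (hq : K.q = lmap (mulKb (bar (xi 1 ^ 2))))

include ha

omit hF hd in
lemma Rep.hE {r s : ℕ} {l : LC} {e : E r s} (h : Rep r s l e) :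
    Rep r s (K.a l) (hE r s e) := by
  rw [ha]; exact h.map fun c hc => ⟨_, rfl⟩

include hq

omit hF hd in
lemma Rep.bE {r s : ℕ} {l : LC} {e : E r s} (h : Rep r s l e) :
    Rep r s (K.b l) (bE r s e) := by
  have : K.b = lmap (mulKb b10) := by
    refine LinearMap.ext fun l => ?_
    obtain ⟨c, N, rfl⟩ := exists_frac l
    rw [K.b_apply, ha, hq]
    simp only [lmap_frac, frac_add]
    congr 1
    change h10 * (bar (xi 1 ^ 2) * c) + bar (xi 1 ^ 2) * (h10 * c) = b10 * c
    simp only [b10, h10, add_mul, mul_assoc]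
  rw [this]; exact h.map fun c hc => ⟨_, rfl⟩

variable (π : ZMod 18 → Cobar →ₗ[kb] Cobar) (hπ : ∀ g, K.pr g = lmap (π g))
  (hodd : ∀ (t : ZMod 18) (c : Cobar), c ∈ evenCobar → π (2 * t + 1) c = 0)
  (heven : ∀ (t : ZMod 18) (c : Cobar), π (2 * t) c ∈ evenCobar)

omit ha hq

include hπ hodd in
lemma exists_rep_of_mem_WPlus {s : ℕ} {e : E 2 s} (h : e ∈ WPlus s) :
    ∃ l, K.Hom (4 * s) l ∧ Rep 2 s l e := by
  obtain ⟨c, hc, N, hce, rfl⟩ := h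
  obtain ⟨hl, hdl⟩ := frac_mem_F K hF hd hc N
  refine ⟨K.pr (4 * s) (frac c N), K.hom_pr _ _, rep_of_sub_mem K hF hd ⟨c, hc, N, rfl, rfl⟩
    (K.pr_mem hl) (by rw [K.d_pr]; exact K.pr_mem hdl) ?_⟩
  have h1 : K.pr (4 * s) (frac c N) - frac c N =
      -∑ g ∈ Finset.univ.erase (4 * (s : ZMod 18)), K.pr g (frac c N) := by
    conv_lhs => enter [2]; rw [← K.sum_pr (frac c N)]
    rw [← Finset.add_sum_erase _ _ (Finset.mem_univ (4 * (s : ZMod 18)))]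
    abel
  rw [h1]
  refine neg_mem (Submodule.sum_mem _ fun g hg => ?_)
  by_cases hpar : ∃ t, g = 2 * t + 1
  · obtain ⟨t, rfl⟩ := hpar
    rw [hπ, lmap_frac, hodd t c hce, frac_zero]
    exact zero_mem _
  · refine K.vanish (Finset.ne_of_mem_erase hg) ?_ (K.pr_mem hl) (K.hom_pr _ _)
      (by rw [K.d_pr]; exact K.pr_mem hdl)
    rintro rfl
    exact hpar ⟨2 * s - 1, by ring⟩

include hπ heven in
lemma mem_WPlus_of_rep {s : ℕ} {e : E 2 s} {l : LC} (hl : K.Hom (4 * s) l) (h : Rep 2 s l e) :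
    e ∈ WPlus s := by
  obtain ⟨hls, hdl⟩ := rep_mem K hF hd h
  have h1 : l = K.pr (4 * s) l := hl.symm
  obtain ⟨c, N, rfl⟩ := exists_frac l
  rw [hπ, lmap_frac] at h1
  rw [h1] at h hls hdl
  rw [hF, frac_mem_locSub] at hls
  rw [hF, hd, lmap_frac, frac_mem_locSub] at hdl
  obtain ⟨u, hu⟩ := hls
  obtain ⟨v, hv⟩ := hdl
  refine ⟨π (4 * s) ((Polynomial.X ^ (u + v) : kb) • c), ?_, N + (u + v), ?_, ?_⟩
  · rw [map_smul]
    refine ⟨?_, ?_⟩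
    · rw [add_comm, pow_add, mul_smul]; exact Submodule.smul_mem _ _ hu
    · change dKb _ ∈ F _
      rw [map_smul, pow_add, mul_smul]; exact Submodule.smul_mem _ _ hv
  · rw [show (4 * s : ZMod 18) = 2 * (2 * s) by ring]; exact heven _ _
  · refine (rep_eq_iff K hF hd h ⟨_, _, _, rfl, rfl⟩).2 ?_
    rw [map_smul, frac_smul, sub_self]
    exact zero_mem _

include ha hq hπ hodd heven

theorem proposition_of_model :
    (∀ (s r : ℕ) (x : E 2 s) (y : E 2 (s + r)) (z : E 2 (s + r + 4)),
      2 ≤ r →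
      (∀ r' : ℕ, 2 ≤ r' → r' < r → DiffEq r' x 0) →
      y ∈ WPlus (s + r) → DiffEq r x (hE 2 (s + r) y) →
      z ∈ WPlus (s + r + 4) → DiffEq 4 y (hE 2 (s + r + 4) z) →
      DiffEq (r + 4) (hE 2 s x) (bE 2 (s + r + 4) z)) ∧
    (∀ r ∈ ({2, 3, 5, 6, 7} : Set ℕ), ∀ s : ℕ, dE r s = 0) ∧
    (∀ (s : ℕ) (v : E 2 s), ∃! p : E 2 s × E 2 s,
      p.1 ∈ WPlus s ∧ p.2 ∈ WPlus s ∧ v = p.1 + hE 2 s p.2) ∧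
    (∀ (s : ℕ), ∀ x ∈ WPlus s,
      DiffEq 4 (hE 2 s x) 0 ∧
      (DiffEq 4 x 0 → DiffEq 8 x 0) ∧
      (∃! y : E 2 (s + 4), y ∈ WPlus (s + 4) ∧
        DiffEq 4 x (hE 2 (s + 4) y)) ∧
      ∀ y ∈ WPlus (s + 4), ∀ z ∈ WPlus (s + 8),
        DiffEq 4 x (hE 2 (s + 4) y) →
        DiffEq 4 y (hE 2 (s + 8) z) →
        DiffEq 8 (hE 2 s x) (bE 2 (s + 8) z)) := by
  have part1 : ∀ (s r : ℕ) (x : E 2 s) (y : E 2 (s + r)) (z : E 2 (s + r + 4)),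
      2 ≤ r → y ∈ WPlus (s + r) → DiffEq r x (hE 2 (s + r) y) →
      z ∈ WPlus (s + r + 4) → DiffEq 4 y (hE 2 (s + r + 4) z) →
      DiffEq (r + 4) (hE 2 s x) (bE 2 (s + r + 4) z) := by
    intro s r x y z hr hy hxy hz hyz
    obtain ⟨ly, gy, hly⟩ := exists_rep_of_mem_WPlus K hF hd π hπ hodd hy
    obtain ⟨lz, gz, hlz⟩ := exists_rep_of_mem_WPlus K hF hd π hπ hodd hz
    obtain ⟨l, m, hl, hm, hdl, h1⟩ := exists_of_diffEq K hF hd hr hxy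
    obtain ⟨l2, m2, hl2, hm2, -, h2⟩ := exists_of_diffEq K hF hd (by norm_num) hyz
    have e1 := (rep_eq_iff K hF hd hm (hly.hE K ha)).1 rfl
    have e2 := (rep_eq_iff K hF hd hm2 (hlz.hE K ha)).1 rfl
    have e3 := (rep_eq_iff K hF hd hl2 hly).1 rfl
    obtain ⟨hls, -⟩ := rep_mem K hF hd hl
    obtain ⟨hlys, -⟩ := rep_mem K hF hd hly
    obtain ⟨hlzs, hdlz⟩ := rep_mem K hF hd hlz
    obtain ⟨X, hX, hXa, hdX⟩ := K.differential_a hr hls (K.le (by omega) hdl) hlys hlzs gy gz hdlz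
      (by
        rw [show K.d l - K.a ly = (K.d l - m) + (m - K.a ly) by abel]
        exact add_mem h1 (K.sup_mono le_rfl (by omega) e1))
      (by
        obtain ⟨e, he, _, ⟨f, hf, rfl⟩, h⟩ := Submodule.mem_sup.1 e3
        have : K.d ly = K.d l2 - K.d e := by
          have h' := congrArg K.d h
          rw [map_add, K.d_d, add_zero, map_sub] at h'
          rw [h']; abel
        rw [show K.d ly - K.a lz = ((K.d l2 - m2) + (m2 - K.a lz)) - K.d e by rw [this]; abel]
        exact sub_mem (add_mem h2 (K.sup_mono le_rfl (by omega) e2))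
          (Submodule.mem_sup_right (Submodule.mem_map_of_mem he)))
    have hdX4 : K.d X ∈ K.F (s + r + 4) := by
      rw [← sub_add_cancel (K.d X) (K.b lz)]
      exact add_mem (K.le (by omega) hdX) (K.b_mem hlzs)
    refine diffEq_of K hF hd (by omega) (l := X) hdX4 ?_ ?_
    · exact rep_of_sub_mem K hF hd (hl.hE K ha) hX (K.le (by omega) hdX4) hXa
    · exact rep_of_sub_mem K hF hd (hlz.bE K ha hq) hdX4 (by rw [K.d_d]; exact zero_mem _)
        (Submodule.mem_sup_left hdX)
  refine ⟨fun s r x y z hr _ hy hxy hz hyz => part1 s r x y z hr hy hxy hz hyz, ?_, ?_, ?_⟩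
  · intro r hr s
    refine LinearMap.ext fun e => ?_
    obtain ⟨l, hl⟩ := exists_rep e
    obtain ⟨hls, hdl⟩ := rep_mem K hF hd hl
    refine (rep_eq_iff K hF hd (hl.dE K hd) rep_zero).2 ?_
    rw [sub_zero, show s + r + 1 - r = s + 1 by omega]
    exact K.differential_zero hr hls hdl
  · intro s v
    obtain ⟨l, hl⟩ := exists_rep v
    obtain ⟨hls, hdl⟩ := rep_mem K hF hd hl
    obtain ⟨x, hx, y, hy, gx, gy, hdx, hdy, h⟩ := K.exists_decomp hls hdl
    obtain ⟨ex, hex⟩ := exists_rep_of_mem K hF hd hx hdx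
    obtain ⟨ey, hey⟩ := exists_rep_of_mem K hF hd hy hdy
    refine ⟨(ex, ey), ⟨mem_WPlus_of_rep K hF hd π hπ heven gx hex,
      mem_WPlus_of_rep K hF hd π hπ heven gy hey,
      (rep_eq_iff K hF hd hl (hex.add (hey.hE K ha))).2 h⟩, ?_⟩
    rintro ⟨ex', ey'⟩ ⟨hx', hy', hv⟩
    obtain ⟨x', gx', hex'⟩ := exists_rep_of_mem_WPlus K hF hd π hπ hodd hx'
    obtain ⟨y', gy', hey'⟩ := exists_rep_of_mem_WPlus K hF hd π hπ hodd hy'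
    have h' := (rep_eq_iff K hF hd hl (hex'.add (hey'.hE K ha))).1 hv
    have hys := rep_mem K hF hd hey'
    have h3 : (x' - x) + K.a (y' - y) ∈ K.F (s + 1) ⊔ (K.F (s - 1)).map K.d := by
      rw [show (x' - x) + K.a (y' - y) = (l - (x + K.a y)) - (l - (x' + K.a y')) by
        rw [map_sub]; abel]
      exact sub_mem h h'
    obtain ⟨h4, h5⟩ := K.decomp_unique (sub_mem hys.1 hy) (gx'.sub gx) (gy'.sub gy)
      (by rw [map_sub]; exact sub_mem hys.2 hdy) h3
    exact Prod.ext ((rep_eq_iff K hF hd hex' hex).2 h4) ((rep_eq_iff K hF hd hey' hey).2 h5)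
  · intro s x hx
    obtain ⟨lx, gx, hlx⟩ := exists_rep_of_mem_WPlus K hF hd π hπ hodd hx
    obtain ⟨hlxs, hdlx⟩ := rep_mem K hF hd hlx
    obtain ⟨x4, hx4, gx4, hx4x, hdx4⟩ := K.exists_four hlxs gx hdlx
    have hrx4 : Rep 2 s x4 x := rep_of_sub_mem K hF hd hlx hx4 (K.le (by omega) hdx4)
      (Submodule.mem_sup_left hx4x)
    refine ⟨?_, ?_, ?_, ?_⟩
    · obtain ⟨X, hX, hXa, hdX⟩ := K.exists_a_four hx4 gx4 hdx4
      refine diffEq_of K hF hd (by norm_num) (K.le (by omega) hdX)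
        (rep_of_sub_mem K hF hd (hrx4.hE K ha) hX (K.le (by omega) hdX)
          (Submodule.mem_sup_left hXa)) ?_
      refine rep_of_sub_mem K hF hd rep_zero (K.le (by omega) hdX)
        (by rw [K.d_d]; exact zero_mem _) ?_
      rw [sub_zero]; exact Submodule.mem_sup_left hdX
    · intro h
      obtain ⟨l, m, hl, hm, hdl, h1⟩ := exists_of_diffEq K hF hd (by norm_num) h
      have e1 := (rep_eq_iff K hF hd hm rep_zero).1 rfl
      obtain ⟨e, he, _, ⟨f, hf, rfl⟩, hef⟩ :=
        Submodule.mem_sup.1 ((rep_eq_iff K hF hd hl hlx).1 rfl)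
      have hdlx' : K.d lx = K.d l - K.d e := by
        have h' := congrArg K.d hef
        rw [map_add, K.d_d, add_zero, map_sub] at h'
        rw [h']; abel
      obtain ⟨x', hx', hxx', hdx'⟩ := K.exists_eight hlxs gx (by
        rw [show K.d lx = ((K.d l - m) + (m - 0)) - K.d e by rw [hdlx']; abel]
        exact sub_mem (add_mem h1 (K.sup_mono le_rfl (by omega) e1))
          (Submodule.mem_sup_right (Submodule.mem_map_of_mem he)))
      refine diffEq_of K hF hd (by norm_num) (K.le (by omega) hdx')
        (rep_of_sub_mem K hF hd hlx hx' (K.le (by omega) hdx') (Submodule.mem_sup_left hxx')) ?_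
      refine rep_of_sub_mem K hF hd rep_zero (K.le (by omega) hdx')
        (by rw [K.d_d]; exact zero_mem _) ?_
      rw [sub_zero]; exact Submodule.mem_sup_left hdx'
    · obtain ⟨y, hy, gy, hdy, hxy⟩ := K.exists_y gx4 hdx4
      obtain ⟨ey, hey⟩ := exists_rep_of_mem (r := 2) K hF hd hy hdy
      refine ⟨ey, ⟨mem_WPlus_of_rep K hF hd π hπ heven gy hey, ?_⟩, ?_⟩
      · exact diffEq_of K hF hd (by norm_num) hdx4 hrx4
          (rep_of_sub_mem K hF hd (hey.hE K ha) hdx4 (by rw [K.d_d]; exact zero_mem _) hxy)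
      · rintro ey' ⟨hy', hdiff⟩
        obtain ⟨y', gy', hey'⟩ := exists_rep_of_mem_WPlus K hF hd π hπ hodd hy'
        obtain ⟨l, m, hl, hm, hdl, h1⟩ := exists_of_diffEq K hF hd (by norm_num) hdiff
        have e1 := (rep_eq_iff K hF hd hm (hey'.hE K ha)).1 rfl
        obtain ⟨e, he, _, ⟨f, hf, rfl⟩, hef⟩ :=
          Submodule.mem_sup.1 ((rep_eq_iff K hF hd hl hrx4).1 rfl)
        have hdl' : K.d l = K.d x4 + K.d e := by
          have h' := congrArg K.d hef
          rw [map_add, K.d_d, add_zero, map_sub] at h'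
          rw [h']; abel
        have hys := rep_mem K hF hd hey'
        refine (rep_eq_iff K hF hd hey' hey).2 (K.y_unique (sub_mem hys.1 hy) (gy'.sub gy)
          (by rw [map_sub]; exact sub_mem hys.2 hdy) ?_)
        rw [show K.a (y' - y) = (K.d x4 - K.a y) - (m - K.a y') - (K.d l - m) + K.d e by
          rw [hdl', map_sub]; abel]
        exact add_mem (sub_mem (sub_mem (K.sup_mono le_rfl (by omega) hxy)
          (K.sup_mono le_rfl (by omega) e1)) h1)
          (Submodule.mem_sup_right (Submodule.mem_map_of_mem he))
    · intro y hy z hz hxy hyz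
      exact part1 s 4 x y z (by norm_num) hy hxy hz hyz

end Model

/-- Exponents of the monomials `∏ⱼ x_j^{q_j} y_j^{r_j}` with `x_j = ξ_{j+1}³` and `y_j = ξ_{j+2}`,
`r_j < 3`. -/
abbrev A : Type := ℕ →₀ ℕ × Fin 3

/-- The exponents of `ξ₁^r ∏ⱼ x_j^{q_j} y_j^{r_j}` in the generators `ξ_{i+1}`. -/
def expo (r : Fin 3) (a : A) : ℕ →₀ ℕ :=
  Finsupp.ofSupportFinite
    (fun i => 3 * (a i).1 + (match i with | 0 => (r : ℕ) | j + 1 => ((a j).2 : ℕ))) <| by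
    refine Set.Finite.subset
      (Set.Finite.union (Set.Finite.union (Set.finite_singleton 0) a.support.finite_toSet)
        (a.support.finite_toSet.image Nat.succ)) ?_
    intro i hi
    by_contra h
    simp only [Set.mem_union, not_or, Set.mem_singleton_iff, Finset.mem_coe,
      Finsupp.mem_support_iff, not_not, Set.mem_image, not_exists, not_and] at h
    obtain ⟨⟨h0, h1⟩, h2⟩ := h
    refine hi ?_
    cases i with
    | zero => exact absurd rfl h0
    | succ j =>
      have : a j = 0 := by by_contra hj; exact h2 j hj rfl
      simp [h1, this]

lemma expo_zero (r : Fin 3) (a : A) : expo r a 0 = 3 * (a 0).1 + r := rfl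

lemma expo_succ (r : Fin 3) (a : A) (j : ℕ) : expo r a (j + 1) = 3 * (a (j + 1)).1 + (a j).2 := rfl

/-- The bijection between the two indexings of the monomials. -/
def expoEquiv : Fin 3 × A ≃ (ℕ →₀ ℕ) where
  toFun p := expo p.1 p.2
  invFun e := (Fin.ofNat 3 (e 0), Finsupp.ofSupportFinite
    (fun j => (e j / 3, Fin.ofNat 3 (e (j + 1)))) <| by
      refine Set.Finite.subset (Set.Finite.union e.support.finite_toSet
        (e.support.finite_toSet.image Nat.pred)) ?_
      intro i hi
      by_contra h
      simp only [Set.mem_union, not_or, Finset.mem_coe,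
        Finsupp.mem_support_iff, not_not, Set.mem_image, not_exists, not_and] at h
      refine hi ?_
      have : e (i + 1) = 0 := by by_contra hj; exact h.2 (i + 1) hj rfl
      simp [h.1, this])
  left_inv := by
    rintro ⟨r, a⟩
    refine Prod.ext (Fin.ext ?_) (Finsupp.ext fun j => Prod.ext ?_ (Fin.ext ?_))
    · simp [expo_zero, Fin.ofNat]
    · change expo r a j / 3 = (a j).1
      cases j with
      | zero => rw [expo_zero]; omega
      | succ j => rw [expo_succ]; omega
    · change expo r a (j + 1) % 3 = ((a j).2 : ℕ)
      rw [expo_succ]; omega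
  right_inv := by
    intro e
    refine Finsupp.ext fun i => ?_
    cases i with
    | zero => rw [expo_zero]; exact Nat.div_add_mod (e 0) 3
    | succ j => rw [expo_succ]; exact Nat.div_add_mod (e (j + 1)) 3

/-- The monomial `∏ⱼ x_j^{q_j} y_j^{r_j}`. -/
def mon (a : A) : P := MvPolynomial.monomial (expo 0 a) 1

lemma expo_eq (r : Fin 3) (a : A) : expo r a = Finsupp.single 0 (r : ℕ) + expo 0 a := by
  refine Finsupp.ext fun i => ?_
  cases i with
  | zero => simp [expo_zero, add_comm]
  | succ j => simp [expo_succ]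

lemma monomial_expo (r : Fin 3) (a : A) :
    (MvPolynomial.monomial (expo r a) 1 : P) = xi 1 ^ (r : ℕ) * mon a := by
  rw [expo_eq, mon, xi, MvPolynomial.X_pow_eq_monomial, MvPolynomial.monomial_mul, one_mul]

lemma mon_zero : mon 0 = 1 := by
  have : expo 0 0 = 0 := Finsupp.ext fun i => by cases i <;> simp [expo_zero, expo_succ]
  rw [mon, this]; rfl

lemma expo_add {a b : A} (h : Disjoint a.support b.support) : expo 0 (a + b) = expo 0 a + expo 0 b := by
  have key : ∀ j, ((a + b) j).2.val = (a j).2.val + (b j).2.val := by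
    intro j
    by_cases ha : a j = 0
    · simp [ha]
    · have : b j = 0 := by
        by_contra hb
        exact Finset.disjoint_left.1 h (Finsupp.mem_support_iff.2 ha) (Finsupp.mem_support_iff.2 hb)
      simp [this]
  refine Finsupp.ext fun i => ?_
  cases i with
  | zero => simp [expo_zero]; ring
  | succ j =>
    rw [Finsupp.add_apply, expo_succ, expo_succ, expo_succ, key]
    simp; ring

lemma mon_add {a b : A} (h : Disjoint a.support b.support) : mon (a + b) = mon a * mon b := by
  rw [mon, mon, mon, MvPolynomial.monomial_mul, expo_add h, one_mul]

lemma mon_single (j : ℕ) (c : ℕ × Fin 3) :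
    mon (Finsupp.single j c) = (MvPolynomial.X j ^ 3) ^ c.1 * MvPolynomial.X (j + 1) ^ (c.2 : ℕ) := by
  have : expo 0 (Finsupp.single j c) = Finsupp.single j (3 * c.1) + Finsupp.single (j + 1) (c.2 : ℕ) := by
    refine Finsupp.ext fun i => ?_
    cases i with
    | zero => rcases j with _ | j <;> simp [expo_zero]
    | succ i =>
      rw [expo_succ, Finsupp.add_apply]
      simp only [Finsupp.single_apply]
      by_cases h1 : j = i + 1 <;> by_cases h2 : j = i <;> simp [h1, h2]
  rw [mon, this, ← pow_mul, MvPolynomial.X_pow_eq_monomial, MvPolynomial.X_pow_eq_monomial,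
    MvPolynomial.monomial_mul, one_mul]

/-- The basis of `P` by the monomials `ξ₁^r mon a`. -/
def basisP : Module.Basis (Fin 3 × A) k P := (MvPolynomial.basisMonomials ℕ k).reindex expoEquiv.symm

lemma basisP_apply (l : Fin 3 × A) : basisP l = xi 1 ^ (l.1 : ℕ) * mon l.2 := by
  rw [basisP, Module.Basis.reindex_apply, Equiv.symm_symm, MvPolynomial.coe_basisMonomials]
  exact monomial_expo l.1 l.2

lemma basisP_eq_monomial (l : Fin 3 × A) : basisP l = MvPolynomial.monomial (expo l.1 l.2) 1 := by
  rw [basisP_apply, monomial_expo]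

/-- The nontrivial monomials. -/
abbrev Letter : Type := {l : Fin 3 × A // l ≠ 0}

lemma expo_ne_zero (l : Letter) : expo l.1.1 l.1.2 ≠ 0 := fun h =>
  l.2 (expoEquiv.injective (h.trans (Finsupp.ext fun i => by
    cases i <;> simp [expoEquiv, expo_zero, expo_succ])))

lemma counit_basisP (l : Letter) : counit (basisP l.1) = 0 := by
  obtain ⟨i, hi⟩ := Finsupp.ne_iff.1 (expo_ne_zero l)
  rw [basisP_eq_monomial, counit, MvPolynomial.aeval_monomial]
  simp only [map_one, one_mul, Finsupp.prod]
  exact Finset.prod_eq_zero (Finsupp.mem_support_iff.2 hi) (zero_pow hi)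

lemma proj_of_mem {p : P} (hp : counit p = 0) : ((proj p : Pbar) : P) = p := by
  rw [proj_coe, hp, map_zero, sub_zero]

/-- The basis of `P̄` by nontrivial monomials. -/
def basisPbar : Module.Basis Letter k Pbar :=
  Module.Basis.mk (v := fun l : Letter => proj (basisP l.1))
    (by
      refine LinearIndependent.of_comp Pbar.subtype ?_
      have : (⇑Pbar.subtype ∘ fun l : Letter => proj (basisP l.1)) = basisP ∘ Subtype.val := by
        funext l
        exact proj_of_mem (counit_basisP l)
      rw [this]
      exact basisP.linearIndependent.comp _ Subtype.val_injective)
    (by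
      rintro x -
      have hx : x = proj (x : P) := Subtype.ext (proj_of_mem x.2).symm
      rw [hx]
      have h2 : (x : P) ∈ Submodule.span k (Set.range basisP) := by rw [basisP.span_eq]; trivial
      generalize (x : P) = p at h2
      induction h2 using Submodule.span_induction with
      | mem p hp =>
        obtain ⟨l, rfl⟩ := hp
        by_cases h : l = 0
        · subst h
          have : proj (basisP 0) = 0 := Subtype.ext (by
            rw [basisP_apply, proj_coe]; simp [mon_zero])
          rw [this]; exact zero_mem _
        · exact Submodule.subset_span ⟨⟨l, h⟩, rfl⟩
      | zero => rw [map_zero]; exact zero_mem _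
      | add p q _ _ hp hq => rw [map_add]; exact add_mem hp hq
      | smul c p _ hp => rw [map_smul]; exact Submodule.smul_mem _ _ hp)

lemma basisPbar_apply (l : Letter) : basisPbar l = proj (basisP l.1) := Module.Basis.mk_apply _ _ _

/-- The word with letters `l`. -/
def lt (l : Letter) : Cobar := bar (basisP l.1)

/-- The basis of the cobar complex by words in nontrivial monomials. -/
def wordBasis : Module.Basis (List Letter) k Cobar := Module.Basis.tensorAlgebra basisPbar

lemma basisFreeMonoid_apply (w : FreeMonoid Letter) : FreeAlgebra.basisFreeMonoid k Letter w =
    FreeAlgebra.equivMonoidAlgebraFreeMonoid.symm (MonoidAlgebra.of k _ w) := by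
  rw [FreeAlgebra.basisFreeMonoid]; simp

lemma tensorAlgebra_basis_apply (w : FreeMonoid Letter) : Module.Basis.tensorAlgebra basisPbar w =
    (TensorAlgebra.equivFreeAlgebra basisPbar).symm
      (FreeAlgebra.equivMonoidAlgebraFreeMonoid.symm (MonoidAlgebra.of k _ w)) := by
  rw [Module.Basis.tensorAlgebra, Module.Basis.map_apply, basisFreeMonoid_apply]
  rfl

@[simp]
lemma wordBasis_nil : wordBasis [] = 1 := by
  refine (tensorAlgebra_basis_apply 1).trans ?_
  rw [map_one, map_one, map_one]; rfl

@[simp]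
lemma wordBasis_cons (l : Letter) (w : List Letter) : wordBasis (l :: w) = lt l * wordBasis w := by
  refine (tensorAlgebra_basis_apply (FreeMonoid.of l * FreeMonoid.ofList w)).trans ?_
  have h2 : FreeAlgebra.equivMonoidAlgebraFreeMonoid.symm (MonoidAlgebra.of k _ (FreeMonoid.of l))
     = FreeAlgebra.ι k l := by
    simp [FreeAlgebra.equivMonoidAlgebraFreeMonoid]
  rw [map_mul, map_mul, map_mul, h2, TensorAlgebra.equivFreeAlgebra_symm_ι, basisPbar_apply,
    ← tensorAlgebra_basis_apply]
  rfl

/-- Induction on words. -/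
lemma word_induction {p : Cobar → Prop} (h1 : p 1) (hl : ∀ l x, p x → p (lt l * x))
    (h0 : p 0) (hadd : ∀ x y, p x → p y → p (x + y)) (hs : ∀ (c : k) x, p x → p (c • x)) (x : Cobar) :
    p x := by
  have hx : x ∈ Submodule.span k (Set.range wordBasis) := by rw [wordBasis.span_eq]; trivial
  induction hx using Submodule.span_induction with
  | mem x hx =>
    obtain ⟨w, rfl⟩ := hx
    induction w with
    | nil => simpa using h1
    | cons l w ih => simpa using hl l _ ih
  | zero => exact h0
  | add x y _ _ hx hy => exact hadd x y hx hy
  | smul c x _ hx => exact hs c x hx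

/-! Spans of words, projections, gradings. -/

/-- The span of a set of words. -/
def wordSpan (S : Set (List Letter)) : Submodule k Cobar := Submodule.span k (wordBasis '' S)

lemma wordBasis_mem {S : Set (List Letter)} {w : List Letter} (h : w ∈ S) :
    wordBasis w ∈ wordSpan S := Submodule.subset_span ⟨w, h, rfl⟩

lemma wordSpan_mono {S T : Set (List Letter)} (h : S ⊆ T) : wordSpan S ≤ wordSpan T :=
  Submodule.span_mono (Set.image_mono h)

lemma wordSpan_le {S : Set (List Letter)} {N : Submodule k Cobar} :
    wordSpan S ≤ N ↔ ∀ w ∈ S, wordBasis w ∈ N := by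
  rw [wordSpan, Submodule.span_le]
  exact Set.image_subset_iff

/-- A linear map that takes the words of `S` into `N` takes their span into `N`. -/
lemma map_mem_of_words {M : Type*} [AddCommGroup M] [Module k M] {S : Set (List Letter)}
    {N : Submodule k M} {f : Cobar →ₗ[k] M} (h : ∀ w ∈ S, f (wordBasis w) ∈ N) {x : Cobar}
    (hx : x ∈ wordSpan S) : f x ∈ N :=
  (wordSpan_le (N := N.comap f)).2 h hx

lemma wordSpan_univ : wordSpan Set.univ = ⊤ := by
  rw [wordSpan, Set.image_univ, wordBasis.span_eq]

open Classical in
/-- The projection onto the span of a set of words. -/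
def wordProj (S : Set (List Letter)) : Cobar →ₗ[k] Cobar :=
  wordBasis.constr k fun w => if w ∈ S then wordBasis w else 0

lemma wordProj_pos {S : Set (List Letter)} {w : List Letter} (h : w ∈ S) :
    wordProj S (wordBasis w) = wordBasis w := by
  rw [wordProj, Module.Basis.constr_basis, if_pos h]

lemma wordProj_neg {S : Set (List Letter)} {w : List Letter} (h : w ∉ S) :
    wordProj S (wordBasis w) = 0 := by
  rw [wordProj, Module.Basis.constr_basis, if_neg h]

lemma wordProj_mem (S : Set (List Letter)) (x : Cobar) : wordProj S x ∈ wordSpan S := by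
  refine map_mem_of_words (S := Set.univ) (fun w _ => ?_) (by rw [wordSpan_univ]; trivial)
  by_cases h : w ∈ S
  · rw [wordProj_pos h]; exact wordBasis_mem h
  · rw [wordProj_neg h]; exact zero_mem _

lemma wordProj_of_mem {S : Set (List Letter)} {x : Cobar} (hx : x ∈ wordSpan S) :
    wordProj S x = x := by
  have : x ∈ LinearMap.ker (wordProj S - LinearMap.id) := by
    refine wordSpan_le.2 (fun w hw => ?_) hx
    simp [wordProj_pos hw]
  simpa [sub_eq_zero] using this

lemma wordProj_of_disjoint {S T : Set (List Letter)} (h : ∀ w ∈ T, w ∉ S) {x : Cobar}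
    (hx : x ∈ wordSpan T) : wordProj S x = 0 := by
  have : x ∈ LinearMap.ker (wordProj S) := wordSpan_le.2 (fun w hw => wordProj_neg (h w hw)) hx
  exact this

lemma wordProj_wordProj (S T : Set (List Letter)) (x : Cobar) :
    wordProj S (wordProj T x) = wordProj (S ∩ T) x := by
  refine LinearMap.congr_fun (f := wordProj S ∘ₗ wordProj T) (wordBasis.ext fun w => ?_) x
  by_cases hT : w ∈ T <;> by_cases hS : w ∈ S <;>
    simp [wordProj, hT, hS]

lemma wordProj_add_compl (S : Set (List Letter)) (x : Cobar) :
    wordProj S x + wordProj Sᶜ x = x := by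
  refine LinearMap.congr_fun (f := wordProj S + wordProj Sᶜ) (g := LinearMap.id)
    (wordBasis.ext fun w => ?_) x
  by_cases hS : w ∈ S <;> simp [wordProj, hS]

lemma wordProj_mem_of_mem {S T : Set (List Letter)} {x : Cobar} (hx : x ∈ wordSpan T) :
    wordProj S x ∈ wordSpan T := by
  refine map_mem_of_words (fun w hw => ?_) hx
  by_cases h : w ∈ S
  · rw [wordProj_pos h]; exact wordBasis_mem hw
  · rw [wordProj_neg h]; exact zero_mem _

/-- `f` shifts the degree of words by `g₀`. -/
def Shifts {G : Type*} [Add G] (W : List Letter → G) (f : Cobar →ₗ[k] Cobar) (g₀ : G) : Prop :=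
  ∀ w, f (wordBasis w) ∈ wordSpan {u | W u = W w + g₀}

lemma Shifts.mem {G : Type*} [Add G] {W : List Letter → G} {f : Cobar →ₗ[k] Cobar} {g₀ g : G}
    (h : Shifts W f g₀) {x : Cobar} (hx : x ∈ wordSpan {u | W u = g}) :
    f x ∈ wordSpan {u | W u = g + g₀} :=
  map_mem_of_words (fun w hw => by rw [← show W w = g from hw]; exact h w) hx

lemma Shifts.wordProj {G : Type*} [AddGroup G] {W : List Letter → G} {f : Cobar →ₗ[k] Cobar}
    {g₀ : G} (h : Shifts W f g₀) (g : G) (x : Cobar) :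
    f (wordProj {u | W u = g} x) = wordProj {u | W u = g + g₀} (f x) := by
  refine LinearMap.congr_fun (f := f ∘ₗ MPASS.wordProj {u | W u = g})
    (g := MPASS.wordProj {u | W u = g + g₀} ∘ₗ f) (wordBasis.ext fun w => ?_) x
  simp only [LinearMap.comp_apply]
  by_cases hw : W w = g
  · rw [wordProj_pos (show w ∈ {u | W u = g} from hw), wordProj_of_mem]
    rw [← hw]; exact h w
  · rw [wordProj_neg (show w ∉ {u | W u = g} from hw), map_zero,
      wordProj_of_disjoint (fun u hu hu' => hw ?_) (h w)]
    exact add_right_cancel ((show W u = W w + g₀ from hu).symm.trans hu')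

lemma Shifts.comp {G : Type*} [AddGroup G] {W : List Letter → G} {f f' : Cobar →ₗ[k] Cobar}
    {g₀ g₁ : G} (h : Shifts W f g₀) (h' : Shifts W f' g₁) : Shifts W (f ∘ₗ f') (g₁ + g₀) := by
  intro w
  rw [← add_assoc]
  exact h.mem (h' w)

lemma Shifts.add {G : Type*} [AddGroup G] {W : List Letter → G} {f f' : Cobar →ₗ[k] Cobar}
    {g₀ : G} (h : Shifts W f g₀) (h' : Shifts W f' g₀) : Shifts W (f + f') g₀ :=
  fun w => add_mem (h w) (h' w)

/-! First letters. -/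

open Classical in
/-- Strip the first letter `l` (words that begin otherwise go to `0`). -/
def strip (l : Letter) : Cobar →ₗ[k] Cobar :=
  wordBasis.constr k fun
    | [] => 0
    | l' :: w => if l' = l then wordBasis w else 0

/-- The coefficient of the empty word. -/
def aug : Cobar →ₗ[k] k :=
  wordBasis.constr k fun
    | [] => 1
    | _ :: _ => 0

@[simp] lemma strip_one (l : Letter) : strip l 1 = 0 := by
  rw [← wordBasis_nil, strip, Module.Basis.constr_basis]

@[simp] lemma aug_one : aug 1 = 1 := by
  rw [← wordBasis_nil, aug, Module.Basis.constr_basis]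

/-- Two linear maps agree if they agree on words. -/
lemma apply_eq_of_words {M : Type*} [AddCommGroup M] [Module k M] (f g : Cobar →ₗ[k] M)
    (h : ∀ w, f (wordBasis w) = g (wordBasis w)) (x : Cobar) : f x = g x :=
  LinearMap.congr_fun (wordBasis.ext h) x

@[simp] lemma strip_lt_mul (l : Letter) (x : Cobar) : strip l (lt l * x) = x := by
  refine apply_eq_of_words (strip l ∘ₗ LinearMap.mulLeft k (lt l)) LinearMap.id (fun w => ?_) x
  simp only [LinearMap.comp_apply, LinearMap.mulLeft_apply, LinearMap.id_apply]
  rw [← wordBasis_cons, strip, Module.Basis.constr_basis]; simp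

lemma strip_lt_mul_of_ne {l l' : Letter} (h : l' ≠ l) (x : Cobar) : strip l (lt l' * x) = 0 := by
  refine apply_eq_of_words (strip l ∘ₗ LinearMap.mulLeft k (lt l')) 0 (fun w => ?_) x
  simp only [LinearMap.comp_apply, LinearMap.mulLeft_apply, LinearMap.zero_apply]
  rw [← wordBasis_cons, strip, Module.Basis.constr_basis]; simp [h]

@[simp] lemma aug_lt_mul (l : Letter) (x : Cobar) : aug (lt l * x) = 0 := by
  refine apply_eq_of_words (aug ∘ₗ LinearMap.mulLeft k (lt l)) 0 (fun w => ?_) x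
  simp only [LinearMap.comp_apply, LinearMap.mulLeft_apply, LinearMap.zero_apply]
  rw [← wordBasis_cons, aug, Module.Basis.constr_basis]

lemma exists_eq_sum_strip (x : Cobar) : ∃ S : Finset Letter, (∀ l ∉ S, strip l x = 0) ∧
    ∀ T, S ⊆ T → x = aug x • 1 + ∑ l ∈ T, lt l * strip l x := by
  classical
  have main : ∃ S : Finset Letter, (∀ l ∉ S, strip l x = 0) ∧
      x = aug x • 1 + ∑ l ∈ S, lt l * strip l x := by
    induction x using word_induction with
    | h1 => exact ⟨∅, by simp, by simp⟩
    | hl l x _ =>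
      refine ⟨{l}, fun l' h => strip_lt_mul_of_ne (fun h' => h (by simp [h'])) x, by simp⟩
    | h0 => exact ⟨∅, by simp, by simp⟩
    | hadd x y hx hy =>
      obtain ⟨S, hS, hx⟩ := hx
      obtain ⟨T, hT, hy⟩ := hy
      refine ⟨S ∪ T, fun l hl => ?_, ?_⟩
      · rw [Finset.mem_union, not_or] at hl
        rw [map_add, hS l hl.1, hT l hl.2, add_zero]
      · have e1 : ∑ l ∈ S, lt l * strip l x = ∑ l ∈ S ∪ T, lt l * strip l x :=
          Finset.sum_subset Finset.subset_union_left fun l _ h => by rw [hS l h, mul_zero]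
        have e2 : ∑ l ∈ T, lt l * strip l y = ∑ l ∈ S ∪ T, lt l * strip l y :=
          Finset.sum_subset Finset.subset_union_right fun l _ h => by rw [hT l h, mul_zero]
        rw [e1] at hx
        rw [e2] at hy
        simp only [map_add, mul_add, Finset.sum_add_distrib, add_smul]
        nth_rewrite 1 [hx, hy]
        abel
    | hs c x hx =>
      obtain ⟨S, hS, hx⟩ := hx
      refine ⟨S, fun l hl => by rw [map_smul, hS l hl, smul_zero], ?_⟩
      nth_rewrite 1 [hx]
      simp only [map_smul, smul_add, Finset.smul_sum, mul_smul_comm, smul_assoc]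
  obtain ⟨S, hS, h⟩ := main
  refine ⟨S, hS, fun T hT => h.trans ?_⟩
  rw [Finset.sum_subset hT fun l _ hl => by rw [hS l hl, mul_zero]]

lemma eq_of_strip {x y : Cobar} (h0 : aug x = aug y) (h : ∀ l, strip l x = strip l y) : x = y := by
  rw [← sub_eq_zero]
  obtain ⟨S, -, hx⟩ := exists_eq_sum_strip (x - y)
  rw [hx S le_rfl, map_sub, h0, sub_self, zero_smul, zero_add]
  exact Finset.sum_eq_zero fun l _ => by rw [map_sub, h l, sub_self, mul_zero]

/-- `x` is a combination of words of length less than `n`. -/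
def LenLt : ℕ → Cobar → Prop
  | 0, x => x = 0
  | n + 1, x => ∀ l, LenLt n (strip l x)

lemma LenLt.zero (n : ℕ) : LenLt n 0 := by
  induction n with
  | zero => rfl
  | succ n ih => intro l; rwa [map_zero]

lemma LenLt.add {n : ℕ} {x y : Cobar} (hx : LenLt n x) (hy : LenLt n y) : LenLt n (x + y) := by
  induction n generalizing x y with
  | zero => rw [LenLt] at *; rw [hx, hy, add_zero]
  | succ n ih => intro l; rw [map_add]; exact ih (hx l) (hy l)

lemma LenLt.smul {n : ℕ} (c : k) {x : Cobar} (hx : LenLt n x) : LenLt n (c • x) := by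
  induction n generalizing x with
  | zero => rw [LenLt] at *; rw [hx, smul_zero]
  | succ n ih => intro l; rw [map_smul]; exact ih (hx l)

lemma LenLt.neg {n : ℕ} {x : Cobar} (hx : LenLt n x) : LenLt n (-x) := by
  have := hx.smul (-1); rwa [neg_one_smul] at this

lemma LenLt.sub {n : ℕ} {x y : Cobar} (hx : LenLt n x) (hy : LenLt n y) : LenLt n (x - y) := by
  rw [sub_eq_add_neg]; exact hx.add hy.neg

lemma LenLt.sum {n : ℕ} {ι : Type*} (S : Finset ι) {x : ι → Cobar} (h : ∀ i ∈ S, LenLt n (x i)) :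
    LenLt n (∑ i ∈ S, x i) := by
  classical
  induction S using Finset.induction_on with
  | empty => exact LenLt.zero n
  | insert a S ha ih =>
    rw [Finset.sum_insert ha]
    exact (h a (by simp)).add (ih fun i hi => h i (by simp [hi]))

lemma LenLt.succ {n : ℕ} {x : Cobar} (hx : LenLt n x) : LenLt (n + 1) x := by
  induction n generalizing x with
  | zero => rw [LenLt] at hx; rw [hx]; exact LenLt.zero _
  | succ n ih => exact fun l => ih (hx l)

lemma LenLt.lt_mul {n : ℕ} (l : Letter) {x : Cobar} (hx : LenLt n x) : LenLt (n + 1) (lt l * x) := by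
  intro l'
  by_cases h : l = l'
  · subst h; rwa [strip_lt_mul]
  · rw [strip_lt_mul_of_ne h]; exact LenLt.zero _

lemma bar_eq_sum (p : P) : ∃ S : Finset Letter, ∃ c : Letter → k, bar p = ∑ l ∈ S, c l • lt l := by
  have hp : p ∈ Submodule.span k (Set.range basisP) := by rw [basisP.span_eq]; trivial
  have : bar p ∈ Submodule.span k (Set.range lt) := by
    induction hp using Submodule.span_induction with
    | mem p hp =>
      obtain ⟨l, rfl⟩ := hp
      by_cases h : l = 0
      · subst h
        rw [basisP_apply]
        simp [mon_zero, bar_one]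
      · exact Submodule.subset_span ⟨⟨l, h⟩, rfl⟩
    | zero => rw [map_zero]; exact zero_mem _
    | add p q _ _ hp hq => rw [map_add]; exact add_mem hp hq
    | smul c p _ hp => rw [map_smul]; exact Submodule.smul_mem _ _ hp
  obtain ⟨c, hc⟩ := Finsupp.mem_span_range_iff_exists_finsupp.1 this
  exact ⟨c.support, c, hc.symm⟩

lemma LenLt.bar_mul {n : ℕ} (p : P) {x : Cobar} (hx : LenLt n x) : LenLt (n + 1) (bar p * x) := by
  obtain ⟨S, c, h⟩ := bar_eq_sum p
  rw [h, Finset.sum_mul]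
  refine LenLt.sum S fun l _ => ?_
  rw [smul_mul_assoc]
  exact (hx.lt_mul l).smul _

lemma exists_lenLt (x : Cobar) : ∃ n, LenLt n x := by
  induction x using word_induction with
  | h1 => exact ⟨1, fun l => strip_one l⟩
  | hl l x hx => obtain ⟨n, hn⟩ := hx; exact ⟨n + 1, hn.lt_mul l⟩
  | h0 => exact ⟨0, rfl⟩
  | hadd x y hx hy =>
    obtain ⟨n, hn⟩ := hx
    obtain ⟨m, hm⟩ := hy
    have mono : ∀ {a : ℕ} (b : ℕ) {z : Cobar}, LenLt a z → LenLt (a + b) z := by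
      intro a b z hz
      induction b with
      | zero => exact hz
      | succ b ih => exact ih.succ
    exact ⟨n + m, (mono m hn).add (by rw [add_comm]; exact mono n hm)⟩
  | hs c x hx => obtain ⟨n, hn⟩ := hx; exact ⟨n, hn.smul c⟩

/-! Graded derivations. -/

lemma basisP_zero : basisP 0 = 1 := by rw [basisP_apply]; simp [mon_zero]

/-- Two linear maps on `P` that vanish at `1` agree if they agree on the nontrivial monomials. -/
lemma apply_eq_of_letters {M : Type*} [AddCommGroup M] [Module k M] (f g : P →ₗ[k] M)
    (h1 : f 1 = g 1) (h : ∀ l : Letter, f (basisP l.1) = g (basisP l.1)) (p : P) : f p = g p :=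
  LinearMap.congr_fun (basisP.ext fun l => by
    by_cases hl : l = 0
    · rw [hl, basisP_zero, h1]
    · exact h ⟨l, hl⟩) p

/-- The values on words of the graded derivation that extends `φ`. -/
def derWord (φ : P →ₗ[k] Cobar) : List Letter → Cobar
  | [] => 0
  | l :: w => φ (basisP l.1) * wordBasis w - lt l * derWord φ w

/-- The graded derivation of the cobar complex that extends `φ`. -/
def der (φ : P →ₗ[k] Cobar) : Cobar →ₗ[k] Cobar := wordBasis.constr k (derWord φ)

@[simp] lemma der_one (φ : P →ₗ[k] Cobar) : der φ 1 = 0 := by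
  rw [← wordBasis_nil, der, Module.Basis.constr_basis, derWord]

lemma der_lt_mul (φ : P →ₗ[k] Cobar) (l : Letter) (x : Cobar) :
    der φ (lt l * x) = φ (basisP l.1) * x - lt l * der φ x := by
  refine apply_eq_of_words (der φ ∘ₗ LinearMap.mulLeft k (lt l))
    (LinearMap.mulLeft k (φ (basisP l.1)) - LinearMap.mulLeft k (lt l) ∘ₗ der φ) (fun w => ?_) x
  simp only [LinearMap.comp_apply, LinearMap.mulLeft_apply, LinearMap.sub_apply]
  rw [← wordBasis_cons, der, Module.Basis.constr_basis, derWord, Module.Basis.constr_basis]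

lemma der_bar_mul {φ : P →ₗ[k] Cobar} (hφ : φ 1 = 0) (p : P) (x : Cobar) :
    der φ (bar p * x) = φ p * x - bar p * der φ x := by
  refine apply_eq_of_letters (der φ ∘ₗ LinearMap.mulRight k x ∘ₗ bar)
    (LinearMap.mulRight k x ∘ₗ φ - LinearMap.mulRight k (der φ x) ∘ₗ bar) ?_ (fun l => ?_) p
  · simp [bar_one, hφ]
  · exact der_lt_mul φ l x

lemma der_add (φ ψ : P →ₗ[k] Cobar) (x : Cobar) : der (φ + ψ) x = der φ x + der ψ x := by
  refine LinearMap.congr_fun (f := der (φ + ψ)) (g := der φ + der ψ)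
    (wordBasis.ext fun w => ?_) x
  induction w with
  | nil => simp
  | cons l w ih =>
    rw [LinearMap.add_apply] at ih
    simp only [wordBasis_cons, LinearMap.add_apply, der_lt_mul, ih]
    noncomm_ring

/-- The additive extension of a weight of letters to words. -/
def weight {G : Type*} [AddCommGroup G] (wt : Letter → G) (w : List Letter) : G := (w.map wt).sum

lemma weight_cons {G : Type*} [AddCommGroup G] (wt : Letter → G) (l : Letter) (w : List Letter) :
    weight wt (l :: w) = wt l + weight wt w := by simp [weight]

lemma weight_append {G : Type*} [AddCommGroup G] (wt : Letter → G) (u w : List Letter) :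
    weight wt (u ++ w) = weight wt u + weight wt w := by simp [weight]

lemma wordBasis_append (u w : List Letter) : wordBasis (u ++ w) = wordBasis u * wordBasis w := by
  induction u with
  | nil => simp
  | cons l u ih => simp [ih, mul_assoc]

lemma mul_mem_wordSpan {S T U : Set (List Letter)} (h : ∀ u ∈ S, ∀ w ∈ T, u ++ w ∈ U) {x y : Cobar}
    (hx : x ∈ wordSpan S) (hy : y ∈ wordSpan T) : x * y ∈ wordSpan U := by
  have h1 := Submodule.mul_mem_mul hx hy
  rw [wordSpan, wordSpan, Submodule.span_mul_span] at h1
  refine Submodule.span_mono ?_ h1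
  rintro _ ⟨_, ⟨u, hu, rfl⟩, _, ⟨w, hw, rfl⟩, rfl⟩
  exact ⟨u ++ w, h u hu w hw, wordBasis_append u w⟩

lemma mul_mem_weight {G : Type*} [AddCommGroup G] {wt : Letter → G} {g h : G} {x y : Cobar}
    (hx : x ∈ wordSpan {u | weight wt u = g}) (hy : y ∈ wordSpan {u | weight wt u = h}) :
    x * y ∈ wordSpan {u | weight wt u = g + h} :=
  mul_mem_wordSpan (fun u hu w hw => by
    rw [Set.mem_ofPred_eq, weight_append, show _ = _ from hu, show _ = _ from hw]) hx hy

lemma mul_mem_weight_of_eq {G : Type*} [AddCommGroup G] {wt : Letter → G} {g h m : G} {x y : Cobar}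
    (hm : g + h = m) (hx : x ∈ wordSpan {u | weight wt u = g})
    (hy : y ∈ wordSpan {u | weight wt u = h}) : x * y ∈ wordSpan {u | weight wt u = m} :=
  hm ▸ mul_mem_weight hx hy

lemma lt_mem_weight {G : Type*} [AddCommGroup G] (wt : Letter → G) (l : Letter) :
    lt l ∈ wordSpan {u | weight wt u = wt l} := by
  have := wordBasis_mem (S := {u | weight wt u = wt l}) (w := [l]) (by simp [weight])
  simpa using this

lemma der_shifts {G : Type*} [AddCommGroup G] {wt : Letter → G} {φ : P →ₗ[k] Cobar} {g₀ : G}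
    (h : ∀ l, φ (basisP l.1) ∈ wordSpan {u | weight wt u = wt l + g₀}) :
    Shifts (weight wt) (der φ) g₀ := by
  intro w
  induction w with
  | nil => rw [wordBasis_nil, der_one]; exact zero_mem _
  | cons l w ih =>
    rw [wordBasis_cons, der_lt_mul, weight_cons]
    refine sub_mem ?_ ?_
    · have := mul_mem_weight (h l) (wordBasis_mem (S := {u | weight wt u = weight wt w}) rfl)
      rwa [add_right_comm] at this
    · have := mul_mem_weight (lt_mem_weight wt l) ih
      rwa [← add_assoc] at this

lemma mulLeft_shifts {G : Type*} [AddCommGroup G] {wt : Letter → G} {c : Cobar} {g₀ : G}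
    (h : c ∈ wordSpan {u | weight wt u = g₀}) : Shifts (weight wt) (LinearMap.mulLeft k c) g₀ := by
  intro w
  rw [add_comm]
  exact mul_mem_weight h (wordBasis_mem (S := {u | weight wt u = weight wt w}) rfl)

lemma mulRight_shifts {G : Type*} [AddCommGroup G] {wt : Letter → G} {c : Cobar} {g₀ : G}
    (h : c ∈ wordSpan {u | weight wt u = g₀}) : Shifts (weight wt) (LinearMap.mulRight k c) g₀ :=
  fun w => mul_mem_weight (wordBasis_mem (S := {u | weight wt u = weight wt w}) rfl) h

/-! The coactions of `D` on `P`. -/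

lemma three_eq_zero {R : Type*} [CommRing R] [Algebra k R] : (3 : R) = 0 := by
  have : algebraMap k R 3 = 0 := by rw [show (3 : k) = 0 from by decide, map_zero]
  rwa [map_ofNat] at this

/-- The derivation `ξ_n ↦ ξ_{n-1}³`, which encodes the left coaction of `D`. -/
def pd : Derivation k P P := MvPolynomial.mkDerivation k fun n => xi n ^ 3

/-- The derivation `∂/∂ξ₁`, which encodes the right coaction of `D`. -/
def th : Derivation k P P := MvPolynomial.pderiv 0

lemma derivation_cube (δ : Derivation k P P) (p : P) : δ (p ^ 3) = 0 := by
  rw [Derivation.leibniz_pow]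
  simp [nsmul_eq_mul, three_eq_zero]

@[simp] lemma pd_X (n : ℕ) : pd (MvPolynomial.X n) = xi n ^ 3 := MvPolynomial.mkDerivation_X _ _ _

lemma th_X (n : ℕ) : th (MvPolynomial.X n) = if n = 0 then 1 else 0 := by
  rw [th, MvPolynomial.pderiv_X]; by_cases h : n = 0 <;> simp [h]

lemma pd_pd_X (n : ℕ) : pd (pd (MvPolynomial.X n)) = 0 := by rw [pd_X, derivation_cube]

lemma th_th_X (n : ℕ) : th (th (MvPolynomial.X n)) = 0 := by
  rw [th_X]; split_ifs <;> simp

lemma derivation_pow_three {δ : Derivation k P P} (h : ∀ n, δ (δ (MvPolynomial.X n)) = 0) (p : P) :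
    δ (δ (δ p)) = 0 := by
  induction p using MvPolynomial.induction_on with
  | C c => rw [MvPolynomial.derivation_C]; simp
  | add p q hp hq => simp [hp, hq]
  | mul_X p n hp =>
    simp only [Derivation.leibniz, smul_eq_mul, map_add, h, hp, mul_zero, zero_add, add_zero]
    linear_combination (δ (MvPolynomial.X n) * δ (δ p)) * three_eq_zero (R := P)

lemma pd_pd_pd (p : P) : pd (pd (pd p)) = 0 := derivation_pow_three pd_pd_X p

lemma pd_th (p : P) : pd (th p) = th (pd p) := by
  induction p using MvPolynomial.induction_on with
  | C c => rw [MvPolynomial.derivation_C, MvPolynomial.derivation_C]; simp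
  | add p q hp hq => simp [hp, hq]
  | mul_X p n hp =>
    have h1 : pd (th (MvPolynomial.X n)) = 0 := by rw [th_X]; split_ifs <;> simp
    have h2 : th (pd (MvPolynomial.X n)) = 0 := by rw [pd_X, derivation_cube]
    simp only [Derivation.leibniz, smul_eq_mul, map_add, h1, h2, hp]
    ring

lemma xi_one : xi 1 = MvPolynomial.X 0 := rfl

lemma xi_one_cube_mem : xi 1 ^ 3 ∈ kerD := Ideal.subset_span (Or.inl rfl)

lemma xi_mem (n : ℕ) : xi (n + 2) ∈ kerD := Ideal.subset_span (Or.inr ⟨n, rfl⟩)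

lemma derivation_kerD {δ : Derivation k P P} (h : ∀ n, δ (MvPolynomial.X (n + 1)) ∈ kerD) {p : P}
    (hp : p ∈ kerD) : δ p ∈ kerD := by
  induction hp using Submodule.span_induction with
  | mem p hp =>
    rcases hp with rfl | ⟨n, rfl⟩
    · rw [derivation_cube]; exact zero_mem _
    · exact h n
  | zero => rw [map_zero]; exact zero_mem _
  | add p q _ _ hp hq => rw [map_add]; exact add_mem hp hq
  | smul c p hp' hp =>
    rw [smul_eq_mul, Derivation.leibniz]
    exact add_mem (kerD.mul_mem_left _ hp) (by
      rw [smul_eq_mul, mul_comm]; exact kerD.mul_mem_left _ hp')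

lemma pd_mem {p : P} (hp : p ∈ kerD) : pd p ∈ kerD := derivation_kerD (fun n => by
  rw [pd_X]
  cases n with
  | zero => exact xi_one_cube_mem
  | succ n => exact Ideal.pow_mem_of_mem _ (xi_mem n) 3 (by norm_num)) hp

lemma th_mem {p : P} (hp : p ∈ kerD) : th p ∈ kerD := derivation_kerD (fun n => by
  rw [th_X, if_neg (by omega)]; exact zero_mem _) hp

/-- The ideal `ker(P → D) ⊗ P`. -/
def kerL : Ideal (P ⊗[k] P) := kerD.map (Algebra.TensorProduct.includeLeft : P →ₐ[k] P ⊗[k] P)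

/-- The ideal `P ⊗ ker(P → D)`. -/
def kerR : Ideal (P ⊗[k] P) := kerD.map (Algebra.TensorProduct.includeRight : P →ₐ[k] P ⊗[k] P)

lemma tmul_mem_kerL {p : P} (hp : p ∈ kerD) (q : P) : p ⊗ₜ[k] q ∈ kerL := by
  have : p ⊗ₜ[k] q = (1 ⊗ₜ q) * (p ⊗ₜ 1) := by simp
  rw [this]
  exact Ideal.mul_mem_left _ _ (Ideal.mem_map_of_mem _ hp)

lemma tmul_mem_kerR {p : P} (hp : p ∈ kerD) (q : P) : q ⊗ₜ[k] p ∈ kerR := by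
  have : q ⊗ₜ[k] p = (q ⊗ₜ 1) * (1 ⊗ₜ p) := by simp
  rw [this]
  exact Ideal.mul_mem_left _ _ (Ideal.mem_map_of_mem _ hp)

/-- The left coaction, lifted to `P ⊗ P`. -/
def coactL : P →ₗ[k] P ⊗[k] P :=
  TensorProduct.mk k P P 1 + TensorProduct.mk k P P (xi 1) ∘ₗ pd.toLinearMap -
    TensorProduct.mk k P P (xi 1 ^ 2) ∘ₗ pd.toLinearMap ∘ₗ pd.toLinearMap

lemma coactL_apply (p : P) :
    coactL p = 1 ⊗ₜ p + xi 1 ⊗ₜ pd p - (xi 1 ^ 2) ⊗ₜ pd (pd p) := rfl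

/-- The right coaction, lifted to `P ⊗ P`. -/
def coactR : P →ₗ[k] P ⊗[k] P :=
  (TensorProduct.mk k P P).flip 1 + (TensorProduct.mk k P P).flip (xi 1) ∘ₗ th.toLinearMap -
    (TensorProduct.mk k P P).flip (xi 1 ^ 2) ∘ₗ th.toLinearMap ∘ₗ th.toLinearMap

lemma coactR_apply (p : P) :
    coactR p = p ⊗ₜ 1 + th p ⊗ₜ xi 1 - th (th p) ⊗ₜ (xi 1 ^ 2) := rfl

/-- A congruence `comul ≡ φ` modulo an ideal that holds on generators and is multiplicative. -/
lemma comul_congr {φ : P →ₗ[k] P ⊗[k] P} {I : Ideal (P ⊗[k] P)} (h1 : φ 1 = 1)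
    (hm : ∀ p q, φ (p * q) - φ p * φ q ∈ I)
    (hX : ∀ n, comul (MvPolynomial.X n) - φ (MvPolynomial.X n) ∈ I) (p : P) :
    comul p - φ p ∈ I := by
  induction p using MvPolynomial.induction_on with
  | C c =>
    have : (MvPolynomial.C c : P) = c • 1 := by rw [MvPolynomial.smul_eq_C_mul, mul_one]
    rw [this, map_smul, map_smul, map_one, h1, sub_self]; exact zero_mem _
  | add p q hp hq =>
    rw [map_add, map_add, add_sub_add_comm]; exact add_mem hp hq
  | mul_X p n hp =>
    have : comul (p * MvPolynomial.X n) - φ (p * MvPolynomial.X n) =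
        comul p * (comul (MvPolynomial.X n) - φ (MvPolynomial.X n)) +
        φ (MvPolynomial.X n) * (comul p - φ p) -
        (φ (p * MvPolynomial.X n) - φ p * φ (MvPolynomial.X n)) := by
      rw [map_mul]; ring
    rw [this]
    exact sub_mem (add_mem (I.mul_mem_left _ (hX n)) (I.mul_mem_left _ hp)) (hm _ _)

/-- The exponential formula for the coactions. -/
lemma exp_mul_sub {R : Type*} [CommRing R] [Algebra k R] (X p p₁ p₂ q q₁ q₂ : R) :
    (p * q + X * (p * q₁ + q * p₁) - X ^ 2 * (p * q₂ + q₁ * p₁ + (q * p₂ + p₁ * q₁))) -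
      (p + X * p₁ - X ^ 2 * p₂) * (q + X * q₁ - X ^ 2 * q₂) =
      X ^ 3 * (p₁ * q₂ + p₂ * q₁ - X * p₂ * q₂) := by
  linear_combination (-(X ^ 2 * p₁ * q₁)) * three_eq_zero (R := R)

lemma comul_sub_coactL (p : P) : comul p - coactL p ∈ kerL := by
  refine comul_congr ?_ (fun p q => ?_) (fun n => ?_) p
  · rw [coactL_apply]; simp [Algebra.TensorProduct.one_def]
  · have h := exp_mul_sub (xi 1 ⊗ₜ[k] (1 : P)) ((1 : P) ⊗ₜ p) (1 ⊗ₜ pd p) (1 ⊗ₜ pd (pd p))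
      (1 ⊗ₜ q) (1 ⊗ₜ pd q) (1 ⊗ₜ pd (pd q))
    simp only [Algebra.TensorProduct.tmul_mul_tmul, mul_one, one_mul, Algebra.TensorProduct.tmul_pow,
      one_pow, ← TensorProduct.tmul_add] at h
    rw [coactL_apply, coactL_apply, coactL_apply]
    simp only [Derivation.leibniz, smul_eq_mul, map_add]
    rw [h]
    exact Ideal.mul_mem_right _ _ (tmul_mem_kerL xi_one_cube_mem _)
  · have h : comul (MvPolynomial.X n) = comul (xi (n + 1)) := rfl
    rw [h, comul_xi, Finset.Nat.sum_antidiagonal_eq_sum_range_succ_mk, Finset.sum_range_succ',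
      Finset.sum_range_succ', coactL_apply, pd_pd_X, pd_X]
    have : (∑ i ∈ Finset.range n, xi (i + 1 + 1) ⊗ₜ[k] (xi (n + 1 - (i + 1 + 1)) ^ 3 ^ (i + 1 + 1))) ∈
        kerL := Submodule.sum_mem _ fun i _ => tmul_mem_kerL (xi_mem i) _
    convert this using 1
    simp [xi]
    abel

lemma comul_sub_coactR (p : P) : comul p - coactR p ∈ kerR := by
  refine comul_congr ?_ (fun p q => ?_) (fun n => ?_) p
  · rw [coactR_apply]; simp [Algebra.TensorProduct.one_def]
  · have h := exp_mul_sub ((1 : P) ⊗ₜ[k] xi 1) (p ⊗ₜ (1 : P)) (th p ⊗ₜ 1) (th (th p) ⊗ₜ 1)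
      (q ⊗ₜ 1) (th q ⊗ₜ 1) (th (th q) ⊗ₜ 1)
    simp only [Algebra.TensorProduct.tmul_mul_tmul, mul_one, one_mul, Algebra.TensorProduct.tmul_pow,
      one_pow, ← TensorProduct.add_tmul] at h
    rw [coactR_apply, coactR_apply, coactR_apply]
    simp only [Derivation.leibniz, smul_eq_mul, map_add]
    rw [h]
    exact Ideal.mul_mem_right _ _ (tmul_mem_kerR xi_one_cube_mem _)
  · have h : comul (MvPolynomial.X n) = comul (xi (n + 1)) := rfl
    rw [h, comul_xi, Finset.Nat.sum_antidiagonal_eq_sum_range_succ_mk, Finset.sum_range_succ,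
      Finset.sum_range_succ, coactR_apply, th_th_X, th_X]
    have h1 : (∑ i ∈ Finset.range n, xi i ⊗ₜ[k] (xi (n + 1 - i) ^ 3 ^ i)) ∈ kerR := by
      refine Submodule.sum_mem _ fun i hi => tmul_mem_kerR ?_ _
      rw [Finset.mem_range] at hi
      refine Ideal.pow_mem_of_mem _ ?_ _ (by positivity)
      rw [show n + 1 - i = (n - i - 1) + 2 by omega]
      exact xi_mem _
    rw [show n + 1 - n = 1 by omega, Nat.sub_self]
    cases n with
    | zero =>
      convert zero_mem kerR using 1
      simp [xi]; abel
    | succ n =>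
      have h2 : xi 1 ^ 3 ^ (n + 1) ∈ kerD := by
        rw [pow_succ', pow_mul]
        exact Ideal.pow_mem_of_mem _ xi_one_cube_mem _ (by positivity)
      convert add_mem h1 (tmul_mem_kerR h2 (xi (n + 1))) using 1
      simp [xi]

/-! The monomials in `ker(P → D)`. -/

lemma mon_mem {a : A} (ha : a ≠ 0) : mon a ∈ kerD := by
  obtain ⟨j, hj⟩ := Finsupp.ne_iff.1 ha
  rw [← Finsupp.single_add_erase j a, mon_add, mon_single]
  · refine kerD.mul_mem_right _ ?_
    have h : (a j).1 ≠ 0 ∨ (a j).2.val ≠ 0 := by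
      by_contra h
      rw [not_or, not_not, not_not] at h
      exact hj (Prod.ext h.1 (Fin.ext h.2))
    rcases h with h | h
    · refine kerD.mul_mem_right _ (Ideal.pow_mem_of_mem _ ?_ _ (Nat.pos_of_ne_zero h))
      cases j with
      | zero => exact xi_one_cube_mem
      | succ j => exact Ideal.pow_mem_of_mem _ (xi_mem j) 3 (by norm_num)
    · exact kerD.mul_mem_left _ (Ideal.pow_mem_of_mem _ (xi_mem j) _ (Nat.pos_of_ne_zero h))
  · rw [Finsupp.support_erase]
    refine Finset.disjoint_left.2 fun i hi hi' => ?_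
    have := Finsupp.support_single_subset hi
    rw [Finset.mem_singleton] at this
    exact (Finset.mem_erase.1 hi').1 this

lemma basisP_mem {l : Fin 3 × A} (h : l.2 ≠ 0) : basisP l ∈ kerD := by
  rw [basisP_apply]; exact kerD.mul_mem_left _ (mon_mem h)

/-- The span of the monomials in `ker(P → D)`. -/
def monSpan : Submodule k P := Submodule.span k {p | ∃ l : Fin 3 × A, l.2 ≠ 0 ∧ p = basisP l}

lemma monomial_mem_monSpan {e : ℕ →₀ ℕ} (h : 3 ≤ e 0 ∨ ∃ j, e (j + 1) ≠ 0) :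
    (MvPolynomial.monomial e 1 : P) ∈ monSpan := by
  refine Submodule.subset_span ⟨expoEquiv.symm e, fun h0 => ?_, ?_⟩
  · have he : e = expo (expoEquiv.symm e).1 0 := by
      rw [← h0]; exact (expoEquiv.apply_symm_apply e).symm
    rcases h with h | ⟨j, h⟩
    · rw [he, expo_zero] at h
      simp at h; omega
    · rw [he, expo_succ] at h
      simp at h
  · rw [basisP_eq_monomial]
    exact congrArg (fun e => MvPolynomial.monomial e 1) (expoEquiv.apply_symm_apply e).symm

lemma kerD_le_monSpan {p : P} (hp : p ∈ kerD) : p ∈ monSpan := by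
  have key : ∀ (g : P), (∀ e, MvPolynomial.monomial e 1 * g ∈ monSpan) → ∀ q, q * g ∈ monSpan := by
    intro g hg q
    induction q using MvPolynomial.induction_on' with
    | monomial e c =>
      have : (MvPolynomial.monomial e c : P) = c • MvPolynomial.monomial e 1 := by
        rw [MvPolynomial.smul_monomial, smul_eq_mul, mul_one]
      rw [this, smul_mul_assoc]
      exact Submodule.smul_mem _ _ (hg e)
    | add p q hp hq => rw [add_mul]; exact add_mem hp hq
  suffices ∀ q : P, q * p ∈ monSpan by simpa using this 1
  induction hp using Submodule.span_induction with
  | mem p hp =>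
    refine key p fun e => ?_
    rcases hp with rfl | ⟨n, rfl⟩
    · rw [MvPolynomial.X_pow_eq_monomial, MvPolynomial.monomial_mul, one_mul]
      exact monomial_mem_monSpan (Or.inl (by simp))
    · change MvPolynomial.monomial e 1 * MvPolynomial.X (n + 1) ∈ monSpan
      rw [← pow_one (MvPolynomial.X (n + 1)), MvPolynomial.X_pow_eq_monomial,
        MvPolynomial.monomial_mul, one_mul]
      exact monomial_mem_monSpan (Or.inr ⟨n, by simp⟩)
  | zero => intro q; rw [mul_zero]; exact zero_mem _
  | add p p' _ _ hp hp' => intro q; rw [mul_add]; exact add_mem (hp q) (hp' q)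
  | smul c p _ hp => intro q; rw [smul_eq_mul, ← mul_assoc]; exact hp _

open Classical in
/-- The projection of `P` onto `ker(P → D)` that kills `1`, `ξ₁` and `ξ₁²`. -/
def projJ : P →ₗ[k] P := basisP.constr k fun l => if l.2 = 0 then 0 else basisP l

lemma projJ_zero (r : Fin 3) : projJ (basisP (r, 0)) = 0 := by
  rw [projJ, Module.Basis.constr_basis, if_pos rfl]

lemma projJ_basisP {l : Fin 3 × A} (h : l.2 ≠ 0) : projJ (basisP l) = basisP l := by
  rw [projJ, Module.Basis.constr_basis, if_neg h]

lemma projJ_of_mem {p : P} (hp : p ∈ kerD) : projJ p = p := by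
  have : p ∈ LinearMap.ker (projJ - LinearMap.id) := by
    refine Submodule.span_le.2 ?_ (kerD_le_monSpan hp)
    rintro _ ⟨l, hl, rfl⟩
    simp [projJ_basisP hl]
  simpa [sub_eq_zero] using this

lemma projJ_mem (p : P) : projJ p ∈ kerD := by
  have hp : p ∈ Submodule.span k (Set.range basisP) := by rw [basisP.span_eq]; trivial
  induction hp using Submodule.span_induction with
  | mem p hp =>
    obtain ⟨l, rfl⟩ := hp
    by_cases h : l.2 = 0
    · obtain ⟨r, a⟩ := l
      rw [show a = 0 from h, projJ_zero]; exact zero_mem _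
    · rw [projJ_basisP h]; exact basisP_mem h
  | zero => rw [map_zero]; exact zero_mem _
  | add p q _ _ hp hq => rw [map_add]; exact add_mem hp hq
  | smul c p _ hp =>
    rw [map_smul, MvPolynomial.smul_eq_C_mul]; exact kerD.mul_mem_left _ hp

lemma map_projJ_of_mem_kerL {t : P ⊗[k] P} (h : t ∈ kerL) :
    TensorProduct.map projJ LinearMap.id t = t := by
  suffices ∀ u : P ⊗[k] P, TensorProduct.map projJ LinearMap.id (u * t) = u * t by
    simpa using this 1
  induction h using Submodule.span_induction with
  | mem t ht =>
    obtain ⟨j, hj, rfl⟩ := ht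
    intro u
    induction u with
    | zero => simp
    | add x y hx hy => rw [add_mul, map_add, hx, hy]
    | tmul x y =>
      simp [projJ_of_mem (kerD.mul_mem_left x hj)]
  | zero => intro u; simp
  | add x y _ _ hx hy => intro u; rw [mul_add, map_add, hx, hy]
  | smul c x _ hx => intro u; rw [smul_eq_mul, ← mul_assoc]; exact hx _

lemma map_projJ_of_mem_kerR {t : P ⊗[k] P} (h : t ∈ kerR) :
    TensorProduct.map LinearMap.id projJ t = t := by
  suffices ∀ u : P ⊗[k] P, TensorProduct.map LinearMap.id projJ (u * t) = u * t by
    simpa using this 1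
  induction h using Submodule.span_induction with
  | mem t ht =>
    obtain ⟨j, hj, rfl⟩ := ht
    intro u
    induction u with
    | zero => simp
    | add x y hx hy => rw [add_mul, map_add, hx, hy]
    | tmul x y =>
      simp [projJ_of_mem (kerD.mul_mem_left y hj)]
  | zero => intro u; simp
  | add x y _ _ hx hy => intro u; rw [mul_add, map_add, hx, hy]
  | smul c x _ hx => intro u; rw [smul_eq_mul, ← mul_assoc]; exact hx _

lemma map_projJ_projJ {t : P ⊗[k] P} (hl : t ∈ kerL) (hr : t ∈ kerR) :
    TensorProduct.map projJ projJ t = t := by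
  have h : TensorProduct.map projJ projJ =
      TensorProduct.map LinearMap.id projJ ∘ₗ TensorProduct.map projJ LinearMap.id := by
    rw [← TensorProduct.map_comp, LinearMap.id_comp, LinearMap.comp_id]
  rw [h, LinearMap.comp_apply, map_projJ_of_mem_kerL hl, map_projJ_of_mem_kerR hr]

/-- For `p ∈ ker(P → D)` the coproduct is the sum of the two coactions and of a term in
`ker(P → D) ⊗ ker(P → D)`. -/
lemma comul_sub_coact {p : P} (hp : p ∈ kerD) :
    TensorProduct.map projJ projJ (comul p - coactL p - coactR p) = comul p - coactL p - coactR p := by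
  refine map_projJ_projJ (sub_mem (comul_sub_coactL p) ?_) ?_
  · rw [coactR_apply]
    exact sub_mem (add_mem (tmul_mem_kerL hp _) (tmul_mem_kerL (th_mem hp) _))
      (tmul_mem_kerL (th_mem (th_mem hp)) _)
  · rw [sub_right_comm]
    refine sub_mem (comul_sub_coactR p) ?_
    rw [coactL_apply]
    exact sub_mem (add_mem (tmul_mem_kerR hp _) (tmul_mem_kerR (pd_mem hp) _))
      (tmul_mem_kerR (pd_mem (pd_mem hp)) _)

/-! The differential as `d₀ + d₁`. -/

/-- The cochain `[ξ₁²]`. -/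
def q20 : Cobar := bar (xi 1 ^ 2)

/-- The part of `d [p]` with as many letters in `ker(P → D)` as `[p]`. -/
def phi0 : P →ₗ[k] Cobar :=
  bar₂ ∘ₗ coactL ∘ₗ projJ + bar₂ ∘ₗ coactR ∘ₗ projJ + bar₂ ∘ₗ comul.toLinearMap ∘ₗ (LinearMap.id - projJ)

/-- The part of `d [p]` with one more letter in `ker(P → D)`. -/
def phi1 : P →ₗ[k] Cobar :=
  bar₂ ∘ₗ (comul.toLinearMap - coactL - coactR) ∘ₗ projJ

lemma phi0_add_phi1 : phi0 + phi1 = bar₂ ∘ₗ comul.toLinearMap := by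
  refine LinearMap.ext fun p => ?_
  simp only [phi0, phi1, LinearMap.add_apply, LinearMap.comp_apply, LinearMap.sub_apply, map_sub,
    LinearMap.id_apply]
  abel

lemma bar₂_tmul (p q : P) : bar₂ (p ⊗ₜ q) = bar p * bar q := by simp [bar₂]

lemma phi0_of_mem {p : P} (hp : p ∈ kerD) :
    phi0 p = h10 * bar (pd p) - q20 * bar (pd (pd p)) + (bar (th p) * h10 - bar (th (th p)) * q20) := by
  simp only [phi0, LinearMap.add_apply, LinearMap.comp_apply, LinearMap.sub_apply,
    projJ_of_mem hp, LinearMap.id_apply, sub_self, map_zero, coactL_apply, coactR_apply, map_add,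
    map_sub, bar₂_tmul, bar_one]
  simp [h10, q20]

lemma bar₂_one : bar₂ 1 = 0 := by rw [Algebra.TensorProduct.one_def, bar₂_tmul, bar_one, zero_mul]

lemma projJ_one : projJ 1 = 0 := by rw [← basisP_zero]; exact projJ_zero 0

lemma basisP_pow (r : Fin 3) : basisP (r, 0) = xi 1 ^ (r : ℕ) := by
  rw [basisP_apply, mon_zero, mul_one]

lemma phi0_one : phi0 1 = 0 := by
  simp [phi0, projJ_one, bar₂_one]

lemma phi1_one : phi1 1 = 0 := by simp [phi1, projJ_one]

lemma phi0_xi : phi0 (xi 1) = 0 := by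
  have h : projJ (xi 1) = 0 := by simpa [basisP_pow] using projJ_zero 1
  simp only [phi0, LinearMap.add_apply, LinearMap.comp_apply, LinearMap.sub_apply, h, map_zero,
    LinearMap.id_apply, sub_zero, zero_add]
  have := d_h10
  rwa [h10, d_bar] at this

lemma phi0_xi_sq : phi0 (xi 1 ^ 2) = -(h10 * h10) := by
  have h : projJ (xi 1 ^ 2) = 0 := by simpa [basisP_pow] using projJ_zero 2
  simp only [phi0, LinearMap.add_apply, LinearMap.comp_apply, LinearMap.sub_apply, h, map_zero,
    LinearMap.id_apply, sub_zero, zero_add]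
  have := d_bar_sq
  rw [d_bar, show (2 : k) = -1 from by decide, neg_one_smul] at this
  exact this

/-- The part of `d` that preserves the number of letters in `ker(P → D)`. -/
def d0 : Cobar →ₗ[k] Cobar := der phi0

/-- The part of `d` that raises the number of letters in `ker(P → D)`. -/
def d1 : Cobar →ₗ[k] Cobar := der phi1

lemma d_eq (x : Cobar) : d x = d0 x + d1 x := by
  rw [d0, d1, ← der_add, phi0_add_phi1]
  induction x using word_induction with
  | h1 => rw [d_one, der_one]
  | hl l x hx => rw [lt, d_bar_mul, hx]; exact (der_lt_mul _ _ _).symm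
  | h0 => simp
  | hadd x y hx hy => rw [map_add, map_add, hx, hy]
  | hs c x hx => rw [map_smul, map_smul, hx]

lemma mem_wordSpan_inter {S T : Set (List Letter)} {x : Cobar} (hS : x ∈ wordSpan S)
    (hT : x ∈ wordSpan T) : x ∈ wordSpan (S ∩ T) := by
  have h := wordProj_wordProj S T x
  rw [wordProj_of_mem hT, wordProj_of_mem hS] at h
  rw [h]; exact wordProj_mem _ _

lemma Shifts.eq_zero_of_add_add {G : Type*} [AddGroup G] {W : List Letter → G}
    {f f' f'' : Cobar →ₗ[k] Cobar} {g g' g'' : G} (h : Shifts W f g) (h' : Shifts W f' g')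
    (h'' : Shifts W f'' g'') (h1 : g ≠ g') (h2 : g ≠ g'') (h0 : f + f' + f'' = 0) : f = 0 := by
  refine wordBasis.ext fun w => ?_
  have h3 := congrArg (MPASS.wordProj {u | W u = W w + g}) (LinearMap.congr_fun h0 (wordBasis w))
  rw [LinearMap.add_apply, LinearMap.add_apply, map_add, map_add, wordProj_of_mem (h w),
    wordProj_of_disjoint (fun u hu hu' => h1 ?_) (h' w),
    wordProj_of_disjoint (fun u hu hu' => h2 ?_) (h'' w)] at h3
  · simpa using h3
  · exact add_left_cancel ((show W u = W w + g from hu').symm.trans hu)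
  · exact add_left_cancel ((show W u = W w + g from hu').symm.trans hu)

/-! The number of letters in `ker(P → D)`. -/

/-- `1` for the letters in `ker(P → D)`, else `0`. -/
def letterJ (l : Letter) : ℤ := if l.1.2 = 0 then 0 else 1

lemma letterJ_pos {l : Letter} (h : l.1.2 ≠ 0) : letterJ l = 1 := if_neg h

lemma letterJ_neg {l : Letter} (h : l.1.2 = 0) : letterJ l = 0 := if_pos h

lemma letterJ_nonneg (l : Letter) : 0 ≤ letterJ l := by rw [letterJ]; split_ifs <;> norm_num

/-- The number of letters in `ker(P → D)` of a word. -/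
notation "countJ" => weight letterJ

lemma countJ_nonneg (w : List Letter) : 0 ≤ countJ w := by
  induction w with
  | nil => simp [weight]
  | cons l w ih => rw [weight_cons]; exact add_nonneg (letterJ_nonneg l) ih

lemma bar_mem_countJ {p : P} (hp : p ∈ kerD) : bar p ∈ wordSpan {u | countJ u = 1} := by
  have h : monSpan ≤ (wordSpan {u | countJ u = 1}).comap bar := by
    refine Submodule.span_le.2 ?_
    rintro _ ⟨l, hl, rfl⟩
    have := lt_mem_weight letterJ ⟨l, fun h => hl (by rw [h]; rfl)⟩
    rwa [letterJ_pos hl] at this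
  exact h (kerD_le_monSpan hp)

lemma h10_mem_countJ : h10 ∈ wordSpan {u | countJ u = 0} := by
  have := lt_mem_weight letterJ ⟨(1, 0), by simp⟩
  rw [letterJ_neg rfl] at this
  simpa [lt, basisP_pow, h10] using this

lemma q20_mem_countJ : q20 ∈ wordSpan {u | countJ u = 0} := by
  have := lt_mem_weight letterJ ⟨(2, 0), by simp⟩
  rw [letterJ_neg rfl] at this
  simpa [lt, basisP_pow, q20] using this

lemma letter_cases (l : Letter) : l.1.2 ≠ 0 ∨ l = ⟨(1, 0), by simp⟩ ∨ l = ⟨(2, 0), by simp⟩ := by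
  obtain ⟨⟨r, a⟩, h⟩ := l
  by_cases ha : a = 0
  · subst ha
    fin_cases r
    · exact absurd rfl h
    · exact Or.inr (Or.inl rfl)
    · exact Or.inr (Or.inr rfl)
  · exact Or.inl ha

lemma lt_one (h : ((1, 0) : Fin 3 × A) ≠ 0) : lt ⟨(1, 0), h⟩ = h10 := by
  simp [lt, basisP_pow, h10]

lemma lt_two (h : ((2, 0) : Fin 3 × A) ≠ 0) : lt ⟨(2, 0), h⟩ = q20 := by
  simp [lt, basisP_pow, q20]

lemma bar_mul_bar_mem {p q : P} (hp : p ∈ kerD) (hq : q ∈ kerD) :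
    bar p * bar q ∈ wordSpan {u | countJ u = 2} :=
  mul_mem_weight_of_eq (by norm_num) (bar_mem_countJ hp) (bar_mem_countJ hq)

lemma d0_shifts_countJ : Shifts countJ d0 0 := by
  refine der_shifts fun l => ?_
  rw [add_zero]
  rcases letter_cases l with h | rfl | rfl
  · have hl : basisP l.1 ∈ kerD := basisP_mem h
    rw [phi0_of_mem hl, letterJ_pos h]
    refine add_mem (sub_mem ?_ ?_) (sub_mem ?_ ?_)
    · exact mul_mem_weight_of_eq (by norm_num) h10_mem_countJ (bar_mem_countJ (pd_mem hl))
    · exact mul_mem_weight_of_eq (by norm_num) q20_mem_countJ (bar_mem_countJ (pd_mem (pd_mem hl)))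
    · exact mul_mem_weight_of_eq (by norm_num) (bar_mem_countJ (th_mem hl)) h10_mem_countJ
    · exact mul_mem_weight_of_eq (by norm_num) (bar_mem_countJ (th_mem (th_mem hl))) q20_mem_countJ
  · simp only [basisP_pow]
    rw [show xi 1 ^ ((1 : Fin 3) : ℕ) = xi 1 by simp, phi0_xi]; exact zero_mem _
  · simp only [basisP_pow]
    rw [show xi 1 ^ ((2 : Fin 3) : ℕ) = xi 1 ^ 2 by simp, phi0_xi_sq, letterJ_neg rfl]
    exact neg_mem (mul_mem_weight_of_eq (by norm_num) h10_mem_countJ h10_mem_countJ)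

lemma bar₂_projJ_mem (t : P ⊗[k] P) :
    bar₂ (TensorProduct.map projJ projJ t) ∈ wordSpan {u | countJ u = 2} := by
  induction t with
  | zero => simp
  | add x y hx hy => rw [map_add, map_add]; exact add_mem hx hy
  | tmul x y => rw [TensorProduct.map_tmul, bar₂_tmul]; exact bar_mul_bar_mem (projJ_mem x) (projJ_mem y)

lemma phi1_of_mem {p : P} (hp : p ∈ kerD) :
    phi1 p = bar₂ (TensorProduct.map projJ projJ (comul p - coactL p - coactR p)) := by
  rw [comul_sub_coact hp]
  simp only [phi1, LinearMap.comp_apply, projJ_of_mem hp]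
  rfl

lemma phi1_basisP (r : Fin 3) : phi1 (basisP (r, 0)) = 0 := by
  simp only [phi1, LinearMap.comp_apply, projJ_zero, map_zero]

lemma d1_shifts_countJ : Shifts countJ d1 1 := by
  refine der_shifts fun l => ?_
  by_cases h : l.1.2 = 0
  · obtain ⟨⟨r, a⟩, hl⟩ := l
    obtain rfl : a = 0 := h
    rw [phi1_basisP]; exact zero_mem _
  · rw [letterJ_pos h, phi1_of_mem (basisP_mem h)]
    exact bar₂_projJ_mem _

lemma d_parts : d0 ∘ₗ d0 = 0 ∧ d0 ∘ₗ d1 + d1 ∘ₗ d0 = 0 ∧ d1 ∘ₗ d1 = 0 := by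
  have h0 := d0_shifts_countJ
  have h1 := d1_shifts_countJ
  have hsum : d0 ∘ₗ d0 + (d0 ∘ₗ d1 + d1 ∘ₗ d0) + d1 ∘ₗ d1 = 0 := by
    refine LinearMap.ext fun x => ?_
    have := d_d x
    rw [d_eq x, d_eq, map_add, map_add] at this
    simp only [LinearMap.add_apply, LinearMap.comp_apply, LinearMap.zero_apply]
    rw [← this]; abel
  have e1 : Shifts countJ (d0 ∘ₗ d0) 0 := by simpa only [add_zero] using h0.comp h0
  have e2 : Shifts countJ (d0 ∘ₗ d1 + d1 ∘ₗ d0) 1 := by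
    have e2a := h0.comp h1
    have e2b := h1.comp h0
    rw [add_zero] at e2a
    rw [zero_add] at e2b
    exact e2a.add e2b
  have e3 : Shifts countJ (d1 ∘ₗ d1) (1 + 1) := h1.comp h1
  refine ⟨e1.eq_zero_of_add_add e2 e3 (by norm_num) (by norm_num) hsum, ?_, ?_⟩
  · refine e2.eq_zero_of_add_add e1 e3 (by norm_num) (by norm_num) ?_
    rw [add_comm (_ + _) (d0 ∘ₗ d0)]; exact hsum
  · refine e3.eq_zero_of_add_add e2 e1 (by norm_num) (by norm_num) ?_
    rw [← hsum]; abel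

lemma d0_d0 (x : Cobar) : d0 (d0 x) = 0 := LinearMap.congr_fun d_parts.1 x

lemma d0_d1 (x : Cobar) : d0 (d1 x) = -d1 (d0 x) :=
  eq_neg_of_add_eq_zero_left (LinearMap.congr_fun d_parts.2.1 x)

lemma d1_d1 (x : Cobar) : d1 (d1 x) = 0 := LinearMap.congr_fun d_parts.2.2 x

open Classical in
lemma prod_letter_mem (l : List Pbar) (n : ℕ)
    (hn : n ≤ l.countP fun a : Pbar => decide ((a : P) ∈ kerD)) :
    (l.map letter).prod ∈ wordSpan {u | (n : ℤ) ≤ countJ u} := by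
  induction l generalizing n with
  | nil =>
    obtain rfl : n = 0 := by simpa using hn
    have h : [] ∈ {u : List Letter | ((0 : ℕ) : ℤ) ≤ countJ u} := by simp [weight]
    have := wordBasis_mem h
    rwa [wordBasis_nil] at this
  | cons a l ih =>
    rw [List.map_cons, List.prod_cons]
    have hb : letter a = bar (a : P) := by
      rw [bar, LinearMap.comp_apply]
      congr 1
      exact Subtype.ext (proj_of_mem a.2).symm
    by_cases ha : (a : P) ∈ kerD
    · rw [List.countP_cons_of_pos (by simpa using ha)] at hn
      have h1 : letter a ∈ wordSpan {u | countJ u = 1} := hb ▸ bar_mem_countJ ha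
      refine mul_mem_wordSpan (fun u hu w hw => ?_) h1 (ih (n - 1) (by omega))
      rw [Set.mem_ofPred_eq] at hu hw ⊢
      rw [weight_append, hu]
      omega
    · rw [List.countP_cons_of_neg (by simpa using ha)] at hn
      refine mul_mem_wordSpan (S := Set.univ) (fun u hu w hw => ?_)
        (by rw [wordSpan_univ]; trivial) (ih n hn)
      rw [Set.mem_ofPred_eq] at hw ⊢
      rw [weight_append]
      have := countJ_nonneg u
      omega

/-- The filtration is the filtration by the number of letters in `ker(P → D)`. -/
lemma filt_eq (s : ℕ) : filt s = wordSpan {u | (s : ℤ) ≤ countJ u} := by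
  classical
  refine le_antisymm (Submodule.span_le.2 ?_) (wordSpan_le.2 fun w hw => ?_)
  · rintro _ ⟨l, hl, rfl⟩
    exact prod_letter_mem l s (by convert hl)
  · have key : ∀ w : List Letter, wordBasis w ∈ filt (countJ w).toNat := by
      intro w
      induction w with
      | nil => exact mem_filt_zero _
      | cons l w ih =>
        rw [wordBasis_cons, weight_cons, Int.toNat_add (letterJ_nonneg l) (countJ_nonneg w)]
        refine mul_mem_filt ?_ ih
        by_cases h : l.1.2 = 0
        · rw [letterJ_neg h]; exact mem_filt_zero _
        · rw [letterJ_pos h]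
          refine Submodule.subset_span ⟨[proj (basisP l.1)], ?_, by simp [lt, bar]⟩
          rw [List.countP_cons_of_pos]
          · simp
          · simpa [proj_of_mem (counit_basisP l)] using basisP_mem h
    have h2 : s ≤ (countJ w).toNat := by
      have : (s : ℤ) ≤ countJ w := hw
      omega
    exact F_anti h2 (key w)

/-! Degrees and weights of coproducts. -/

/-- The internal degree of a monomial, with `|ξ_n| = 3^n - 1`. -/
def expoDeg : (ℕ →₀ ℕ) →+ ℕ :=
  Finsupp.liftAddHom fun i => AddMonoidHom.mulRight (3 ^ (i + 1) - 1)

/-- The weight of a monomial, with `ξ_n` of weight `3^{n-1}`. -/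
def expoWt : (ℕ →₀ ℕ) →+ ℕ := Finsupp.liftAddHom fun i => AddMonoidHom.mulRight (3 ^ i)

lemma expoDeg_single (i n : ℕ) : expoDeg (Finsupp.single i n) = n * (3 ^ (i + 1) - 1) := by
  simp [expoDeg]

lemma expoWt_single (i n : ℕ) : expoWt (Finsupp.single i n) = n * 3 ^ i := by simp [expoWt]

/-- The span of the tensors of monomials of total degree `D` and total weight at least `w`. -/
def tensorFilt (D w : ℕ) : Submodule k (P ⊗[k] P) :=
  Submodule.span k {t | ∃ e f : ℕ →₀ ℕ, expoDeg e + expoDeg f = D ∧ w ≤ expoWt e + expoWt f ∧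
    t = MvPolynomial.monomial e 1 ⊗ₜ MvPolynomial.monomial f 1}

lemma tensorFilt_anti {D w w' : ℕ} (h : w ≤ w') : tensorFilt D w' ≤ tensorFilt D w :=
  Submodule.span_mono fun _ ⟨e, f, hD, hw, ht⟩ => ⟨e, f, hD, h.trans hw, ht⟩

lemma mul_mem_tensorFilt {D D' w w' : ℕ} {t t' : P ⊗[k] P} (h : t ∈ tensorFilt D w)
    (h' : t' ∈ tensorFilt D' w') : t * t' ∈ tensorFilt (D + D') (w + w') := by
  have h1 := Submodule.mul_mem_mul h h'
  rw [tensorFilt, tensorFilt, Submodule.span_mul_span] at h1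
  refine Submodule.span_mono ?_ h1
  rintro _ ⟨_, ⟨e, f, hD, hw, rfl⟩, _, ⟨e', f', hD', hw', rfl⟩, rfl⟩
  refine ⟨e + e', f + f', ?_, ?_, ?_⟩
  · rw [map_add, map_add]; omega
  · rw [map_add, map_add]; omega
  · simp [MvPolynomial.monomial_mul]

/-- The exponent of `ξ_n`. -/
def xiExpo : ℕ → ℕ →₀ ℕ
  | 0 => 0
  | n + 1 => Finsupp.single n 1

lemma xi_eq_monomial (n : ℕ) : xi n = MvPolynomial.monomial (xiExpo n) 1 := by
  cases n <;> rfl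

lemma xi_pow_eq_monomial (n m : ℕ) : xi n ^ m = MvPolynomial.monomial (m • xiExpo n) 1 := by
  rw [xi_eq_monomial, MvPolynomial.monomial_pow, one_pow]

lemma expoDeg_xiExpo (n : ℕ) : expoDeg (xiExpo n) = 3 ^ n - 1 := by
  cases n with
  | zero => simp [xiExpo]
  | succ n => simp [xiExpo, expoDeg_single]

/-- The coproduct for which the generators are primitive. -/
def primComul : P →ₐ[k] P ⊗[k] P :=
  MvPolynomial.aeval fun n => MvPolynomial.X n ⊗ₜ 1 + 1 ⊗ₜ MvPolynomial.X n

lemma xi_tmul_mem {n i j w : ℕ} (h : i + j = n + 1) (hw : w ≤ expoWt (xiExpo i) + 3 ^ i * expoWt (xiExpo j)) :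
    xi i ⊗ₜ[k] (xi j ^ 3 ^ i) ∈ tensorFilt (3 ^ (n + 1) - 1) w := by
  refine Submodule.subset_span ⟨xiExpo i, 3 ^ i • xiExpo j, ?_, ?_, ?_⟩
  · rw [map_nsmul, expoDeg_xiExpo, expoDeg_xiExpo, smul_eq_mul, ← h, pow_add]
    have h1 : 1 ≤ 3 ^ i := Nat.one_le_pow _ _ (by norm_num)
    have h2 : 1 ≤ 3 ^ j := Nat.one_le_pow _ _ (by norm_num)
    rw [Nat.mul_sub, mul_one]
    have h3 : 3 ^ i ≤ 3 ^ i * 3 ^ j := Nat.le_mul_of_pos_right _ h2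
    omega
  · rwa [map_nsmul, smul_eq_mul]
  · rw [xi_pow_eq_monomial, xi_eq_monomial]

lemma expoWt_xiExpo_succ (n : ℕ) : expoWt (xiExpo (n + 1)) = 3 ^ n := by
  simp [xiExpo, expoWt_single]

lemma expoWt_xi_tmul {n i j : ℕ} (h : i + j = n + 1) :
    3 ^ n ≤ expoWt (xiExpo i) + 3 ^ i * expoWt (xiExpo j) ∧
    (i ≠ 0 → j ≠ 0 → 3 ^ n + 1 ≤ expoWt (xiExpo i) + 3 ^ i * expoWt (xiExpo j)) := by
  rcases i with _ | i
  · obtain rfl : j = n + 1 := by omega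
    rw [expoWt_xiExpo_succ]
    exact ⟨by simp, fun h => absurd rfl h⟩
  · rcases j with _ | j
    · obtain rfl : i = n := by omega
      rw [expoWt_xiExpo_succ]
      exact ⟨by simp, fun _ h => absurd rfl h⟩
    · rw [expoWt_xiExpo_succ, expoWt_xiExpo_succ, ← pow_add, show i + 1 + j = n by omega]
      have : 1 ≤ 3 ^ i := Nat.one_le_pow _ _ (by norm_num)
      exact ⟨by omega, fun _ _ => by omega⟩

lemma comul_X_mem (n : ℕ) : comul (MvPolynomial.X n) ∈ tensorFilt (3 ^ (n + 1) - 1) (3 ^ n) := by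
  change comul (xi (n + 1)) ∈ _
  rw [comul_xi]
  refine Submodule.sum_mem _ fun ij hij => ?_
  rw [Finset.HasAntidiagonal.mem_antidiagonal] at hij
  exact xi_tmul_mem hij (expoWt_xi_tmul hij).1

lemma comul_X_sub_mem (n : ℕ) : comul (MvPolynomial.X n) - primComul (MvPolynomial.X n) ∈
    tensorFilt (3 ^ (n + 1) - 1) (3 ^ n + 1) := by
  change comul (xi (n + 1)) - _ ∈ _
  rw [comul_xi, primComul, MvPolynomial.aeval_X, Finset.Nat.sum_antidiagonal_eq_sum_range_succ_mk,
    Finset.sum_range_succ, Finset.sum_range_succ']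
  have h : (∑ i ∈ Finset.range n, xi (i + 1) ⊗ₜ[k] (xi (n + 1 - (i + 1)) ^ 3 ^ (i + 1))) ∈
      tensorFilt (3 ^ (n + 1) - 1) (3 ^ n + 1) := by
    refine Submodule.sum_mem _ fun i hi => ?_
    rw [Finset.mem_range] at hi
    have hij : (i + 1) + (n + 1 - (i + 1)) = n + 1 := by omega
    exact xi_tmul_mem hij ((expoWt_xi_tmul hij).2 (by omega) (by omega))
  convert h using 1
  simp [xi]
  abel

lemma primComul_X_mem (n : ℕ) : primComul (MvPolynomial.X n) ∈
    tensorFilt (3 ^ (n + 1) - 1) (3 ^ n) := by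
  have := sub_mem (comul_X_mem n) (tensorFilt_anti (Nat.le_succ _) (comul_X_sub_mem n))
  simpa using this

lemma monomial_comul_mem (e : ℕ →₀ ℕ) :
    comul (MvPolynomial.monomial e 1) ∈ tensorFilt (expoDeg e) (expoWt e) ∧
    primComul (MvPolynomial.monomial e 1) ∈ tensorFilt (expoDeg e) (expoWt e) ∧
    comul (MvPolynomial.monomial e 1) - primComul (MvPolynomial.monomial e 1) ∈
      tensorFilt (expoDeg e) (expoWt e + 1) := by
  have hadd : ∀ e f : ℕ →₀ ℕ,
      (comul (MvPolynomial.monomial e 1) ∈ tensorFilt (expoDeg e) (expoWt e) ∧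
      primComul (MvPolynomial.monomial e 1) ∈ tensorFilt (expoDeg e) (expoWt e) ∧
      comul (MvPolynomial.monomial e 1) - primComul (MvPolynomial.monomial e 1) ∈
        tensorFilt (expoDeg e) (expoWt e + 1)) →
      (comul (MvPolynomial.monomial f 1) ∈ tensorFilt (expoDeg f) (expoWt f) ∧
      primComul (MvPolynomial.monomial f 1) ∈ tensorFilt (expoDeg f) (expoWt f) ∧
      comul (MvPolynomial.monomial f 1) - primComul (MvPolynomial.monomial f 1) ∈
        tensorFilt (expoDeg f) (expoWt f + 1)) →
      (comul (MvPolynomial.monomial (e + f) 1) ∈ tensorFilt (expoDeg (e + f)) (expoWt (e + f)) ∧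
      primComul (MvPolynomial.monomial (e + f) 1) ∈ tensorFilt (expoDeg (e + f)) (expoWt (e + f)) ∧
      comul (MvPolynomial.monomial (e + f) 1) - primComul (MvPolynomial.monomial (e + f) 1) ∈
        tensorFilt (expoDeg (e + f)) (expoWt (e + f) + 1)) := by
    rintro e f ⟨h1, h2, h3⟩ ⟨h1', h2', h3'⟩
    have hm : (MvPolynomial.monomial (e + f) 1 : P) =
        MvPolynomial.monomial e 1 * MvPolynomial.monomial f 1 := by
      rw [MvPolynomial.monomial_mul, one_mul]
    rw [hm, map_mul, map_mul, map_add, map_add]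
    refine ⟨mul_mem_tensorFilt h1 h1', mul_mem_tensorFilt h2 h2', ?_⟩
    have e1 := mul_mem_tensorFilt h1 h3'
    have e2 := mul_mem_tensorFilt h3 h2'
    rw [← add_assoc] at e1
    rw [add_right_comm] at e2
    convert add_mem e1 e2 using 1
    ring
  induction e using Finsupp.induction_linear with
  | zero =>
    have h1 : (MvPolynomial.monomial 0 1 : P) = 1 := rfl
    have : (1 : P ⊗[k] P) ∈ tensorFilt 0 0 :=
      Submodule.subset_span ⟨0, 0, by simp, by simp, by rw [h1]; rfl⟩
    rw [h1, map_one, map_one, sub_self, map_zero, map_zero]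
    exact ⟨this, this, zero_mem _⟩
  | add e f he hf => exact hadd e f he hf
  | single i n =>
    induction n with
    | zero =>
      rw [Finsupp.single_zero]
      have h1 : (MvPolynomial.monomial 0 1 : P) = 1 := rfl
      have : (1 : P ⊗[k] P) ∈ tensorFilt 0 0 :=
        Submodule.subset_span ⟨0, 0, by simp, by simp, by rw [h1]; rfl⟩
      rw [h1, map_one, map_one, sub_self, map_zero, map_zero]
      exact ⟨this, this, zero_mem _⟩
    | succ n ih =>
      rw [Finsupp.single_add]
      refine hadd _ _ ih ?_
      rw [expoDeg_single, expoWt_single, one_mul, one_mul]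
      exact ⟨comul_X_mem i, primComul_X_mem i, comul_X_sub_mem i⟩

/-- The letter of a nontrivial monomial. -/
def letterOf (e : ℕ →₀ ℕ) (he : e ≠ 0) : Letter :=
  ⟨expoEquiv.symm e, fun h => he (by
    rw [Equiv.symm_apply_eq] at h
    rw [h]
    exact Finsupp.ext fun i => by cases i <;> simp [expoEquiv, expo_zero, expo_succ])⟩

lemma expo_letterOf (e : ℕ →₀ ℕ) (he : e ≠ 0) :
    expo (letterOf e he).1.1 (letterOf e he).1.2 = e := expoEquiv.apply_symm_apply e

lemma lt_letterOf (e : ℕ →₀ ℕ) (he : e ≠ 0) :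
    lt (letterOf e he) = bar (MvPolynomial.monomial e 1) := by
  rw [lt, basisP_eq_monomial, expo_letterOf]

/-- The internal degree of a letter. -/
def letterDeg (l : Letter) : ℤ := expoDeg (expo l.1.1 l.1.2)

/-- The internal degree of words. -/
notation "wordDeg" => weight letterDeg

/-- The length of words, as an integer. -/
notation "wordLen" => weight fun _ : Letter => (1 : ℤ)

lemma bar₂_mem_wordDeg {D w : ℕ} {t : P ⊗[k] P} (h : t ∈ tensorFilt D w) :
    bar₂ t ∈ wordSpan ({u | wordDeg u = D} ∩ {u | wordLen u = 2}) := by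
  have : tensorFilt D w ≤ (wordSpan ({u | wordDeg u = D} ∩ {u | wordLen u = 2})).comap bar₂ := by
    refine Submodule.span_le.2 ?_
    rintro _ ⟨e, f, hD, -, rfl⟩
    rw [SetLike.mem_coe, Submodule.mem_comap, bar₂_tmul]
    by_cases he : e = 0
    · subst he
      have : bar (MvPolynomial.monomial (0 : ℕ →₀ ℕ) 1) = 0 := bar_one
      rw [this, zero_mul]; exact zero_mem _
    by_cases hf : f = 0
    · subst hf
      have : bar (MvPolynomial.monomial (0 : ℕ →₀ ℕ) 1) = 0 := bar_one
      rw [this, mul_zero]; exact zero_mem _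
    rw [← lt_letterOf e he, ← lt_letterOf f hf]
    have := wordBasis_mem (S := {u | wordDeg u = D} ∩ {u | wordLen u = 2})
      (w := [letterOf e he, letterOf f hf]) (by
        refine ⟨?_, by simp [weight]⟩
        simp [weight, letterDeg, expo_letterOf, ← hD])
    simpa using this
  exact this h

lemma d_eq_der (x : Cobar) : d x = der (bar₂ ∘ₗ comul.toLinearMap) x := by
  rw [d_eq, ← phi0_add_phi1, der_add]; rfl

lemma d_shifts_wordDeg : Shifts wordDeg d 0 := by
  have h : Shifts wordDeg (der (bar₂ ∘ₗ comul.toLinearMap)) 0 := der_shifts fun l => by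
    rw [add_zero, basisP_eq_monomial]
    exact wordSpan_mono Set.inter_subset_left (bar₂_mem_wordDeg (monomial_comul_mem _).1)
  intro w
  rw [d_eq_der]; exact h w

lemma d_shifts_wordLen : Shifts wordLen d 1 := by
  have h : Shifts wordLen (der (bar₂ ∘ₗ comul.toLinearMap)) 1 := der_shifts fun l => by
    rw [basisP_eq_monomial]
    exact wordSpan_mono Set.inter_subset_right (bar₂_mem_wordDeg (monomial_comul_mem _).1)
  intro w
  rw [d_eq_der]; exact h w

lemma d0_eq_wordProj (w : List Letter) :
    d0 (wordBasis w) = wordProj {u | countJ u = countJ w} (d (wordBasis w)) := by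
  have h0 := d0_shifts_countJ w
  rw [add_zero] at h0
  rw [d_eq, map_add, wordProj_of_mem h0,
    wordProj_of_disjoint (fun u hu hu' => ?_) (d1_shifts_countJ w), add_zero]
  have e1 : countJ u = countJ w + 1 := hu
  have e2 : countJ u = countJ w := hu'
  omega

lemma d0_shifts {G : Type*} [AddGroup G] {W : List Letter → G} {g : G} (h : Shifts W d g) :
    Shifts W d0 g := fun w => by
  rw [d0_eq_wordProj]; exact wordProj_mem_of_mem (h w)

lemma d1_shifts {G : Type*} [AddGroup G] {W : List Letter → G} {g : G} (h : Shifts W d g) :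
    Shifts W d1 g := fun w => by
  rw [show d1 (wordBasis w) = d (wordBasis w) - d0 (wordBasis w) by rw [d_eq]; abel]
  exact sub_mem (h w) (d0_shifts h w)

/-! The homotopy between left and right multiplication by `b₁₀`. -/

lemma counit_xi_succ (n : ℕ) : counit (xi (n + 1)) = 0 := MvPolynomial.aeval_X _ _

lemma counit_left (p : P) :
    TensorProduct.lid k P (TensorProduct.map counit.toLinearMap LinearMap.id (comul p)) = p := by
  have h : ((Algebra.TensorProduct.lid k P).toAlgHom.comp
      (Algebra.TensorProduct.map counit (AlgHom.id k P))).comp comul = AlgHom.id k P := by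
    refine MvPolynomial.algHom_ext fun n => ?_
    change Algebra.TensorProduct.lid k P (Algebra.TensorProduct.map counit (AlgHom.id k P)
      (comul (xi (n + 1)))) = xi (n + 1)
    rw [comul_xi, map_sum, map_sum, Finset.sum_eq_single (0, n + 1)]
    · simp [xi]
    · rintro ⟨i, j⟩ hij hne
      rw [Finset.HasAntidiagonal.mem_antidiagonal] at hij
      cases i with
      | zero => exact absurd (show (0, j) = (0, n + 1) by rw [← hij, Nat.zero_add]) hne
      | succ i => simp [counit_xi_succ]
    · intro h; exact absurd (by simp) h
  exact DFunLike.congr_fun h p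

lemma counit_right (p : P) :
    TensorProduct.rid k P (TensorProduct.map LinearMap.id counit.toLinearMap (comul p)) = p := by
  have h : ((Algebra.TensorProduct.rid k k P).toAlgHom.comp
      (Algebra.TensorProduct.map (AlgHom.id k P) counit)).comp comul = AlgHom.id k P := by
    refine MvPolynomial.algHom_ext fun n => ?_
    change Algebra.TensorProduct.rid k k P (Algebra.TensorProduct.map (AlgHom.id k P) counit
      (comul (xi (n + 1)))) = xi (n + 1)
    rw [comul_xi, map_sum, map_sum, Finset.sum_eq_single (n + 1, 0)]
    · simp [xi]
    · rintro ⟨i, j⟩ hij hne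
      rw [Finset.HasAntidiagonal.mem_antidiagonal] at hij
      cases j with
      | zero => exact absurd (show (i, 0) = (n + 1, 0) by rw [← hij, Nat.add_zero]) hne
      | succ j => simp [counit_xi_succ]
    · intro h; exact absurd (by simp) h
  exact DFunLike.congr_fun h p

/-- The cocycle `ξ₁ ⊗ ξ₁² + ξ₁² ⊗ ξ₁` that represents `b₁₀`. -/
def betaTensor : P ⊗[k] P := xi 1 ⊗ₜ (xi 1 ^ 2) + (xi 1 ^ 2) ⊗ₜ xi 1

lemma bar₂_betaTensor : bar₂ betaTensor = b10 := by
  rw [betaTensor, map_add, bar₂_tmul, bar₂_tmul, b10]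

/-- The homotopy on letters. -/
def htpyLetter : P →ₗ[k] Cobar :=
  bar₂ ∘ₗ LinearMap.mulRight k betaTensor ∘ₗ comul.toLinearMap -
    LinearMap.toSpanSingleton k Cobar b10 ∘ₗ counit.toLinearMap

lemma htpyLetter_apply (p : P) :
    htpyLetter p = bar₂ (comul p * betaTensor) - counit p • b10 := rfl

lemma htpyLetter_one : htpyLetter 1 = 0 := by
  rw [htpyLetter_apply]; simp [bar₂_betaTensor]

/-- The homotopy between left and right multiplication by `b₁₀`. -/
def htpy : Cobar →ₗ[k] Cobar := der htpyLetter

/-- The linear map `p ⊗ q ⊗ r ↦ [p | q | r]`. -/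
def bar₃ : P ⊗[k] (P ⊗[k] P) →ₗ[k] Cobar := LinearMap.mul' k Cobar ∘ₗ TensorProduct.map bar bar₂

lemma bar₃_assoc (u : P ⊗[k] P) (p : P) :
    bar₃ (Algebra.TensorProduct.assoc k k k P P P (u ⊗ₜ p)) = bar₂ u * bar p := by
  induction u with
  | zero => simp
  | add x y hx hy => simp only [TensorProduct.add_tmul, map_add, hx, hy, add_mul]
  | tmul x y => simp [bar₂, bar₃, mul_assoc]

lemma bar₃_tmul (p : P) (u : P ⊗[k] P) : bar₃ (p ⊗ₜ u) = bar p * bar₂ u := by simp [bar₃]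

lemma d_bar₂_mul (t : P ⊗[k] P) (x : Cobar) :
    d (bar₂ t * x) = d (bar₂ t) * x + bar₂ t * d x := by
  induction t with
  | zero => simp
  | add s t hs ht => simp only [map_add, add_mul, hs, ht]; abel
  | tmul p q =>
    rw [bar₂_tmul, mul_assoc, d_bar_mul, d_bar_mul, d_bar_mul, d_bar]
    noncomm_ring

lemma d_bar₂ (t : P ⊗[k] P) : d (bar₂ t) =
    bar₃ (Algebra.TensorProduct.assoc k k k P P P
      (Algebra.TensorProduct.map comul (AlgHom.id k P) t)) -
    bar₃ (Algebra.TensorProduct.map (AlgHom.id k P) comul t) := by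
  induction t with
  | zero => simp
  | add x y hx hy => simp only [map_add, hx, hy]; abel
  | tmul a b =>
    rw [Algebra.TensorProduct.map_tmul, Algebra.TensorProduct.map_tmul, AlgHom.id_apply,
      AlgHom.id_apply, bar₃_assoc, bar₃_tmul, bar₂_tmul, d_bar_mul, d_bar]

lemma betaTensor_cocycle :
    Algebra.TensorProduct.assoc k k k P P P
      (Algebra.TensorProduct.map comul (AlgHom.id k P) betaTensor) -
    Algebra.TensorProduct.map (AlgHom.id k P) comul betaTensor =
    1 ⊗ₜ betaTensor - Algebra.TensorProduct.assoc k k k P P P (betaTensor ⊗ₜ 1) := by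
  simp only [betaTensor, map_add, Algebra.TensorProduct.map_tmul, AlgHom.id_apply, map_pow,
    comul_xi_one]
  set X := xi 1 ⊗ₜ[k] ((1 : P) ⊗ₜ[k] (1 : P)) with hX'
  set Y := (1 : P) ⊗ₜ[k] (xi 1 ⊗ₜ[k] (1 : P)) with hY'
  set Z := (1 : P) ⊗ₜ[k] ((1 : P) ⊗ₜ[k] xi 1) with hZ'
  have e1 : Algebra.TensorProduct.assoc k k k P P P ((xi 1 ⊗ₜ 1 + 1 ⊗ₜ xi 1) ⊗ₜ (xi 1 ^ 2)) = (X + Y) * Z ^ 2 := by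
    have : (X + Y) * Z ^ 2 = X * Z ^ 2 + Y * Z ^ 2 := by ring
    rw [this]
    simp [hX', hY', hZ', TensorProduct.add_tmul]
  have e2 : Algebra.TensorProduct.assoc k k k P P P (((xi 1 ⊗ₜ 1 + 1 ⊗ₜ xi 1) ^ 2) ⊗ₜ xi 1) = (X + Y) ^ 2 * Z := by
    have : ((xi 1 ⊗ₜ[k] (1 : P) + 1 ⊗ₜ xi 1) ^ 2) ⊗ₜ[k] xi 1 =
        ((xi 1 ⊗ₜ[k] (1 : P) + 1 ⊗ₜ xi 1) ⊗ₜ[k] (1 : P)) ^ 2 * ((1 : P ⊗[k] P) ⊗ₜ[k] xi 1) := by simp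
    rw [this, map_mul, map_pow]
    congr 1
  have e3 : xi 1 ⊗ₜ[k] ((xi 1 ⊗ₜ[k] (1 : P) + 1 ⊗ₜ xi 1) ^ 2) = X * (Y + Z) ^ 2 := by
    simp [hX', hY', hZ', ← TensorProduct.tmul_add, Algebra.TensorProduct.tmul_pow,
      ← Algebra.TensorProduct.one_def]
  have e4 : (xi 1 ^ 2) ⊗ₜ[k] (xi 1 ⊗ₜ[k] (1 : P) + 1 ⊗ₜ xi 1) = X ^ 2 * (Y + Z) := by
    simp [hX', hY', hZ', ← TensorProduct.tmul_add, Algebra.TensorProduct.tmul_pow,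
      ← Algebra.TensorProduct.one_def]
  have e5 : (1 : P) ⊗ₜ[k] (xi 1 ⊗ₜ[k] (xi 1 ^ 2) + (xi 1 ^ 2) ⊗ₜ xi 1) = Y * Z ^ 2 + Y ^ 2 * Z := by
    simp [hY', hZ', TensorProduct.tmul_add]
  have e6 : Algebra.TensorProduct.assoc k k k P P P
      ((xi 1 ⊗ₜ[k] (xi 1 ^ 2) + (xi 1 ^ 2) ⊗ₜ xi 1) ⊗ₜ 1) = X * Y ^ 2 + X ^ 2 * Y := by
    simp [hX', hY', TensorProduct.add_tmul]
  rw [e1, e2, e3, e4, e5, e6]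
  ring

/-- The value of the homotopy on two-letter words. -/
def htpyTensor : P ⊗[k] P →ₗ[k] Cobar :=
  LinearMap.mul' k Cobar ∘ₗ TensorProduct.map htpyLetter bar -
    LinearMap.mul' k Cobar ∘ₗ TensorProduct.map bar htpyLetter

lemma htpy_bar₂_mul (t : P ⊗[k] P) (x : Cobar) :
    htpy (bar₂ t * x) = htpyTensor t * x + bar₂ t * htpy x := by
  induction t with
  | zero => simp
  | add s t hs ht => simp only [map_add, add_mul, hs, ht]; abel
  | tmul p q =>
    rw [bar₂_tmul, mul_assoc, htpy, der_bar_mul htpyLetter_one, der_bar_mul htpyLetter_one]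
    simp only [htpyTensor, LinearMap.sub_apply, LinearMap.comp_apply, TensorProduct.map_tmul,
      LinearMap.mul'_apply]
    noncomm_ring

lemma htpyTensor_left (t : P ⊗[k] P) :
    LinearMap.mul' k Cobar (TensorProduct.map htpyLetter bar t) =
      bar₃ (Algebra.TensorProduct.assoc k k k P P P
        (Algebra.TensorProduct.map comul (AlgHom.id k P) t * betaTensor ⊗ₜ 1)) -
      b10 * bar (TensorProduct.lid k P (TensorProduct.map counit.toLinearMap LinearMap.id t)) := by
  induction t with
  | zero => simp
  | add s t hs ht => simp only [map_add, hs, ht, add_mul, mul_add]; abel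
  | tmul p q =>
    simp only [TensorProduct.map_tmul, LinearMap.mul'_apply, Algebra.TensorProduct.map_tmul,
      Algebra.TensorProduct.tmul_mul_tmul, mul_one, bar₃_assoc, htpyLetter_apply, sub_mul,
      AlgHom.id_apply, TensorProduct.lid_tmul, map_smul, LinearMap.id_apply,
      AlgHom.toLinearMap_apply, mul_smul_comm, smul_mul_assoc]

lemma htpyTensor_right (t : P ⊗[k] P) :
    LinearMap.mul' k Cobar (TensorProduct.map bar htpyLetter t) =
      bar₃ (Algebra.TensorProduct.map (AlgHom.id k P) comul t * 1 ⊗ₜ betaTensor) -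
      bar (TensorProduct.rid k P (TensorProduct.map LinearMap.id counit.toLinearMap t)) * b10 := by
  induction t with
  | zero => simp
  | add s t hs ht => simp only [map_add, hs, ht, add_mul]; abel
  | tmul p q =>
    simp only [TensorProduct.map_tmul, LinearMap.mul'_apply, Algebra.TensorProduct.map_tmul,
      Algebra.TensorProduct.tmul_mul_tmul, mul_one, bar₃_tmul, htpyLetter_apply, mul_sub,
      AlgHom.id_apply, TensorProduct.rid_tmul, map_smul, LinearMap.id_apply,
      AlgHom.toLinearMap_apply, mul_smul_comm, smul_mul_assoc]

lemma d_htpyLetter (p : P) :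
    d (htpyLetter p) + htpyTensor (comul p) = bar p * b10 - b10 * bar p := by
  rw [htpyTensor, LinearMap.sub_apply, LinearMap.comp_apply, LinearMap.comp_apply, htpyTensor_left,
    htpyTensor_right, counit_left, counit_right, htpyLetter_apply, map_sub, map_smul, d_b10,
    smul_zero, sub_zero, d_bar₂,
    map_mul (Algebra.TensorProduct.map comul (AlgHom.id k P)),
    map_mul (Algebra.TensorProduct.map (AlgHom.id k P) comul),
    map_mul (Algebra.TensorProduct.assoc k k k P P P),
    map_mul (Algebra.TensorProduct.assoc k k k P P P), coassoc]
  set T := Algebra.TensorProduct.map (AlgHom.id k P) comul (comul p)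
  have h : bar₃ (T * (Algebra.TensorProduct.assoc k k k P P P
      (Algebra.TensorProduct.map comul (AlgHom.id k P) betaTensor) -
    Algebra.TensorProduct.map (AlgHom.id k P) comul betaTensor)) =
    bar₃ (T * (1 ⊗ₜ betaTensor - Algebra.TensorProduct.assoc k k k P P P (betaTensor ⊗ₜ 1))) := by
    rw [betaTensor_cocycle]
  rw [mul_sub, mul_sub, map_sub, map_sub] at h
  rw [h]
  abel

lemma d_htpy (x : Cobar) : d (htpy x) + htpy (d x) = x * b10 - b10 * x := by
  induction x using word_induction with
  | h1 => simp [htpy, d_one]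
  | hl l x hx =>
    rw [lt]
    generalize basisP l.1 = p
    have h1 : htpy (bar p * x) = htpyLetter p * x - bar p * htpy x := der_bar_mul htpyLetter_one p x
    have h2 : d (htpyLetter p * x) = d (htpyLetter p) * x + htpyLetter p * d x := by
      rw [htpyLetter_apply, sub_mul, map_sub, d_bar₂_mul, smul_mul_assoc, map_smul, d_b10_mul,
        map_sub, map_smul, d_b10, smul_zero, sub_zero, sub_mul, smul_mul_assoc]
      abel
    have h3 : htpy (bar p * d x) = htpyLetter p * d x - bar p * htpy (d x) :=
      der_bar_mul htpyLetter_one p _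
    rw [h1, map_sub, h2, d_bar_mul, d_bar_mul, map_sub, htpy_bar₂_mul, h3]
    have h4 := congrArg (fun z => z * x) (d_htpyLetter p)
    have h5 := congrArg (fun z => bar p * z) hx
    simp only [add_mul, sub_mul, mul_add, mul_sub] at h4 h5
    have : d (htpyLetter p) * x + htpyLetter p * d x - (bar₂ (comul p) * htpy x - bar p * d (htpy x)) +
        (htpyTensor (comul p) * x + bar₂ (comul p) * htpy x - (htpyLetter p * d x - bar p * htpy (d x))) =
        (d (htpyLetter p) * x + htpyTensor (comul p) * x) + (bar p * d (htpy x) + bar p * htpy (d x)) := by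
      abel
    rw [this, h4, h5]
    noncomm_ring
  | h0 => simp
  | hadd x y hx hy =>
    simp only [map_add, add_mul, mul_add]
    rw [add_add_add_comm, hx, hy]; abel
  | hs c x hx =>
    simp only [map_smul, ← smul_add, hx, smul_sub, smul_mul_assoc, mul_smul_comm]

lemma der_mem_countJ {φ : P →ₗ[k] Cobar}
    (h : ∀ l : Letter, l.1.2 ≠ 0 → φ (basisP l.1) ∈ wordSpan {u | 1 ≤ countJ u}) (s : ℤ) {x : Cobar}
    (hx : x ∈ wordSpan {u | s ≤ countJ u}) : der φ x ∈ wordSpan {u | s ≤ countJ u} := by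
  have key : ∀ w : List Letter, der φ (wordBasis w) ∈ wordSpan {u | countJ w ≤ countJ u} := by
    intro w
    induction w with
    | nil => simp
    | cons l w ih =>
      rw [wordBasis_cons, der_lt_mul, weight_cons]
      refine sub_mem ?_ ?_
      · have h1 : φ (basisP l.1) ∈ wordSpan {u | letterJ l ≤ countJ u} := by
          by_cases hl : l.1.2 = 0
          · have : {u : List Letter | letterJ l ≤ countJ u} = Set.univ :=
              Set.eq_univ_of_forall fun u => by
                rw [Set.mem_ofPred_eq, letterJ_neg hl]; exact countJ_nonneg u
            rw [this, wordSpan_univ]; trivial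
          · rw [letterJ_pos hl]; exact h l hl
        refine mul_mem_wordSpan (fun u hu v hv => ?_) h1
          (wordBasis_mem (S := {u | countJ u = countJ w}) rfl)
        rw [Set.mem_ofPred_eq] at hu hv ⊢
        rw [weight_append, hv]; omega
      · refine mul_mem_wordSpan (fun u hu v hv => ?_) (lt_mem_weight letterJ l) ih
        rw [Set.mem_ofPred_eq] at hu hv ⊢
        rw [weight_append, hu]; omega
  refine map_mem_of_words (fun w hw => wordSpan_mono (fun u hu => ?_) (key w)) hx
  exact le_trans (show s ≤ countJ w from hw) hu

lemma bar₂_mem_of_mem_ker {t : P ⊗[k] P} (h : t ∈ kerL ∨ t ∈ kerR) :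
    bar₂ t ∈ wordSpan {u | 1 ≤ countJ u} := by
  have h1 : ∀ p ∈ kerD, bar p ∈ wordSpan {u | 1 ≤ countJ u} := fun p hp =>
    wordSpan_mono (fun u hu => le_of_eq (show countJ u = 1 from hu).symm) (bar_mem_countJ hp)
  have h2 : ∀ p : P, bar p ∈ wordSpan Set.univ := fun p => by rw [wordSpan_univ]; trivial
  rcases h with h | h
  · rw [← map_projJ_of_mem_kerL h]
    clear h
    induction t with
    | zero => simp
    | add s t hs ht => rw [map_add, map_add]; exact add_mem hs ht
    | tmul p q =>
      rw [TensorProduct.map_tmul, bar₂_tmul]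
      refine mul_mem_wordSpan (fun u hu v _ => ?_) (h1 _ (projJ_mem p)) (h2 _)
      have h3 := countJ_nonneg v
      rw [Set.mem_ofPred_eq] at hu ⊢
      rw [weight_append]; omega
  · rw [← map_projJ_of_mem_kerR h]
    clear h
    induction t with
    | zero => simp
    | add s t hs ht => rw [map_add, map_add]; exact add_mem hs ht
    | tmul p q =>
      rw [TensorProduct.map_tmul, bar₂_tmul]
      refine mul_mem_wordSpan (fun u _ v hv => ?_) (h2 _) (h1 _ (projJ_mem q))
      have h3 := countJ_nonneg u
      rw [Set.mem_ofPred_eq] at hv ⊢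
      rw [weight_append]; omega

lemma htpy_mem_filt {s : ℕ} {x : Cobar} (hx : x ∈ filt s) : htpy x ∈ filt s := by
  rw [filt_eq] at hx ⊢
  refine der_mem_countJ (fun l hl => ?_) s hx
  have hp := basisP_mem hl
  rw [htpyLetter_apply, counit_basisP, zero_smul, sub_zero,
    show comul (basisP l.1) * betaTensor = (comul (basisP l.1) - coactL (basisP l.1)) * betaTensor +
      coactL (basisP l.1) * betaTensor by ring, map_add]
  refine add_mem (bar₂_mem_of_mem_ker (Or.inl (Ideal.mul_mem_right _ _ (comul_sub_coactL _))))
    (bar₂_mem_of_mem_ker (Or.inr (Ideal.mul_mem_right _ _ ?_)))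
  rw [coactL_apply]
  exact sub_mem (add_mem (tmul_mem_kerR hp _) (tmul_mem_kerR (pd_mem hp) _))
    (tmul_mem_kerR (pd_mem (pd_mem hp)) _)

/-! The derivation on words in the monomials `mon a`. -/

/-- The nontrivial monomials `mon a`. -/
abbrev BLetter : Type := {a : A // a ≠ 0}

/-- The space with basis the words in the nontrivial monomials `mon a`. -/
abbrev BWords : Type := List BLetter →₀ k

/-- Put the letter `a` in front of a word (`0` if `a` is trivial). -/
def cns (a : A) : BWords →ₗ[k] BWords :=
  if h : a ≠ 0 then Finsupp.lmapDomain k k (List.cons ⟨a, h⟩) else 0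

/-- The word `w` as a basis element. -/
abbrev bword (w : List BLetter) : BWords := Finsupp.single w 1

lemma cns_bword {a : A} (h : a ≠ 0) (w : List BLetter) : cns a (bword w) = bword (⟨a, h⟩ :: w) := by
  rw [cns, dif_pos h, Finsupp.lmapDomain_apply, Finsupp.mapDomain_single]

lemma cns_zero : cns 0 = 0 := by rw [cns, dif_neg (by simp)]

/-- Replace a factor `y_j` by `x_j`. -/
def shift (a : A) (j : ℕ) : A := a.update j ((a j).1 + 1, (a j).2 - 1)

lemma shift_ne_zero (a : A) (j : ℕ) : shift a j ≠ 0 := fun h => by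
  have := DFunLike.congr_fun h j
  simp [shift] at this

/-- The values on words of the derivation `y_j ↦ x_j`. -/
def pdWord : List BLetter → BWords
  | [] => 0
  | a :: w => ∑ j ∈ a.1.support, ((a.1 j).2.val : k) • cns (shift a j) (bword w) + cns a (pdWord w)

/-- The derivation `y_j ↦ x_j`. -/
def pdN : BWords →ₗ[k] BWords := Finsupp.linearCombination k pdWord

@[simp] lemma pdN_bword (w : List BLetter) : pdN (bword w) = pdWord w := by simp [pdN]

lemma bwords_ext {M : Type*} [AddCommGroup M] [Module k M] (f g : BWords →ₗ[k] M)
    (h : ∀ w, f (bword w) = g (bword w)) (x : BWords) : f x = g x :=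
  LinearMap.congr_fun (Finsupp.lhom_ext' fun w => LinearMap.ext_ring (h w)) x

lemma pdN_cns (a : A) (x : BWords) :
    pdN (cns a x) = ∑ j ∈ a.support, ((a j).2.val : k) • cns (shift a j) x + cns a (pdN x) := by
  by_cases h : a = 0
  · subst h; simp [cns_zero]
  · refine bwords_ext (pdN ∘ₗ cns a)
      (∑ j ∈ a.support, ((a j).2.val : k) • cns (shift a j) + cns a ∘ₗ pdN) (fun w => ?_) x |>.trans ?_
    · simp only [LinearMap.comp_apply, LinearMap.add_apply, LinearMap.sum_apply,
        LinearMap.smul_apply, cns_bword h, pdN_bword]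
      rfl
    · simp only [LinearMap.comp_apply, LinearMap.add_apply, LinearMap.sum_apply,
        LinearMap.smul_apply]

lemma th_mon (a : A) : th (mon a) = 0 := by
  have h : ((3 * (a 0).1 + ((0 : Fin 3) : ℕ) : ℕ) : k) = 0 := by
    rw [Fin.val_zero, add_zero, Nat.cast_mul]
    exact mul_eq_zero_of_left (by decide) _
  rw [th, mon, MvPolynomial.pderiv_monomial, expo_zero, h, mul_zero, map_zero]

lemma pd_mon (a : A) : pd (mon a) = ∑ j ∈ a.support, ((a j).2.val : k) • mon (shift a j) := by
  induction a using Finsupp.induction with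
  | zero => simp [mon_zero]
  | single_add j c a ha hc ih =>
    have hd : ∀ c' : ℕ × Fin 3, Disjoint (Finsupp.single j c').support a.support := fun c' =>
      Finset.disjoint_left.2 fun i hi hi' => by
        have := Finsupp.support_single_subset hi
        rw [Finset.mem_singleton] at this
        exact ha (this ▸ hi')
    have hj : a j = 0 := Finsupp.notMem_support_iff.1 ha
    have hs : (Finsupp.single j c + a).support = insert j a.support := by
      rw [Finsupp.support_add_eq (hd c), Finsupp.support_single _ hc]; rfl
    have h0 : pd (mon (Finsupp.single j c)) = ((c.2.val : ℕ) : k) • mon (Finsupp.single j (c.1 + 1, c.2 - 1)) := by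
      rw [mon_single, mon_single, Derivation.leibniz, Derivation.leibniz_pow, Derivation.leibniz_pow,
        derivation_cube, pd_X]
      obtain ⟨q, r⟩ := c
      fin_cases r
      · simp
      · simp [xi]; ring
      · simp [xi, show (2 : Fin 3) - 1 = 1 from rfl, two_smul]; ring
    rw [mon_add (hd c), Derivation.leibniz, ih, hs, Finset.sum_insert ha, h0, add_comm, smul_eq_mul,
      smul_eq_mul, Finset.mul_sum]
    congr 1
    · rw [Finsupp.add_apply, hj, add_zero, Finsupp.single_eq_same, mul_comm, smul_mul_assoc,
        ← mon_add (hd _)]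
      congr 2
      ext i : 1
      rw [shift, Finsupp.add_apply, Finsupp.update_apply, Finsupp.single_apply]
      by_cases hi : i = j
      · subst hi; simp [hj]
      · simp [hi, Ne.symm hi]
    · refine Finset.sum_congr rfl fun i hi => ?_
      have hij : i ≠ j := fun h => ha (h ▸ hi)
      have hd' : Disjoint (Finsupp.single j c).support (shift a i).support :=
        Finset.disjoint_left.2 fun i' hi' hi'' => by
          have := Finsupp.support_single_subset hi'
          rw [Finset.mem_singleton] at this
          subst this
          refine Finsupp.mem_support_iff.1 hi'' ?_
          rw [shift, Finsupp.update_apply, if_neg (Ne.symm hij), hj]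
      rw [Finsupp.add_apply, Finsupp.single_apply, if_neg (Ne.symm hij), zero_add, mul_smul_comm,
        ← mon_add hd']
      congr 2
      ext i' : 1
      rw [shift, shift, Finsupp.add_apply, Finsupp.update_apply, Finsupp.update_apply,
        Finsupp.add_apply, Finsupp.single_apply, Finsupp.add_apply, Finsupp.single_apply,
        if_neg (Ne.symm hij)]
      by_cases hi' : i' = i
      · subst hi'; simp [Ne.symm hij]
      · simp [hi', Finsupp.single_apply]

/-- The letter `ξ₁^r mon a`. -/
def jl (r : Fin 3) {a : A} (h : a ≠ 0) : Letter := ⟨(r, a), fun h' => h (congrArg Prod.snd h')⟩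

lemma lt_jl (r : Fin 3) {a : A} (h : a ≠ 0) : lt (jl r h) = bar (xi 1 ^ (r : ℕ) * mon a) := by
  rw [lt, basisP_apply]; rfl

/-! Operators on the first letter. -/

/-- The operator that applies `φ` to the first letter. -/
def onFirst (φ : P →ₗ[k] Cobar) : Cobar →ₗ[k] Cobar :=
  wordBasis.constr k fun
    | [] => 0
    | l :: w => φ (basisP l.1) * wordBasis w

@[simp] lemma onFirst_one (φ : P →ₗ[k] Cobar) : onFirst φ 1 = 0 := by
  rw [← wordBasis_nil, onFirst, Module.Basis.constr_basis]

lemma onFirst_lt_mul (φ : P →ₗ[k] Cobar) (l : Letter) (x : Cobar) :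
    onFirst φ (lt l * x) = φ (basisP l.1) * x := by
  refine apply_eq_of_words (onFirst φ ∘ₗ LinearMap.mulLeft k (lt l))
    (LinearMap.mulLeft k (φ (basisP l.1))) (fun w => ?_) x
  simp only [LinearMap.comp_apply, LinearMap.mulLeft_apply]
  rw [← wordBasis_cons, onFirst, Module.Basis.constr_basis]

lemma onFirst_bar_mul {φ : P →ₗ[k] Cobar} (hφ : φ 1 = 0) (p : P) (x : Cobar) :
    onFirst φ (bar p * x) = φ p * x := by
  refine apply_eq_of_letters (onFirst φ ∘ₗ LinearMap.mulRight k x ∘ₗ bar)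
    (LinearMap.mulRight k x ∘ₗ φ) ?_ (fun l => ?_) p
  · simp [bar_one, hφ]
  · exact onFirst_lt_mul φ l x

/-- The left coaction derivation on the first letter, for words that begin in `ker(P → D)`. -/
def hd : Cobar →ₗ[k] Cobar := onFirst (bar ∘ₗ pd.toLinearMap ∘ₗ projJ)

@[simp] lemma hd_one : hd 1 = 0 := onFirst_one _

lemma hd_bar_mul {p : P} (hp : p ∈ kerD) (x : Cobar) : hd (bar p * x) = bar (pd p) * x := by
  rw [hd, onFirst_bar_mul (by simp [projJ_one])]
  simp [projJ_of_mem hp]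

lemma projJ_xi : projJ (xi 1) = 0 := by simpa [basisP_pow] using projJ_zero 1

lemma projJ_xi_sq : projJ (xi 1 ^ 2) = 0 := by simpa [basisP_pow] using projJ_zero 2

@[simp] lemma hd_h10_mul (x : Cobar) : hd (h10 * x) = 0 := by
  rw [hd, h10, onFirst_bar_mul (by simp [projJ_one])]; simp [projJ_xi]

@[simp] lemma hd_q20_mul (x : Cobar) : hd (q20 * x) = 0 := by
  rw [hd, q20, onFirst_bar_mul (by simp [projJ_one])]; simp [projJ_xi_sq]

/-- Induction on words, by the type of the first letter. -/
lemma cobar_cases {M : Type*} [AddCommGroup M] [Module k M] {f g : Cobar →ₗ[k] M} (h1 : f 1 = g 1)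
    (hJ : ∀ p ∈ kerD, ∀ x, f x = g x → f (bar p * x) = g (bar p * x))
    (ha : ∀ x, f x = g x → f (h10 * x) = g (h10 * x)) (hq : ∀ x, f x = g x → f (q20 * x) = g (q20 * x))
    (x : Cobar) : f x = g x := by
  induction x using word_induction with
  | h1 => exact h1
  | hl l x ih =>
    rcases letter_cases l with h | rfl | rfl
    · exact hJ _ (basisP_mem h) x ih
    · rw [lt_one]; exact ha x ih
    · rw [lt_two]; exact hq x ih
  | h0 => simp
  | hadd x y hx hy => rw [map_add, map_add, hx, hy]
  | hs c x hx => rw [map_smul, map_smul, hx]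

lemma hd_hd_hd (x : Cobar) : hd (hd (hd x)) = 0 := by
  refine cobar_cases (f := hd ∘ₗ hd ∘ₗ hd) (g := 0) (by simp) (fun p hp x _ => ?_)
    (fun x _ => by simp) (fun x _ => by simp) x
  simp only [LinearMap.comp_apply, LinearMap.zero_apply]
  rw [hd_bar_mul hp, hd_bar_mul (pd_mem hp), hd_bar_mul (pd_mem (pd_mem hp)), pd_pd_pd]
  simp

lemma d0_bar_mul {p : P} (hp : p ∈ kerD) (x : Cobar) : d0 (bar p * x) =
    h10 * (bar (pd p) * x) - q20 * (bar (pd (pd p)) * x) + bar (th p) * (h10 * x) -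
      bar (th (th p)) * (q20 * x) - bar p * d0 x := by
  rw [d0, der_bar_mul phi0_one, phi0_of_mem hp]
  noncomm_ring

lemma d0_h10_mul (x : Cobar) : d0 (h10 * x) = -(h10 * d0 x) := by
  rw [d0, h10, der_bar_mul phi0_one, phi0_xi]; simp

lemma d0_q20_mul (x : Cobar) : d0 (q20 * x) = -(h10 * (h10 * x)) - q20 * d0 x := by
  rw [d0, q20, der_bar_mul phi0_one, phi0_xi_sq, neg_mul, mul_assoc]

@[simp] lemma d0_one : d0 1 = 0 := der_one _

@[simp] lemma d1_one : d1 1 = 0 := der_one _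

lemma phi1_xi : phi1 (xi 1) = 0 := by simpa [basisP_pow] using phi1_basisP 1

lemma phi1_xi_sq : phi1 (xi 1 ^ 2) = 0 := by simpa [basisP_pow] using phi1_basisP 2

lemma d1_h10_mul (x : Cobar) : d1 (h10 * x) = -(h10 * d1 x) := by
  rw [d1, h10, der_bar_mul phi1_one, phi1_xi]; simp

lemma d1_q20_mul (x : Cobar) : d1 (q20 * x) = -(q20 * d1 x) := by
  rw [d1, q20, der_bar_mul phi1_one, phi1_xi_sq]; simp

lemma b10_mul (x : Cobar) : b10 * x = h10 * (q20 * x) + q20 * (h10 * x) := by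
  simp only [b10, h10, q20]; noncomm_ring

lemma d0_b10_mul (x : Cobar) : d0 (b10 * x) = b10 * d0 x := by
  simp only [b10_mul, map_add, d0_h10_mul, d0_q20_mul]
  noncomm_ring

lemma d1_b10_mul (x : Cobar) : d1 (b10 * x) = b10 * d1 x := by
  simp only [b10_mul, map_add, d1_h10_mul, d1_q20_mul]
  noncomm_ring

/-- The part of `d₀` that does not create a new first letter. -/
def inner : Cobar →ₗ[k] Cobar :=
  d0 - LinearMap.mulLeft k h10 ∘ₗ hd + LinearMap.mulLeft k q20 ∘ₗ hd ∘ₗ hd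

lemma inner_apply (x : Cobar) : inner x = d0 x - h10 * hd x + q20 * hd (hd x) := rfl

@[simp] lemma inner_one : inner 1 = 0 := by simp [inner_apply]

lemma inner_bar_mul {p : P} (hp : p ∈ kerD) (x : Cobar) : inner (bar p * x) =
    bar (th p) * (h10 * x) - bar (th (th p)) * (q20 * x) - bar p * d0 x := by
  rw [inner_apply, hd_bar_mul hp, hd_bar_mul (pd_mem hp), d0_bar_mul hp]; abel

lemma inner_h10_mul (x : Cobar) : inner (h10 * x) = -(h10 * d0 x) := by
  simp [inner_apply, d0_h10_mul]

lemma inner_q20_mul (x : Cobar) : inner (q20 * x) = -(h10 * (h10 * x)) - q20 * d0 x := by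
  simp [inner_apply, d0_q20_mul]

lemma hd_inner (x : Cobar) : hd (inner x) = inner (hd x) := by
  refine cobar_cases (f := hd ∘ₗ inner) (g := inner ∘ₗ hd) (by simp) (fun p hp x _ => ?_)
    (fun x _ => ?_) (fun x _ => ?_) x
  · simp only [LinearMap.comp_apply]
    rw [hd_bar_mul hp, inner_bar_mul hp, inner_bar_mul (pd_mem hp), map_sub, map_sub,
      hd_bar_mul (th_mem hp), hd_bar_mul (th_mem (th_mem hp)), hd_bar_mul hp, pd_th, pd_th, pd_th]
  · simp [inner_h10_mul]
  · simp [inner_q20_mul]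

/-- The twisted multiplication by `mon a`. -/
def twist (a : A) : Cobar →ₗ[k] Cobar :=
  LinearMap.mulLeft k (bar (mon a)) + LinearMap.mulLeft k (bar (xi 1 * mon a)) ∘ₗ hd -
    LinearMap.mulLeft k (bar (xi 1 ^ 2 * mon a)) ∘ₗ hd ∘ₗ hd

lemma twist_apply (a : A) (x : Cobar) : twist a x =
    bar (mon a) * x + bar (xi 1 * mon a) * hd x - bar (xi 1 ^ 2 * mon a) * hd (hd x) := rfl

lemma pd_xi_one : pd (xi 1) = 1 := by rw [xi_one, pd_X]; simp [xi]

lemma th_xi_one : th (xi 1) = 1 := by rw [xi_one, th_X]; simp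

lemma pd_xi_mul (p : P) : pd (xi 1 * p) = xi 1 * pd p + p := by
  rw [Derivation.leibniz, pd_xi_one]; simp

lemma pd_xi_sq_mul (p : P) : pd (xi 1 ^ 2 * p) = xi 1 ^ 2 * pd p - xi 1 * p := by
  rw [Derivation.leibniz, Derivation.leibniz_pow, pd_xi_one]
  simp
  linear_combination (xi 1 * p) * three_eq_zero (R := P)

lemma th_xi_mul_mon (a : A) : th (xi 1 * mon a) = mon a := by
  rw [Derivation.leibniz, th_xi_one, th_mon]; simp

lemma th_xi_sq_mul_mon (a : A) : th (xi 1 ^ 2 * mon a) = -(xi 1 * mon a) := by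
  rw [Derivation.leibniz, Derivation.leibniz_pow, th_xi_one, th_mon]
  simp
  linear_combination (xi 1 * mon a) * three_eq_zero (R := P)

lemma xi_mul_mon_mem (n : ℕ) {a : A} (ha : a ≠ 0) : xi 1 ^ n * mon a ∈ kerD :=
  kerD.mul_mem_left _ (mon_mem ha)

lemma xi_mul_mon_mem' {a : A} (ha : a ≠ 0) : xi 1 * mon a ∈ kerD :=
  kerD.mul_mem_left _ (mon_mem ha)

lemma hd_twist {a : A} (ha : a ≠ 0) (x : Cobar) : hd (twist a x) =
    ∑ j ∈ a.support, ((a j).2.val : k) • twist (shift a j) x + twist a (hd x) := by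
  have e : ∀ n : ℕ, bar (xi 1 ^ n * pd (mon a)) =
      ∑ j ∈ a.support, ((a j).2.val : k) • bar (xi 1 ^ n * mon (shift a j)) := by
    intro n
    rw [pd_mon, Finset.mul_sum, map_sum]
    simp only [mul_smul_comm, map_smul]
  have e0 := e 0
  have e1 := e 1
  have e2 := e 2
  simp only [pow_zero, one_mul, pow_one] at e0 e1
  simp only [twist_apply, map_sub, map_add, hd_bar_mul (mon_mem ha), hd_bar_mul (xi_mul_mon_mem' ha),
    hd_bar_mul (xi_mul_mon_mem 2 ha), pd_xi_mul, pd_xi_sq_mul, e0, e1, e2, hd_hd_hd, add_mul, sub_mul,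
    Finset.sum_mul, smul_mul_assoc, smul_add, smul_sub, Finset.sum_add_distrib,
    Finset.sum_sub_distrib]
  simp
  abel

lemma inner_lt_zero {a : A} (ha : a ≠ 0) (x : Cobar) :
    inner (bar (mon a) * x) = -(bar (mon a) * d0 x) := by
  rw [inner_bar_mul (mon_mem ha), th_mon]; simp

lemma inner_lt_one {a : A} (ha : a ≠ 0) (x : Cobar) :
    inner (bar (xi 1 * mon a) * x) = bar (mon a) * (h10 * x) - bar (xi 1 * mon a) * d0 x := by
  rw [inner_bar_mul (xi_mul_mon_mem' ha), th_xi_mul_mon, th_mon]; simp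

lemma inner_lt_two {a : A} (ha : a ≠ 0) (x : Cobar) :
    inner (bar (xi 1 ^ 2 * mon a) * x) = -(bar (xi 1 * mon a) * (h10 * x)) + bar (mon a) * (q20 * x) -
      bar (xi 1 ^ 2 * mon a) * d0 x := by
  rw [inner_bar_mul (xi_mul_mon_mem 2 ha), th_xi_sq_mul_mon, map_neg th, th_xi_mul_mon]; simp

lemma inner_twist {a : A} (ha : a ≠ 0) (x : Cobar) : inner (twist a x) = -twist a (inner x) := by
  rw [twist_apply, twist_apply, hd_inner, hd_inner, map_sub, map_add, inner_lt_zero ha,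
    inner_lt_one ha, inner_lt_two ha]
  simp only [inner_apply, hd_hd_hd, map_zero, mul_zero, sub_zero, add_zero]
  noncomm_ring

/-- The values of `iota` on words. -/
def iotaWord : List BLetter → Cobar
  | [] => 1
  | a :: w => twist a (iotaWord w)

/-- The twisted embedding of the words in the monomials `mon a`. -/
def iota : BWords →ₗ[k] Cobar := Finsupp.linearCombination k iotaWord

@[simp] lemma iota_bword (w : List BLetter) : iota (bword w) = iotaWord w := by simp [iota]

lemma iota_cns {a : A} (ha : a ≠ 0) (x : BWords) : iota (cns a x) = twist a (iota x) := by
  refine bwords_ext (iota ∘ₗ cns a) (twist a ∘ₗ iota) (fun w => ?_) x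
  simp only [LinearMap.comp_apply, cns_bword ha, iota_bword]; rfl

/-- Words are built from letters. -/
lemma bwords_induction {p : BWords → Prop} (h1 : p (bword [])) (hl : ∀ a ≠ 0, ∀ x, p x → p (cns a x))
    (h0 : p 0) (hadd : ∀ x y, p x → p y → p (x + y)) (hs : ∀ (c : k) x, p x → p (c • x)) (x : BWords) :
    p x := by
  induction x using Finsupp.induction_linear with
  | zero => exact h0
  | add x y hx hy => exact hadd x y hx hy
  | single w c =>
    have : Finsupp.single w c = c • bword w := by simp
    rw [this]
    refine hs c _ ?_
    clear this
    induction w with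
    | nil => exact h1
    | cons a w ih => rw [← cns_bword a.2]; exact hl _ a.2 _ ih

lemma hd_iota (x : BWords) : hd (iota x) = iota (pdN x) := by
  induction x using bwords_induction with
  | h1 => simp [iotaWord, pdWord]
  | hl a ha x ih =>
    rw [iota_cns ha, hd_twist ha, ih, pdN_cns, map_add, iota_cns ha, map_sum]
    simp only [map_smul, iota_cns (shift_ne_zero _ _)]
  | h0 => simp
  | hadd x y hx hy => simp only [map_add, hx, hy]
  | hs c x hx => simp only [map_smul, hx]

lemma inner_iota (x : BWords) : inner (iota x) = 0 := by
  induction x using bwords_induction with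
  | h1 => simp [iotaWord]
  | hl a ha x ih => rw [iota_cns ha, inner_twist ha, ih]; simp
  | h0 => simp
  | hadd x y hx hy => simp only [map_add, hx, hy, add_zero]
  | hs c x hx => simp only [map_smul, hx, smul_zero]

lemma d0_iota (x : BWords) : d0 (iota x) = h10 * iota (pdN x) - q20 * iota (pdN (pdN x)) := by
  have h := inner_iota x
  rw [inner_apply, hd_iota, hd_iota] at h
  rw [eq_sub_iff_add_eq, ← sub_eq_zero, ← h]; abel

/-! Splitting off the leading letters `ξ₁`, `ξ₁²`. -/

/-- Strip the first letter `ξ₁`. -/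
def stripH : Cobar →ₗ[k] Cobar := strip ⟨(1, 0), by simp⟩

/-- Strip the first letter `ξ₁²`. -/
def stripQ : Cobar →ₗ[k] Cobar := strip ⟨(2, 0), by simp⟩

@[simp] lemma stripH_h10_mul (x : Cobar) : stripH (h10 * x) = x := by
  rw [stripH, ← lt_one (by simp), strip_lt_mul]

@[simp] lemma stripQ_q20_mul (x : Cobar) : stripQ (q20 * x) = x := by
  rw [stripQ, ← lt_two (by simp), strip_lt_mul]

@[simp] lemma stripH_q20_mul (x : Cobar) : stripH (q20 * x) = 0 := by
  rw [stripH, ← lt_two (by simp), strip_lt_mul_of_ne (by simp)]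

@[simp] lemma stripQ_h10_mul (x : Cobar) : stripQ (h10 * x) = 0 := by
  rw [stripQ, ← lt_one (by simp), strip_lt_mul_of_ne (by simp)]

lemma strip_h10_mul {l : Letter} (h : l.1.2 ≠ 0) (x : Cobar) : strip l (h10 * x) = 0 := by
  rw [← lt_one (by simp), strip_lt_mul_of_ne]
  rintro rfl; exact h rfl

lemma strip_q20_mul {l : Letter} (h : l.1.2 ≠ 0) (x : Cobar) : strip l (q20 * x) = 0 := by
  rw [← lt_two (by simp), strip_lt_mul_of_ne]
  rintro rfl; exact h rfl

/-- The combinations of the empty word and words that begin in `ker(P → D)`. -/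
def startJ : Submodule k Cobar := LinearMap.ker stripH ⊓ LinearMap.ker stripQ

lemma mem_startJ {x : Cobar} : x ∈ startJ ↔ stripH x = 0 ∧ stripQ x = 0 := Iff.rfl

lemma one_mem_startJ : (1 : Cobar) ∈ startJ := ⟨strip_one _, strip_one _⟩

lemma bar_mul_mem_startJ {p : P} (hp : p ∈ kerD) (x : Cobar) : bar p * x ∈ startJ := by
  have h : monSpan ≤ startJ.comap (LinearMap.mulRight k x ∘ₗ bar) := by
    refine Submodule.span_le.2 ?_
    rintro _ ⟨l, hl, rfl⟩
    have hl0 : l ≠ 0 := fun h => hl (by rw [h]; rfl)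
    change lt ⟨l, hl0⟩ * x ∈ startJ
    refine ⟨strip_lt_mul_of_ne (fun h => hl ?_) x, strip_lt_mul_of_ne (fun h => hl ?_) x⟩
    · exact congrArg (fun l : Letter => l.1.2) h
    · exact congrArg (fun l : Letter => l.1.2) h
  exact h (kerD_le_monSpan hp)

lemma map_mem_startJ_of_words {f : Cobar →ₗ[k] Cobar} (h1 : f 1 ∈ startJ)
    (hJ : ∀ p ∈ kerD, ∀ x, f (bar p * x) ∈ startJ) {x : Cobar} (hx : x ∈ startJ) : f x ∈ startJ := by
  obtain ⟨S, hS, h⟩ := exists_eq_sum_strip x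
  rw [h S le_rfl, map_add, map_smul, map_sum]
  refine add_mem (Submodule.smul_mem _ _ h1) (Submodule.sum_mem _ fun l _ => ?_)
  rcases letter_cases l with hl | rfl | rfl
  · exact hJ _ (basisP_mem hl) _
  · rw [show strip _ x = 0 from hx.1]; simp
  · rw [show strip _ x = 0 from hx.2]; simp

lemma inner_mem_startJ {x : Cobar} (hx : x ∈ startJ) : inner x ∈ startJ :=
  map_mem_startJ_of_words (by simp) (fun p hp x => by
    rw [inner_bar_mul hp]
    exact sub_mem (sub_mem (bar_mul_mem_startJ (th_mem hp) _)
      (bar_mul_mem_startJ (th_mem (th_mem hp)) _)) (bar_mul_mem_startJ hp _)) hx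

lemma twist_mem_startJ {a : A} (ha : a ≠ 0) (x : Cobar) : twist a x ∈ startJ := by
  rw [twist_apply]
  exact sub_mem (add_mem (bar_mul_mem_startJ (mon_mem ha) _)
    (bar_mul_mem_startJ (xi_mul_mon_mem' ha) _)) (bar_mul_mem_startJ (xi_mul_mon_mem 2 ha) _)

lemma iota_mem_startJ (x : BWords) : iota x ∈ startJ := by
  induction x using bwords_induction with
  | h1 => rw [iota_bword]; exact one_mem_startJ
  | hl a ha x _ => rw [iota_cns ha]; exact twist_mem_startJ ha _
  | h0 => simp
  | hadd x y hx hy => rw [map_add]; exact add_mem hx hy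
  | hs c x hx => rw [map_smul]; exact Submodule.smul_mem _ _ hx

lemma stripH_add {x : Cobar} (hx : x ∈ startJ) (u v : Cobar) :
    stripH (x + h10 * u + q20 * v) = u := by
  rw [map_add, map_add, (mem_startJ.1 hx).1]; simp

lemma stripQ_add {x : Cobar} (hx : x ∈ startJ) (u v : Cobar) :
    stripQ (x + h10 * u + q20 * v) = v := by
  rw [map_add, map_add, (mem_startJ.1 hx).2]; simp

lemma sub_strip_mem_startJ (x : Cobar) : x - h10 * stripH x - q20 * stripQ x ∈ startJ := by
  constructor <;> simp

/-- Uniqueness of the decomposition by the first letter. -/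
lemma startJ_unique {x x' u u' v v' : Cobar} (hx : x ∈ startJ) (hx' : x' ∈ startJ)
    (h : x + h10 * u + q20 * v = x' + h10 * u' + q20 * v') : x = x' ∧ u = u' ∧ v = v' := by
  have h1 : u = u' := by rw [← stripH_add hx u v, h, stripH_add hx']
  have h2 : v = v' := by rw [← stripQ_add hx u v, h, stripQ_add hx']
  subst h1 h2
  exact ⟨by simpa using h, rfl, rfl⟩

lemma LenLt.lt_mul' {n : ℕ} (l : Letter) {x : Cobar} (hx : LenLt (n - 1) x) : LenLt n (lt l * x) := by
  cases n with
  | zero => rw [show x = 0 from hx, mul_zero]; rfl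
  | succ n => exact LenLt.lt_mul l hx

lemma LenLt.strip {n : ℕ} (l : Letter) {x : Cobar} (hx : LenLt n x) : LenLt (n - 1) (strip l x) := by
  cases n with
  | zero => rw [show x = 0 from hx, map_zero]; rfl
  | succ n => exact hx l

lemma LenLt.h10_mul {n : ℕ} {x : Cobar} (hx : LenLt (n - 1) x) : LenLt n (h10 * x) := by
  rw [← lt_one (by simp)]; exact hx.lt_mul' _

lemma LenLt.q20_mul {n : ℕ} {x : Cobar} (hx : LenLt (n - 1) x) : LenLt n (q20 * x) := by
  rw [← lt_two (by simp)]; exact hx.lt_mul' _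

lemma LenLt.bar_mul' {n : ℕ} (p : P) {x : Cobar} (hx : LenLt (n - 1) x) : LenLt n (bar p * x) := by
  cases n with
  | zero => rw [show x = 0 from hx, mul_zero]; rfl
  | succ n => exact LenLt.bar_mul p hx

lemma LenLt.hd {n : ℕ} {x : Cobar} (hx : LenLt n x) : LenLt n (hd x) := by
  obtain ⟨S, -, h⟩ := exists_eq_sum_strip x
  rw [h S le_rfl, map_add, map_smul, hd_one, smul_zero, zero_add, map_sum]
  refine LenLt.sum S fun l _ => ?_
  rw [MPASS.hd, onFirst_lt_mul]
  exact LenLt.bar_mul' _ (hx.strip l)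

lemma LenLt.d0 {n : ℕ} {x : Cobar} (hx : LenLt n x) : LenLt (n + 1) (d0 x) := by
  induction n generalizing x with
  | zero => rw [show x = 0 from hx, map_zero]; exact LenLt.zero _
  | succ n ih =>
    obtain ⟨S, -, h⟩ := exists_eq_sum_strip x
    rw [h S le_rfl, map_add, map_smul, d0_one, smul_zero, zero_add, map_sum]
    refine LenLt.sum S fun l _ => ?_
    have hy : LenLt n (MPASS.strip l x) := hx l
    have h1 : LenLt (n + 1 + 1) (lt l * MPASS.d0 (MPASS.strip l x)) := (ih hy).lt_mul l
    rcases letter_cases l with hl | rfl | rfl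
    · rw [lt, d0_bar_mul (basisP_mem hl)]
      refine LenLt.sub (LenLt.sub (LenLt.add (LenLt.sub ?_ ?_) ?_) ?_) h1
      · exact LenLt.h10_mul (LenLt.bar_mul _ hy)
      · exact LenLt.q20_mul (LenLt.bar_mul _ hy)
      · exact LenLt.bar_mul _ (LenLt.h10_mul hy)
      · exact LenLt.bar_mul _ (LenLt.q20_mul hy)
    · rw [lt_one] at h1 ⊢
      rw [d0_h10_mul]; exact h1.neg
    · rw [lt_two] at h1 ⊢
      rw [d0_q20_mul]
      exact LenLt.sub (LenLt.neg (LenLt.h10_mul (LenLt.h10_mul hy))) h1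

/-! Cocycles of the inner differential. -/

lemma strip_bar {l l' : Letter} (x : Cobar) [Decidable (l' = l)] :
    strip l (lt l' * x) = if l' = l then x else 0 := by
  split_ifs with h
  · rw [h, strip_lt_mul]
  · exact strip_lt_mul_of_ne h x

lemma strip_inner (a : A) (ha : a ≠ 0) (x : Cobar) :
    strip (jl 0 ha) (inner x) =
      -d0 (strip (jl 0 ha) x) + h10 * strip (jl 1 ha) x + q20 * strip (jl 2 ha) x ∧
    strip (jl 1 ha) (inner x) = -d0 (strip (jl 1 ha) x) - h10 * strip (jl 2 ha) x ∧
    strip (jl 2 ha) (inner x) = -d0 (strip (jl 2 ha) x) := by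
  classical
  have key : ∀ (r r' : Fin 3) (b : A) (hb : b ≠ 0) (y : Cobar),
      strip (jl r ha) (lt (jl r' hb) * y) = if b = a then (if r' = r then y else 0) else 0 := by
    intro r r' b hb y
    rw [strip_bar]
    by_cases h1 : b = a
    · subst h1
      by_cases h2 : r' = r
      · subst h2; simp
      · rw [if_neg, if_pos rfl, if_neg h2]
        intro h; exact h2 (congrArg (fun l : Letter => l.1.1) h)
    · rw [if_neg, if_neg h1]
      intro h; exact h1 (congrArg (fun l : Letter => l.1.2) h)
  have hjl : ∀ r, (jl r ha).1.2 ≠ 0 := fun _ => ha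
  induction x using word_induction with
  | h1 => simp
  | hl l x _ =>
    rcases letter_cases l with h | rfl | rfl
    · obtain ⟨⟨r', b⟩, hl⟩ := l
      have hb : b ≠ 0 := h
      have e0 : bar (mon b) = lt (jl 0 hb) := by rw [lt_jl]; simp
      have e1 : bar (xi 1 * mon b) = lt (jl 1 hb) := by rw [lt_jl]; simp
      have e2 : bar (xi 1 ^ 2 * mon b) = lt (jl 2 hb) := by rw [lt_jl]; simp
      have i0 := inner_lt_zero hb x
      have i1 := inner_lt_one hb x
      have i2 := inner_lt_two hb x
      rw [e0] at i0
      rw [e0, e1] at i1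
      rw [e0, e1, e2] at i2
      have hr : r' = 0 ∨ r' = 1 ∨ r' = 2 := by fin_cases r' <;> simp
      rcases hr with rfl | rfl | rfl
      · change (strip _ (inner (lt (jl 0 hb) * x)) = -d0 (strip _ (lt (jl 0 hb) * x)) +
          h10 * strip _ (lt (jl 0 hb) * x) + q20 * strip _ (lt (jl 0 hb) * x)) ∧
          strip _ (inner (lt (jl 0 hb) * x)) = -d0 (strip _ (lt (jl 0 hb) * x)) -
          h10 * strip _ (lt (jl 0 hb) * x) ∧
          strip _ (inner (lt (jl 0 hb) * x)) = -d0 (strip _ (lt (jl 0 hb) * x))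
        rw [i0]
        simp only [map_neg, key]
        by_cases hba : b = a <;> simp [hba]
      · change (strip _ (inner (lt (jl 1 hb) * x)) = -d0 (strip _ (lt (jl 1 hb) * x)) +
          h10 * strip _ (lt (jl 1 hb) * x) + q20 * strip _ (lt (jl 1 hb) * x)) ∧
          strip _ (inner (lt (jl 1 hb) * x)) = -d0 (strip _ (lt (jl 1 hb) * x)) -
          h10 * strip _ (lt (jl 1 hb) * x) ∧
          strip _ (inner (lt (jl 1 hb) * x)) = -d0 (strip _ (lt (jl 1 hb) * x))
        rw [i1]
        simp only [map_sub, key]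
        by_cases hba : b = a <;> simp [hba]
      · change (strip _ (inner (lt (jl 2 hb) * x)) = -d0 (strip _ (lt (jl 2 hb) * x)) +
          h10 * strip _ (lt (jl 2 hb) * x) + q20 * strip _ (lt (jl 2 hb) * x)) ∧
          strip _ (inner (lt (jl 2 hb) * x)) = -d0 (strip _ (lt (jl 2 hb) * x)) -
          h10 * strip _ (lt (jl 2 hb) * x) ∧
          strip _ (inner (lt (jl 2 hb) * x)) = -d0 (strip _ (lt (jl 2 hb) * x))
        rw [i2]
        simp only [map_add, map_sub, map_neg, key]
        by_cases hba : b = a <;> simp [hba]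
    · rw [lt_one, inner_h10_mul]
      simp [strip_h10_mul (hjl _)]
    · rw [lt_two, inner_q20_mul]
      simp [strip_h10_mul (hjl _), strip_q20_mul (hjl _)]
  | h0 => simp
  | hadd x y hx hy =>
    simp only [map_add, hx, hy, mul_add]
    refine ⟨by abel, by abel, by abel⟩
  | hs c x hx =>
    simp only [map_smul, hx, smul_add, smul_sub, smul_neg, mul_smul_comm]
    exact ⟨trivial, trivial, trivial⟩

/-- An element of `startJ` is the sum of its blocks. -/
lemma exists_eq_sum_blocks {x : Cobar} (hx : x ∈ startJ) : ∃ T : Finset BLetter, x = aug x • 1 +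
    ∑ a ∈ T, (bar (mon a.1) * strip (jl 0 a.2) x + bar (xi 1 * mon a.1) * strip (jl 1 a.2) x +
      bar (xi 1 ^ 2 * mon a.1) * strip (jl 2 a.2) x) := by
  classical
  obtain ⟨S, hS, h⟩ := exists_eq_sum_strip x
  let f : Letter → A := fun l => l.1.2
  let T : Finset BLetter := (S.image f).subtype (· ≠ 0)
  refine ⟨T, ?_⟩
  refine eq_of_strip (by simp [map_sum, show ∀ a : BLetter, bar (mon a.1) = lt (jl 0 a.2) from fun a => by rw [lt_jl]; simp, show ∀ a : BLetter, bar (xi 1 * mon a.1) = lt (jl 1 a.2) from fun a => by rw [lt_jl]; simp, show ∀ a : BLetter, bar (xi 1 ^ 2 * mon a.1) = lt (jl 2 a.2) from fun a => by rw [lt_jl]; simp]) fun l => ?_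
  simp only [map_add, map_smul, map_sum, strip_one, smul_zero, zero_add, show ∀ a : BLetter, bar (mon a.1) = lt (jl 0 a.2) from fun a => by rw [lt_jl]; simp, show ∀ a : BLetter, bar (xi 1 * mon a.1) = lt (jl 1 a.2) from fun a => by rw [lt_jl]; simp, show ∀ a : BLetter, bar (xi 1 ^ 2 * mon a.1) = lt (jl 2 a.2) from fun a => by rw [lt_jl]; simp]
  rcases letter_cases l with hl | rfl | rfl
  · obtain ⟨⟨r, b⟩, hl'⟩ := l
    have hb : b ≠ 0 := hl
    have e : (⟨(r, b), hl'⟩ : Letter) = jl r hb := rfl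
    rw [e]
    have key : ∀ (r' : Fin 3) (a : BLetter) (y : Cobar),
        strip (jl r hb) (lt (jl r' a.2) * y) = if a = ⟨b, hb⟩ then (if r' = r then y else 0) else 0 := by
      intro r' a y
      rw [strip_bar]
      by_cases h1 : a = ⟨b, hb⟩
      · subst h1
        by_cases h2 : r' = r
        · subst h2; simp
        · rw [if_neg, if_pos rfl, if_neg h2]
          intro h; exact h2 (congrArg (fun l : Letter => l.1.1) h)
      · rw [if_neg, if_neg h1]
        intro h; exact h1 (Subtype.ext (congrArg (fun l : Letter => l.1.2) h))
    simp only [key]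
    by_cases hT : (⟨b, hb⟩ : BLetter) ∈ T
    · rw [Finset.sum_eq_single_of_mem _ hT (fun a _ hne => by simp [hne])]
      have hr : r = 0 ∨ r = 1 ∨ r = 2 := by fin_cases r <;> simp
      rcases hr with rfl | rfl | rfl <;> simp
    · rw [Finset.sum_eq_zero, hS]
      · intro h'
        refine hT ?_
        rw [Finset.mem_subtype]
        exact Finset.mem_image.2 ⟨_, h', rfl⟩
      · intro a ha
        have : a ≠ ⟨b, hb⟩ := fun h => hT (h ▸ ha)
        simp [this]
  · rw [show strip _ x = 0 from hx.1, Finset.sum_eq_zero]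
    intro a _
    rw [strip_lt_mul_of_ne, strip_lt_mul_of_ne, strip_lt_mul_of_ne]
    · simp
    all_goals intro h; exact a.2 (congrArg (fun l : Letter => l.1.2) h)
  · rw [show strip _ x = 0 from hx.2, Finset.sum_eq_zero]
    intro a _
    rw [strip_lt_mul_of_ne, strip_lt_mul_of_ne, strip_lt_mul_of_ne]
    · simp
    all_goals intro h; exact a.2 (congrArg (fun l : Letter => l.1.2) h)

lemma d0_of_startJ {w : Cobar} (u v : Cobar) : d0 (w + h10 * u + q20 * v) =
    inner w + h10 * (hd w - d0 u - h10 * v) + q20 * (-hd (hd w) - d0 v) := by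
  rw [map_add, map_add, d0_h10_mul, d0_q20_mul, inner_apply]
  noncomm_ring

lemma exists_block {n : ℕ} {a : A} (ha : a ≠ 0)
    (ih : ∀ {x : Cobar}, x ∈ startJ → LenLt (n + 1) x → inner x = 0 →
      ∃ e ∈ startJ, LenLt n e ∧ ∃ f, x = inner e + iota f) {c y z : Cobar} (hc : LenLt (n + 1) c)
    (h0 : d0 c = h10 * y + q20 * z) : ∃ e ∈ startJ, LenLt (n + 1) e ∧ ∃ f,
      bar (mon a) * c + bar (xi 1 * mon a) * y + bar (xi 1 ^ 2 * mon a) * z = inner e + iota f := by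
  obtain ⟨u, hu⟩ : ∃ u, u = stripH c := ⟨_, rfl⟩
  obtain ⟨v, hv⟩ : ∃ v, v = stripQ c := ⟨_, rfl⟩
  obtain ⟨w, hw⟩ : ∃ w, w = c - h10 * u - q20 * v := ⟨_, rfl⟩
  have hun : LenLt n u := hu ▸ hc.strip _
  have hvn : LenLt n v := hv ▸ hc.strip _
  have hwJ : w ∈ startJ := by rw [hw, hu, hv]; exact sub_strip_mem_startJ c
  have hwn : LenLt (n + 1) w := by
    rw [hw]; exact LenLt.sub (LenLt.sub hc (LenLt.h10_mul hun)) (LenLt.q20_mul hvn)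
  have hc' : c = w + h10 * u + q20 * v := by rw [hw]; abel
  rw [hc', d0_of_startJ, ← zero_add (h10 * y)] at h0
  obtain ⟨e1, e2, e3⟩ := startJ_unique (inner_mem_startJ hwJ) (zero_mem _) h0
  obtain ⟨e, heJ, hen, f, hef⟩ := ih hwJ hwn e1
  refine ⟨-twist a e + bar (xi 1 * mon a) * u + bar (xi 1 ^ 2 * mon a) * v, ?_, ?_, cns a f, ?_⟩
  · exact add_mem (add_mem (neg_mem (twist_mem_startJ ha e)) (bar_mul_mem_startJ (xi_mul_mon_mem' ha) u))
      (bar_mul_mem_startJ (xi_mul_mon_mem 2 ha) v)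
  · refine LenLt.add (LenLt.add (LenLt.neg ?_) (LenLt.bar_mul _ hun)) (LenLt.bar_mul _ hvn)
    rw [twist_apply]
    exact LenLt.sub (LenLt.add (LenLt.bar_mul _ hen) (LenLt.bar_mul _ hen.hd))
      (LenLt.bar_mul _ hen.hd.hd)
  · have h1 : twist a w = -inner (twist a e) + iota (cns a f) := by
      rw [hef, map_add, iota_cns ha, inner_twist ha, neg_neg]
    rw [map_add, map_add, map_neg, inner_lt_one ha, inner_lt_two ha, ← e2, ← e3, hc']
    rw [twist_apply] at h1
    rw [show -inner (twist a e) = bar (mon a) * w + bar (xi 1 * mon a) * hd w -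
      bar (xi 1 ^ 2 * mon a) * hd (hd w) - iota (cns a f) by rw [h1]; abel]
    noncomm_ring

/-- Cocycles of the inner differential come from `iota`. -/
lemma exists_of_inner_eq_zero (n : ℕ) {x : Cobar} (hx : x ∈ startJ) (hn : LenLt (n + 1) x)
    (h0 : inner x = 0) : ∃ e ∈ startJ, LenLt n e ∧ ∃ f, x = inner e + iota f := by
  induction n generalizing x with
  | zero =>
    refine ⟨0, zero_mem _, rfl, aug x • bword [], ?_⟩
    obtain ⟨S, -, h⟩ := exists_eq_sum_strip x
    rw [map_zero, zero_add, map_smul, iota_bword]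
    conv_lhs => rw [h S le_rfl]
    rw [Finset.sum_eq_zero fun l _ => by rw [show strip l x = 0 from hn l, mul_zero], add_zero]
    rfl
  | succ n ih =>
    obtain ⟨T, hT⟩ := exists_eq_sum_blocks hx
    have key : ∀ a : BLetter, ∃ e ∈ startJ, LenLt (n + 1) e ∧ ∃ f,
        bar (mon a.1) * strip (jl 0 a.2) x + bar (xi 1 * mon a.1) * strip (jl 1 a.2) x +
          bar (xi 1 ^ 2 * mon a.1) * strip (jl 2 a.2) x = inner e + iota f := by
      intro a
      have h := (strip_inner a.1 a.2 x).1
      rw [h0, map_zero] at h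
      refine exists_block a.2 ih (hn _) ?_
      rw [eq_comm, add_assoc, neg_add_eq_zero] at h
      exact h
    choose e heJ hen f hf using key
    refine ⟨∑ a ∈ T, e a, sum_mem fun a _ => heJ a, LenLt.sum _ fun a _ => hen a,
      aug x • bword [] + ∑ a ∈ T, f a, ?_⟩
    conv_lhs => rw [hT]
    simp only [hf, map_add, map_sum, map_smul, iota_bword, Finset.sum_add_distrib]
    change aug x • (1 : Cobar) + _ = _ + (aug x • (1 : Cobar) + _)
    abel

/-! Projection to the words without a factor `ξ₁`. -/

/-- The values of `coWord` on words. -/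
def coWord : List Letter → BWords
  | [] => bword []
  | l :: w => if l.1.1 = 0 then cns l.1.2 (coWord w) else 0

/-- The projection to the words in the monomials `mon a`. -/
def prB : Cobar →ₗ[k] BWords := wordBasis.constr k coWord

@[simp] lemma prB_one : prB 1 = bword [] := by
  rw [← wordBasis_nil, prB, Module.Basis.constr_basis]; rfl

lemma prB_lt_mul (l : Letter) (x : Cobar) :
    prB (lt l * x) = if l.1.1 = 0 then cns l.1.2 (prB x) else 0 := by
  refine (apply_eq_of_words (prB ∘ₗ LinearMap.mulLeft k (lt l))
    (if l.1.1 = 0 then cns l.1.2 ∘ₗ prB else 0) (fun w => ?_) x).trans (by split_ifs <;> rfl)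
  simp only [LinearMap.comp_apply, LinearMap.mulLeft_apply]
  rw [← wordBasis_cons, prB, Module.Basis.constr_basis, coWord]
  split_ifs
  · rw [LinearMap.comp_apply, Module.Basis.constr_basis]
  · rfl

@[simp] lemma prB_h10_mul (x : Cobar) : prB (h10 * x) = 0 := by
  rw [← lt_one (by simp), prB_lt_mul]; simp

@[simp] lemma prB_q20_mul (x : Cobar) : prB (q20 * x) = 0 := by
  rw [← lt_two (by simp), prB_lt_mul]; simp

lemma prB_bar_mul_eq_zero (p : P) {x : Cobar} (hx : prB x = 0) : prB (bar p * x) = 0 := by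
  refine apply_eq_of_letters (prB ∘ₗ LinearMap.mulRight k x ∘ₗ bar) 0 (by simp [bar_one])
    (fun l => ?_) p
  refine (prB_lt_mul l x).trans ?_
  simp [hx]

lemma prB_twist {a : A} (ha : a ≠ 0) (x : Cobar) : prB (twist a x) = cns a (prB x) := by
  have e0 : bar (mon a) = lt (jl 0 ha) := by rw [lt_jl]; simp
  have e1 : bar (xi 1 * mon a) = lt (jl 1 ha) := by rw [lt_jl]; simp
  have e2 : bar (xi 1 ^ 2 * mon a) = lt (jl 2 ha) := by rw [lt_jl]; simp
  rw [twist_apply, e0, e1, e2, map_sub, map_add, prB_lt_mul, prB_lt_mul, prB_lt_mul]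
  simp [jl]

@[simp] lemma prB_iota (x : BWords) : prB (iota x) = x := by
  induction x using bwords_induction with
  | h1 => simp [iotaWord]
  | hl a ha x ih => rw [iota_cns ha, prB_twist ha, ih]
  | h0 => simp
  | hadd x y hx hy => simp only [map_add, hx, hy]
  | hs c x hx => simp only [map_smul, hx]

lemma prB_d0 (x : Cobar) : prB (d0 x) = 0 := by
  refine cobar_cases (f := prB ∘ₗ d0) (g := 0) (by simp) (fun p hp x hx => ?_)
    (fun x _ => by simp [d0_h10_mul]) (fun x _ => by simp [d0_q20_mul]) x
  have hx' : prB (d0 x) = 0 := hx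
  simp only [LinearMap.comp_apply, LinearMap.zero_apply]
  rw [d0_bar_mul hp, map_sub, map_sub, map_add, map_sub, prB_h10_mul, prB_q20_mul,
    prB_bar_mul_eq_zero _ (prB_h10_mul x), prB_bar_mul_eq_zero _ (prB_q20_mul x),
    prB_bar_mul_eq_zero _ hx']
  simp

lemma prB_inner (x : Cobar) : prB (inner x) = 0 := by
  rw [inner_apply, map_add, map_sub, prB_d0]; simp

/-! The extension of `iota` to words that begin with letters `ξ₁`, `ξ₁²`. -/

/-- Membership in the span of the products of letters `ξ₁`, `ξ₁²` and an element of the range of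
`iota`. -/
inductive InDIota : Cobar → Prop
  | iota (x : BWords) : InDIota (iota x)
  | h10_mul {y : Cobar} : InDIota y → InDIota (h10 * y)
  | q20_mul {y : Cobar} : InDIota y → InDIota (q20 * y)
  | add {y z : Cobar} : InDIota y → InDIota z → InDIota (y + z)

lemma InDIota.zero : InDIota 0 := by simpa using InDIota.iota 0

/-- The span of the products of letters `ξ₁`, `ξ₁²` and an element of the range of `iota`. -/
def dIota : Submodule k Cobar where
  carrier := {y | InDIota y}
  add_mem' := .add
  zero_mem' := .zero
  smul_mem' c x hx := by
    change InDIota (c • x)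
    induction hx with
    | iota x => rw [← map_smul]; exact .iota _
    | h10_mul _ h => rw [← mul_smul_comm]; exact .h10_mul h
    | q20_mul _ h => rw [← mul_smul_comm]; exact .q20_mul h
    | add _ _ h h' => rw [smul_add]; exact .add h h'

lemma iota_mem_dIota (x : BWords) : iota x ∈ dIota := InDIota.iota x

lemma h10_mul_mem_dIota {y : Cobar} (hy : y ∈ dIota) : h10 * y ∈ dIota := InDIota.h10_mul hy

lemma q20_mul_mem_dIota {y : Cobar} (hy : y ∈ dIota) : q20 * y ∈ dIota := InDIota.q20_mul hy

lemma exists_of_mem_dIota {y : Cobar} (hy : y ∈ dIota) :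
    ∃ F, ∃ u ∈ dIota, ∃ v ∈ dIota, y = iota F + h10 * u + q20 * v := by
  induction hy with
  | iota x => exact ⟨x, 0, zero_mem _, 0, zero_mem _, by simp⟩
  | h10_mul h => exact ⟨0, _, h, 0, zero_mem _, by simp⟩
  | q20_mul h => exact ⟨0, 0, zero_mem _, _, h, by simp⟩
  | add _ _ h h' =>
    obtain ⟨F, u, hu, v, hv, e⟩ := h
    obtain ⟨F', u', hu', v', hv', e'⟩ := h'
    exact ⟨F + F', _, add_mem hu hu', _, add_mem hv hv', by rw [e, e', map_add]; noncomm_ring⟩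

/-- A cochain with `d₀`-boundary in `dIota` lies in `dIota` up to a boundary. -/
lemma exists_of_d0_mem_dIota (n : ℕ) {c : Cobar} (hn : LenLt n c) (h : d0 c ∈ dIota) :
    ∃ y ∈ dIota, ∃ w, LenLt (n - 1) w ∧ c = y + d0 w := by
  induction n generalizing c with
  | zero => exact ⟨0, zero_mem _, 0, LenLt.zero _, by rw [show c = 0 from hn]; simp⟩
  | succ n ih =>
    obtain ⟨u, hu⟩ : ∃ u, u = stripH c := ⟨_, rfl⟩
    obtain ⟨v, hv⟩ : ∃ v, v = stripQ c := ⟨_, rfl⟩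
    obtain ⟨x, hx⟩ : ∃ x, x = c - h10 * u - q20 * v := ⟨_, rfl⟩
    have hun : LenLt n u := hu ▸ hn.strip _
    have hvn : LenLt n v := hv ▸ hn.strip _
    have hxJ : x ∈ startJ := by rw [hx, hu, hv]; exact sub_strip_mem_startJ c
    have hxn : LenLt (n + 1) x := by
      rw [hx]; exact LenLt.sub (LenLt.sub hn (LenLt.h10_mul hun)) (LenLt.q20_mul hvn)
    have hc : c = x + h10 * u + q20 * v := by rw [hx]; abel
    obtain ⟨F, y1, hy1, y2, hy2, e⟩ := exists_of_mem_dIota h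
    rw [hc, d0_of_startJ] at e
    obtain ⟨e1, e2, e3⟩ := startJ_unique (inner_mem_startJ hxJ) (iota_mem_startJ F) e
    have hF : F = 0 := by rw [← prB_iota F, ← e1, prB_inner]
    rw [hF, map_zero] at e1
    obtain ⟨t, -, htn, F', hF'⟩ := exists_of_inner_eq_zero n hxJ hxn e1
    have e2' : d0 (u - hd t) = -y1 + iota (pdN F') - h10 * (v + hd (hd t)) := by
      rw [← e2, hF', map_add, hd_inner, hd_iota, map_sub, inner_apply (hd t), hd_hd_hd]
      noncomm_ring
    have e3' : d0 (v + hd (hd t)) = -y2 - iota (pdN (pdN F')) := by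
      have h2 : hd (hd x) = d0 (hd (hd t)) + iota (pdN (pdN F')) := by
        simp only [hF', map_add, hd_inner, hd_iota, inner_apply (hd (hd t)), hd_hd_hd, map_zero,
          mul_zero, sub_zero, add_zero]
      rw [← e3, h2, map_add]
      abel
    obtain ⟨y, hy, w, hw, ev⟩ := ih (hvn.add htn.hd.hd)
      (by rw [e3']; exact sub_mem (neg_mem hy2) (iota_mem_dIota _))
    obtain ⟨y', hy', w', hw', eu⟩ := ih (c := u - hd t - h10 * w)
      ((hun.sub htn.hd).sub (LenLt.h10_mul hw)) (by
        rw [map_sub, e2', ev, d0_h10_mul]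
        have : -y1 + iota (pdN F') - h10 * (y + d0 w) - -(h10 * d0 w) =
            -y1 + iota (pdN F') - h10 * y := by noncomm_ring
        rw [this]
        exact sub_mem (add_mem (neg_mem hy1) (iota_mem_dIota _)) (h10_mul_mem_dIota hy))
    refine ⟨iota F' + h10 * y' + q20 * y, add_mem (add_mem (iota_mem_dIota _)
      (h10_mul_mem_dIota hy')) (q20_mul_mem_dIota hy), t - q20 * w - h10 * w',
      (htn.sub (LenLt.q20_mul hw)).sub (LenLt.h10_mul hw'), ?_⟩
    have eu' : u = hd t + h10 * w + (y' + d0 w') := by rw [← eu]; abel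
    have ev' : v = -hd (hd t) + (y + d0 w) := by rw [← ev]; abel
    rw [hc, hF', eu', ev', map_sub, map_sub, d0_q20_mul, d0_h10_mul, inner_apply]
    noncomm_ring

/-! The differential on words in the monomials `mon a`. -/

lemma iota_injective : Function.Injective iota := fun x y h => by
  rw [← prB_iota x, h, prB_iota]

@[simp] lemma pdN_pdN_pdN (x : BWords) : pdN (pdN (pdN x)) = 0 :=
  iota_injective (by rw [← hd_iota, ← hd_iota, ← hd_iota, hd_hd_hd, map_zero])

/-- The differential on words in the monomials `mon a`. -/
def deltaN : BWords →ₗ[k] BWords := prB ∘ₗ d1 ∘ₗ iota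

/-- The values of `killD` on words. -/
def killDWord : List Letter → Cobar
  | [] => 1
  | l :: w => if l.1.2 = 0 then 0 else lt l * killDWord w

/-- The projection to the words with all letters in the kernel of `P → D`. -/
def killD : Cobar →ₗ[k] Cobar := wordBasis.constr k killDWord

@[simp] lemma killD_one : killD 1 = 1 := by
  rw [← wordBasis_nil, killD, Module.Basis.constr_basis, wordBasis_nil]; rfl

lemma killD_lt_mul (l : Letter) (x : Cobar) :
    killD (lt l * x) = if l.1.2 = 0 then 0 else lt l * killD x := by
  refine (apply_eq_of_words (killD ∘ₗ LinearMap.mulLeft k (lt l))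
    (if l.1.2 = 0 then 0 else LinearMap.mulLeft k (lt l) ∘ₗ killD) (fun w => ?_) x).trans
    (by split_ifs <;> rfl)
  simp only [LinearMap.comp_apply, LinearMap.mulLeft_apply]
  rw [← wordBasis_cons, killD, Module.Basis.constr_basis, killDWord]
  split_ifs
  · rfl
  · rw [LinearMap.comp_apply, Module.Basis.constr_basis]; rfl

@[simp] lemma killD_h10_mul (x : Cobar) : killD (h10 * x) = 0 := by
  rw [← lt_one (by simp), killD_lt_mul]; simp

@[simp] lemma killD_q20_mul (x : Cobar) : killD (q20 * x) = 0 := by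
  rw [← lt_two (by simp), killD_lt_mul]; simp

lemma killD_bar_mul {p : P} (hp : p ∈ kerD) (x : Cobar) : killD (bar p * x) = bar p * killD x := by
  have h : monSpan ≤ LinearMap.ker (killD ∘ₗ LinearMap.mulRight k x ∘ₗ bar -
      LinearMap.mulRight k (killD x) ∘ₗ bar) := by
    refine Submodule.span_le.2 ?_
    rintro _ ⟨l, hl, rfl⟩
    have hl0 : l ≠ 0 := fun h => hl (by rw [h]; rfl)
    change killD (lt ⟨l, hl0⟩ * x) - lt ⟨l, hl0⟩ * killD x = 0
    rw [killD_lt_mul, if_neg hl, sub_self]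
  exact sub_eq_zero.1 (h (kerD_le_monSpan hp))

lemma killD_d0 (x : Cobar) : killD (d0 x) = 0 := by
  refine cobar_cases (f := killD ∘ₗ d0) (g := 0) (by simp) (fun p hp x hx => ?_)
    (fun x _ => by simp [d0_h10_mul]) (fun x _ => by simp [d0_q20_mul]) x
  have hx' : killD (d0 x) = 0 := hx
  simp only [LinearMap.comp_apply, LinearMap.zero_apply]
  rw [d0_bar_mul hp, map_sub, map_sub, map_add, map_sub, killD_h10_mul, killD_q20_mul,
    killD_bar_mul (th_mem hp), killD_bar_mul (th_mem (th_mem hp)), killD_bar_mul hp, hx']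
  simp

lemma d1_bar_mul (p : P) (x : Cobar) : d1 (bar p * x) = phi1 p * x - bar p * d1 x := by
  rw [d1, der_bar_mul phi1_one]

lemma killD_d1 (x : Cobar) : killD (d1 x) = d1 (killD x) := by
  refine cobar_cases (f := killD ∘ₗ d1) (g := d1 ∘ₗ killD) (by simp) (fun p hp x hx => ?_)
    (fun x _ => by simp [d1_h10_mul]) (fun x _ => by simp [d1_q20_mul]) x
  have hx' : killD (d1 x) = d1 (killD x) := hx
  have h : ∀ t : P ⊗[k] P, killD (bar₂ (TensorProduct.map projJ projJ t) * x) =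
      bar₂ (TensorProduct.map projJ projJ t) * killD x := by
    intro t
    induction t with
    | zero => simp
    | add t t' h h' => simp only [map_add, add_mul, h, h']
    | tmul p q =>
      rw [TensorProduct.map_tmul, bar₂_tmul, mul_assoc, mul_assoc, killD_bar_mul (projJ_mem p),
        killD_bar_mul (projJ_mem q)]
  simp only [LinearMap.comp_apply]
  rw [d1_bar_mul, map_sub, killD_bar_mul hp, killD_bar_mul hp, d1_bar_mul, hx', phi1_of_mem hp, h]

lemma killD_hd (x : Cobar) : killD (hd x) = hd (killD x) := by
  refine cobar_cases (f := killD ∘ₗ hd) (g := hd ∘ₗ killD) (by simp) (fun p hp x _ => ?_)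
    (fun x _ => by simp) (fun x _ => by simp) x
  simp only [LinearMap.comp_apply]
  rw [hd_bar_mul hp, killD_bar_mul hp, killD_bar_mul (pd_mem hp), hd_bar_mul hp]

lemma killD_iota (x : BWords) : killD (iota x) = iota x := by
  induction x using bwords_induction with
  | h1 => simp [iotaWord]
  | hl a ha x ih =>
    rw [iota_cns ha, twist_apply, map_sub, map_add, killD_bar_mul (mon_mem ha),
      killD_bar_mul (xi_mul_mon_mem' ha), killD_bar_mul (xi_mul_mon_mem 2 ha), killD_hd, killD_hd,
      killD_hd, ih]
  | h0 => simp
  | hadd x y hx hy => simp only [map_add, hx, hy]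
  | hs c x hx => simp only [map_smul, hx]

lemma d1_iota_of_pdN {x : BWords} (h1 : d1 (iota (pdN x)) ∈ dIota)
    (h2 : d1 (iota (pdN (pdN x))) ∈ dIota) : d1 (iota x) = iota (deltaN x) := by
  obtain ⟨n, hn⟩ := exists_lenLt (d1 (iota x))
  obtain ⟨y, hy, w, -, e⟩ := exists_of_d0_mem_dIota n hn (by
    rw [d0_d1, d0_iota, map_sub, d1_h10_mul, d1_q20_mul]
    exact neg_mem (sub_mem (neg_mem (h10_mul_mem_dIota h1)) (neg_mem (q20_mul_mem_dIota h2))))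
  obtain ⟨F, u, -, v, -, e'⟩ := exists_of_mem_dIota hy
  have h : d1 (iota x) = iota F := by
    have := congrArg killD e
    rw [killD_d1, killD_iota, map_add, killD_d0, e'] at this
    simpa [killD_iota] using this
  rw [deltaN, LinearMap.comp_apply, LinearMap.comp_apply, h, prB_iota]

lemma d1_iota (x : BWords) : d1 (iota x) = iota (deltaN x) := by
  have h2 : d1 (iota (pdN (pdN x))) = _ := d1_iota_of_pdN (by simp) (by simp)
  have h1 : d1 (iota (pdN x)) = _ :=
    d1_iota_of_pdN (by rw [h2]; exact iota_mem_dIota _) (by simp)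
  exact d1_iota_of_pdN (by rw [h1]; exact iota_mem_dIota _) (by rw [h2]; exact iota_mem_dIota _)

lemma deltaN_pdN (x : BWords) : deltaN (pdN x) = pdN (deltaN x) := by
  have h := d0_d1 (iota x)
  rw [d1_iota, d0_iota, d0_iota, map_sub, d1_h10_mul, d1_q20_mul, d1_iota, d1_iota] at h
  have h' : (0 : Cobar) + h10 * iota (pdN (deltaN x)) + q20 * -iota (pdN (pdN (deltaN x))) =
      0 + h10 * iota (deltaN (pdN x)) + q20 * -iota (deltaN (pdN (pdN x))) := by
    rw [zero_add, zero_add, mul_neg, ← sub_eq_add_neg, h]; noncomm_ring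
  exact (iota_injective (startJ_unique (zero_mem _) (zero_mem _) h').2.1).symm

/-- The second family of elements, `h₁₀ ι(x) - [ξ₁²] ι(∂x)`. -/
def sigma : BWords →ₗ[k] Cobar :=
  LinearMap.mulLeft k h10 ∘ₗ iota - LinearMap.mulLeft k q20 ∘ₗ iota ∘ₗ pdN

lemma sigma_apply (x : BWords) : sigma x = h10 * iota x - q20 * iota (pdN x) := rfl

lemma d0_iota' (x : BWords) : d0 (iota x) = sigma (pdN x) := d0_iota x

lemma d0_sigma (x : BWords) : d0 (sigma x) = b10 * iota (pdN (pdN x)) := by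
  rw [sigma_apply, map_sub, d0_h10_mul, d0_q20_mul, d0_iota, d0_iota, b10_mul]
  simp
  noncomm_ring

lemma d1_sigma (x : BWords) : d1 (sigma x) = -sigma (deltaN x) := by
  rw [sigma_apply, map_sub, d1_h10_mul, d1_q20_mul, d1_iota, d1_iota, deltaN_pdN, sigma_apply]
  noncomm_ring

/-- Membership in the span of the elements `b₁₀^i ι(x)` and `b₁₀^i σ(x)`. -/
inductive InPer : Cobar → Prop
  | iota (x : BWords) : InPer (iota x)
  | sigma (x : BWords) : InPer (sigma x)
  | b10_mul {y : Cobar} : InPer y → InPer (b10 * y)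
  | add {y z : Cobar} : InPer y → InPer z → InPer (y + z)

/-- The span of the elements `b₁₀^i ι(x)` and `b₁₀^i σ(x)`. -/
def per : Submodule k Cobar where
  carrier := {y | InPer y}
  add_mem' := .add
  zero_mem' := by simpa using InPer.iota 0
  smul_mem' c x hx := by
    change InPer (c • x)
    induction hx with
    | iota x => rw [← map_smul]; exact .iota _
    | sigma x => rw [← map_smul]; exact .sigma _
    | b10_mul _ h => rw [← mul_smul_comm]; exact .b10_mul h
    | add _ _ h h' => rw [smul_add]; exact .add h h'

lemma iota_mem_per (x : BWords) : iota x ∈ per := InPer.iota x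

lemma sigma_mem_per (x : BWords) : sigma x ∈ per := InPer.sigma x

lemma b10_mul_mem_per {y : Cobar} (hy : y ∈ per) : b10 * y ∈ per := InPer.b10_mul hy

lemma exists_of_mem_per {y : Cobar} (hy : y ∈ per) :
    ∃ F G, ∃ p ∈ per, y = iota F + sigma G + b10 * p := by
  induction hy with
  | iota x => exact ⟨x, 0, 0, zero_mem _, by simp⟩
  | sigma x => exact ⟨0, x, 0, zero_mem _, by simp⟩
  | b10_mul h => exact ⟨0, 0, _, h, by simp⟩
  | add _ _ h h' =>
    obtain ⟨F, G, p, hp, e⟩ := h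
    obtain ⟨F', G', p', hp', e'⟩ := h'
    exact ⟨F + F', G + G', _, add_mem hp hp', by rw [e, e', map_add, map_add]; noncomm_ring⟩

lemma b10_mul_mem_dIota {y : Cobar} (hy : y ∈ dIota) : b10 * y ∈ dIota := by
  rw [b10_mul]
  exact add_mem (h10_mul_mem_dIota (q20_mul_mem_dIota hy)) (q20_mul_mem_dIota (h10_mul_mem_dIota hy))

lemma per_le_dIota : per ≤ dIota := fun y hy => by
  induction hy with
  | iota x => exact iota_mem_dIota x
  | sigma x =>
    exact sub_mem (h10_mul_mem_dIota (iota_mem_dIota _)) (q20_mul_mem_dIota (iota_mem_dIota _))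
  | b10_mul _ h => exact b10_mul_mem_dIota h
  | add _ _ h h' => exact add_mem h h'

/-- Uniqueness of the decomposition of elements of `dIota`. -/
lemma parts_unique {F F' G G' : BWords} {u u' v v' w w' : Cobar}
    (h : iota F + q20 * iota G + h10 * u + b10 * v + q20 * (q20 * w) =
      iota F' + q20 * iota G' + h10 * u' + b10 * v' + q20 * (q20 * w')) :
    F = F' ∧ G = G' ∧ u = u' ∧ v = v' ∧ w = w' := by
  have e : ∀ (F G : BWords) (u v w : Cobar),
      iota F + q20 * iota G + h10 * u + b10 * v + q20 * (q20 * w) =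
      iota F + h10 * (u + q20 * v) + q20 * (iota G + h10 * v + q20 * w) := by
    intro F G u v w; rw [b10_mul]; noncomm_ring
  rw [e, e] at h
  obtain ⟨h1, h2, h3⟩ := startJ_unique (iota_mem_startJ _) (iota_mem_startJ _) h
  obtain ⟨h4, h5, h6⟩ := startJ_unique (iota_mem_startJ _) (iota_mem_startJ _) h3
  refine ⟨iota_injective h1, iota_injective h4, ?_, h5, h6⟩
  rw [h5] at h2
  exact add_right_cancel h2

lemma b10_mul_cancel {x y : Cobar} (h : b10 * x = b10 * y) : x = y :=
  (parts_unique (F := 0) (F' := 0) (G := 0) (G' := 0) (u := 0) (u' := 0) (w := 0) (w' := 0)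
    (by simpa using h)).2.2.2.1

lemma LenLt.d0' {n : ℕ} {x : Cobar} (hx : LenLt (n - 1) x) : LenLt n (MPASS.d0 x) := by
  cases n with
  | zero => rw [show x = 0 from hx, map_zero]; exact LenLt.zero _
  | succ n => exact LenLt.d0 hx

lemma LenLt.b10_mul {n : ℕ} {x : Cobar} (hx : LenLt (n - 1 - 1) x) : LenLt n (b10 * x) := by
  rw [MPASS.b10_mul]
  exact LenLt.add (LenLt.h10_mul (LenLt.q20_mul hx)) (LenLt.q20_mul (LenLt.h10_mul hx))

lemma d0_parts (F G : BWords) (u v w : Cobar) :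
    d0 (iota F + q20 * iota G + h10 * u + b10 * v + q20 * (q20 * w)) =
      iota 0 + q20 * iota (-pdN (pdN F)) + h10 * (iota (pdN F) - sigma G - d0 u - b10 * w) +
        b10 * (-iota (pdN G) + d0 v + h10 * w) + q20 * (q20 * (iota (pdN (pdN G)) + d0 w)) := by
  simp only [map_add, d0_iota, d0_q20_mul, d0_h10_mul, sigma_apply, map_neg, map_zero,
    b10_mul]
  noncomm_ring

/-- An element of `dIota` whose `d₀`-boundary lies in `per` lies in `per` up to a boundary. -/
lemma exists_of_dIota_of_d0_mem_per (n : ℕ) {y : Cobar} (hy : y ∈ dIota) (hn : LenLt n y)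
    (h : d0 y ∈ per) : ∃ p ∈ per, ∃ w ∈ dIota, LenLt (n - 1) w ∧ y = p + d0 w := by
  induction n using Nat.strong_induction_on generalizing y with
  | _ n ih =>
  cases n with
  | zero => exact ⟨0, zero_mem _, 0, zero_mem _, LenLt.zero _, by rw [show y = 0 from hn]; simp⟩
  | succ n =>
    obtain ⟨F, y1, hy1, y2, hy2, e⟩ := exists_of_mem_dIota hy
    have ny1 : LenLt n y1 := by
      have := hn.strip ⟨(1, 0), by simp⟩
      rwa [← stripH, e, stripH_add (iota_mem_startJ _)] at this
    have ny2 : LenLt n y2 := by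
      have := hn.strip ⟨(2, 0), by simp⟩
      rwa [← stripQ, e, stripQ_add (iota_mem_startJ _)] at this
    obtain ⟨G, v, hv, w, hw, e2⟩ := exists_of_mem_dIota hy2
    have nv : LenLt (n - 1) v := by
      have := ny2.strip ⟨(1, 0), by simp⟩
      rwa [← stripH, e2, stripH_add (iota_mem_startJ _)] at this
    have nw : LenLt (n - 1) w := by
      have := ny2.strip ⟨(2, 0), by simp⟩
      rwa [← stripQ, e2, stripQ_add (iota_mem_startJ _)] at this
    obtain ⟨u, hu⟩ : ∃ u, u = y1 - q20 * v := ⟨_, rfl⟩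
    have hey : y = iota F + q20 * iota G + h10 * u + b10 * v + q20 * (q20 * w) := by
      rw [e, e2, hu, b10_mul]; noncomm_ring
    have huY : u ∈ dIota := hu ▸ sub_mem hy1 (q20_mul_mem_dIota hv)
    have nu : LenLt n u := hu ▸ ny1.sub (LenLt.q20_mul nv)
    obtain ⟨F', F'', p', hp', ep⟩ := exists_of_mem_per h
    have ep' : d0 y = iota F' + q20 * iota (-pdN F'') + h10 * iota F'' + b10 * p' +
        q20 * (q20 * 0) := by
      rw [ep, sigma_apply, map_neg]; noncomm_ring
    rw [hey, d0_parts] at ep'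
    obtain ⟨-, -, eA, eB, eC⟩ := parts_unique ep'
    -- the part `q20 * q20 * w`
    obtain ⟨pw, hpw, w', hw', nw', ew⟩ := ih (n - 1) (by omega) hw nw (by
      rw [show d0 w = -iota (pdN (pdN G)) by rw [← add_eq_zero_iff_eq_neg', eC]]
      exact neg_mem (iota_mem_per _))
    -- the part `h10 * u`
    have eu0 : d0 (u + b10 * w') = iota (pdN F) - sigma G - iota F'' - b10 * pw := by
      have hpw' : pw = w - d0 w' := by rw [ew]; abel
      rw [map_add, d0_b10_mul, hpw', ← eA]; noncomm_ring
    obtain ⟨pu, hpu, z, hz, nz, eu⟩ := ih n (by omega)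
      (add_mem huY (b10_mul_mem_dIota hw')) (nu.add (LenLt.b10_mul nw')) (by
        rw [eu0]
        exact sub_mem (sub_mem (sub_mem (iota_mem_per _) (sigma_mem_per _)) (iota_mem_per _))
          (b10_mul_mem_per hpw))
    have npu : LenLt n pu := by
      rw [show pu = u + b10 * w' - d0 z by rw [eu]; abel]
      exact (nu.add (LenLt.b10_mul nw')).sub nz.d0'
    obtain ⟨A, A', p, hp, epu⟩ := exists_of_mem_per hpu
    have epu' : pu = iota A + h10 * (iota A' + q20 * p) + q20 * (-iota (pdN A') + h10 * p) := by
      rw [epu, sigma_apply, b10_mul]; noncomm_ring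
    have ns : LenLt (n - 1) (iota A' + q20 * p) := by
      have := npu.strip ⟨(1, 0), by simp⟩
      rwa [← stripH, epu', stripH_add (iota_mem_startJ _)] at this
    have ns' : LenLt (n - 1) (-iota (pdN A') + h10 * p) := by
      have := npu.strip ⟨(2, 0), by simp⟩
      rwa [← stripQ, epu', stripQ_add (iota_mem_startJ _)] at this
    have eu1 : iota (pdN F - F'') + q20 * iota (pdN G) + h10 * (-iota G) + b10 * (-pw) +
        q20 * (q20 * 0) = iota 0 + q20 * iota (-pdN (pdN A)) + h10 * iota (pdN A) +
          b10 * (iota (pdN (pdN A')) + d0 p) + q20 * (q20 * 0) := by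
      have h1 := congrArg d0 eu
      rw [eu0, map_add, d0_d0, add_zero, epu, map_add, map_add, d0_iota, d0_sigma, d0_b10_mul,
        sigma_apply] at h1
      rw [show iota (pdN F - F'') + q20 * iota (pdN G) + h10 * (-iota G) + b10 * (-pw) +
        q20 * (q20 * 0) = iota (pdN F) - (h10 * iota G - q20 * iota (pdN G)) - iota F'' - b10 * pw by
          rw [map_sub]; noncomm_ring, h1, map_zero, map_neg]
      noncomm_ring
    obtain ⟨-, -, eG, ePw, -⟩ := parts_unique eu1
    have eG' : G = -pdN A := iota_injective (by rw [map_neg, ← eG, neg_neg])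
    have ePw' : pw = -(iota (pdN (pdN A')) + d0 p) := by rw [← ePw, neg_neg]
    -- the part `b10 * v`
    have ev0 : d0 (v - h10 * w' + (-iota (pdN A') + h10 * p)) = p' - iota (pdN (pdN A)) := by
      have ev : d0 v = p' + iota (pdN G) - h10 * w := by rw [← eB]; abel
      rw [map_add, map_sub, map_add, map_neg, ev, ew, ePw', eG', d0_h10_mul, d0_h10_mul, d0_iota]
      simp
      noncomm_ring
    obtain ⟨p3, hp3, t, ht, nt, et⟩ := ih (n - 1) (by omega)
      (add_mem (sub_mem hv (h10_mul_mem_dIota hw')) (add_mem (neg_mem (iota_mem_dIota (pdN A')))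
        (h10_mul_mem_dIota (per_le_dIota hp)))) ((nv.sub (LenLt.h10_mul nw')).add ns')
      (by rw [ev0]; exact sub_mem hp' (iota_mem_per _))
    refine ⟨iota F + sigma A + b10 * p3,
      add_mem (add_mem (iota_mem_per _) (sigma_mem_per _)) (b10_mul_mem_per hp3),
      q20 * (q20 * w') - h10 * z - q20 * (iota A' + q20 * p) + b10 * t, ?_, ?_, ?_⟩
    · refine add_mem (sub_mem (sub_mem (q20_mul_mem_dIota (q20_mul_mem_dIota hw'))
        (h10_mul_mem_dIota hz)) (q20_mul_mem_dIota (add_mem (iota_mem_dIota _)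
          (q20_mul_mem_dIota (per_le_dIota hp))))) (b10_mul_mem_dIota ht)
    · exact (((LenLt.q20_mul (LenLt.q20_mul nw')).sub (LenLt.h10_mul nz)).sub
        (LenLt.q20_mul ns)).add (LenLt.b10_mul nt)
    · have eu' : u = pu + d0 z - b10 * w' := by rw [← eu]; abel
      have ev' : v = p3 + d0 t + h10 * w' + iota (pdN A') - h10 * p := by rw [← et]; abel
      rw [hey, eu', ev', ew, ePw', epu, eG', sigma_apply, sigma_apply]
      simp only [map_add, map_sub, map_neg, d0_q20_mul, d0_h10_mul, d0_iota, b10_mul]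
      noncomm_ring

/-- A cochain with `d₀`-boundary in `per` lies in `per` up to a boundary. -/
lemma exists_of_d0_mem_per {c : Cobar} (h : d0 c ∈ per) : ∃ p ∈ per, ∃ w, c = p + d0 w := by
  obtain ⟨n, hn⟩ := exists_lenLt c
  obtain ⟨y, hy, w, -, e⟩ := exists_of_d0_mem_dIota n hn (per_le_dIota h)
  obtain ⟨m, hm⟩ := exists_lenLt y
  obtain ⟨p, hp, w', -, -, e'⟩ := exists_of_dIota_of_d0_mem_per m hy hm (by
    rwa [e, map_add, d0_d0, add_zero] at h)
  exact ⟨p, hp, w' + w, by rw [e, e', map_add]; abel⟩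

/-! Spans of words in the monomials `mon a`. -/

/-- The span of the words in `S`. -/
def bSpan (S : Set (List BLetter)) : Submodule k BWords := Submodule.span k (bword '' S)

lemma bword_mem {S : Set (List BLetter)} {w : List BLetter} (h : w ∈ S) : bword w ∈ bSpan S :=
  Submodule.subset_span ⟨w, h, rfl⟩

lemma bSpan_mono {S T : Set (List BLetter)} (h : S ⊆ T) : bSpan S ≤ bSpan T :=
  Submodule.span_mono (Set.image_mono h)

lemma map_mem_of_bwords {M : Type*} [AddCommGroup M] [Module k M] {S : Set (List BLetter)}
    {N : Submodule k M} {f : BWords →ₗ[k] M} (h : ∀ w ∈ S, f (bword w) ∈ N) {x : BWords}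
    (hx : x ∈ bSpan S) : f x ∈ N := by
  have : bSpan S ≤ N.comap f := Submodule.span_le.2 (by rintro _ ⟨w, hw, rfl⟩; exact h w hw)
  exact this hx

lemma apply_eq_of_bwords {M : Type*} [AddCommGroup M] [Module k M] {S : Set (List BLetter)}
    {f g : BWords →ₗ[k] M} (h : ∀ w ∈ S, f (bword w) = g (bword w)) {x : BWords}
    (hx : x ∈ bSpan S) : f x = g x :=
  sub_eq_zero.1 (map_mem_of_bwords (N := ⊥) (f := f - g) (fun w hw => by simp [h w hw]) hx)

lemma mem_bSpan_univ (x : BWords) : x ∈ bSpan Set.univ := by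
  induction x using Finsupp.induction_linear with
  | zero => exact zero_mem _
  | add x y hx hy => exact add_mem hx hy
  | single w c =>
    have : Finsupp.single w c = c • bword w := by simp
    rw [this]; exact Submodule.smul_mem _ _ (bword_mem trivial)

open Classical in
/-- The projection to the span of the words in `S`. -/
def bProj (S : Set (List BLetter)) : BWords →ₗ[k] BWords :=
  Finsupp.linearCombination k fun w => if w ∈ S then bword w else 0

lemma bProj_pos {S : Set (List BLetter)} {w : List BLetter} (h : w ∈ S) :
    bProj S (bword w) = bword w := by simp [bProj, h]

lemma bProj_neg {S : Set (List BLetter)} {w : List BLetter} (h : w ∉ S) :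
    bProj S (bword w) = 0 := by simp [bProj, h]

lemma bProj_mem (S : Set (List BLetter)) (x : BWords) : bProj S x ∈ bSpan S :=
  map_mem_of_bwords (fun w _ => by
    by_cases h : w ∈ S
    · rw [bProj_pos h]; exact bword_mem h
    · rw [bProj_neg h]; exact zero_mem _) (mem_bSpan_univ x)

lemma bProj_of_mem {S : Set (List BLetter)} {x : BWords} (hx : x ∈ bSpan S) : bProj S x = x :=
  apply_eq_of_bwords (g := LinearMap.id) (fun _ hw => bProj_pos hw) hx

lemma bProj_of_disjoint {S T : Set (List BLetter)} (h : ∀ w ∈ T, w ∉ S) {x : BWords}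
    (hx : x ∈ bSpan T) : bProj S x = 0 :=
  apply_eq_of_bwords (g := 0) (fun w hw => bProj_neg (h w hw)) hx

lemma bProj_mem_of_mem {S T : Set (List BLetter)} {x : BWords} (hx : x ∈ bSpan T) :
    bProj S x ∈ bSpan (S ∩ T) :=
  map_mem_of_bwords (fun w hw => by
    by_cases h : w ∈ S
    · rw [bProj_pos h]; exact bword_mem ⟨h, hw⟩
    · rw [bProj_neg h]; exact zero_mem _) hx

lemma sub_bProj_mem_of_mem {S T : Set (List BLetter)} {x : BWords} (hx : x ∈ bSpan T) :
    x - bProj S x ∈ bSpan (T \ S) :=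
  map_mem_of_bwords (f := LinearMap.id - bProj S) (fun w hw => by
    by_cases h : w ∈ S
    · simp [bProj_pos h]
    · simpa [bProj_neg h] using bword_mem (S := T \ S) ⟨hw, h⟩) hx

/-- Projections commute with maps that match the sets of words. -/
lemma bProj_comm {f : BWords →ₗ[k] BWords} {S T : Set (List BLetter)}
    (hS : ∀ w ∈ S, f (bword w) ∈ bSpan T) (hT : ∀ w ∉ S, f (bword w) ∈ bSpan Tᶜ) (x : BWords) :
    bProj T (f x) = f (bProj S x) :=
  apply_eq_of_bwords (f := bProj T ∘ₗ f) (g := f ∘ₗ bProj S) (fun w _ => by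
    simp only [LinearMap.comp_apply]
    by_cases h : w ∈ S
    · rw [bProj_pos h, bProj_of_mem (hS w h)]
    · rw [bProj_neg h, map_zero, bProj_of_disjoint (T := Tᶜ) (fun u hu hu' => hu hu') (hT w h)])
    (mem_bSpan_univ x)

/-! Patterns, degrees and weights. -/

/-- The polynomial degrees of `mon a` in the pairs of variables `x_j`, `y_j`. -/
def pat (a : A) : ℕ →₀ ℕ := a.mapRange (fun c => c.1 + c.2) rfl

lemma pat_apply (a : A) (j : ℕ) : pat a j = (a j).1 + (a j).2 := rfl

lemma mem_support_pat {a : A} {j : ℕ} : j ∈ (pat a).support ↔ j ∈ a.support := by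
  rw [Finsupp.mem_support_iff, Finsupp.mem_support_iff, pat_apply, Ne, Ne, not_iff_not]
  constructor
  · intro h
    exact Prod.ext (by simp; omega) (Fin.ext (by simp; omega))
  · intro h; simp [h]

lemma support_pat (a : A) : (pat a).support = a.support := Finset.ext fun _ => mem_support_pat

/-- The pattern of a word. -/
def wpat (w : List BLetter) : List (ℕ →₀ ℕ) := w.map fun a => pat a.1

@[simp] lemma wpat_nil : wpat [] = [] := rfl

@[simp] lemma wpat_cons (a : BLetter) (w : List BLetter) : wpat (a :: w) = pat a.1 :: wpat w := rfl

/-- The internal degree of a word. -/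
def wdeg (w : List BLetter) : ℕ := (w.map fun a => expoDeg (expo 0 a.1)).sum

@[simp] lemma wdeg_nil : wdeg [] = 0 := rfl

@[simp] lemma wdeg_cons (a : BLetter) (w : List BLetter) :
    wdeg (a :: w) = expoDeg (expo 0 a.1) + wdeg w := by simp [wdeg]

/-- The weight of a pattern. -/
def patWt : (ℕ →₀ ℕ) →+ ℕ := expoWt

/-- The weight of a list of patterns. -/
def pWt (p : List (ℕ →₀ ℕ)) : ℕ := (p.map patWt).sum

@[simp] lemma pWt_cons (a : ℕ →₀ ℕ) (p : List (ℕ →₀ ℕ)) : pWt (a :: p) = patWt a + pWt p := by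
  simp [pWt]

/-- The number of pairs `m ≤ n` with `n ∈ T` and `m ∈ U`. -/
def invPairs (T U : Finset ℕ) : ℕ := ((T ×ˢ U).filter fun x => x.2 ≤ x.1).card

/-- The number of inversions between `T` and a list of patterns. -/
def crossInv (T : Finset ℕ) (p : List (ℕ →₀ ℕ)) : ℕ := (p.map fun a => invPairs T a.support).sum

@[simp] lemma crossInv_cons (T : Finset ℕ) (a : ℕ →₀ ℕ) (p : List (ℕ →₀ ℕ)) :
    crossInv T (a :: p) = invPairs T a.support + crossInv T p := by simp [crossInv]

/-- The number of inversions in a list of patterns. -/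
def inv : List (ℕ →₀ ℕ) → ℕ
  | [] => 0
  | a :: p => crossInv a.support p + inv p

@[simp] lemma inv_cons (a : ℕ →₀ ℕ) (p : List (ℕ →₀ ℕ)) :
    inv (a :: p) = crossInv a.support p + inv p := rfl

lemma invPairs_union_left (T T' U : Finset ℕ) : invPairs (T ∪ T') U ≤ invPairs T U + invPairs T' U := by
  rw [invPairs, Finset.union_product, Finset.filter_union]
  exact Finset.card_union_le _ _

lemma invPairs_union_right (T U U' : Finset ℕ) : invPairs T (U ∪ U') ≤ invPairs T U + invPairs T U' := by
  rw [invPairs, Finset.product_union, Finset.filter_union]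
  exact Finset.card_union_le _ _

lemma crossInv_union (T T' : Finset ℕ) (p : List (ℕ →₀ ℕ)) :
    crossInv (T ∪ T') p ≤ crossInv T p + crossInv T' p := by
  induction p with
  | nil => simp [crossInv]
  | cons a p ih =>
    rw [crossInv_cons, crossInv_cons, crossInv_cons]
    have := invPairs_union_left T T' a.support
    omega

lemma invPairs_pos {T U : Finset ℕ} {n m : ℕ} (hn : n ∈ T) (hm : m ∈ U) (h : m ≤ n) :
    1 ≤ invPairs T U :=
  Finset.card_pos.2 ⟨(n, m), Finset.mem_filter.2 ⟨Finset.mem_product.2 ⟨hn, hm⟩, h⟩⟩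

lemma support_add_nat (a b : ℕ →₀ ℕ) : (a + b).support = a.support ∪ b.support := by
  ext i; simp only [Finsupp.mem_support_iff, Finsupp.add_apply, Finset.mem_union]; omega

/-- The words that appear in the error terms of the differential on `w`. -/
def Above (w : List BLetter) : Set (List BLetter) :=
  {u | u.length = w.length + 1 ∧ wdeg u = wdeg w ∧ (pWt (wpat w) < pWt (wpat u) ∨
    (pWt (wpat w) = pWt (wpat u) ∧ inv (wpat w) < inv (wpat u) ∧
      ∀ T, crossInv T (wpat w) ≤ crossInv T (wpat u)))}

lemma cons_mem_above (a : BLetter) {u w : List BLetter} (h : u ∈ Above w) : a :: u ∈ Above (a :: w) := by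
  obtain ⟨h1, h2, h3⟩ := h
  refine ⟨by simp [h1], by simp [h2], ?_⟩
  simp only [wpat_cons, pWt_cons, inv_cons, crossInv_cons]
  rcases h3 with h3 | ⟨h3, h4, h5⟩
  · left; omega
  · right
    refine ⟨by omega, ?_, fun T => ?_⟩
    · have := h5 (pat a.1).support; omega
    · have := h5 T; omega

lemma expoWt_expo (a : A) : expoWt (expo 0 a) = 3 * patWt (pat a) := by
  induction a using Finsupp.induction with
  | zero =>
    have : expo 0 0 = 0 := Finsupp.ext fun i => by cases i <;> simp [expo_zero, expo_succ]
    have h' : pat 0 = 0 := Finsupp.ext fun j => by simp [pat_apply]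
    rw [this, h']; simp
  | single_add j c a ha hc ih =>
    have hd : Disjoint (Finsupp.single j c).support a.support :=
      Finset.disjoint_left.2 fun i hi hi' => by
        have := Finsupp.support_single_subset hi
        rw [Finset.mem_singleton] at this
        exact ha (this ▸ hi')
    have hp : pat (Finsupp.single j c + a) = Finsupp.single j (c.1 + (c.2 : ℕ)) + pat a := by
      have haj : a j = 0 := Finsupp.notMem_support_iff.1 ha
      refine Finsupp.ext fun i => ?_
      rw [Finsupp.add_apply, pat_apply, pat_apply, Finsupp.add_apply, Finsupp.single_apply,
        Finsupp.single_apply]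
      split_ifs with h
      · subst h; simp [haj]
      · simp
    have hs : expo 0 (Finsupp.single j c) =
        Finsupp.single j (3 * c.1) + Finsupp.single (j + 1) (c.2 : ℕ) := by
      refine Finsupp.ext fun i => ?_
      cases i with
      | zero => rcases j with _ | j <;> simp [expo_zero]
      | succ i =>
        rw [expo_succ, Finsupp.add_apply]
        simp only [Finsupp.single_apply]
        by_cases h1 : j = i + 1 <;> by_cases h2 : j = i <;> simp [h1, h2]
    rw [expo_add hd, hp, map_add, map_add, ih, hs, map_add, expoWt_single, expoWt_single, mul_add,
      show patWt (Finsupp.single j (c.1 + (c.2 : ℕ))) = _ from expoWt_single _ _]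
    ring

lemma pat_shift {a : A} {j : ℕ} (h : (a j).2 ≠ 0) : pat (shift a j) = pat a := by
  refine Finsupp.ext fun i => ?_
  rw [pat_apply, pat_apply, shift, Finsupp.update_apply]
  split_ifs with hi
  · subst hi
    have : (((a i).2 - 1 : Fin 3) : ℕ) + 1 = (a i).2 := by
      generalize (a i).2 = r at h
      fin_cases r
      · exact absurd rfl h
      · rfl
      · rfl
    simp only
    omega
  · rfl

lemma expoDeg_shift {a : A} {j : ℕ} (h : (a j).2 ≠ 0) :
    expoDeg (expo 0 (shift a j)) + 2 = expoDeg (expo 0 a) := by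
  have hr : (((a j).2 - 1 : Fin 3) : ℕ) + 1 = (a j).2 := by
    generalize (a j).2 = r at h
    fin_cases r
    · exact absurd rfl h
    · rfl
    · rfl
  have key : expo 0 (shift a j) + Finsupp.single (j + 1) 1 = expo 0 a + Finsupp.single j 3 := by
    refine Finsupp.ext fun i => ?_
    rw [Finsupp.add_apply, Finsupp.add_apply]
    cases i with
    | zero =>
      rw [expo_zero, expo_zero, shift, Finsupp.update_apply, Finsupp.single_apply,
        Finsupp.single_apply]
      by_cases hj : j = 0
      · subst hj; simp; ring
      · simp [hj, Ne.symm hj]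
    | succ i =>
      rw [expo_succ, expo_succ, shift, Finsupp.update_apply, Finsupp.update_apply,
        Finsupp.single_apply, Finsupp.single_apply]
      by_cases h1 : i + 1 = j
      · have h2 : i ≠ j := by omega
        have h3 : ¬ (j + 1 = i + 1) := by omega
        rw [if_pos h1, if_neg h2, if_neg h3, if_pos h1.symm]
        subst h1
        simp
        ring
      · have h1' : ¬ j = i + 1 := fun h => h1 h.symm
        rw [if_neg h1, if_neg h1']
        by_cases h2 : i = j
        · subst h2
          rw [if_pos rfl, if_pos rfl]
          simp only
          omega
        · have h3 : ¬ j + 1 = i + 1 := by omega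
          rw [if_neg h2, if_neg h3]
  have h1 := congrArg expoDeg key
  rw [map_add, map_add, expoDeg_single, expoDeg_single, one_mul, pow_succ 3 (j + 1)] at h1
  have : 1 ≤ 3 ^ (j + 1) := Nat.one_le_pow _ _ (by norm_num)
  omega

/-- The derivation `∂` preserves the patterns and lowers the degree by `2`. -/
lemma pdWord_mem (w : List BLetter) : pdWord w ∈ bSpan {u | wpat u = wpat w ∧ wdeg u + 2 = wdeg w} := by
  induction w with
  | nil => exact zero_mem _
  | cons a w ih =>
    rw [pdWord]
    refine add_mem (sum_mem fun j _ => ?_) ?_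
    · by_cases h : (a.1 j).2 = 0
      · rw [h]; simp
      · refine Submodule.smul_mem _ _ ?_
        rw [cns_bword (shift_ne_zero _ _)]
        refine bword_mem ⟨?_, ?_⟩
        · simp [pat_shift h]
        · rw [wdeg_cons, wdeg_cons, ← expoDeg_shift h]; ring
    · refine map_mem_of_bwords (fun u hu => ?_) ih
      obtain ⟨h1, h2⟩ := hu
      rw [cns_bword a.2]
      exact bword_mem ⟨by simp [h1], by rw [wdeg_cons, wdeg_cons, ← h2]; ring⟩

lemma wpat_length {u w : List BLetter} (h : wpat u = wpat w) : u.length = w.length := by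
  have := congrArg List.length h
  simpa [wpat] using this

/-! The differential on a word. -/

/-- Put an element of `P` in front of a word (`0` on multiples of `ξ₁` and on constants). -/
def cnsP : P →ₗ[k] Module.End k BWords := basisP.constr k fun l => if l.1 = 0 then cns l.2 else 0

lemma cnsP_basisP (l : Fin 3 × A) : cnsP (basisP l) = if l.1 = 0 then cns l.2 else 0 := by
  rw [cnsP, Module.Basis.constr_basis]

lemma cnsP_mon (a : A) : cnsP (mon a) = cns a := by
  have : mon a = basisP (0, a) := by rw [basisP_apply]; simp
  rw [this, cnsP_basisP, if_pos rfl]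

lemma cnsP_xi_mul_mon (a : A) : cnsP (xi 1 * mon a) = 0 := by
  have : xi 1 * mon a = basisP (1, a) := by rw [basisP_apply]; simp
  rw [this, cnsP_basisP, if_neg (by simp)]

lemma cnsP_xi_sq_mul_mon (a : A) : cnsP (xi 1 ^ 2 * mon a) = 0 := by
  have : xi 1 ^ 2 * mon a = basisP (2, a) := by rw [basisP_apply]; simp
  rw [this, cnsP_basisP, if_neg (by simp)]

lemma prB_bar_mul (p : P) (x : Cobar) : prB (bar p * x) = cnsP p (prB x) := by
  refine apply_eq_of_letters (prB ∘ₗ LinearMap.mulRight k x ∘ₗ bar)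
    (LinearMap.applyₗ (prB x) ∘ₗ cnsP) ?_ (fun l => ?_) p
  · simp only [LinearMap.comp_apply, LinearMap.mulRight_apply, bar_one, LinearMap.applyₗ_apply_apply]
    rw [← mon_zero, cnsP_mon, cns_zero]; simp
  · refine (prB_lt_mul l x).trans ?_
    simp only [LinearMap.comp_apply, LinearMap.applyₗ_apply_apply]
    rw [cnsP_basisP]
    split_ifs <;> rfl

/-- Put a tensor of elements of `P` in front of a word. -/
def cns₂ : P ⊗[k] P →ₗ[k] Module.End k BWords :=
  LinearMap.mul' k (Module.End k BWords) ∘ₗ TensorProduct.map cnsP cnsP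

lemma cns₂_tmul (p q : P) (x : BWords) : cns₂ (p ⊗ₜ q) x = cnsP p (cnsP q x) := by
  simp [cns₂]

lemma prB_bar₂_mul (t : P ⊗[k] P) (x : Cobar) : prB (bar₂ t * x) = cns₂ t (prB x) := by
  induction t with
  | zero => simp
  | add t t' h h' => simp only [map_add, add_mul, LinearMap.add_apply, h, h']
  | tmul p q => rw [bar₂_tmul, mul_assoc, prB_bar_mul, prB_bar_mul, cns₂_tmul]

lemma deltaN_eq (x : BWords) : deltaN x = prB (d (iota x)) := by
  rw [d_eq, map_add, prB_d0, zero_add]; rfl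

lemma deltaN_cns {a : A} (ha : a ≠ 0) (x : BWords) : deltaN (cns a x) =
    cns₂ (comul (mon a)) x + cns₂ (comul (xi 1 * mon a)) (pdN x) -
      cns₂ (comul (xi 1 ^ 2 * mon a)) (pdN (pdN x)) - cns a (deltaN x) := by
  rw [deltaN_eq, iota_cns ha, twist_apply, map_sub, map_add, d_bar_mul, d_bar_mul, d_bar_mul]
  simp only [map_sub, map_add, prB_bar₂_mul, prB_bar_mul, hd_iota, prB_iota, cnsP_xi_mul_mon,
    cnsP_xi_sq_mul_mon, cnsP_mon, ← deltaN_eq, LinearMap.zero_apply]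
  abel

@[simp] lemma deltaN_nil : deltaN (bword []) = 0 := by
  rw [deltaN_eq, iota_bword]
  change prB (d 1) = 0
  rw [d_one, map_zero]

lemma exists_expo (e : ℕ →₀ ℕ) : ∃ r b, e = expo r b :=
  ⟨_, _, (expoEquiv.apply_symm_apply e).symm⟩

lemma cnsP_monomial (r : Fin 3) (b : A) :
    cnsP (MvPolynomial.monomial (expo r b) 1) = if r = 0 then cns b else 0 := by
  rw [← basisP_eq_monomial (r, b), cnsP_basisP]

/-- Tensors of large weight raise the weight. -/
lemma cns₂_tensorFilt_mem {D n : ℕ} {t : P ⊗[k] P} (ht : t ∈ tensorFilt D n) (w : List BLetter) :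
    cns₂ t (bword w) ∈ bSpan {u | ∃ b c, u = b :: c :: w ∧
      expoDeg (expo 0 b.1) + expoDeg (expo 0 c.1) = D ∧ n ≤ 3 * (patWt (pat b.1) + patWt (pat c.1))} := by
  have : tensorFilt D n ≤ (bSpan {u | ∃ b c, u = b :: c :: w ∧
      expoDeg (expo 0 b.1) + expoDeg (expo 0 c.1) = D ∧
        n ≤ 3 * (patWt (pat b.1) + patWt (pat c.1))}).comap
      (LinearMap.applyₗ (bword w) ∘ₗ cns₂) := by
    refine Submodule.span_le.2 ?_
    rintro _ ⟨e, f, hD, hn, rfl⟩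
    obtain ⟨r, b, rfl⟩ := exists_expo e
    obtain ⟨r', c, rfl⟩ := exists_expo f
    rw [SetLike.mem_coe, Submodule.mem_comap, LinearMap.comp_apply, LinearMap.applyₗ_apply_apply,
      cns₂_tmul, cnsP_monomial, cnsP_monomial]
    by_cases hr : r = 0
    · by_cases hr' : r' = 0
      · subst hr hr'
        rw [if_pos rfl, if_pos rfl]
        by_cases hb : b = 0
        · subst hb; simp [cns_zero]
        by_cases hc : c = 0
        · subst hc; simp [cns_zero]
        rw [cns_bword hc, cns_bword hb]
        refine bword_mem ⟨⟨b, hb⟩, ⟨c, hc⟩, rfl, hD, ?_⟩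
        rw [expoWt_expo, expoWt_expo] at hn
        simp only; omega
      · rw [if_neg hr']; simp
    · rw [if_neg hr]; simp
  exact this ht

/-- The tensors of monomials with an inversion, of the pattern of `mon a`. -/
def tensorBad (a : A) : Submodule k (P ⊗[k] P) :=
  Submodule.span k {t | ∃ g h : A, pat g + pat h = pat a ∧ expo 0 g + expo 0 h = expo 0 a ∧
    (∃ n ∈ g.support, ∃ m ∈ h.support, m ≤ n) ∧ t = mon g ⊗ₜ mon h}

lemma cns₂_tensorBad_mem {a : A} (ha : a ≠ 0) {t : P ⊗[k] P} (ht : t ∈ tensorBad a) (w : List BLetter) :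
    cns₂ t (bword w) ∈ bSpan (Above (⟨a, ha⟩ :: w)) := by
  have : tensorBad a ≤ (bSpan (Above (⟨a, ha⟩ :: w))).comap
      (LinearMap.applyₗ (bword w) ∘ₗ cns₂) := by
    refine Submodule.span_le.2 ?_
    rintro _ ⟨g, h, hp, he, ⟨n, hn, m, hm, hmn⟩, rfl⟩
    have hg : g ≠ 0 := by rintro rfl; simp at hn
    have hh : h ≠ 0 := by rintro rfl; simp at hm
    rw [SetLike.mem_coe, Submodule.mem_comap, LinearMap.comp_apply, LinearMap.applyₗ_apply_apply,
      cns₂_tmul, cnsP_mon, cnsP_mon, cns_bword hh, cns_bword hg]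
    refine bword_mem ⟨rfl, ?_, Or.inr ⟨?_, ?_, fun T => ?_⟩⟩
    · rw [wdeg_cons, wdeg_cons, wdeg_cons, ← he, map_add]; ring
    · simp only [wpat_cons, pWt_cons, ← hp, map_add]; ring
    · simp only [wpat_cons, inv_cons, crossInv_cons, ← hp, support_add_nat]
      have h1 := crossInv_union (pat g).support (pat h).support (wpat w)
      have h2 := invPairs_pos (mem_support_pat.2 hn) (mem_support_pat.2 hm) hmn
      omega
    · simp only [wpat_cons, crossInv_cons, ← hp, support_add_nat]
      have := invPairs_union_right T (pat g).support (pat h).support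
      omega
  exact this ht

/-! The leading term of the coproduct. -/

/-- The tensors of monomials of the pattern of `mon a`. -/
def tensorMon (a : A) : Submodule k (P ⊗[k] P) :=
  Submodule.span k {t | ∃ g h : A, pat g + pat h = pat a ∧ expo 0 g + expo 0 h = expo 0 a ∧
    t = mon g ⊗ₜ mon h}

lemma tensorBad_le (a : A) : tensorBad a ≤ tensorMon a :=
  Submodule.span_mono fun _ ⟨g, h, h1, h2, _, h4⟩ => ⟨g, h, h1, h2, h4⟩

lemma pat_add {a b : A} (h : Disjoint a.support b.support) : pat (a + b) = pat a + pat b := by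
  refine Finsupp.ext fun j => ?_
  rw [Finsupp.add_apply, pat_apply, pat_apply, pat_apply, Finsupp.add_apply]
  by_cases ha : a j = 0
  · simp [ha]
  · have : b j = 0 := by
      by_contra hb
      exact Finset.disjoint_left.1 h (Finsupp.mem_support_iff.2 ha) (Finsupp.mem_support_iff.2 hb)
    simp [this]

lemma support_subset_of_pat_add {g h a : A} (e : pat g + pat h = pat a) :
    g.support ⊆ a.support ∧ h.support ⊆ a.support := by
  have := congrArg Finsupp.support e
  rw [support_add_nat, support_pat, support_pat, support_pat] at this
  exact ⟨this ▸ Finset.subset_union_left, this ▸ Finset.subset_union_right⟩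

lemma support_add_of_disjoint {a b : A} (h : Disjoint a.support b.support) :
    (a + b).support = a.support ∪ b.support := Finsupp.support_add_eq h

lemma tensorBad_mul {a b : A} (hd : Disjoint a.support b.support) {t t' : P ⊗[k] P}
    (ht : t ∈ tensorBad a) (ht' : t' ∈ tensorMon b) : t * t' ∈ tensorBad (a + b) := by
  have h := Submodule.mul_mem_mul ht ht'
  rw [tensorBad, tensorMon, Submodule.span_mul_span] at h
  refine Submodule.span_mono ?_ h
  rintro _ ⟨_, ⟨g, h, h1, h2, ⟨n, hn, m, hm, hmn⟩, rfl⟩, _, ⟨g', h', h1', h2', rfl⟩, rfl⟩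
  obtain ⟨s1, s2⟩ := support_subset_of_pat_add h1
  obtain ⟨s1', s2'⟩ := support_subset_of_pat_add h1'
  have d1 : Disjoint g.support g'.support := hd.mono s1 s1'
  have d2 : Disjoint h.support h'.support := hd.mono s2 s2'
  refine ⟨g + g', h + h', ?_, ?_, ⟨n, ?_, m, ?_, hmn⟩, ?_⟩
  · rw [pat_add d1, pat_add d2, pat_add hd, ← h1, ← h1']; abel
  · rw [expo_add d1, expo_add d2, expo_add hd, ← h2, ← h2']; abel
  · rw [support_add_of_disjoint d1]; exact Finset.mem_union_left _ hn
  · rw [support_add_of_disjoint d2]; exact Finset.mem_union_left _ hm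
  · simp only [Algebra.TensorProduct.tmul_mul_tmul]
    rw [mon_add d1, mon_add d2]

lemma tensorBad_mul' {a b : A} (hd : Disjoint a.support b.support) {t t' : P ⊗[k] P}
    (ht : t ∈ tensorMon a) (ht' : t' ∈ tensorBad b) : t * t' ∈ tensorBad (a + b) := by
  rw [mul_comm, add_comm]; exact tensorBad_mul hd.symm ht' ht

/-- The part of `a` below `t`. -/
def below (a : A) (t : ℕ) : A := a.filter (· < t)

/-- The part of `a` from `t` on. -/
def from' (a : A) (t : ℕ) : A := a.filter (t ≤ ·)

lemma below_add_from (a : A) (t : ℕ) : below a t + from' a t = a := by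
  have := Finsupp.filter_add_filter_not a (· < t)
  simpa [below, from', not_lt] using this

lemma mem_support_below {a : A} {t j : ℕ} : j ∈ (below a t).support ↔ j ∈ a.support ∧ j < t := by
  rw [below, Finsupp.support_filter, Finset.mem_filter]

lemma mem_support_from {a : A} {t j : ℕ} : j ∈ (from' a t).support ↔ j ∈ a.support ∧ t ≤ j := by
  rw [from', Finsupp.support_filter, Finset.mem_filter]

lemma disjoint_below_from (a : A) (t : ℕ) : Disjoint (below a t).support (from' a t).support :=
  Finset.disjoint_left.2 fun j h h' => by
    have := (mem_support_below.1 h).2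
    have := (mem_support_from.1 h').2
    omega

/-- The sum of the ordered splittings of `mon a`. -/
def cuts (a : A) : P ⊗[k] P :=
  mon a ⊗ₜ 1 + ∑ t ∈ a.support, mon (below a t) ⊗ₜ mon (from' a t)

lemma primComul_X (n : ℕ) :
    primComul (MvPolynomial.X n) = MvPolynomial.X n ⊗ₜ 1 + 1 ⊗ₜ MvPolynomial.X n := by
  rw [primComul, MvPolynomial.aeval_X]

lemma sum_sub_sub_mem {ι M : Type*} [AddCommGroup M] [Module k M] {N : Submodule k M} [DecidableEq ι]
    {s : Finset ι} {f : ι → M} {i j : ι} (hi : i ∈ s) (hj : j ∈ s) (hij : i ≠ j)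
    (h : ∀ l ∈ s, l ≠ i → l ≠ j → f l ∈ N) : ∑ l ∈ s, f l - f i - f j ∈ N := by
  rw [← Finset.add_sum_erase s f hi, ← Finset.add_sum_erase (s.erase i) f
    (Finset.mem_erase.2 ⟨hij.symm, hj⟩)]
  have : ∑ l ∈ (s.erase i).erase j, f l ∈ N := sum_mem fun l hl => by
    rw [Finset.mem_erase, Finset.mem_erase] at hl
    exact h l hl.2.2 hl.2.1 hl.1
  convert this using 1
  abel

lemma expo_single (j : ℕ) (c : ℕ × Fin 3) : expo 0 (Finsupp.single j c) =
    Finsupp.single j (3 * c.1) + Finsupp.single (j + 1) (c.2 : ℕ) := by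
  refine Finsupp.ext fun i => ?_
  cases i with
  | zero => rcases j with _ | j <;> simp [expo_zero]
  | succ i =>
    rw [expo_succ, Finsupp.add_apply]
    simp only [Finsupp.single_apply]
    by_cases h1 : j = i + 1 <;> by_cases h2 : j = i <;> simp [h1, h2]

lemma pat_single (j : ℕ) (c : ℕ × Fin 3) :
    pat (Finsupp.single j c) = Finsupp.single j (c.1 + (c.2 : ℕ)) := by
  refine Finsupp.ext fun i => ?_
  rw [pat_apply, Finsupp.single_apply, Finsupp.single_apply]
  split_ifs <;> simp

lemma primComul_single (j : ℕ) {c : ℕ × Fin 3} (hc : c ≠ 0) :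
    primComul (mon (Finsupp.single j c)) - mon (Finsupp.single j c) ⊗ₜ 1 -
      1 ⊗ₜ mon (Finsupp.single j c) ∈ tensorBad (Finsupp.single j c) := by
  obtain ⟨q, r⟩ := c
  have hx : primComul ((MvPolynomial.X j ^ 3) ^ q) = ∑ i ∈ Finset.range (q + 1),
      (q.choose i : k) • (((MvPolynomial.X j ^ 3) ^ i : P) ⊗ₜ[k] ((MvPolynomial.X j ^ 3) ^ (q - i) : P)) := by
    have h3 : ((MvPolynomial.X j : P) ⊗ₜ[k] (1 : P) + (1 : P) ⊗ₜ[k] (MvPolynomial.X j : P)) ^ 3 =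
        (MvPolynomial.X j ^ 3 : P) ⊗ₜ[k] (1 : P) + (1 : P) ⊗ₜ[k] (MvPolynomial.X j ^ 3 : P) := by
      rw [add_pow_char, Algebra.TensorProduct.tmul_pow, Algebra.TensorProduct.tmul_pow, one_pow]
    rw [map_pow, map_pow, primComul_X, h3, add_pow]
    refine Finset.sum_congr rfl fun i _ => ?_
    rw [Algebra.TensorProduct.tmul_pow, Algebra.TensorProduct.tmul_pow,
      Algebra.TensorProduct.tmul_mul_tmul, one_pow, one_pow, one_mul, mul_one, mul_comm,
      ← nsmul_eq_mul, Nat.cast_smul_eq_nsmul]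
  have hy : primComul (MvPolynomial.X (j + 1) ^ (r : ℕ)) = ∑ l ∈ Finset.univ.filter (· ≤ r),
      ((r : ℕ).choose l : k) • ((MvPolynomial.X (j + 1) ^ (l : ℕ) : P) ⊗ₜ[k]
        (MvPolynomial.X (j + 1) ^ ((r - l : Fin 3) : ℕ) : P)) := by
    rw [map_pow, primComul_X, Finset.sum_filter, Fin.sum_univ_three]
    fin_cases r
    · simp [Algebra.TensorProduct.one_def]
    · simp [add_comm]
    · simp [show (2 : Fin 3) - 1 = 1 from rfl, pow_two, mul_add, add_mul, two_smul]
      abel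
  set f : ℕ × Fin 3 → P ⊗[k] P := fun p => ((q.choose p.1 : k) * ((r : ℕ).choose p.2 : k)) •
    (mon (Finsupp.single j p) ⊗ₜ mon (Finsupp.single j (q - p.1, r - p.2))) with hf
  have hsum : primComul (mon (Finsupp.single j (q, r))) =
      ∑ p ∈ Finset.range (q + 1) ×ˢ Finset.univ.filter (· ≤ r), f p := by
    rw [mon_single, map_mul, hx, hy, Finset.sum_mul_sum, Finset.sum_product]
    refine Finset.sum_congr rfl fun i _ => Finset.sum_congr rfl fun l _ => ?_
    rw [hf]
    simp only
    rw [mon_single, mon_single, smul_mul_smul_comm, Algebra.TensorProduct.tmul_mul_tmul]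
  have h1 : f (q, r) = mon (Finsupp.single j (q, r)) ⊗ₜ 1 := by
    rw [hf]; simp [mon_zero, show ((0 : ℕ), (0 : Fin 3)) = 0 from rfl]
  have h2 : f (0, 0) = 1 ⊗ₜ mon (Finsupp.single j (q, r)) := by
    rw [hf]; simp [mon_zero, show ((0 : ℕ), (0 : Fin 3)) = 0 from rfl]
  rw [hsum, ← h1, ← h2]
  classical
  refine sum_sub_sub_mem (by simp) (by simp) hc ?_
  rintro ⟨i, l⟩ hp hne hne'
  rw [Finset.mem_product, Finset.mem_range, Finset.mem_filter] at hp
  obtain ⟨hi, -, hl⟩ := hp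
  simp only at hi hl
  have hl' : ((r - l : Fin 3) : ℕ) + l = r := by rw [Fin.sub_val_of_le hl]; exact Nat.sub_add_cancel hl
  have hn1 : ((i, l) : ℕ × Fin 3) ≠ 0 := hne'
  have hn2 : ((q - i, r - l) : ℕ × Fin 3) ≠ 0 := by
    intro h
    have e1 : q - i = 0 := congrArg Prod.fst h
    have e2 : r - l = 0 := congrArg Prod.snd h
    refine hne (Prod.ext ?_ ?_)
    · simp only; omega
    · exact (sub_eq_zero.1 e2).symm
  refine Submodule.smul_mem _ _ (Submodule.subset_span ⟨_, _, ?_, ?_, ⟨j, ?_, j, ?_, le_rfl⟩, rfl⟩)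
  · rw [pat_single, pat_single, pat_single, ← Finsupp.single_add]
    congr 1
    simp only; omega
  · rw [expo_single, expo_single, expo_single]
    simp only
    rw [add_add_add_comm, ← Finsupp.single_add, ← Finsupp.single_add]
    congr 2 <;> omega
  · rw [Finsupp.support_single _ hn1]; simp
  · rw [Finsupp.support_single _ hn2]; simp

lemma pat_zero : pat 0 = 0 := Finsupp.ext fun j => by simp [pat_apply]

lemma expo_zero_zero : expo 0 0 = 0 := Finsupp.ext fun i => by cases i <;> simp [expo_zero, expo_succ]

lemma mon_tmul_one_mem (a : A) : mon a ⊗ₜ 1 ∈ tensorMon a :=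
  Submodule.subset_span ⟨a, 0, by simp [pat_zero], by simp [expo_zero_zero], by rw [mon_zero]⟩

lemma one_tmul_mon_mem (a : A) : 1 ⊗ₜ mon a ∈ tensorMon a :=
  Submodule.subset_span ⟨0, a, by simp [pat_zero], by simp [expo_zero_zero], by rw [mon_zero]⟩

lemma cuts_mem (a : A) : cuts a ∈ tensorMon a :=
  add_mem (mon_tmul_one_mem a) (sum_mem fun t _ => Submodule.subset_span ⟨below a t, from' a t,
    by rw [← pat_add (disjoint_below_from a t), below_add_from],
    by rw [← expo_add (disjoint_below_from a t), below_add_from], rfl⟩)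

lemma primComul_mon_sub_cuts (a : A) : primComul (mon a) - cuts a ∈ tensorBad a := by
  induction a using Finsupp.induction_on_max₂ with
  | zero => simp [cuts, mon_zero, Algebra.TensorProduct.one_def]
  | add_single t c a ht hc ih =>
    have hta : t ∉ a.support := fun h => lt_irrefl t (ht t h)
    have hd : Disjoint a.support (Finsupp.single t c).support :=
      Finset.disjoint_left.2 fun i hi hi' => by
        have := Finsupp.support_single_subset hi'
        rw [Finset.mem_singleton] at this
        exact hta (this ▸ hi)
    have hs : (a + Finsupp.single t c).support = insert t a.support := by
      rw [Finsupp.support_add_eq hd, Finsupp.support_single _ hc, Finset.union_comm]; rfl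
    have hb : ∀ i ∈ a.support, below (a + Finsupp.single t c) i = below a i ∧
        from' (a + Finsupp.single t c) i = from' a i + Finsupp.single t c := by
      intro i hi
      have := ht i hi
      constructor
      · rw [below, Finsupp.filter_add, Finsupp.filter_single_of_neg _ (by omega), add_zero]; rfl
      · rw [from', Finsupp.filter_add, Finsupp.filter_single_of_pos _ (by omega)]; rfl
    have hbt : below (a + Finsupp.single t c) t = a ∧
        from' (a + Finsupp.single t c) t = Finsupp.single t c := by
      constructor
      · rw [below, Finsupp.filter_add, Finsupp.filter_single_of_neg _ (by omega), add_zero,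
          Finsupp.filter_eq_self_iff]
        intro i hi
        exact ht i (Finsupp.mem_support_iff.2 hi)
      · rw [from', Finsupp.filter_add, Finsupp.filter_single_of_pos _ le_rfl]
        rw [(Finsupp.filter_eq_zero_iff _ _).2, zero_add]
        intro i hi
        by_contra h
        have := ht i (Finsupp.mem_support_iff.2 h)
        omega
    have hcut : cuts (a + Finsupp.single t c) = cuts a * (1 ⊗ₜ mon (Finsupp.single t c)) +
        mon (a + Finsupp.single t c) ⊗ₜ 1 := by
      rw [cuts, cuts, hs, Finset.sum_insert hta, hbt.1, hbt.2, add_mul, Finset.sum_mul,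
        Algebra.TensorProduct.tmul_mul_tmul, mul_one, one_mul]
      rw [Finset.sum_congr rfl fun i hi => by
        rw [(hb i hi).1, (hb i hi).2, mon_add (hd.mono_left (by
          rw [from', Finsupp.support_filter]; exact Finset.filter_subset _ _))]]
      simp only [Algebra.TensorProduct.tmul_mul_tmul, mul_one]
      abel
    have hbad : cuts a * (mon (Finsupp.single t c) ⊗ₜ 1) - mon (a + Finsupp.single t c) ⊗ₜ 1 ∈
        tensorBad (a + Finsupp.single t c) := by
      rw [cuts, add_mul, Algebra.TensorProduct.tmul_mul_tmul, mul_one, ← mon_add hd,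
        add_sub_cancel_left, Finset.sum_mul]
      refine sum_mem fun i hi => ?_
      have hd' : Disjoint (below a i).support (Finsupp.single t c).support := hd.mono_left (by
        rw [below, Finsupp.support_filter]; exact Finset.filter_subset _ _)
      rw [Algebra.TensorProduct.tmul_mul_tmul, mul_one, ← mon_add hd']
      refine Submodule.subset_span ⟨_, _, ?_, ?_, ⟨t, ?_, i, ?_, (ht i hi).le⟩, rfl⟩
      · rw [pat_add hd', add_right_comm, ← pat_add (disjoint_below_from a i), below_add_from, pat_add hd]
      · rw [expo_add hd', add_right_comm, ← expo_add (disjoint_below_from a i), below_add_from,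
          expo_add hd]
      · rw [support_add_of_disjoint hd', Finsupp.support_single _ hc]
        exact Finset.mem_union_right _ (Finset.mem_singleton_self t)
      · exact mem_support_from.2 ⟨hi, le_rfl⟩
    have h1 : primComul (mon a) * (primComul (mon (Finsupp.single t c)) -
        mon (Finsupp.single t c) ⊗ₜ 1 - 1 ⊗ₜ mon (Finsupp.single t c)) ∈
          tensorBad (a + Finsupp.single t c) := by
      refine tensorBad_mul' hd ?_ (primComul_single t hc)
      have := add_mem (tensorBad_le _ ih) (cuts_mem a)
      simpa using this
    have h2 : (primComul (mon a) - cuts a) * (mon (Finsupp.single t c) ⊗ₜ 1 +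
        1 ⊗ₜ mon (Finsupp.single t c)) ∈ tensorBad (a + Finsupp.single t c) :=
      tensorBad_mul hd ih (add_mem (mon_tmul_one_mem _) (one_tmul_mon_mem _))
    have := add_mem (add_mem h1 h2) hbad
    convert this using 1
    rw [hcut, mon_add hd, map_mul]
    ring

lemma cns₂_cuts (a : A) (x : BWords) :
    cns₂ (cuts a) x = ∑ t ∈ a.support, cns (below a t) (cns (from' a t) x) := by
  have h1 : cnsP (1 : P) = 0 := by rw [← mon_zero, cnsP_mon, cns_zero]
  rw [cuts, map_add, map_sum, LinearMap.add_apply, LinearMap.sum_apply, cns₂_tmul, h1]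
  simp [cns₂_tmul, cnsP_mon]

lemma cns₂_xi_mul (r : ℕ) (hr : r = 1 ∨ r = 2) (a : A) (x : BWords) :
    cns₂ (primComul (xi 1 ^ r * mon a)) x = 0 := by
  have hm : primComul (mon a) ∈ tensorMon a := by
    have := add_mem (tensorBad_le _ (primComul_mon_sub_cuts a)) (cuts_mem a)
    simpa using this
  have : tensorMon a ≤ LinearMap.ker (LinearMap.applyₗ x ∘ₗ cns₂ ∘ₗ
      LinearMap.mulLeft k (primComul (xi 1) ^ r)) := by
    refine Submodule.span_le.2 ?_
    rintro _ ⟨g, h, -, -, rfl⟩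
    rw [SetLike.mem_coe, LinearMap.mem_ker, LinearMap.comp_apply, LinearMap.comp_apply,
      LinearMap.applyₗ_apply_apply, LinearMap.mulLeft_apply]
    rw [xi_one, primComul_X, ← xi_one]
    rcases hr with rfl | rfl
    · rw [pow_one, add_mul, Algebra.TensorProduct.tmul_mul_tmul, Algebra.TensorProduct.tmul_mul_tmul,
        map_add, LinearMap.add_apply, cns₂_tmul, cns₂_tmul, cnsP_xi_mul_mon, cnsP_xi_mul_mon]
      simp
    · rw [pow_two, add_mul, mul_add, mul_add, add_mul, add_mul, add_mul]
      simp only [Algebra.TensorProduct.tmul_mul_tmul, one_mul, mul_one, ← pow_two, map_add,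
        LinearMap.add_apply, cns₂_tmul, cnsP_xi_mul_mon]
      simp only [Algebra.TensorProduct.tmul_pow, one_pow, Algebra.TensorProduct.tmul_mul_tmul, one_mul,
        cns₂_tmul, cnsP_xi_sq_mul_mon]
      simp
  rw [map_mul, map_pow]
  exact this hm

/-- The leading term of the differential. -/
lemma deltaN_cons (a : BLetter) (w : List BLetter) :
    deltaN (bword (a :: w)) - ∑ t ∈ a.1.support, cns (below a.1 t) (cns (from' a.1 t) (bword w)) +
      cns a.1 (deltaN (bword w)) ∈ bSpan (Above (a :: w)) := by
  obtain ⟨a, ha⟩ := a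
  have hX : ∀ (r : Fin 3) (u : List BLetter), wpat u = wpat w → wdeg u + 2 * r = wdeg w →
      cns₂ (comul (xi 1 ^ (r : ℕ) * mon a) - primComul (xi 1 ^ (r : ℕ) * mon a)) (bword u) ∈
        bSpan (Above (⟨a, ha⟩ :: w)) := by
    intro r u hp hdeg
    have h := (monomial_comul_mem (expo r a)).2.2
    rw [monomial_expo] at h
    refine bSpan_mono ?_ (cns₂_tensorFilt_mem h u)
    rintro _ ⟨b, c, rfl, hD, hw⟩
    have e1 : expoDeg (expo r a) = 2 * r + expoDeg (expo 0 a) := by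
      rw [expo_eq, map_add, expoDeg_single]; ring
    have e2 : expoWt (expo r a) = r + 3 * patWt (pat a) := by
      rw [expo_eq, map_add, expoWt_single, expoWt_expo]; ring
    rw [e1] at hD
    rw [e2] at hw
    refine ⟨by simp [wpat_length hp], ?_, Or.inl ?_⟩
    · simp only [wdeg_cons]; omega
    · simp only [wpat_cons, pWt_cons, hp]; omega
  have h0 := hX 0 w rfl (by simp)
  have h1 : cns₂ (comul (xi 1 * mon a)) (pdN (bword w)) ∈ bSpan (Above (⟨a, ha⟩ :: w)) := by
    rw [pdN_bword]
    refine map_mem_of_bwords (fun u hu => ?_) (pdWord_mem w)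
    have := hX 1 u hu.1 (by simpa using hu.2)
    rw [map_sub, LinearMap.sub_apply, cns₂_xi_mul _ (Or.inl (by simp)), sub_zero] at this
    simpa using this
  have h2 : cns₂ (comul (xi 1 ^ 2 * mon a)) (pdN (pdN (bword w))) ∈ bSpan (Above (⟨a, ha⟩ :: w)) := by
    rw [pdN_bword]
    have : pdN (pdWord w) ∈ bSpan {u | wpat u = wpat w ∧ wdeg u + 4 = wdeg w} := by
      refine map_mem_of_bwords (fun u hu => ?_) (pdWord_mem w)
      rw [pdN_bword]
      refine bSpan_mono ?_ (pdWord_mem u)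
      rintro v ⟨hv, hv'⟩
      obtain ⟨hu, hu'⟩ := hu
      exact ⟨hv.trans hu, by omega⟩
    refine map_mem_of_bwords (fun u hu => ?_) this
    have := hX 2 u hu.1 (by simpa using hu.2)
    rw [map_sub, LinearMap.sub_apply, cns₂_xi_mul _ (Or.inr (by simp)), sub_zero] at this
    simpa using this
  have h3 := cns₂_tensorBad_mem ha (primComul_mon_sub_cuts a) w
  rw [← cns_bword ha, deltaN_cns ha, ← cns₂_cuts]
  have := sub_mem (add_mem (add_mem h0 h3) h1) h2
  convert this using 1
  simp only [map_sub, LinearMap.sub_apply, Fin.val_zero, pow_zero, one_mul]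
  abel

/-! The leading term of the differential and its contraction. -/

/-- The leading term of the differential, on words. -/
def leadWord : List BLetter → BWords
  | [] => 0
  | a :: w => ∑ t ∈ a.1.support, cns (below a.1 t) (cns (from' a.1 t) (bword w)) - cns a.1 (leadWord w)

/-- The leading term of the differential. -/
def leadN : BWords →ₗ[k] BWords := Finsupp.linearCombination k leadWord

@[simp] lemma leadN_bword (w : List BLetter) : leadN (bword w) = leadWord w := by simp [leadN]

lemma leadN_cns (a : A) (x : BWords) : leadN (cns a x) =
    ∑ t ∈ a.support, cns (below a t) (cns (from' a t) x) - cns a (leadN x) := by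
  by_cases h : a = 0
  · subst h; simp [cns_zero]
  · refine (bwords_ext (leadN ∘ₗ cns a) (∑ t ∈ a.support, cns (below a t) ∘ₗ cns (from' a t) -
      cns a ∘ₗ leadN) (fun w => ?_) x).trans ?_
    · simp only [LinearMap.comp_apply, LinearMap.sub_apply, LinearMap.sum_apply, cns_bword h,
        leadN_bword]
      rfl
    · simp only [LinearMap.comp_apply, LinearMap.sub_apply, LinearMap.sum_apply]

lemma deltaN_sub_leadN (w : List BLetter) : deltaN (bword w) - leadN (bword w) ∈ bSpan (Above w) := by
  induction w with
  | nil => simp [leadWord]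
  | cons a w ih =>
    have h : cns a.1 (deltaN (bword w) - leadN (bword w)) ∈ bSpan (Above (a :: w)) :=
      map_mem_of_bwords (fun u hu => by
        rw [cns_bword a.2]; exact bword_mem (cons_mem_above a hu)) ih
    have := sub_mem (deltaN_cons a w) h
    convert this using 1
    rw [← cns_bword a.2 w, leadN_cns, map_sub]
    abel

/-- All elements of the first support are below all elements of the second. -/
def Asc (a b : A) : Prop := ∀ n ∈ a.support, ∀ m ∈ b.support, n < m

open Classical in
/-- The contraction, on words: merge the first ascent if all letters before it are powers. -/
def etaWord : List BLetter → BWords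
  | [] => 0
  | [_] => 0
  | a :: b :: w =>
    if a.1.support.card = 1 then
      if Asc a.1 b.1 then cns (a.1 + b.1) (bword w) else -cns a.1 (etaWord (b :: w))
    else 0

/-- The contraction. -/
def etaN : BWords →ₗ[k] BWords := Finsupp.linearCombination k etaWord

@[simp] lemma etaN_bword (w : List BLetter) : etaN (bword w) = etaWord w := by simp [etaN]

lemma etaN_cns_nil (a : A) : etaN (cns a (bword [])) = 0 := by
  by_cases h : a = 0
  · simp [h, cns_zero]
  · rw [cns_bword h, etaN_bword, etaWord]

lemma etaN_cns_of_card_ne {a : A} (h : a.support.card ≠ 1) (x : BWords) : etaN (cns a x) = 0 := by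
  by_cases ha : a = 0
  · simp [ha, cns_zero]
  refine bwords_ext (etaN ∘ₗ cns a) 0 (fun w => ?_) x
  rw [LinearMap.comp_apply, cns_bword ha, etaN_bword]
  cases w with
  | nil => rw [etaWord]; rfl
  | cons b w => rw [etaWord, if_neg h]; rfl

lemma etaN_cns_cns_of_asc {a b : A} (h : a.support.card = 1) (hb : b ≠ 0) (hab : Asc a b) (x : BWords) :
    etaN (cns a (cns b x)) = cns (a + b) x := by
  have ha : a ≠ 0 := by rintro rfl; simp at h
  refine bwords_ext (etaN ∘ₗ cns a ∘ₗ cns b) (cns (a + b)) (fun w => ?_) x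
  rw [LinearMap.comp_apply, LinearMap.comp_apply, cns_bword hb, cns_bword ha, etaN_bword, etaWord,
    if_pos h, if_pos hab]

lemma etaN_cns_cns_of_not_asc {a b : A} (h : a.support.card = 1) (hab : ¬ Asc a b)
    (x : BWords) : etaN (cns a (cns b x)) = -cns a (etaN (cns b x)) := by
  have ha : a ≠ 0 := by rintro rfl; simp at h
  have hb : b ≠ 0 := by rintro rfl; exact hab fun n _ m hm => by simp at hm
  refine bwords_ext (etaN ∘ₗ cns a ∘ₗ cns b) (-cns a ∘ₗ etaN ∘ₗ cns b) (fun w => ?_) x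
  simp only [LinearMap.comp_apply, LinearMap.neg_apply]
  rw [cns_bword hb, cns_bword ha, etaN_bword, etaWord, if_pos h, if_neg hab, etaN_bword]

/-- The words on which the contraction vanishes and that are not hit by it. -/
def Crit : List BLetter → Prop
  | [] => True
  | [a] => a.1.support.card = 1
  | a :: b :: w => a.1.support.card = 1 ∧ ¬ Asc a.1 b.1 ∧ Crit (b :: w)

lemma Crit.card {w : List BLetter} (h : Crit w) : ∀ a ∈ w, a.1.support.card = 1 := by
  induction w with
  | nil => simp
  | cons a w ih =>
    cases w with
    | nil =>
      intro b hb
      rw [List.mem_singleton] at hb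
      subst hb; exact h
    | cons b w =>
      obtain ⟨h1, -, h3⟩ := h
      intro c hc
      rcases List.mem_cons.1 hc with rfl | hc
      · exact h1
      · exact ih h3 c hc

lemma card_filter_card (S : Finset ℕ) (c : ℕ) :
    (S.filter fun t => (S.filter (· < t)).card = c).card = if c < S.card then 1 else 0 := by
  induction S using Finset.induction_on_max with
  | empty => simp
  | insert m S hm ih =>
    have hmS : m ∉ S := fun h => lt_irrefl m (hm m h)
    have h1 : ∀ t ∈ S, (insert m S).filter (· < t) = S.filter (· < t) := by
      intro t ht
      rw [Finset.filter_insert, if_neg (by have := hm t ht; omega)]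
    have h2 : (insert m S).filter (· < m) = S := by
      rw [Finset.filter_insert, if_neg (lt_irrefl m), Finset.filter_true_of_mem hm]
    rw [Finset.filter_insert, h2, Finset.filter_congr fun t ht => by rw [h1 t ht],
      Finset.card_insert_of_notMem hmS]
    split_ifs with h3 h4 h4
    · rw [Finset.card_insert_of_notMem (by simp [hmS]), ih, if_neg (by omega)]
    · omega
    · rw [ih, if_pos (by omega)]
    · rw [ih, if_neg (by omega)]

lemma support_below (a : A) (t : ℕ) : (below a t).support = a.support.filter (· < t) := by
  rw [below, Finsupp.support_filter]

lemma sum_below_card (a : A) (c : ℕ) (x : BWords) :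
    ∑ t ∈ a.support, (if (below a t).support.card = c then x else 0) =
      if c < a.support.card then x else 0 := by
  rw [← Finset.sum_filter, Finset.sum_const, Finset.filter_congr fun t _ => by rw [support_below],
    card_filter_card]
  split_ifs <;> simp

lemma from_ne_zero {a : A} {t : ℕ} (ht : t ∈ a.support) : from' a t ≠ 0 := fun h => by
  have : t ∈ (from' a t).support := mem_support_from.2 ⟨ht, le_rfl⟩
  rw [h] at this; simp at this

lemma asc_below_from (a : A) (t : ℕ) : Asc (below a t) (from' a t) := fun _ hn _ hm =>
  lt_of_lt_of_le (mem_support_below.1 hn).2 (mem_support_from.1 hm).2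

lemma etaN_cuts (a : A) (x : BWords) :
    etaN (∑ t ∈ a.support, cns (below a t) (cns (from' a t) x)) =
      if 1 < a.support.card then cns a x else 0 := by
  rw [map_sum, ← sum_below_card]
  refine Finset.sum_congr rfl fun t ht => ?_
  split_ifs with h
  · rw [etaN_cns_cns_of_asc h (from_ne_zero ht) (asc_below_from a t), below_add_from]
  · exact etaN_cns_of_card_ne h _

lemma leadN_cns_of_card_eq {a : A} (h : a.support.card = 1) (x : BWords) :
    leadN (cns a x) = -cns a (leadN x) := by
  rw [leadN_cns, Finset.sum_eq_zero, zero_sub]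
  intro t ht
  have : below a t = 0 := by
    rw [← Finsupp.support_eq_empty, support_below, Finset.filter_eq_empty_iff]
    intro j hj
    rw [Finset.card_eq_one] at h
    obtain ⟨n, hn⟩ := h
    rw [hn, Finset.mem_singleton] at ht hj
    omega
  rw [this, cns_zero]; rfl

lemma below_add_of_asc {a b : A} (hab : Asc a b) {t : ℕ} (ht : t ∈ b.support) :
    below (a + b) t = a + below b t ∧ from' (a + b) t = from' b t := by
  constructor
  · rw [below, Finsupp.filter_add]
    congr 1
    rw [Finsupp.filter_eq_self_iff]
    intro i hi
    exact hab i (Finsupp.mem_support_iff.2 hi) t ht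
  · rw [from', Finsupp.filter_add, (Finsupp.filter_eq_zero_iff _ _).2, zero_add]
    · rfl
    · intro i hi
      by_contra h
      have := hab i (Finsupp.mem_support_iff.2 h) t ht
      omega

lemma Asc.disjoint {a b : A} (h : Asc a b) : Disjoint a.support b.support :=
  Finset.disjoint_left.2 fun n hn hn' => lt_irrefl n (h n hn n hn')

lemma leadN_cns_add {a b : A} (h : a.support.card = 1) (hab : Asc a b) (x : BWords) :
    leadN (cns (a + b) x) =
      ∑ t ∈ b.support, cns (a + below b t) (cns (from' b t) x) - cns (a + b) (leadN x) := by
  rw [leadN_cns, support_add_of_disjoint hab.disjoint, Finset.sum_union hab.disjoint,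
    Finset.sum_eq_zero (s := a.support), zero_add]
  · congr 1
    refine Finset.sum_congr rfl fun t ht => ?_
    rw [(below_add_of_asc hab ht).1, (below_add_of_asc hab ht).2]
  · intro t ht
    have : below (a + b) t = 0 := by
      rw [← Finsupp.support_eq_empty, support_below, Finset.filter_eq_empty_iff,
        support_add_of_disjoint hab.disjoint]
      intro j hj
      rw [Finset.card_eq_one] at h
      obtain ⟨n, hn⟩ := h
      have htn : t = n := by rwa [hn, Finset.mem_singleton] at ht
      rcases Finset.mem_union.1 hj with hj | hj
      · rw [hn, Finset.mem_singleton] at hj; omega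
      · have := hab t ht j hj; omega
    rw [this, cns_zero]; rfl

lemma not_asc_below {a b : A} (hab : ¬ Asc a b) {t : ℕ} (h : below b t ≠ 0) : ¬ Asc a (below b t) := by
  intro h'
  refine hab fun n hn m hm => ?_
  by_cases hmt : m < t
  · exact h' n hn m (mem_support_below.2 ⟨hm, hmt⟩)
  · obtain ⟨j, hj⟩ := Finsupp.support_nonempty_iff.2 h
    have h1 := h' n hn j hj
    have h2 := (mem_support_below.1 hj).2
    omega

open Classical in
/-- The contraction is a homotopy from the identity to zero off the critical words. -/
lemma leadN_etaN_add (w : List BLetter) :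
    leadN (etaN (bword w)) + etaN (leadN (bword w)) = if Crit w then 0 else bword w := by
  induction w with
  | nil => simp [etaWord, leadWord, Crit]
  | cons a w ih =>
    by_cases h : a.1.support.card = 1
    · have hn : ¬ 1 < a.1.support.card := by omega
      rcases w with _ | ⟨b, w⟩
      · rw [if_pos (show Crit [a] from h), ← cns_bword a.2, leadN_cns_of_card_eq h, etaN_cns_nil]
        simp [leadWord]
      · by_cases hab : Asc a.1 b.1
        · rw [if_neg fun hc => hc.2.1 hab]
          rw [← cns_bword a.2, ← cns_bword b.2, etaN_cns_cns_of_asc h b.2 hab, leadN_cns_add h hab,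
            leadN_cns_of_card_eq h, leadN_cns, map_sub, map_neg, map_sub,
            etaN_cns_cns_of_asc h b.2 hab, map_sum, map_sum]
          have key : ∀ t ∈ b.1.support, etaN (cns a.1 (cns (below b.1 t) (cns (from' b.1 t) (bword w)))) =
              cns (a.1 + below b.1 t) (cns (from' b.1 t) (bword w)) -
                (if (below b.1 t).support.card = 0 then cns a.1 (cns b.1 (bword w)) else 0) := by
            intro t _
            by_cases h0 : below b.1 t = 0
            · have hf : from' b.1 t = b.1 := by
                have := below_add_from b.1 t
                rwa [h0, zero_add] at this
              rw [if_pos (by rw [h0]; simp), h0, hf, cns_zero]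
              simp
            · rw [if_neg (by rwa [Finset.card_eq_zero, Finsupp.support_eq_empty]), sub_zero]
              refine etaN_cns_cns_of_asc h h0 (fun n hn m hm => hab n hn m ?_) _
              exact (mem_support_below.1 hm).1
          rw [Finset.sum_congr rfl key, Finset.sum_sub_distrib, sum_below_card, if_pos
            (Finset.card_pos.2 (Finsupp.support_nonempty_iff.2 b.2))]
          abel
        · have hc : Crit (a :: b :: w) ↔ Crit (b :: w) :=
            ⟨fun hc => hc.2.2, fun hc => ⟨h, hab, hc⟩⟩
          have key : etaN (cns a.1 (leadN (bword (b :: w)))) =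
              -cns a.1 (etaN (leadN (bword (b :: w)))) := by
            rw [← cns_bword b.2, leadN_cns]
            simp only [map_sub, map_sum, etaN_cns_cns_of_not_asc h hab]
            rw [Finset.sum_congr rfl fun t _ => show _ =
              -cns a.1 (etaN (cns (below b.1 t) (cns (from' b.1 t) (bword w)))) from ?_]
            · rw [Finset.sum_neg_distrib]; abel
            · by_cases h0 : below b.1 t = 0
              · rw [h0, cns_zero]; simp
              · exact etaN_cns_cns_of_not_asc h (not_asc_below hab h0) _
          have e1 : etaN (bword (a :: b :: w)) = -cns a.1 (etaN (bword (b :: w))) := by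
            rw [← cns_bword a.2, ← cns_bword b.2, etaN_cns_cns_of_not_asc h hab]
          have e2 : leadN (bword (a :: b :: w)) = -cns a.1 (leadN (bword (b :: w))) := by
            rw [← cns_bword a.2, leadN_cns_of_card_eq h]
          rw [e1, e2, map_neg, map_neg, leadN_cns_of_card_eq h, key, neg_neg, neg_neg, ← map_add, ih]
          simp only [hc]
          split_ifs
          · simp
          · rw [cns_bword a.2]
    · have hn : 1 < a.1.support.card := by
        have := Finset.card_pos.2 (Finsupp.support_nonempty_iff.2 a.2)
        omega
      have hc : ¬ Crit (a :: w) := fun hc => h (hc.card a (List.mem_cons_self ..))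
      rw [if_neg hc, ← cns_bword a.2, etaN_cns_of_card_ne h, leadN_cns, map_sub, etaN_cuts, if_pos hn,
        etaN_cns_of_card_ne h]
      simp

lemma support_shift {a : A} {j : ℕ} (h : (a j).2 ≠ 0) : (shift a j).support = a.support := by
  rw [← support_pat, pat_shift h, support_pat]

lemma shift_add {a b : A} (h : Disjoint a.support b.support) {j : ℕ} (hj : j ∈ a.support) :
    shift (a + b) j = shift a j + b := by
  have hb : b j = 0 := Finsupp.notMem_support_iff.1 (Finset.disjoint_left.1 h hj)
  ext i : 1
  rw [shift, shift, Finsupp.add_apply, Finsupp.add_apply, Finsupp.update_apply, Finsupp.update_apply,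
    Finsupp.add_apply]
  split_ifs with hi
  · subst hi; simp [hb]
  · rfl

lemma pdN_etaN (x : BWords) : pdN (etaN x) = etaN (pdN x) := by
  refine bwords_ext (pdN ∘ₗ etaN) (etaN ∘ₗ pdN) (fun w => ?_) x
  simp only [LinearMap.comp_apply]
  induction w with
  | nil => simp [etaWord, pdWord]
  | cons a w ih =>
    have hz : ∀ {j : ℕ} {z z' : BWords}, ((a.1 j).2 ≠ 0 → z = z') →
        ((a.1 j).2.val : k) • z = ((a.1 j).2.val : k) • z' := by
      intro j z z' hzz
      by_cases h : (a.1 j).2 = 0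
      · rw [h]; simp
      · rw [hzz h]
    by_cases h : a.1.support.card = 1
    · rcases w with _ | ⟨b, w⟩
      · rw [← cns_bword a.2, etaN_cns_nil, pdN_cns, map_add, map_sum]
        simp [pdWord, etaN_cns_nil]
      · by_cases hab : Asc a.1 b.1
        · rw [← cns_bword a.2, ← cns_bword b.2, etaN_cns_cns_of_asc h b.2 hab, pdN_cns, pdN_cns,
            pdN_cns, support_add_of_disjoint hab.disjoint, Finset.sum_union hab.disjoint]
          simp only [map_add, map_sum, map_smul]
          rw [etaN_cns_cns_of_asc h b.2 hab, ← add_assoc]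
          congr 1
          congr 1
          · refine Finset.sum_congr rfl fun j hj => ?_
            have hb : b.1 j = 0 := Finsupp.notMem_support_iff.1 (Finset.disjoint_left.1 hab.disjoint hj)
            rw [Finsupp.add_apply, hb, add_zero]
            refine hz fun hr => ?_
            rw [shift_add hab.disjoint hj, etaN_cns_cns_of_asc (by rwa [support_shift hr]) b.2]
            intro n hn m hm
            rw [support_shift hr] at hn
            exact hab n hn m hm
          · refine Finset.sum_congr rfl fun j hj => ?_
            have ha : a.1 j = 0 :=
              Finsupp.notMem_support_iff.1 (Finset.disjoint_left.1 hab.disjoint.symm hj)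
            rw [Finsupp.add_apply, ha, zero_add]
            by_cases hr : (b.1 j).2 = 0
            · rw [hr]; simp
            · congr 1
              rw [add_comm a.1, shift_add hab.disjoint.symm hj, add_comm,
                etaN_cns_cns_of_asc h (shift_ne_zero _ _)]
              intro n hn m hm
              rw [support_shift hr] at hm
              exact hab n hn m hm
        · have e1 : etaN (bword (a :: b :: w)) = -cns a.1 (etaN (bword (b :: w))) := by
            rw [← cns_bword a.2, ← cns_bword b.2, etaN_cns_cns_of_not_asc h hab]
          have e2 : etaN (cns a.1 (pdN (bword (b :: w)))) = -cns a.1 (etaN (pdN (bword (b :: w)))) := by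
            rw [← cns_bword b.2, pdN_cns]
            simp only [map_add, map_sum, map_smul, etaN_cns_cns_of_not_asc h hab]
            rw [Finset.sum_congr rfl fun j _ => show _ =
              -(((b.1 j).2.val : k) • cns a.1 (etaN (cns (shift b.1 j) (bword w)))) from ?_]
            · rw [Finset.sum_neg_distrib]; abel
            · by_cases hr : (b.1 j).2 = 0
              · rw [hr]; simp
              · rw [etaN_cns_cns_of_not_asc h, smul_neg]
                intro h'
                refine hab fun n hn m hm => h' n hn m ?_
                rwa [support_shift hr]
          rw [e1, map_neg, pdN_cns, ih, ← cns_bword a.2, pdN_cns, map_add, e2, neg_add, map_sum,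
            ← Finset.sum_neg_distrib]
          congr 1
          refine Finset.sum_congr rfl fun j _ => ?_
          rw [map_smul, ← smul_neg]
          refine hz fun hr => ?_
          rw [← cns_bword b.2, etaN_cns_cns_of_not_asc (by rwa [support_shift hr])]
          intro h'
          refine hab fun n hn m hm => h' n ?_ m hm
          rwa [support_shift hr]
    · rw [← cns_bword a.2, etaN_cns_of_card_ne h, pdN_cns, map_add, etaN_cns_of_card_ne h, map_sum,
        map_zero, Finset.sum_eq_zero, add_zero]
      intro j _
      rw [map_smul]
      by_cases hr : (a.1 j).2 = 0
      · rw [hr]; simp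
      · rw [etaN_cns_of_card_ne (by rwa [support_shift hr]), smul_zero]

lemma crossInv_add_of_asc (T : Finset ℕ) {a b : A} (h : Asc a b) (p : List (ℕ →₀ ℕ)) :
    crossInv T (pat (a + b) :: p) = crossInv T (pat a :: pat b :: p) := by
  have hd := h.disjoint
  simp only [crossInv_cons, support_pat, support_add_of_disjoint hd, invPairs, Finset.product_union,
    Finset.filter_union]
  rw [Finset.card_union_of_disjoint, add_assoc]
  refine Finset.disjoint_left.2 fun x hx hx' => ?_
  rw [Finset.mem_filter, Finset.mem_product] at hx hx'
  exact Finset.disjoint_left.1 hd hx.1.2 hx'.1.2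

lemma crossInv_union_of_disjoint {T T' : Finset ℕ} (h : Disjoint T T') (p : List (ℕ →₀ ℕ)) :
    crossInv (T ∪ T') p = crossInv T p + crossInv T' p := by
  induction p with
  | nil => simp [crossInv]
  | cons a p ih =>
    rw [crossInv_cons, crossInv_cons, crossInv_cons, ih, invPairs, invPairs, invPairs,
      Finset.union_product, Finset.filter_union, Finset.card_union_of_disjoint]
    · ring
    · refine Finset.disjoint_left.2 fun x hx hx' => ?_
      rw [Finset.mem_filter, Finset.mem_product] at hx hx'
      exact Finset.disjoint_left.1 h hx.1.1 hx'.1.1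

/-- The contraction preserves the degree, the weight and the number of inversions. -/
lemma etaN_mem (w : List BLetter) : etaN (bword w) ∈ bSpan {u | u.length + 1 = w.length ∧
    wdeg u = wdeg w ∧ pWt (wpat u) = pWt (wpat w) ∧ inv (wpat u) = inv (wpat w) ∧
      ∀ T, crossInv T (wpat u) = crossInv T (wpat w)} := by
  induction w with
  | nil => rw [etaN_bword]; exact zero_mem _
  | cons a w ih =>
    by_cases h : a.1.support.card = 1
    · rcases w with _ | ⟨b, w⟩
      · rw [etaN_bword]; exact zero_mem _
      · by_cases hab : Asc a.1 b.1
        · have hne : a.1 + b.1 ≠ 0 := by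
            intro h0
            have := support_add_of_disjoint hab.disjoint
            rw [h0, Finsupp.support_zero] at this
            rw [(Finset.union_eq_empty.1 this.symm).1] at h
            simp at h
          rw [← cns_bword a.2, ← cns_bword b.2, etaN_cns_cns_of_asc h b.2 hab, cns_bword hne]
          refine bword_mem ⟨rfl, ?_, ?_, ?_, fun T => ?_⟩
          · simp only [wdeg_cons, expo_add hab.disjoint, map_add]; ring
          · simp only [wpat_cons, pWt_cons, pat_add hab.disjoint, map_add]; ring
          · simp only [wpat_cons, inv_cons, crossInv_cons]
            have h0 : invPairs (pat a.1).support (pat b.1).support = 0 := by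
              rw [invPairs, Finset.card_eq_zero, Finset.filter_eq_empty_iff]
              rintro ⟨n, m⟩ hx
              rw [Finset.mem_product, support_pat, support_pat] at hx
              have := hab n hx.1 m hx.2
              simp only; omega
            rw [h0, support_pat, support_pat, support_pat, support_add_of_disjoint hab.disjoint,
              crossInv_union_of_disjoint hab.disjoint]
            ring
          · simp only [wpat_cons]; exact crossInv_add_of_asc T hab _
        · rw [← cns_bword a.2, ← cns_bword b.2, etaN_cns_cns_of_not_asc h hab, cns_bword b.2]
          refine neg_mem (map_mem_of_bwords (fun u hu => ?_) ih)
          obtain ⟨h1, h2, h3, h4, h5⟩ := hu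
          rw [cns_bword a.2]
          refine bword_mem ⟨?_, ?_, ?_, ?_, fun T => ?_⟩
          · simp only [List.length_cons] at h1 ⊢; omega
          · rw [wdeg_cons, wdeg_cons, h2]
          · rw [wpat_cons, wpat_cons, pWt_cons, pWt_cons, h3]
          · rw [wpat_cons, wpat_cons, inv_cons, inv_cons, h4, h5]
          · rw [wpat_cons, wpat_cons, crossInv_cons, crossInv_cons, h5]
    · rw [← cns_bword a.2, etaN_cns_of_card_ne h]; exact zero_mem _

/-! The reduction to critical words. -/

lemma expoWt_le_expoDeg (e : ℕ →₀ ℕ) : expoWt e ≤ expoDeg e := by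
  induction e using Finsupp.induction_linear with
  | zero => simp
  | add e f he hf => rw [map_add, map_add]; omega
  | single i n =>
    rw [expoWt_single, expoDeg_single]
    refine Nat.mul_le_mul_left _ ?_
    have : 1 ≤ 3 ^ i := Nat.one_le_pow _ _ (by norm_num)
    rw [pow_succ]; omega

lemma pWt_le_wdeg (w : List BLetter) : pWt (wpat w) ≤ wdeg w := by
  induction w with
  | nil => simp [pWt]
  | cons a w ih =>
    have h1 := expoWt_expo a.1
    have h2 := expoWt_le_expoDeg (expo 0 a.1)
    rw [wpat_cons, pWt_cons, wdeg_cons]; omega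

lemma card_support_le_patWt (p : ℕ →₀ ℕ) : p.support.card ≤ patWt p := by
  induction p using Finsupp.induction with
  | zero => simp
  | single_add i n p hp hn ih =>
    have h1 : (Finsupp.single i n + p).support.card ≤ 1 + p.support.card := by
      refine (Finset.card_le_card Finsupp.support_add).trans ((Finset.card_union_le _ _).trans ?_)
      rw [Finsupp.support_single _ hn, Finset.card_singleton]
    have h2 : 1 ≤ n * 3 ^ i := Nat.mul_pos (Nat.pos_of_ne_zero hn) (Nat.pow_pos (by norm_num))
    have h3 : patWt (Finsupp.single i n) = n * 3 ^ i := expoWt_single i n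
    rw [map_add]; omega

lemma crossInv_le (T : Finset ℕ) (p : List (ℕ →₀ ℕ)) : crossInv T p ≤ T.card * pWt p := by
  induction p with
  | nil => simp [crossInv]
  | cons a p ih =>
    rw [crossInv_cons, pWt_cons, mul_add]
    refine add_le_add ?_ ih
    refine (Finset.card_filter_le _ _).trans ?_
    rw [Finset.card_product]
    exact Nat.mul_le_mul_left _ (card_support_le_patWt a)

lemma inv_le (p : List (ℕ →₀ ℕ)) : inv p ≤ pWt p ^ 2 := by
  induction p with
  | nil => simp [inv]
  | cons a p ih =>
    rw [inv_cons, pWt_cons]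
    have h1 := crossInv_le a.support p
    have h2 := Nat.mul_le_mul_right (pWt p) (card_support_le_patWt a)
    nlinarith

/-- The order used in the reduction. -/
def key (M : ℕ) (p : List (ℕ →₀ ℕ)) : ℕ := pWt p * M + inv p

lemma key_lt {U : ℕ} {u w : List BLetter} (hw : wdeg w ≤ U) (h : u ∈ Above w) :
    key (U ^ 2 + 1) (wpat w) < key (U ^ 2 + 1) (wpat u) := by
  obtain ⟨-, -, h | ⟨h, h', -⟩⟩ := h
  · have h1 := inv_le (wpat w)
    have h2 := pow_le_pow_left₀ (Nat.zero_le _) ((pWt_le_wdeg w).trans hw) 2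
    have h3 := Nat.mul_le_mul_right (U ^ 2 + 1) (Nat.succ_le_of_lt h)
    rw [Nat.succ_mul] at h3
    rw [key, key]; omega
  · rw [key, key, h]; omega

lemma key_le {U : ℕ} {w : List BLetter} (hw : wdeg w ≤ U) :
    key (U ^ 2 + 1) (wpat w) ≤ U * (U ^ 2 + 1) + U ^ 2 := by
  have h0 := (pWt_le_wdeg w).trans hw
  have h1 := inv_le (wpat w)
  have h2 := pow_le_pow_left₀ (Nat.zero_le _) h0 2
  have h3 := Nat.mul_le_mul_right (U ^ 2 + 1) h0
  rw [key]; omega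

/-- The length and the degree modulo `18` of a word. -/
def bwt (w : List BLetter) : ℤ × ZMod 18 := (w.length, wdeg w)

/-- The span of the words of given length and degree modulo `18`. -/
def homB (g : ℤ × ZMod 18) : Submodule k BWords := bSpan {w | bwt w = g}

lemma exists_wdeg_le {S : Set (List BLetter)} {x : BWords} (hx : x ∈ bSpan S) :
    ∃ U, x ∈ bSpan {w | w ∈ S ∧ wdeg w ≤ U} := by
  induction hx using Submodule.span_induction with
  | mem x hx => obtain ⟨w, hw, rfl⟩ := hx; exact ⟨wdeg w, bword_mem ⟨hw, le_rfl⟩⟩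
  | zero => exact ⟨0, zero_mem _⟩
  | add x y _ _ hx hy =>
    obtain ⟨U, hU⟩ := hx
    obtain ⟨V, hV⟩ := hy
    have h : ∀ {U W : ℕ}, U ≤ W → {w | w ∈ S ∧ wdeg w ≤ U} ⊆ {w | w ∈ S ∧ wdeg w ≤ W} :=
      fun hUW w hw => ⟨hw.1, hw.2.trans hUW⟩
    exact ⟨max U V, add_mem (bSpan_mono (h (le_max_left _ _)) hU)
      (bSpan_mono (h (le_max_right _ _)) hV)⟩
  | smul c x _ hx => obtain ⟨U, hU⟩ := hx; exact ⟨U, Submodule.smul_mem _ _ hU⟩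

/-- The words in powers. -/
def powerWords : Set (List BLetter) := {w | ∀ a ∈ w, a.1.support.card = 1}

/-- Reduction of membership in `T` to the case of words in powers. -/
lemma mem_of_reduce {Q T : Submodule k BWords} {g : ℤ × ZMod 18}
    (h1 : ∀ m ∈ Q, deltaN (etaN m) + etaN (deltaN m) ∈ T ∧
      m - (deltaN (etaN m) + etaN (deltaN m)) ∈ Q)
    (h2 : ∀ m ∈ Q, m ∈ homB g → ∀ S : Set (List (ℕ →₀ ℕ)),
      bProj {w | wpat w ∈ S} m ∈ bSpan powerWords →
        bProj {w | wpat w ∈ S} m ∈ T ∧ m - bProj {w | wpat w ∈ S} m ∈ Q)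
    {m : BWords} (hm : m ∈ Q) (hg : m ∈ homB g) : m ∈ T := by
  obtain ⟨U, hU⟩ := exists_wdeg_le hg
  have main : ∀ j N : ℕ, U * (U ^ 2 + 1) + U ^ 2 + 1 ≤ N + j → ∀ m ∈ Q,
      m ∈ bSpan {w | bwt w = g ∧ wdeg w ≤ U ∧ N ≤ key (U ^ 2 + 1) (wpat w)} → m ∈ T := by
    intro j
    induction j with
    | zero =>
      intro N hN m _ hm
      have : m = 0 := apply_eq_of_bwords (f := LinearMap.id) (g := 0) (fun w hw => by
        obtain ⟨-, hw, hw'⟩ := hw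
        have := key_le hw
        omega) hm
      rw [this]; exact zero_mem _
    | succ j ih =>
      intro N hN m hmQ hm
      obtain ⟨hT, hQ⟩ := h1 m hmQ
      have hm1 : m - (deltaN (etaN m) + etaN (deltaN m)) ∈ bSpan {w | bwt w = g ∧ wdeg w ≤ U ∧
          N ≤ key (U ^ 2 + 1) (wpat w) ∧ (key (U ^ 2 + 1) (wpat w) = N → w ∈ powerWords)} := by
        refine map_mem_of_bwords (f := LinearMap.id - (deltaN ∘ₗ etaN + etaN ∘ₗ deltaN))
          (fun w hw => ?_) hm
        obtain ⟨hwg, hwU, hwN⟩ := hw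
        have hwl : (w.length : ℤ) = g.1 := congrArg Prod.fst hwg
        have hwd : (wdeg w : ZMod 18) = g.2 := congrArg Prod.snd hwg
        have e1 : bword w - (leadN (etaN (bword w)) + etaN (leadN (bword w))) ∈
            bSpan {w | bwt w = g ∧ wdeg w ≤ U ∧
              N ≤ key (U ^ 2 + 1) (wpat w) ∧ (key (U ^ 2 + 1) (wpat w) = N → w ∈ powerWords)} := by
          rw [leadN_etaN_add]
          split_ifs with hc
          · rw [sub_zero]; exact bword_mem ⟨hwg, hwU, hwN, fun _ => hc.card⟩
          · rw [sub_self]; exact zero_mem _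
        have e2 : (deltaN - leadN) (etaN (bword w)) ∈ bSpan {w | bwt w = g ∧ wdeg w ≤ U ∧
              N ≤ key (U ^ 2 + 1) (wpat w) ∧ (key (U ^ 2 + 1) (wpat w) = N → w ∈ powerWords)} := by
          refine map_mem_of_bwords (fun u hu => ?_) (etaN_mem w)
          obtain ⟨hu1, hu2, hu3, hu4, -⟩ := hu
          refine bSpan_mono (fun v hv => ?_) (deltaN_sub_leadN u)
          have hk := key_lt (U := U) (by rw [hu2]; exact hwU) hv
          obtain ⟨hv1, hv2, -⟩ := hv
          have hk' : key (U ^ 2 + 1) (wpat u) = key (U ^ 2 + 1) (wpat w) := by rw [key, key, hu3, hu4]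
          refine ⟨Prod.ext ?_ ?_, ?_, ?_, fun h => ?_⟩
          · rw [← hwl]; simp only [bwt]; omega
          · rw [← hwd]; simp only [bwt]; rw [hv2, hu2]
          · omega
          · omega
          · omega
        have e3 : etaN ((deltaN - leadN) (bword w)) ∈ bSpan {w | bwt w = g ∧ wdeg w ≤ U ∧
              N ≤ key (U ^ 2 + 1) (wpat w) ∧ (key (U ^ 2 + 1) (wpat w) = N → w ∈ powerWords)} := by
          refine map_mem_of_bwords (fun u hu => ?_) (deltaN_sub_leadN w)
          have hk := key_lt (U := U) hwU hu
          obtain ⟨hu1, hu2, -⟩ := hu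
          refine bSpan_mono (fun v hv => ?_) (etaN_mem u)
          obtain ⟨hv1, hv2, hv3, hv4, -⟩ := hv
          have hk' : key (U ^ 2 + 1) (wpat v) = key (U ^ 2 + 1) (wpat u) := by rw [key, key, hv3, hv4]
          refine ⟨Prod.ext ?_ ?_, ?_, ?_, fun h => ?_⟩
          · rw [← hwl]; simp only [bwt]; omega
          · rw [← hwd]; simp only [bwt]; rw [hv2, hu2]
          · omega
          · omega
          · omega
        have := sub_mem (sub_mem e1 e2) e3
        convert this using 1
        simp only [LinearMap.sub_apply, LinearMap.add_apply, LinearMap.comp_apply, LinearMap.id_apply,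
          map_sub]
        abel
      have hpart := h2 _ hQ (bSpan_mono (fun w hw => hw.1) hm1) {p | key (U ^ 2 + 1) p = N}
        (bSpan_mono (fun w hw => hw.2.2.2.2 hw.1) (bProj_mem_of_mem hm1))
      have hrest := ih (N + 1) (by omega) _ hpart.2 (bSpan_mono (fun w hw => by
        obtain ⟨⟨h1, h2, h3, -⟩, h4⟩ := hw
        have h4' : key (U ^ 2 + 1) (wpat w) ≠ N := h4
        exact ⟨h1, h2, by omega⟩) (sub_bProj_mem_of_mem hm1))
      have := add_mem (add_mem hrest hpart.1) hT
      convert this using 1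
      abel
  refine main (U * (U ^ 2 + 1) + U ^ 2 + 1) 0 (by omega) m hm (bSpan_mono (fun w hw => ?_) hU)
  exact ⟨hw.1, hw.2, Nat.zero_le _⟩

/-! Words in powers. -/

/-- Remove a given first letter. -/
def stripN (b : A) : BWords →ₗ[k] BWords :=
  Finsupp.linearCombination k fun w => match w with
    | [] => 0
    | a :: w => if a.1 = b then bword w else 0

lemma stripN_cns_self {b : A} (h : b ≠ 0) (x : BWords) : stripN b (cns b x) = x :=
  bwords_ext (stripN b ∘ₗ cns b) LinearMap.id (fun w => by
    rw [LinearMap.comp_apply, cns_bword h]; simp [stripN]) x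

lemma stripN_cns_of_ne {a b : A} (hab : a ≠ b) (x : BWords) : stripN b (cns a x) = 0 := by
  by_cases h : a = 0
  · simp [h, cns_zero]
  · exact bwords_ext (stripN b ∘ₗ cns a) 0 (fun w => by
      rw [LinearMap.comp_apply, cns_bword h]; simp [stripN, hab]) x

/-- The power `x_j^q y_j^r`. -/
abbrev pw (j q : ℕ) (r : Fin 3) : A := Finsupp.single j (q, r)

lemma pw_ne_zero {j q : ℕ} {r : Fin 3} (h : q ≠ 0 ∨ r ≠ 0) : pw j q r ≠ 0 := by
  rw [Ne, Finsupp.single_eq_zero, Prod.mk_eq_zero, not_and_or]; exact h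

lemma pw_ne_pw {j q q' : ℕ} {r r' : Fin 3} (h : r ≠ r') : pw j q r ≠ pw j q' r' := fun h' =>
  h (congrArg Prod.snd (Finsupp.single_injective j h'))

lemma pdN_cns_pw {j q : ℕ} {r : Fin 3} (h : q ≠ 0 ∨ r ≠ 0) (x : BWords) :
    pdN (cns (pw j q r) x) = ((r : ℕ) : k) • cns (pw j (q + 1) (r - 1)) x + cns (pw j q r) (pdN x) := by
  have h' : ((q, r) : ℕ × Fin 3) ≠ 0 := by
    rw [Ne, Prod.mk_eq_zero, not_and_or]; exact h
  have e : shift (pw j q r) j = pw j (q + 1) (r - 1) := by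
    ext i : 1
    rw [shift, Finsupp.update_apply, Finsupp.single_apply, Finsupp.single_apply]
    by_cases hi : i = j
    · subst hi; simp
    · simp [hi, Ne.symm hi]
  rw [pdN_cns, Finsupp.support_single _ h', Finset.sum_singleton, e, Finsupp.single_eq_same]

lemma eq_pw_of_pat {a : A} {j d : ℕ} (h : pat a = Finsupp.single j d) :
    ∃ q r, a = pw j q r ∧ q + (r : ℕ) = d := by
  refine ⟨(a j).1, (a j).2, ?_, ?_⟩
  · ext i : 1
    rw [Finsupp.single_apply]
    split_ifs with hi
    · subst hi; rfl
    · have h1 := DFunLike.congr_fun h i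
      rw [pat_apply, Finsupp.single_apply, if_neg hi] at h1
      exact Prod.ext (by simp; omega) (Fin.ext (by simp; omega))
  · have h1 := DFunLike.congr_fun h j
    rwa [pat_apply, Finsupp.single_eq_same] at h1

/-- The span of the words of pattern `p` and degree satisfying `R`. -/
def patSpan (p : List (ℕ →₀ ℕ)) (R : ZMod 18 → Prop) : Submodule k BWords :=
  bSpan {w | wpat w = p ∧ R (wdeg w)}

/-- The degree of a power, modulo `18`. -/
lemma expoDeg_pw (j q : ℕ) (r : Fin 3) :
    (expoDeg (expo 0 (pw j q r)) : ZMod 18) = 6 * q + 8 * (r : ℕ) := by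
  have h9 : ∀ n : ℕ, (3 ^ (n + 2) : ZMod 18) = 9 := by
    intro n
    induction n with
    | zero => decide
    | succ n ih => rw [pow_succ, ih]; decide
  rw [expo_single, map_add, expoDeg_single, expoDeg_single]
  have h1 : 1 ≤ 3 ^ (j + 1) := Nat.one_le_pow _ _ (by norm_num)
  have h2 : 1 ≤ 3 ^ (j + 1 + 1) := Nat.one_le_pow _ _ (by norm_num)
  push_cast [Nat.cast_sub h1, Nat.cast_sub h2]
  have h3 : (3 : ZMod 18) * 3 ^ (j + 1) = 9 := by rw [← h9 j]; ring
  rw [h9 j]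
  linear_combination (q : ZMod 18) * h3

/-- Decomposition by the first letter, for a linear factor. -/
lemma exists_of_mem_patSpan_one {j : ℕ} {p : List (ℕ →₀ ℕ)} {R : ZMod 18 → Prop} {n : BWords}
    (hn : n ∈ patSpan (Finsupp.single j 1 :: p) R) :
    ∃ n1 ∈ patSpan p (fun t => R (6 + t)), ∃ n2 ∈ patSpan p (fun t => R (8 + t)),
      n = cns (pw j 1 0) n1 + cns (pw j 0 1) n2 := by
  induction hn using Submodule.span_induction with
  | mem x hx =>
    obtain ⟨w, ⟨hp, hR⟩, rfl⟩ := hx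
    cases w with
    | nil => simp at hp
    | cons a w =>
      rw [wpat_cons, List.cons.injEq] at hp
      obtain ⟨ha, hp⟩ := hp
      obtain ⟨q, r, e, hqr⟩ := eq_pw_of_pat ha
      rw [wdeg_cons, Nat.cast_add, e, expoDeg_pw] at hR
      have hr : r = 0 ∨ r = 1 := by
        fin_cases r
        · exact Or.inl rfl
        · exact Or.inr rfl
        · simp at hqr
      rcases hr with rfl | rfl
      · obtain rfl : q = 1 := by simpa using hqr
        refine ⟨bword w, bword_mem ⟨hp, by simpa using hR⟩, 0, zero_mem _, ?_⟩
        rw [← cns_bword a.2, e, map_zero, add_zero]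
      · obtain rfl : q = 0 := by simpa using hqr
        refine ⟨0, zero_mem _, bword w, bword_mem ⟨hp, by simpa using hR⟩, ?_⟩
        rw [← cns_bword a.2, e, map_zero, zero_add]
  | zero => exact ⟨0, zero_mem _, 0, zero_mem _, by simp⟩
  | add x y _ _ hx hy =>
    obtain ⟨n1, h1, n2, h2, e⟩ := hx
    obtain ⟨m1, g1, m2, g2, e'⟩ := hy
    exact ⟨_, add_mem h1 g1, _, add_mem h2 g2, by rw [e, e', map_add, map_add]; abel⟩
  | smul c x _ hx =>
    obtain ⟨n1, h1, n2, h2, e⟩ := hx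
    exact ⟨_, Submodule.smul_mem _ c h1, _, Submodule.smul_mem _ c h2, by
      rw [e, map_smul, map_smul, smul_add]⟩

/-- Decomposition by the first letter, for a factor of degree at least `2`. -/
lemma exists_of_mem_patSpan_two {j d : ℕ} {p : List (ℕ →₀ ℕ)} {n : BWords}
    (hn : n ∈ patSpan (Finsupp.single j (d + 2) :: p) fun _ => True) :
    ∃ n1 ∈ patSpan p (fun _ => True), ∃ n2 n3, n = cns (pw j (d + 2) 0) n1 +
      cns (pw j (d + 1) 1) n2 + cns (pw j d 2) n3 := by
  induction hn using Submodule.span_induction with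
  | mem x hx =>
    obtain ⟨w, ⟨hp, -⟩, rfl⟩ := hx
    cases w with
    | nil => simp at hp
    | cons a w =>
      rw [wpat_cons, List.cons.injEq] at hp
      obtain ⟨ha, hp⟩ := hp
      obtain ⟨q, r, e, hqr⟩ := eq_pw_of_pat ha
      have hr : r = 0 ∨ r = 1 ∨ r = 2 := by fin_cases r <;> simp
      rcases hr with rfl | rfl | rfl
      · obtain rfl : q = d + 2 := by simpa using hqr
        refine ⟨bword w, bword_mem ⟨hp, trivial⟩, 0, 0, ?_⟩
        rw [← cns_bword a.2, e]; simp
      · obtain rfl : q = d + 1 := by simpa using hqr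
        refine ⟨0, zero_mem _, bword w, 0, ?_⟩
        rw [← cns_bword a.2, e]; simp
      · obtain rfl : q = d := by simpa using hqr
        refine ⟨0, zero_mem _, 0, bword w, ?_⟩
        rw [← cns_bword a.2, e]; simp
  | zero => exact ⟨0, zero_mem _, 0, 0, by simp⟩
  | add x y _ _ hx hy =>
    obtain ⟨n1, h1, n2, n3, e⟩ := hx
    obtain ⟨m1, g1, m2, m3, e'⟩ := hy
    exact ⟨_, add_mem h1 g1, n2 + m2, n3 + m3, by rw [e, e', map_add, map_add, map_add]; abel⟩
  | smul c x _ hx =>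
    obtain ⟨n1, h1, n2, n3, e⟩ := hx
    exact ⟨_, Submodule.smul_mem _ c h1, c • n2, c • n3, by
      rw [e, map_smul, map_smul, map_smul, smul_add, smul_add]⟩

lemma two_eq : (2 : k) = -1 := by decide

lemma three_smul_zero (x : BWords) : x + x + x = 0 := by
  rw [← two_smul k x, two_eq]; simp

lemma pdN_x (j : ℕ) (n : BWords) : pdN (cns (pw j 1 0) n) = cns (pw j 1 0) (pdN n) := by
  rw [pdN_cns_pw (Or.inl one_ne_zero)]; simp

lemma pdN_y (j : ℕ) (n : BWords) :
    pdN (cns (pw j 0 1) n) = cns (pw j 1 0) n + cns (pw j 0 1) (pdN n) := by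
  rw [pdN_cns_pw (Or.inr one_ne_zero)]; simp

lemma pdN_xx (j d : ℕ) (n : BWords) :
    pdN (cns (pw j (d + 2) 0) n) = cns (pw j (d + 2) 0) (pdN n) := by
  rw [pdN_cns_pw (Or.inl (by omega))]; simp

lemma pdN_xy (j d : ℕ) (n : BWords) :
    pdN (cns (pw j (d + 1) 1) n) = cns (pw j (d + 2) 0) n + cns (pw j (d + 1) 1) (pdN n) := by
  rw [pdN_cns_pw (Or.inl (by omega))]; simp

lemma pdN_yy (j d : ℕ) (n : BWords) :
    pdN (cns (pw j d 2) n) = -cns (pw j (d + 1) 1) n + cns (pw j d 2) (pdN n) := by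
  rw [pdN_cns_pw (Or.inr (by decide))]; simp [two_eq, show (2 : Fin 3) - 1 = 1 from rfl]

lemma one_parts {j : ℕ} {a b a' b' : BWords}
    (h : cns (pw j 1 0) a + cns (pw j 0 1) b = cns (pw j 1 0) a' + cns (pw j 0 1) b') :
    a = a' ∧ b = b' := by
  have hx : pw j 1 0 ≠ 0 := pw_ne_zero (Or.inl one_ne_zero)
  have hy : pw j 0 1 ≠ 0 := pw_ne_zero (Or.inr one_ne_zero)
  have hxy : pw j 1 0 ≠ pw j 0 1 := pw_ne_pw (by decide)
  constructor
  · have := congrArg (stripN (pw j 1 0)) h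
    simpa [stripN_cns_self hx, stripN_cns_of_ne hxy.symm] using this
  · have := congrArg (stripN (pw j 0 1)) h
    simpa [stripN_cns_self hy, stripN_cns_of_ne hxy] using this

lemma two_parts {j d : ℕ} {a b c : BWords} (h : cns (pw j (d + 2) 0) a +
    cns (pw j (d + 1) 1) b + cns (pw j d 2) c = 0) : a = 0 ∧ b = 0 ∧ c = 0 := by
  have h0 : pw j (d + 2) 0 ≠ 0 := pw_ne_zero (Or.inl (by omega))
  have h1 : pw j (d + 1) 1 ≠ 0 := pw_ne_zero (Or.inl (by omega))
  have h2 : pw j d 2 ≠ 0 := pw_ne_zero (Or.inr (by decide))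
  have h01 : pw j (d + 2) 0 ≠ pw j (d + 1) 1 := pw_ne_pw (by decide)
  have h02 : pw j (d + 2) 0 ≠ pw j d 2 := pw_ne_pw (by decide)
  have h12 : pw j (d + 1) 1 ≠ pw j d 2 := pw_ne_pw (by decide)
  refine ⟨?_, ?_, ?_⟩
  · have := congrArg (stripN (pw j (d + 2) 0)) h
    simpa [stripN_cns_self h0, stripN_cns_of_ne h01.symm, stripN_cns_of_ne h02.symm] using this
  · have := congrArg (stripN (pw j (d + 1) 1)) h
    simpa [stripN_cns_self h1, stripN_cns_of_ne h01, stripN_cns_of_ne h12.symm] using this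
  · have := congrArg (stripN (pw j d 2)) h
    simpa [stripN_cns_self h2, stripN_cns_of_ne h02, stripN_cns_of_ne h12] using this

/-- `∂` acts freely on the words of pattern `p`. -/
def FreePat (p : List (ℕ →₀ ℕ)) : Prop :=
  ∀ n ∈ patSpan p (fun _ => True), pdN n = 0 → ∃ m, n = pdN (pdN m)

lemma pdN_mem_patSpan {p : List (ℕ →₀ ℕ)} {n : BWords} (hn : n ∈ patSpan p fun _ => True) :
    pdN n ∈ patSpan p fun _ => True :=
  map_mem_of_bwords (fun w hw => by
    rw [pdN_bword]
    refine bSpan_mono (fun u hu => ?_) (pdWord_mem w)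
    exact ⟨hu.1.trans hw.1, trivial⟩) hn

lemma pdN_bProj (S : Set (List (ℕ →₀ ℕ))) (x : BWords) :
    bProj {w | wpat w ∈ S} (pdN x) = pdN (bProj {w | wpat w ∈ S} x) := by
  refine bProj_comm (fun w hw => ?_) (fun w hw => ?_) x
  · rw [pdN_bword]
    refine bSpan_mono (fun u hu => ?_) (pdWord_mem w)
    have hw' : wpat w ∈ S := hw
    rw [← hu.1] at hw'
    exact hw'
  · rw [pdN_bword]
    refine bSpan_mono (fun u hu => ?_) (pdWord_mem w)
    have hw' : wpat w ∉ S := hw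
    rw [← hu.1] at hw'
    exact hw'

lemma eq_neg_of_add {x y : BWords} (h : x + y = 0) : y = -x := eq_neg_of_add_eq_zero_right h

lemma freePat_cons_two (j d : ℕ) (p : List (ℕ →₀ ℕ)) : FreePat (Finsupp.single j (d + 2) :: p) := by
  intro n hn h0
  obtain ⟨n1, -, n2, n3, rfl⟩ := exists_of_mem_patSpan_two hn
  rw [map_add, map_add, pdN_xx, pdN_xy, pdN_yy] at h0
  have h0' : cns (pw j (d + 2) 0) (pdN n1 + n2) + cns (pw j (d + 1) 1) (pdN n2 - n3) +
      cns (pw j d 2) (pdN n3) = 0 := by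
    rw [map_add, map_sub, ← h0]; abel
  obtain ⟨e1, e2, -⟩ := two_parts h0'
  obtain rfl := eq_neg_of_add e1
  obtain rfl := (sub_eq_zero.1 e2).symm
  refine ⟨cns (pw j d 2) (-n1), ?_⟩
  have e3 : cns (pw j (d + 1) 1) (pdN n1) + cns (pw j (d + 1) 1) (pdN n1) +
      cns (pw j (d + 1) 1) (pdN n1) = 0 := three_smul_zero _
  simp only [map_neg, map_add, pdN_xy, pdN_yy]
  rw [← sub_eq_zero, ← neg_eq_zero, ← e3]
  abel

lemma freePat_cons_one (j : ℕ) {p : List (ℕ →₀ ℕ)} (hp : FreePat p) :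
    FreePat (Finsupp.single j 1 :: p) := by
  intro n hn h0
  obtain ⟨n1, h1, n2, h2, rfl⟩ := exists_of_mem_patSpan_one hn
  rw [map_add, pdN_x, pdN_y] at h0
  have h0' : cns (pw j 1 0) (pdN n1 + n2) + cns (pw j 0 1) (pdN n2) =
      cns (pw j 1 0) 0 + cns (pw j 0 1) 0 := by
    rw [map_add, map_zero, map_zero, add_zero, ← h0]; abel
  obtain ⟨e1, e2⟩ := one_parts h0'
  obtain rfl := eq_neg_of_add e1
  have h3 : -pdN n1 ∈ patSpan p fun _ => True := neg_mem (pdN_mem_patSpan h1)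
  obtain ⟨m, hm⟩ := hp _ h3 e2
  -- correct `m` so that it has pattern `p`
  obtain ⟨m', hm', e'⟩ : ∃ m' ∈ patSpan p (fun _ => True), -pdN n1 = pdN (pdN m') := by
    have hS : {w | wpat w ∈ ({p} : Set (List (ℕ →₀ ℕ)))} = {w | wpat w = p ∧ True} := by
      ext w; simp
    have h4 := bProj_of_mem h3
    rw [← hS, hm, pdN_bProj, pdN_bProj, ← hm] at h4
    refine ⟨_, ?_, h4.symm⟩
    rw [hS]
    exact bProj_mem _ _
  have h4 : n1 + pdN m' ∈ patSpan p fun _ => True := add_mem h1 (pdN_mem_patSpan hm')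
  have h5 : pdN (n1 + pdN m') = 0 := by rw [map_add, ← e', add_neg_cancel]
  obtain ⟨t, ht⟩ := hp _ h4 h5
  refine ⟨cns (pw j 1 0) t + cns (pw j 0 1) m', ?_⟩
  rw [map_add, pdN_x, pdN_y, map_add, pdN_x, map_add, pdN_x, pdN_y, ← ht, ← e', map_add]
  rw [show cns (pw j 1 0) n1 + cns (pw j 0 1) (-pdN n1) = cns (pw j 1 0) n1 +
    (cns (pw j 1 0) (pdN m') + cns (pw j 1 0) (pdN m') + cns (pw j 1 0) (pdN m')) +
      cns (pw j 0 1) (-pdN n1) by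
        rw [← two_smul k (cns _ _), two_eq]; simp]
  abel

/-- A pattern of powers is free or consists of linear factors. -/
lemma freePat_or (p : List (ℕ →₀ ℕ)) (hp : ∀ a ∈ p, ∃ j d, a = Finsupp.single j (d + 1)) :
    FreePat p ∨ ∀ a ∈ p, ∃ j, a = Finsupp.single j 1 := by
  induction p with
  | nil => right; simp
  | cons a p ih =>
    obtain ⟨j, d, rfl⟩ := hp a (List.mem_cons_self ..)
    rcases d with _ | d
    · rcases ih fun b hb => hp b (List.mem_cons_of_mem _ hb) with h | h
      · left; exact freePat_cons_one j h
      · right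
        intro b hb
        rcases List.mem_cons.1 hb with rfl | hb
        · exact ⟨j, rfl⟩
        · exact h b hb
    · left; exact freePat_cons_two j d p

lemma mem_patSpan_nil {R : ZMod 18 → Prop} {n : BWords} (hn : n ∈ patSpan [] R) : pdN n = 0 :=
  apply_eq_of_bwords (g := 0) (fun w hw => by
    obtain ⟨hw, -⟩ := hw
    have : w = [] := List.map_eq_nil_iff.1 hw
    rw [this]; simp [pdWord]) hn

lemma patSpan_mono {p : List (ℕ →₀ ℕ)} {R R' : ZMod 18 → Prop} (h : ∀ t, R t → R' t) :
    patSpan p R ≤ patSpan p R' := bSpan_mono fun _ hw => ⟨hw.1, h _ hw.2⟩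

lemma patSpan_eq_zero {R : ZMod 18 → Prop} (h : ¬ R 0) {n : BWords} (hn : n ∈ patSpan [] R) : n = 0 :=
  apply_eq_of_bwords (f := LinearMap.id) (g := 0) (fun w hw => by
    obtain ⟨hw, hR⟩ := hw
    have : w = [] := List.map_eq_nil_iff.1 hw
    subst this
    exact absurd (by simpa using hR) h) hn

/-- Two linear factors. -/
lemma exists_two_linear {i j : ℕ} {p : List (ℕ →₀ ℕ)} {R : ZMod 18 → Prop} {n : BWords}
    (hn : n ∈ patSpan (Finsupp.single i 1 :: Finsupp.single j 1 :: p) R) :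
    ∃ n1 n4, ∃ n2 ∈ patSpan p (fun t => R (14 + t)), ∃ n3 ∈ patSpan p (fun t => R (14 + t)),
      n = cns (pw i 1 0) (cns (pw j 1 0) n1 + cns (pw j 0 1) n2) +
        cns (pw i 0 1) (cns (pw j 1 0) n3 + cns (pw j 0 1) n4) := by
  obtain ⟨a, ha, b, hb, rfl⟩ := exists_of_mem_patSpan_one hn
  obtain ⟨n1, h1, n2, h2, rfl⟩ := exists_of_mem_patSpan_one ha
  obtain ⟨n3, h3, n4, h4, rfl⟩ := exists_of_mem_patSpan_one hb
  refine ⟨n1, n4, n2, patSpan_mono (fun t ht => ?_) h2, n3, patSpan_mono (fun t ht => ?_) h3, rfl⟩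
  · rw [← add_assoc] at ht
    exact ht
  · rw [← add_assoc] at ht
    exact ht

lemma pdN_two_linear (i j : ℕ) (n1 n2 n3 n4 : BWords) :
    pdN (cns (pw i 1 0) (cns (pw j 1 0) n1 + cns (pw j 0 1) n2) +
        cns (pw i 0 1) (cns (pw j 1 0) n3 + cns (pw j 0 1) n4)) =
      cns (pw i 1 0) (cns (pw j 1 0) (pdN n1 + n2 + n3) + cns (pw j 0 1) (pdN n2 + n4)) +
        cns (pw i 0 1) (cns (pw j 1 0) (pdN n3 + n4) + cns (pw j 0 1) (pdN n4)) := by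
  simp only [map_add, pdN_x, pdN_y]
  abel

lemma two_linear_parts {i j : ℕ} {n1 n2 n3 n4 : BWords}
    (h : cns (pw i 1 0) (cns (pw j 1 0) n1 + cns (pw j 0 1) n2) +
        cns (pw i 0 1) (cns (pw j 1 0) n3 + cns (pw j 0 1) n4) = 0) :
    n1 = 0 ∧ n2 = 0 ∧ n3 = 0 ∧ n4 = 0 := by
  have hz : ∀ i : ℕ, cns (pw i 1 0) 0 + cns (pw i 0 1) 0 = 0 := by simp
  obtain ⟨h1, h2⟩ := one_parts (h.trans (hz i).symm)
  obtain ⟨h1, h3⟩ := one_parts (h1.trans (hz j).symm)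
  obtain ⟨h2, h4⟩ := one_parts (h2.trans (hz j).symm)
  exact ⟨h1, h3, h2, h4⟩

/-- `∂`-preimages, for two linear factors. -/
lemma two_linear_preimage (i j : ℕ) {n1 n2 n3 n4 t : BWords} (ht : n2 - n3 = pdN t)
    (h : pdN (pdN n1) = pdN n2 + pdN n3 + n4) :
    cns (pw i 1 0) (cns (pw j 1 0) n1 + cns (pw j 0 1) n2) +
      cns (pw i 0 1) (cns (pw j 1 0) n3 + cns (pw j 0 1) n4) =
    pdN (cns (pw i 1 0) (cns (pw j 1 0) 0 + cns (pw j 0 1) (-(n1 + t))) +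
      cns (pw i 0 1) (cns (pw j 1 0) (-(n1 - t)) + cns (pw j 0 1) (n2 + pdN n1 + pdN t))) := by
  rw [pdN_two_linear]
  have e1 : n1 = pdN 0 + -(n1 + t) + -(n1 - t) := by
    rw [map_zero, ← sub_eq_zero]
    rw [show n1 - (0 + -(n1 + t) + -(n1 - t)) = n1 + n1 + n1 by abel, three_smul_zero]
  have e2 : n2 = pdN (-(n1 + t)) + (n2 + pdN n1 + pdN t) := by rw [map_neg, map_add]; abel
  have e3 : n3 = pdN (-(n1 - t)) + (n2 + pdN n1 + pdN t) := by
    have : n3 = n2 - pdN t := by rw [← ht]; abel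
    rw [map_neg, map_sub, this, ← sub_eq_zero, show n2 - pdN t -
      (-(pdN n1 - pdN t) + (n2 + pdN n1 + pdN t)) = -(pdN t + pdN t + pdN t) by abel,
      three_smul_zero, neg_zero]
  have e4 : n4 = pdN (n2 + pdN n1 + pdN t) := by
    rw [map_add, map_add, h, ← ht, map_sub, ← sub_eq_zero,
      show n4 - (pdN n2 + (pdN n2 + pdN n3 + n4) + (pdN n2 - pdN n3)) =
        -(pdN n2 + pdN n2 + pdN n2) by abel, three_smul_zero, neg_zero]
  rw [← e1, ← e2, ← e3, ← e4]

/-- Cycles of linear factors. -/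
lemma linear_ker (p : List (ℕ →₀ ℕ)) (hp : ∀ a ∈ p, ∃ j, a = Finsupp.single j 1) {n : BWords}
    (hn : n ∈ patSpan p fun t => t ≠ 7 * (p.length : ZMod 18)) (h : pdN n = 0) : ∃ m, n = pdN m := by
  induction hl : p.length using Nat.strong_induction_on generalizing p n with
  | _ l ih =>
  rcases p with _ | ⟨a, _ | ⟨b, p⟩⟩
  · exact ⟨0, by rw [patSpan_eq_zero (by simp) hn, map_zero]⟩
  · obtain ⟨j, rfl⟩ := hp a (List.mem_cons_self ..)
    obtain ⟨n1, h1, n2, h2, rfl⟩ := exists_of_mem_patSpan_one hn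
    have e1 := mem_patSpan_nil h1
    have e2 := mem_patSpan_nil h2
    rw [map_add, pdN_x, pdN_y, e1, e2, map_zero, map_zero, zero_add, add_zero] at h
    have : n2 = 0 := (one_parts (j := j) (b := 0) (b' := 0) (a' := 0) (by simpa using h)).1
    exact ⟨cns (pw j 0 1) n1, by rw [pdN_y, e1, this]⟩
  · obtain ⟨i, rfl⟩ := hp a (List.mem_cons_self ..)
    obtain ⟨j, rfl⟩ := hp b (List.mem_cons_of_mem _ (List.mem_cons_self ..))
    obtain ⟨n1, n4, n2, h2, n3, h3, rfl⟩ := exists_two_linear hn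
    rw [pdN_two_linear] at h
    obtain ⟨e1, e2, e3, e4⟩ := two_linear_parts h
    have hR : patSpan p (fun t => 14 + t ≠ 7 * (((Finsupp.single i 1 ::
        Finsupp.single j 1 :: p : List (ℕ →₀ ℕ)).length : ℕ) : ZMod 18)) ≤
        patSpan p (fun t => t ≠ 7 * (p.length : ZMod 18)) := by
      refine patSpan_mono fun t ht h' => ht ?_
      rw [h']; push_cast [List.length_cons]; ring
    simp only [List.length_cons] at hl
    have hsub := hR (sub_mem h2 h3)
    have hpd : pdN (n2 - n3) = 0 := by
      rw [map_sub, eq_neg_of_add_eq_zero_left e2, eq_neg_of_add_eq_zero_left e3, sub_self]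
    obtain ⟨t, ht⟩ := ih p.length (by omega) p
      (fun c hc => hp c (List.mem_cons_of_mem _ (List.mem_cons_of_mem _ hc))) hsub hpd rfl
    refine ⟨_, two_linear_preimage i j ht ?_⟩
    have h4 : n4 = -pdN n2 := eq_neg_of_add e2
    have h5 : pdN n1 = -(n2 + n3) := by
      rw [eq_neg_iff_add_eq_zero, ← e1]; abel
    rw [h5, map_neg, map_add, show pdN n3 = pdN n2 by
      rw [show pdN n3 = -n4 from eq_neg_of_add_eq_zero_left e3, h4, neg_neg], h4]
    rw [← sub_eq_zero, show -(pdN n2 + pdN n2) - (pdN n2 + pdN n2 + -pdN n2) =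
      -(pdN n2 + pdN n2 + pdN n2) by abel, three_smul_zero, neg_zero]

/-- Elements killed by `∂²`, for linear factors. -/
lemma linear_ker_sq (p : List (ℕ →₀ ℕ)) (hp : ∀ a ∈ p, ∃ j, a = Finsupp.single j 1) {n : BWords}
    (hn : n ∈ patSpan p fun t => t - 1 ≠ 7 * (p.length : ZMod 18)) (h : pdN (pdN n) = 0) :
    ∃ c m, pdN c = 0 ∧ n = c + pdN m := by
  induction hl : p.length using Nat.strong_induction_on generalizing p n with
  | _ l ih =>
  rcases p with _ | ⟨a, _ | ⟨b, p⟩⟩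
  · exact ⟨n, 0, mem_patSpan_nil hn, by simp⟩
  · obtain ⟨j, rfl⟩ := hp a (List.mem_cons_self ..)
    obtain ⟨n1, h1, n2, h2, rfl⟩ := exists_of_mem_patSpan_one hn
    have e1 := mem_patSpan_nil h1
    have e2 : n2 = 0 := patSpan_eq_zero (by simp; decide) h2
    exact ⟨cns (pw j 1 0) n1, 0, by rw [pdN_x, e1, map_zero], by rw [e2]; simp⟩
  · obtain ⟨i, rfl⟩ := hp a (List.mem_cons_self ..)
    obtain ⟨j, rfl⟩ := hp b (List.mem_cons_of_mem _ (List.mem_cons_self ..))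
    obtain ⟨n1, n4, n2, h2, n3, h3, rfl⟩ := exists_two_linear hn
    rw [pdN_two_linear, pdN_two_linear] at h
    obtain ⟨e1, e2, e3, e4⟩ := two_linear_parts h
    have hR : patSpan p (fun t => 14 + t - 1 ≠ 7 * (((Finsupp.single i 1 ::
        Finsupp.single j 1 :: p : List (ℕ →₀ ℕ)).length : ℕ) : ZMod 18)) ≤
        patSpan p (fun t => t - 1 ≠ 7 * (p.length : ZMod 18)) := by
      refine patSpan_mono fun t ht h' => ht ?_
      rw [add_sub_assoc, h']; push_cast [List.length_cons]; ring
    simp only [List.length_cons] at hl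
    have hsub := hR (sub_mem h2 h3)
    have hpd : pdN (pdN (n2 - n3)) = 0 := by
      have f2 : pdN (pdN n2) = -(pdN n4 + pdN n4) := by
        rw [eq_neg_iff_add_eq_zero, ← e2, map_add]; abel
      have f3 : pdN (pdN n3) = -(pdN n4 + pdN n4) := by
        rw [eq_neg_iff_add_eq_zero, ← e3, map_add]; abel
      rw [map_sub, map_sub, f2, f3, sub_self]
    obtain ⟨c, t, hc, ht⟩ := ih p.length (by omega) p
      (fun c hc => hp c (List.mem_cons_of_mem _ (List.mem_cons_of_mem _ hc))) hsub hpd rfl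
    have ht' : n2 + c - (n3 - c) = pdN t := by
      rw [show n2 + c - (n3 - c) = (n2 - n3) + (c + c) by abel, ht,
        show c + pdN t + (c + c) = (c + c + c) + pdN t by abel, three_smul_zero, zero_add]
    have h1 : pdN (pdN n1) = pdN (n2 + c) + pdN (n3 - c) + n4 := by
      have f1 : pdN (pdN n1) = -(pdN n2 + pdN n3 + pdN n2 + pdN n3 + n4 + n4) := by
        rw [eq_neg_iff_add_eq_zero, ← e1, map_add, map_add]; abel
      rw [f1, map_add, map_sub, hc, add_zero, sub_zero, ← sub_eq_zero,
        show -(pdN n2 + pdN n3 + pdN n2 + pdN n3 + n4 + n4) - (pdN n2 + pdN n3 + n4) =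
          -(pdN n2 + pdN n2 + pdN n2) - (pdN n3 + pdN n3 + pdN n3) - (n4 + n4 + n4) by abel,
        three_smul_zero, three_smul_zero, three_smul_zero]
      simp
    have hpre := two_linear_preimage i j ht' h1
    have hc' : pdN (cns (pw i 1 0) (cns (pw j 1 0) 0 + cns (pw j 0 1) (-c)) +
        cns (pw i 0 1) (cns (pw j 1 0) c + cns (pw j 0 1) 0)) = 0 := by
      rw [pdN_two_linear, map_neg, hc]; simp
    refine ⟨_, _, hc', Eq.trans ?_ (congrArg (_ + ·) hpre)⟩
    simp only [map_add, map_sub, map_neg, map_zero]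
    abel

/-! The bigrading. -/

lemma deltaN_deltaN (x : BWords) : deltaN (deltaN x) = 0 := by
  apply iota_injective
  rw [← d1_iota, ← d1_iota, d1_d1, map_zero]

lemma leadN_mem (w : List BLetter) :
    leadN (bword w) ∈ bSpan {u | u.length = w.length + 1 ∧ wdeg u = wdeg w} := by
  induction w with
  | nil =>
    have h := deltaN_sub_leadN []
    rw [deltaN_nil, zero_sub] at h
    refine bSpan_mono (fun u hu => ?_) (neg_mem_iff.1 h)
    exact ⟨hu.1, hu.2.1⟩
  | cons a w ih =>
    rw [← cns_bword a.2, leadN_cns]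
    refine sub_mem (Submodule.sum_mem _ fun t _ => ?_) (map_mem_of_bwords (fun u hu => ?_) ih)
    · have h := below_add_from a.1 t
      by_cases h1 : below a.1 t = 0
      · rw [h1, cns_zero]; exact zero_mem _
      by_cases h2 : from' a.1 t = 0
      · rw [h2, cns_zero, LinearMap.zero_apply, map_zero]; exact zero_mem _
      rw [cns_bword h2, cns_bword h1]
      refine bword_mem ⟨by simp, ?_⟩
      rw [wdeg_cons, wdeg_cons, wdeg_cons, ← add_assoc, ← map_add,
        ← expo_add (disjoint_below_from a.1 t), h]
    · rw [cns_bword a.2]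
      exact bword_mem ⟨by simp [hu.1], by rw [wdeg_cons, wdeg_cons, hu.2]⟩

lemma deltaN_bword_mem (w : List BLetter) :
    deltaN (bword w) ∈ bSpan {u | u.length = w.length + 1 ∧ wdeg u = wdeg w} := by
  rw [← sub_add_cancel (deltaN (bword w)) (leadN (bword w))]
  refine add_mem (bSpan_mono (fun u hu => ?_) (deltaN_sub_leadN w)) (leadN_mem w)
  exact ⟨hu.1, hu.2.1⟩

/-- The homogeneous part. -/
def homP (s : ℤ) (t : ZMod 18) : BWords →ₗ[k] BWords := bProj {w | bwt w = (s, t)}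

lemma homP_mem (s : ℤ) (t : ZMod 18) (x : BWords) : homP s t x ∈ homB (s, t) := bProj_mem _ _

lemma homP_of_mem {s : ℤ} {t : ZMod 18} {x : BWords} (hx : x ∈ homB (s, t)) : homP s t x = x :=
  bProj_of_mem hx

lemma bProj_shift {f : BWords →ₗ[k] BWords} {g₀ : ℤ × ZMod 18}
    (hf : ∀ w, f (bword w) ∈ homB (bwt w + g₀)) (g : ℤ × ZMod 18) (x : BWords) :
    bProj {w | bwt w = g + g₀} (f x) = f (bProj {w | bwt w = g} x) := by
  refine bProj_comm (fun w hw => ?_) (fun w hw => ?_) x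
  · have hw' : bwt w = g := hw
    have := hf w
    rwa [hw'] at this
  · have hw' : bwt w ≠ g := hw
    have h1 : {u | bwt u = bwt w + g₀} ⊆ {u | bwt u = g + g₀}ᶜ :=
      fun u h1 h2 => hw' (add_right_cancel (h1.symm.trans h2))
    exact bSpan_mono h1 (hf w)

lemma homP_pdN (s : ℤ) (t : ZMod 18) (x : BWords) : homP s t (pdN x) = pdN (homP s (t + 2) x) := by
  have h := bProj_shift (f := pdN) (g₀ := (0, -2)) (fun w => by
    rw [pdN_bword]
    refine bSpan_mono (fun u hu => ?_) (pdWord_mem w)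
    obtain ⟨h1, h2⟩ := hu
    refine Prod.ext ?_ ?_
    · simp [bwt, wpat_length h1]
    · simp [bwt, ← h2]) (s, t + 2) x
  have e : ((s, t + 2) : ℤ × ZMod 18) + (0, -2) = (s, t) := by simp
  rw [e] at h
  exact h

lemma homP_deltaN (s : ℤ) (t : ZMod 18) (x : BWords) :
    homP s t (deltaN x) = deltaN (homP (s - 1) t x) := by
  have h := bProj_shift (f := deltaN) (g₀ := (1, 0)) (fun w => by
    refine bSpan_mono (fun u hu => ?_) (deltaN_bword_mem w)
    exact Prod.ext (by simp [bwt, hu.1]) (by simp [bwt, hu.2])) (s - 1, t) x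
  have e : ((s - 1, t) : ℤ × ZMod 18) + (1, 0) = (s, t) := by simp
  rw [e] at h
  exact h

lemma pdN_mem {s : ℤ} {t t' : ZMod 18} {x : BWords} (hx : x ∈ homB (s, t)) (h : t = t' + 2) :
    pdN x ∈ homB (s, t') := by
  subst h
  rw [← homP_of_mem hx, ← homP_pdN]
  exact homP_mem _ _ _

lemma deltaN_mem {s s' : ℤ} {t : ZMod 18} {x : BWords} (hx : x ∈ homB (s, t)) (h : s' = s + 1) :
    deltaN x ∈ homB (s', t) := by
  obtain rfl : s = s' - 1 := by omega
  rw [← homP_of_mem hx, ← homP_deltaN]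
  exact homP_mem _ _ _

/-! Words in powers. -/

lemma exists_pat {x : BWords} {S : Set (List BLetter)} (hx : x ∈ bSpan S) :
    ∃ F : Finset (List (ℕ →₀ ℕ)), x ∈ bSpan {w | w ∈ S ∧ wpat w ∈ F} := by
  classical
  induction hx using Submodule.span_induction with
  | mem x hx => obtain ⟨w, hw, rfl⟩ := hx; exact ⟨{wpat w}, bword_mem ⟨hw, by simp⟩⟩
  | zero => exact ⟨∅, zero_mem _⟩
  | add x y _ _ hx hy =>
    obtain ⟨F, hF⟩ := hx
    obtain ⟨G, hG⟩ := hy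
    have h : ∀ {F G : Finset (List (ℕ →₀ ℕ))}, F ⊆ G →
        {w | w ∈ S ∧ wpat w ∈ F} ⊆ {w | w ∈ S ∧ wpat w ∈ G} := fun hFG w hw => ⟨hw.1, hFG hw.2⟩
    exact ⟨F ∪ G, add_mem (bSpan_mono (h Finset.subset_union_left) hF)
      (bSpan_mono (h Finset.subset_union_right) hG)⟩
  | smul c x _ hx => obtain ⟨F, hF⟩ := hx; exact ⟨F, Submodule.smul_mem _ _ hF⟩

/-- Reduction to a single pattern. -/
lemma mem_of_pat {Q N : Submodule k BWords} {S : Set (List BLetter)}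
    (hQ : ∀ x ∈ Q, ∀ S : Set (List (ℕ →₀ ℕ)), bProj {w | wpat w ∈ S} x ∈ Q)
    (hN : ∀ p, ∀ x ∈ Q, x ∈ bSpan {w | wpat w = p ∧ w ∈ S} → x ∈ N) {x : BWords} (hx : x ∈ Q)
    (hS : x ∈ bSpan S) : x ∈ N := by
  classical
  obtain ⟨F, hF⟩ := exists_pat hS
  induction F using Finset.induction generalizing x with
  | empty =>
    have : x = 0 := apply_eq_of_bwords (f := LinearMap.id) (g := 0) (fun w hw => by
      exact absurd hw.2 (Finset.notMem_empty _)) hF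
    rw [this]; exact zero_mem _
  | insert p F _ ih =>
    have h1 := hQ x hx {p}
    rw [← sub_add_cancel x (bProj {w | wpat w ∈ ({p} : Set _)} x)]
    refine add_mem (ih (sub_mem hx h1) (bSpan_mono (fun w hw => ?_) (sub_bProj_mem_of_mem hS))
      (bSpan_mono (fun w hw => ?_) (sub_bProj_mem_of_mem hF)))
      (hN p _ h1 (bSpan_mono (fun w hw => ?_) (bProj_mem_of_mem hS)))
    · exact hw.1
    · obtain ⟨⟨h2, h3⟩, h4⟩ := hw
      exact ⟨h2, (Finset.mem_insert.1 h3).resolve_left h4⟩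
    · exact ⟨hw.1, hw.2⟩

lemma pat_of_mem_powerWords {w : List BLetter} (hw : w ∈ powerWords) :
    ∀ a ∈ wpat w, ∃ j d, a = Finsupp.single j (d + 1) := by
  intro a ha
  obtain ⟨b, hb, rfl⟩ := List.mem_map.1 ha
  have h := hw b hb
  rw [← support_pat, Finsupp.card_support_eq_one'] at h
  obtain ⟨j, n, hn, e⟩ := h
  obtain ⟨d, rfl⟩ := Nat.exists_eq_succ_of_ne_zero hn
  exact ⟨j, d, e⟩

/-- On words in powers, `∂` is free or all factors are linear. -/
lemma powerWords_cases {p : List (ℕ →₀ ℕ)} {s : ℤ} {t : ZMod 18} {x : BWords}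
    (hx : x ∈ bSpan {w | wpat w = p ∧ w ∈ powerWords ∩ {w | bwt w = (s, t)}}) :
    x = 0 ∨ (FreePat p ∧ x ∈ patSpan p fun _ => True) ∨
      ((∀ a ∈ p, ∃ j, a = Finsupp.single j 1) ∧ (p.length : ℤ) = s ∧ x ∈ patSpan p (· = t)) := by
  by_cases h : ∃ w : List BLetter, wpat w = p ∧ w ∈ powerWords ∩ {w | bwt w = (s, t)}
  · obtain ⟨w, rfl, hw, hwt⟩ := h
    right
    rcases freePat_or _ (pat_of_mem_powerWords hw) with h | h
    · refine Or.inl ⟨h, bSpan_mono (fun u hu => ?_) hx⟩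
      exact ⟨hu.1, trivial⟩
    · refine Or.inr ⟨h, ?_, bSpan_mono (fun u hu => ?_) hx⟩
      · rw [wpat, List.length_map]; exact congrArg Prod.fst hwt
      · exact ⟨hu.1, congrArg Prod.snd hu.2.2⟩
  · left
    exact apply_eq_of_bwords (f := LinearMap.id) (g := 0) (fun w hw => absurd ⟨w, hw⟩ h) hx

lemma exists_pdN_of_powerWords {s : ℤ} {t : ZMod 18} (hst : t ≠ 7 * s) {x : BWords}
    (hx : x ∈ bSpan (powerWords ∩ {w | bwt w = (s, t)})) (h : pdN x = 0) : ∃ y, x = pdN y := by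
  have := mem_of_pat (Q := LinearMap.ker pdN) (N := LinearMap.range pdN) (fun x hx S => by
    rw [LinearMap.mem_ker] at hx ⊢
    rw [← pdN_bProj, hx, map_zero]) (fun p x hx hxp => ?_) h hx
  · obtain ⟨y, hy⟩ := this; exact ⟨y, hy.symm⟩
  · rcases powerWords_cases hxp with rfl | ⟨hf, hp⟩ | ⟨hl, hs, hp⟩
    · exact zero_mem _
    · obtain ⟨m, rfl⟩ := hf x hp hx
      exact ⟨_, rfl⟩
    · obtain ⟨m, rfl⟩ := linear_ker p hl (patSpan_mono (fun u hu => by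
        rw [hu]; rw [← hs] at hst; exact_mod_cast hst) hp) hx
      exact ⟨_, rfl⟩

lemma exists_pdN_sq_of_powerWords {s : ℤ} {t : ZMod 18} (hst : t - 1 ≠ 7 * s) {x : BWords}
    (hx : x ∈ bSpan (powerWords ∩ {w | bwt w = (s, t)})) (h : pdN (pdN x) = 0) :
    ∃ c y, pdN c = 0 ∧ x = c + pdN y := by
  have := mem_of_pat (Q := LinearMap.ker (pdN ∘ₗ pdN)) (N := LinearMap.ker pdN ⊔ LinearMap.range pdN)
    (fun x hx S => by
      rw [LinearMap.mem_ker, LinearMap.comp_apply] at hx ⊢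
      rw [← pdN_bProj, ← pdN_bProj, hx, map_zero]) (fun p x hx hxp => ?_) h hx
  · obtain ⟨c, hc, _, ⟨y, rfl⟩, e⟩ := Submodule.mem_sup.1 this
    exact ⟨c, y, hc, e.symm⟩
  · rcases powerWords_cases hxp with rfl | ⟨hf, hp⟩ | ⟨hl, hs, hp⟩
    · exact zero_mem _
    · obtain ⟨m, hm⟩ := hf _ (pdN_mem_patSpan hp) hx
      refine Submodule.mem_sup.2 ⟨x - pdN m, ?_, _, ⟨m, rfl⟩, sub_add_cancel _ _⟩
      rw [LinearMap.mem_ker, map_sub, hm, sub_self]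
    · obtain ⟨c, m, hc, rfl⟩ := linear_ker_sq p hl (patSpan_mono (fun u hu => by
        rw [hu]; rw [← hs] at hst; exact_mod_cast hst) hp) hx
      exact Submodule.mem_sup.2 ⟨c, hc, _, ⟨m, rfl⟩, rfl⟩

/-- Decomposition of the cycles of `∂`. -/
lemma exists_of_pdN_eq_zero {s : ℤ} {t : ZMod 18} (hst : t ≠ 7 * s) {m p : BWords}
    (hm : m ∈ homB (s, t)) (h : pdN m = 0) (hp : deltaN m = pdN p) :
    ∃ n ∈ homB (s, t + 2), ∃ c ∈ homB (s - 1, t), pdN c = 0 ∧ m = pdN n + deltaN c := by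
  have key : m ∈ LinearMap.range pdN ⊔ (LinearMap.ker pdN).map deltaN := by
    refine mem_of_reduce (Q := LinearMap.ker pdN ⊓ (LinearMap.range pdN).comap deltaN)
      (g := (s, t)) ?_ ?_ ⟨h, p, hp.symm⟩ hm
    · rintro m ⟨h, p, hp⟩
      have h : pdN m = 0 := h
      have e1 : pdN (deltaN (etaN m)) = 0 := by rw [← deltaN_pdN, pdN_etaN, h, map_zero, map_zero]
      have e2 : etaN (deltaN m) = pdN (etaN p) := by rw [← hp, pdN_etaN]
      refine ⟨?_, ?_, ?_⟩
      · rw [e2, add_comm]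
        refine Submodule.add_mem_sup ⟨_, rfl⟩ ⟨_, ?_, rfl⟩
        rw [SetLike.mem_coe, LinearMap.mem_ker, pdN_etaN, h, map_zero]
      · rw [SetLike.mem_coe, LinearMap.mem_ker, map_sub, map_add, h, e1, pdN_etaN, ← deltaN_pdN, h]
        simp
      · refine ⟨p - deltaN (etaN p), ?_⟩
        rw [map_sub, map_sub, map_add, deltaN_deltaN, zero_add, e2, deltaN_pdN, hp]
    · rintro m ⟨h, p, hp⟩ hg S hS
      have h : pdN m = 0 := h
      have e : pdN (bProj {w | wpat w ∈ S} m) = 0 := by rw [← pdN_bProj, h, map_zero]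
      have hh := bProj_mem_of_mem (S := powerWords) (bProj_mem_of_mem (S := {w | wpat w ∈ S}) hg)
      rw [bProj_of_mem hS] at hh
      obtain ⟨y, hy⟩ := exists_pdN_of_powerWords hst (bSpan_mono (fun w hw => by
        exact ⟨hw.1, hw.2.2⟩) hh) e
      rw [hy]
      refine ⟨Submodule.mem_sup_left ⟨_, rfl⟩, ?_, p - deltaN y, ?_⟩
      · rw [SetLike.mem_coe, LinearMap.mem_ker, map_sub, ← hy, e, h, sub_zero]
      · rw [map_sub, map_sub, hp, deltaN_pdN]
  obtain ⟨_, ⟨n, rfl⟩, _, ⟨c, hc, rfl⟩, e⟩ := Submodule.mem_sup.1 key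
  have hc : pdN c = 0 := hc
  refine ⟨homP s (t + 2) n, homP_mem _ _ _, homP (s - 1) t c, homP_mem _ _ _, ?_, ?_⟩
  · have h1 := homP_pdN (s - 1) (t - 2) c
    rw [sub_add_cancel, hc, map_zero] at h1
    exact h1.symm
  · rw [← homP_pdN, ← homP_deltaN, ← map_add, e, homP_of_mem hm]

/-- Decomposition of the elements killed by `∂²`. -/
lemma exists_of_pdN_pdN_eq_zero {s : ℤ} {t : ZMod 18} (hst : t - 1 ≠ 7 * s) {m p : BWords}
    (hm : m ∈ homB (s, t)) (h : pdN (pdN m) = 0) (hp : pdN (deltaN m) = pdN (pdN p)) :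
    ∃ c ∈ homB (s, t), ∃ l ∈ homB (s, t + 2), ∃ n ∈ homB (s - 1, t), pdN c = 0 ∧
      pdN (pdN n) = 0 ∧ m = c + pdN l + deltaN n := by
  have key : m ∈ LinearMap.ker pdN ⊔ LinearMap.range pdN ⊔
      (LinearMap.ker (pdN ∘ₗ pdN)).map deltaN := by
    refine mem_of_reduce (Q := LinearMap.ker (pdN ∘ₗ pdN) ⊓
      (LinearMap.range (pdN ∘ₗ pdN)).comap (pdN ∘ₗ deltaN)) (g := (s, t)) ?_ ?_ ⟨h, p, hp.symm⟩ hm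
    · rintro m ⟨h, p, hp⟩
      have h : pdN (pdN m) = 0 := h
      have hp : pdN (pdN p) = pdN (deltaN m) := hp
      have e1 : pdN (pdN (deltaN (etaN m))) = 0 := by
        rw [← deltaN_pdN, ← deltaN_pdN, pdN_etaN, pdN_etaN, h, map_zero, map_zero]
      refine ⟨?_, ?_, ?_⟩
      · rw [add_comm, show etaN (deltaN m) = etaN (deltaN m - pdN p) + pdN (etaN p) by
          rw [pdN_etaN, ← map_add, sub_add_cancel]]
        refine Submodule.add_mem_sup (Submodule.add_mem_sup ?_ ⟨_, rfl⟩) ⟨_, ?_, rfl⟩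
        · rw [LinearMap.mem_ker, pdN_etaN, map_sub, hp, sub_self, map_zero]
        · rw [SetLike.mem_coe, LinearMap.mem_ker, LinearMap.comp_apply, pdN_etaN, pdN_etaN, h,
            map_zero]
      · rw [SetLike.mem_coe, LinearMap.mem_ker, LinearMap.comp_apply, map_sub, map_sub, map_add,
          map_add, h, e1, pdN_etaN, pdN_etaN, ← deltaN_pdN, ← deltaN_pdN, h]
        simp
      · refine ⟨p - deltaN (etaN p), ?_⟩
        have e2 : pdN (pdN (deltaN (etaN p))) = pdN (deltaN (etaN (deltaN m))) := by
          rw [← deltaN_pdN (etaN p), ← deltaN_pdN (pdN (etaN p)), pdN_etaN, pdN_etaN, hp, ← pdN_etaN,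
            deltaN_pdN]
        simp only [LinearMap.comp_apply, map_sub, map_add, deltaN_deltaN, hp, e2, map_zero, zero_add]
    · rintro m ⟨h, p, hp⟩ hg S hS
      have h : pdN (pdN m) = 0 := h
      have hp : pdN (pdN p) = pdN (deltaN m) := hp
      have e : pdN (pdN (bProj {w | wpat w ∈ S} m)) = 0 := by
        rw [← pdN_bProj, ← pdN_bProj, h, map_zero]
      have hh := bProj_mem_of_mem (S := powerWords) (bProj_mem_of_mem (S := {w | wpat w ∈ S}) hg)
      rw [bProj_of_mem hS] at hh
      obtain ⟨c, y, hc, hy⟩ := exists_pdN_sq_of_powerWords hst (bSpan_mono (fun w hw => by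
        exact ⟨hw.1, hw.2.2⟩) hh) e
      rw [hy]
      refine ⟨Submodule.mem_sup_left (Submodule.add_mem_sup hc ⟨_, rfl⟩), ?_, p - deltaN y, ?_⟩
      · rw [SetLike.mem_coe, LinearMap.mem_ker, LinearMap.comp_apply, map_sub, map_sub, ← hy, e, h,
          sub_zero]
      · simp only [LinearMap.comp_apply, map_sub, map_add, hp]
        rw [← deltaN_pdN c, hc, deltaN_pdN]; simp
  obtain ⟨_, h1, _, ⟨n, hn, rfl⟩, e⟩ := Submodule.mem_sup.1 key
  obtain ⟨c, hc, _, ⟨l, rfl⟩, rfl⟩ := Submodule.mem_sup.1 h1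
  have hc : pdN c = 0 := hc
  have hn : pdN (pdN n) = 0 := hn
  refine ⟨homP s t c, homP_mem _ _ _, homP s (t + 2) l, homP_mem _ _ _, homP (s - 1) t n,
    homP_mem _ _ _, ?_, ?_, ?_⟩
  · have h1 := homP_pdN s (t - 2) c
    rw [sub_add_cancel, hc, map_zero] at h1
    exact h1.symm
  · have h1 := homP_pdN (s - 1) (t - 2 - 2) (pdN n)
    rw [hn, map_zero, homP_pdN, sub_add_cancel, sub_add_cancel] at h1
    exact h1.symm
  · rw [← homP_pdN, ← homP_deltaN, ← map_add, ← map_add, e, homP_of_mem hm]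

/-! Exactness. -/

lemma exists_even_of_eq {s : ℤ} {t : ZMod 18} (hst : t + 1 ≠ 7 * s) {m n c p : BWords}
    (hn : n ∈ homB (s, t + 2)) (h : pdN m = 0) (hp : deltaN m = pdN (pdN p)) (hc : pdN c = 0)
    (e : m = pdN n + deltaN c) : ∃ l c', pdN c' = 0 ∧ m = pdN (pdN l) + deltaN c' := by
  have h1 : pdN n = m - deltaN c := by rw [e]; abel
  obtain ⟨c1, -, l, -, n1, -, hc1, hn1, e1⟩ := exists_of_pdN_pdN_eq_zero (p := p)
    (by rwa [show t + 2 - 1 = t + 1 by ring]) hn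
    (by rw [h1, map_sub, h, ← deltaN_pdN, hc]; simp)
    (by rw [← deltaN_pdN, h1, map_sub, deltaN_deltaN, hp, sub_zero])
  refine ⟨l, pdN n1 + c, by rw [map_add, hn1, hc, add_zero], ?_⟩
  rw [e, e1, map_add, map_add, hc1, zero_add, map_add, deltaN_pdN]
  abel

lemma exists_even {s : ℤ} {t : ZMod 18} (h0 : t ≠ 7 * s) (h1 : t + 1 ≠ 7 * s) {m p : BWords}
    (hm : m ∈ homB (s, t)) (h : pdN m = 0) (hp : deltaN m = pdN (pdN p)) :
    ∃ l c, pdN c = 0 ∧ m = pdN (pdN l) + deltaN c := by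
  obtain ⟨n, hn, c, -, hc, e⟩ := exists_of_pdN_eq_zero h0 hm h hp
  exact exists_even_of_eq h1 hn h hp hc e

lemma exists_odd {s : ℤ} {t : ZMod 18} (h0 : t ≠ 7 * s) (h1 : t - 1 ≠ 7 * s) {m x : BWords}
    (hm : m ∈ homB (s, t)) (h : pdN (pdN m) = 0) (hx : deltaN m = pdN x) :
    ∃ l n, pdN (pdN n) = 0 ∧ m = pdN l + deltaN n := by
  obtain ⟨c, hc', l, -, n, -, hc, hn, e⟩ := exists_of_pdN_pdN_eq_zero (p := x) h1 hm h (by rw [hx])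
  obtain ⟨n', -, c', -, hc1, e'⟩ := exists_of_pdN_eq_zero (p := x - deltaN l) h0 hc' hc (by
    rw [map_sub, ← hx, e, map_add, map_add, deltaN_deltaN, deltaN_pdN]; abel)
  refine ⟨n' + l, n + c', by rw [map_add, map_add, hn, hc1, map_zero, add_zero], ?_⟩
  rw [e, e', map_add, map_add]; abel

lemma ne_add {t c : ZMod 18} (hc : c ≠ 0) : t + c ≠ t := by simpa using hc

lemma exists_even_of_odd {s : ℤ} {t : ZMod 18} (ht : t = 7 * s) {m p n n' : BWords}
    (hm : m ∈ homB (s, t)) (h : pdN m = 0) (hp : deltaN m = pdN (pdN p))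
    (hn' : pdN (pdN n') = 0) (e : m = pdN n + deltaN n') :
    ∃ l c, pdN c = 0 ∧ m = pdN (pdN l) + deltaN c := by
  wlog hn : n ∈ homB (s, t + 2) ∧ n' ∈ homB (s - 1, t) generalizing n n'
  · refine this (n := homP s (t + 2) n) (n' := homP (s - 1) t n') ?_ ?_
      ⟨homP_mem _ _ _, homP_mem _ _ _⟩
    · have h1 := homP_pdN (s - 1) (t - 2 - 2) (pdN n')
      rw [hn', map_zero, homP_pdN, sub_add_cancel, sub_add_cancel] at h1
      exact h1.symm
    · rw [← homP_pdN, ← homP_deltaN, ← map_add, ← e, homP_of_mem hm]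
  obtain ⟨c, -, l, hl, n1, -, hc, -, e1⟩ := exists_of_pdN_pdN_eq_zero (s := s - 1) (p := -n) (by
    rw [ht]; push_cast
    rw [show (7 : ZMod 18) * s - 1 = 7 * (s - 1) + 6 by ring]
    exact ne_add (by decide)) hn.2 hn' (by
      rw [map_neg, map_neg, eq_neg_iff_add_eq_zero, add_comm, ← map_add, ← e, h])
  refine exists_even_of_eq (n := n + deltaN l) (c := c) (by rw [ht]; exact ne_add (by decide))
    (add_mem hn.1 (deltaN_mem hl (by ring))) h hp hc ?_
  rw [e, e1, map_add, map_add, map_add, deltaN_deltaN, deltaN_pdN]; abel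

lemma exists_odd_of_even {s : ℤ} {t : ZMod 18} (ht : t = 7 * s + 1) {m x p c : BWords}
    (hm : m ∈ homB (s, t)) (hx : deltaN m = pdN x)
    (hc : pdN c = 0) (e : pdN m = pdN (pdN p) + deltaN c) :
    ∃ l n, pdN (pdN n) = 0 ∧ m = pdN l + deltaN n := by
  wlog hh : p ∈ homB (s, t + 2) ∧ c ∈ homB (s - 1, t - 2) generalizing p c
  · refine this (p := homP s (t + 2) p) (c := homP (s - 1) (t - 2) c) ?_ ?_
      ⟨homP_mem _ _ _, homP_mem _ _ _⟩
    · have h1 := homP_pdN (s - 1) (t - 2 - 2) c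
      rw [hc, map_zero, sub_add_cancel] at h1
      exact h1.symm
    · have h1 := homP_pdN s (t - 2) (pdN p)
      rw [sub_add_cancel t 2, homP_pdN s t p] at h1
      rw [← h1, ← homP_deltaN, ← map_add, ← e, homP_pdN, sub_add_cancel, homP_of_mem hm]
  have h1 : deltaN c = pdN (m - pdN p) := by rw [map_sub, e]; abel
  obtain ⟨n, hn, v, -, hv, e1⟩ := exists_of_pdN_eq_zero (s := s - 1) (by
    rw [ht]; push_cast
    rw [show (7 : ZMod 18) * s + 1 - 2 = 7 * (s - 1) + 6 by ring]
    exact ne_add (by decide)) hh.2 hc h1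
  rw [sub_add_cancel] at hn
  have h2 : deltaN c = pdN (deltaN n) := by rw [e1, map_add, deltaN_deltaN, deltaN_pdN, add_zero]
  obtain ⟨n2, -, c2, -, hc2, e2⟩ := exists_of_pdN_eq_zero (s := s) (t := t)
    (m := m - pdN p - deltaN n) (p := x - deltaN p) (by rw [ht]; exact ne_add (by decide))
    (sub_mem (sub_mem hm (pdN_mem hh.1 rfl)) (deltaN_mem hn (by ring)))
    (by rw [map_sub, ← h1, h2, sub_self])
    (by rw [map_sub, map_sub, deltaN_deltaN, hx, deltaN_pdN, map_sub, sub_zero])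
  refine ⟨p + n2, n + c2, ?_, ?_⟩
  · have h3 : pdN n = c - deltaN v := by rw [e1]; abel
    rw [map_add, hc2, add_zero, h3, map_sub, hc, ← deltaN_pdN, hv]; simp
  · rw [map_add, map_add, ← sub_eq_zero, show m - (pdN p + pdN n2 + (deltaN n + deltaN c2)) =
      m - pdN p - deltaN n - (pdN n2 + deltaN c2) by abel, e2, sub_self]

lemma exists_even_mod_odd {s : ℤ} {t : ZMod 18} (ht : t = 7 * s) {m x : BWords}
    (hm : m ∈ homB (s, t)) (h : pdN (pdN m) = 0) (hx : deltaN m = pdN x) :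
    ∃ c ∈ homB (s, t), pdN c = 0 ∧ (∃ p, deltaN c = pdN (pdN p)) ∧
      ∃ l n, pdN (pdN n) = 0 ∧ m = c + pdN l + deltaN n := by
  wlog hh : x ∈ homB (s + 1, t + 2) generalizing x
  · refine this (x := homP (s + 1) (t + 2) x) ?_ (homP_mem _ _ _)
    rw [← homP_pdN, ← hx, homP_of_mem (deltaN_mem hm rfl)]
  obtain ⟨c, hcm, l, hl, n, -, hc, hn, e⟩ := exists_of_pdN_pdN_eq_zero (p := x)
    (by rw [ht, sub_eq_add_neg]; exact ne_add (by decide)) hm h (by rw [hx])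
  have h1 : pdN (x - deltaN l) = deltaN c := by
    rw [map_sub, ← hx, e, map_add, map_add, deltaN_deltaN, deltaN_pdN]; abel
  obtain ⟨c3, -, l3, -, n3, hn3m, hc3, hn3, e3⟩ := exists_of_pdN_pdN_eq_zero (p := 0)
    (by
      rw [ht]; push_cast
      rw [show (7 : ZMod 18) * s + 2 - 1 = 7 * (s + 1) + 12 by ring_nf; congr 1]
      exact ne_add (by decide))
    (sub_mem hh (deltaN_mem hl rfl)) (by rw [h1, ← deltaN_pdN, hc, map_zero])
    (by rw [← deltaN_pdN, h1, deltaN_deltaN, map_zero, map_zero])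
  rw [add_sub_cancel_right] at hn3m
  refine ⟨c - pdN n3, sub_mem hcm (pdN_mem hn3m rfl), by rw [map_sub, hc, hn3, sub_zero],
    ⟨l3, ?_⟩, l + n3, n, hn, ?_⟩
  · rw [map_sub, ← h1, e3, map_add, map_add, hc3, deltaN_pdN]; abel
  · rw [e, map_add]; abel

lemma exists_odd_mod_even {s : ℤ} {t : ZMod 18} (ht : t + 1 = 7 * s) {m p : BWords}
    (hm : m ∈ homB (s, t)) (h : pdN m = 0) (hp : deltaN m = pdN (pdN p)) :
    ∃ n ∈ homB (s, t + 2), pdN (pdN n) = 0 ∧ (∃ x, deltaN n = pdN x) ∧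
      ∃ c, pdN c = 0 ∧ m = pdN n + deltaN c := by
  wlog hh : p ∈ homB (s + 1, t + 2 + 2) generalizing p
  · refine this (p := homP (s + 1) (t + 2 + 2) p) ?_ (homP_mem _ _ _)
    rw [← homP_pdN, ← homP_pdN, ← hp, homP_of_mem (deltaN_mem hm rfl)]
  obtain ⟨n, hn, c, -, hc, e⟩ := exists_of_pdN_eq_zero (by
    rw [← ht]; exact (ne_add (by decide)).symm) hm h hp
  have h1 : pdN n = m - deltaN c := by rw [e]; abel
  obtain ⟨n2, -, v, hvm, hv, e2⟩ := exists_of_pdN_eq_zero (s := s + 1) (t := t + 2)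
    (m := deltaN n - pdN p) (p := -deltaN p) (by
      push_cast
      rw [show (7 : ZMod 18) * (s + 1) = t + 2 + 6 by rw [mul_add, ← ht]; ring]
      exact (ne_add (by decide)).symm)
    (sub_mem (deltaN_mem hn rfl) (pdN_mem hh rfl))
    (by rw [map_sub, ← deltaN_pdN, h1, map_sub, deltaN_deltaN, hp]; abel)
    (by rw [map_sub, deltaN_deltaN, deltaN_pdN, zero_sub, map_neg])
  rw [add_sub_cancel_right] at hvm
  refine ⟨n - v, sub_mem hn hvm, ?_, ⟨p + n2, ?_⟩, c, hc, ?_⟩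
  · rw [map_sub, hv, sub_zero, h1, map_sub, h, ← deltaN_pdN, hc]; simp
  · rw [map_sub, map_add, show deltaN n = (deltaN n - pdN p) + pdN p by abel, e2]; abel
  · rw [map_sub, hv, sub_zero, e]

/-! The trigrading of words. -/

/-- For a letter: membership in `ker(P → D)`, its complement, and the degree minus `3`, mod `18`. -/
def letterW (l : Letter) : ℤ × ℤ × ZMod 18 := (letterJ l, 1 - letterJ l, (letterDeg l : ZMod 18) - 3)

/-- The trigrading of words. -/
notation "wordW" => weight letterW

lemma wordW_eq (u : List Letter) : wordW u =
    (countJ u, wordLen u - countJ u, ((wordDeg u : ℤ) : ZMod 18) - 3 * ((wordLen u : ℤ) : ZMod 18)) := by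
  induction u with
  | nil => simp [weight]; rfl
  | cons l u ih =>
    simp only [weight_cons, ih, letterW, Prod.mk_add_mk, Prod.mk.injEq]
    refine ⟨trivial, by ring, ?_⟩
    push_cast
    ring

lemma shifts_wordW {f : Cobar →ₗ[k] Cobar} {a n g : ℤ} (hJ : Shifts countJ f a)
    (hL : Shifts wordLen f n) (hD : Shifts wordDeg f g) :
    Shifts wordW f (a, n - a, (g : ZMod 18) - 3 * (n : ZMod 18)) := by
  intro w
  refine wordSpan_mono ?_ (mem_wordSpan_inter (mem_wordSpan_inter (hJ w) (hL w)) (hD w))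
  rintro u ⟨⟨h1, h2⟩, h3⟩
  have h1 : countJ u = countJ w + a := h1
  have h2 : wordLen u = wordLen w + n := h2
  have h3 : wordDeg u = wordDeg w + g := h3
  change wordW u = _
  rw [wordW_eq, wordW_eq, h1, h2, h3]
  simp only [Prod.mk_add_mk, Prod.mk.injEq, true_and]
  refine ⟨by ring, ?_⟩
  push_cast
  ring

lemma Shifts.comp_hom {G H : Type*} [AddGroup G] [AddGroup H] {W : List Letter → G}
    {f : Cobar →ₗ[k] Cobar} {g : G} (h : Shifts W f g) (φ : G →+ H) :
    Shifts (fun u => φ (W u)) f (φ g) := by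
  intro w
  refine wordSpan_mono (fun u hu => ?_) (h w)
  have hu : W u = W w + g := hu
  change φ (W u) = _
  rw [hu, map_add]

/-- The number of letters outside `ker(P → D)`, for monomial letters. -/
def countD (u : List Letter) : ℤ := (wordW u).2.1

/-- The degree minus three times the length, mod `18`. -/
def grade (u : List Letter) : ZMod 18 := (wordW u).2.2

lemma d0_shifts_wordW : Shifts wordW d0 (0, 1, -3) := by
  have := shifts_wordW d0_shifts_countJ (d0_shifts d_shifts_wordLen) (d0_shifts d_shifts_wordDeg)
  simpa using this

lemma d1_shifts_wordW : Shifts wordW d1 (1, 0, -3) := by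
  have := shifts_wordW d1_shifts_countJ (d1_shifts d_shifts_wordLen) (d1_shifts d_shifts_wordDeg)
  simpa using this

lemma Shifts.countD {f : Cobar →ₗ[k] Cobar} {g : ℤ × ℤ × ZMod 18} (h : Shifts wordW f g) :
    Shifts countD f g.2.1 := h.comp_hom ((AddMonoidHom.fst ℤ (ZMod 18)).comp (AddMonoidHom.snd ℤ _))

lemma Shifts.grade {f : Cobar →ₗ[k] Cobar} {g : ℤ × ℤ × ZMod 18} (h : Shifts wordW f g) :
    Shifts grade f g.2.2 := h.comp_hom ((AddMonoidHom.snd ℤ (ZMod 18)).comp (AddMonoidHom.snd ℤ _))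

lemma letterDeg_eq (r : Fin 3) (a : A) (h : (r, a) ≠ 0) :
    letterDeg ⟨(r, a), h⟩ = 2 * (r : ℕ) + expoDeg (expo 0 a) := by
  rw [letterDeg, expo_eq, map_add, expoDeg_single]
  push_cast
  ring

lemma h10_mem_wordW : h10 ∈ wordSpan {u | wordW u = (0, 1, -1)} := by
  have h := lt_mem_weight letterW ⟨(1, 0), by simp⟩
  rw [lt_one] at h
  have e : letterW ⟨(1, 0), by simp⟩ = (0, 1, -1) := by
    rw [letterW, letterDeg_eq, letterJ_neg rfl]
    have : expo 0 0 = 0 := by ext i; cases i <;> simp [expo_zero, expo_succ]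
    rw [this]
    refine Prod.ext rfl (Prod.ext rfl ?_)
    simp only [map_zero]
    decide
  rwa [e] at h

lemma q20_mem_wordW : q20 ∈ wordSpan {u | wordW u = (0, 1, 1)} := by
  have h := lt_mem_weight letterW ⟨(2, 0), by simp⟩
  rw [lt_two] at h
  have e : letterW ⟨(2, 0), by simp⟩ = (0, 1, 1) := by
    rw [letterW, letterDeg_eq, letterJ_neg rfl]
    have : expo 0 0 = 0 := by ext i; cases i <;> simp [expo_zero, expo_succ]
    rw [this]
    refine Prod.ext rfl (Prod.ext rfl ?_)
    simp only [map_zero]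
    decide
  rwa [e] at h

lemma b10_eq : b10 = h10 * q20 + q20 * h10 := by
  have := b10_mul 1
  simpa using this

lemma b10_mem_wordW : b10 ∈ wordSpan {u | wordW u = (0, 2, 0)} := by
  rw [b10_eq]
  exact add_mem (mul_mem_weight_of_eq (by decide) h10_mem_wordW q20_mem_wordW)
    (mul_mem_weight_of_eq (by decide) q20_mem_wordW h10_mem_wordW)

lemma lt_mem_wordW (r : Fin 3) {a : A} (ha : a ≠ 0) : bar (xi 1 ^ (r : ℕ) * mon a) ∈
    wordSpan {u | wordW u = (1, 0, 2 * (r : ℕ) + (expoDeg (expo 0 a) : ZMod 18) - 3)} := by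
  have hl : ((r, a) : Fin 3 × A) ≠ 0 := fun h => ha (congrArg Prod.snd h)
  have h := lt_mem_weight letterW ⟨(r, a), hl⟩
  rw [lt, basisP_apply] at h
  have e : letterW ⟨(r, a), hl⟩ = (1, 0, 2 * (r : ℕ) + (expoDeg (expo 0 a) : ZMod 18) - 3) := by
    rw [letterW, letterDeg_eq, letterJ_pos ha]
    push_cast
    rfl
  rwa [e] at h

lemma iota_mem_wordW {n : ℕ} {t : ZMod 18} {x : BWords} (hx : x ∈ homB (n, t)) :
    iota x ∈ wordSpan {u | wordW u = ((n : ℤ), 0, t - 3 * n)} := by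
  induction n generalizing t x with
  | zero =>
    refine map_mem_of_bwords (fun w hw => ?_) hx
    have h1 : (w.length : ℤ) = (0 : ℕ) := congrArg Prod.fst hw
    obtain rfl : w = [] := List.length_eq_zero_iff.1 (by exact_mod_cast h1)
    have h2 : ((wdeg [] : ℕ) : ZMod 18) = t := congrArg Prod.snd hw
    rw [wdeg_nil, Nat.cast_zero] at h2
    subst h2
    rw [iota_bword, iotaWord, ← wordBasis_nil]
    exact wordBasis_mem (by simp [weight]; rfl)
  | succ n ih =>
    refine map_mem_of_bwords (fun w hw => ?_) hx
    cases w with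
    | nil => exact absurd (congrArg Prod.fst hw) (by simp [bwt]; omega)
    | cons a w =>
      have hl : w.length = n := by
        have := congrArg Prod.fst hw
        simp only [bwt, List.length_cons] at this
        exact_mod_cast (by push_cast at this; linarith : (w.length : ℤ) = n)
      have ht : (expoDeg (expo 0 a.1) : ZMod 18) + wdeg w = t := by
        rw [← show (wdeg (a :: w) : ZMod 18) = t from congrArg Prod.snd hw, wdeg_cons, Nat.cast_add]
      have h0 : bword w ∈ homB (n, wdeg w) := bword_mem (by rw [← hl]; rfl)
      have h1 := pdN_mem h0 (t' := wdeg w - 2) (by ring)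
      have h2 := pdN_mem h1 (t' := wdeg w - 4) (by ring)
      have k0 := lt_mem_wordW 0 a.2
      have k1 := lt_mem_wordW 1 a.2
      have k2 := lt_mem_wordW 2 a.2
      rw [← cns_bword a.2, iota_cns a.2, twist_apply, hd_iota, hd_iota, ← ht]
      refine sub_mem (add_mem (mul_mem_weight_of_eq ?_ (by simpa using k0) (ih h0))
        (mul_mem_weight_of_eq ?_ (by simpa using k1) (ih h1)))
        (mul_mem_weight_of_eq ?_ (by simpa using k2) (ih h2))
      all_goals
        refine Prod.ext ?_ (Prod.ext ?_ ?_)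
        · simp [add_comm]
        · simp
        · simp only [Prod.mk_add_mk]; push_cast; ring

/-! The periodic complex. -/

/-- The elements `b₁₀^i ι(x)` and `b₁₀^i σ(x)`. -/
def tau : ℕ → BWords →ₗ[k] Cobar
  | 0 => iota
  | 1 => sigma
  | j + 2 => LinearMap.mulLeft k b10 ∘ₗ tau j

/-- The differentials `∂` and `∂²`, alternately. -/
def pdJ : ℕ → BWords →ₗ[k] BWords
  | 0 => pdN
  | 1 => pdN ∘ₗ pdN
  | j + 2 => pdJ j

/-- The maps `1` and `-∂`, alternately. -/
def up : ℕ → BWords →ₗ[k] BWords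
  | 0 => LinearMap.id
  | 1 => -pdN
  | j + 2 => up j

/-- The parity. -/
def eps : ℕ → ZMod 18
  | 0 => 0
  | 1 => 1
  | j + 2 => eps j

lemma tau_add_two (j : ℕ) (x : BWords) : tau (j + 2) x = b10 * tau j x := rfl

lemma pdJ_add_two (j : ℕ) : pdJ (j + 2) = pdJ j := rfl

lemma parity_cases : ∀ j : ℕ,
    (pdJ j = pdN ∧ pdJ (j + 1) = pdN ∘ₗ pdN ∧ eps j = 0 ∧ eps (j + 1) = 1 ∧
      up j = LinearMap.id ∧ up (j + 1) = -pdN) ∨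
    (pdJ j = pdN ∘ₗ pdN ∧ pdJ (j + 1) = pdN ∧ eps j = 1 ∧ eps (j + 1) = 0 ∧
      up j = -pdN ∧ up (j + 1) = LinearMap.id)
  | 0 => Or.inl ⟨rfl, rfl, rfl, rfl, rfl, rfl⟩
  | 1 => Or.inr ⟨rfl, rfl, rfl, rfl, rfl, rfl⟩
  | j + 2 => parity_cases j

lemma d0_tau : ∀ (j : ℕ) (x : BWords), d0 (tau j x) = tau (j + 1) (pdJ j x)
  | 0, x => d0_iota' x
  | 1, x => d0_sigma x
  | j + 2, x => by rw [tau_add_two, d0_b10_mul, d0_tau j]; rfl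

lemma d1_tau : ∀ (j : ℕ) (x : BWords), d1 (tau j x) = tau j ((-1 : k) ^ j • deltaN x)
  | 0, x => by rw [pow_zero, one_smul]; exact d1_iota x
  | 1, x => by rw [pow_one, neg_one_smul, map_neg]; exact d1_sigma x
  | j + 2, x => by rw [tau_add_two, d1_b10_mul, d1_tau j, pow_add, neg_one_sq, mul_one]; rfl

lemma tau_injective : ∀ j : ℕ, Function.Injective (tau j)
  | 0 => iota_injective
  | 1 => fun x y h => by
    have h' : sigma x = sigma y := h
    rw [sigma_apply, sigma_apply] at h'
    refine iota_injective (startJ_unique (zero_mem startJ) (zero_mem startJ)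
      (v := -iota (pdN x)) (v' := -iota (pdN y)) ?_).2.1
    rw [mul_neg, mul_neg, zero_add, zero_add, ← sub_eq_add_neg, h', sub_eq_add_neg]
  | j + 2 => fun x y h => tau_injective j (b10_mul_cancel h)

lemma tau_mem_per : ∀ (j : ℕ) (x : BWords), tau j x ∈ per
  | 0, x => iota_mem_per x
  | 1, x => sigma_mem_per x
  | j + 2, x => b10_mul_mem_per (tau_mem_per j x)

lemma tau_mem_wordW {n : ℕ} {t : ZMod 18} {x : BWords} (hx : x ∈ homB (n, t)) : ∀ j : ℕ,
    tau j x ∈ wordSpan {u | wordW u = ((n : ℤ), (j : ℤ), t - 3 * n - eps j)}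
  | 0 => by
    rw [eps, sub_zero]
    exact iota_mem_wordW hx
  | 1 => by
    have h := pdN_mem hx (t' := t - 2) (by ring)
    change sigma x ∈ _
    rw [sigma_apply]
    refine sub_mem (mul_mem_weight_of_eq ?_ h10_mem_wordW (iota_mem_wordW hx))
      (mul_mem_weight_of_eq ?_ q20_mem_wordW (iota_mem_wordW h))
    · refine Prod.ext (by simp) (Prod.ext (by simp) ?_)
      simp only [Prod.mk_add_mk, eps]; ring
    · refine Prod.ext (by simp) (Prod.ext (by simp) ?_)
      simp only [Prod.mk_add_mk, eps]; ring
  | j + 2 => by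
    refine mul_mem_weight_of_eq ?_ b10_mem_wordW (tau_mem_wordW hx j)
    refine Prod.ext (by simp) (Prod.ext (by push_cast; exact add_comm _ _) ?_)
    simp only [Prod.mk_add_mk, eps, zero_add]

lemma tau_bword_mem (j : ℕ) (w : List BLetter) : tau j (bword w) ∈
    wordSpan {u | wordW u = ((w.length : ℤ), (j : ℤ), wdeg w - 3 * w.length - eps j)} :=
  tau_mem_wordW (bword_mem rfl) j

lemma tau_mem_countD (j : ℕ) (x : BWords) : tau j x ∈ wordSpan {u | countD u = j} :=
  map_mem_of_bwords (fun w _ => wordSpan_mono (fun u hu => by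
    have hu : wordW u = _ := hu
    change (wordW u).2.1 = j
    rw [hu]) (tau_bword_mem j w)) (mem_bSpan_univ x)

lemma wordProj_tau (s : ℤ) (j : ℕ) (g : ZMod 18) (x : BWords) :
    wordProj {u | wordW u = (s, (j : ℤ), g)} (tau j x) = tau j (homP s (g + 3 * s + eps j) x) := by
  refine bwords_ext (wordProj {u | wordW u = (s, (j : ℤ), g)} ∘ₗ tau j)
    (tau j ∘ₗ homP s (g + 3 * s + eps j)) (fun w => ?_) x
  simp only [LinearMap.comp_apply]
  have h := tau_bword_mem j w
  by_cases hw : bwt w = (s, g + 3 * s + eps j)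
  · rw [homP, bProj_pos hw]
    have h1 : (w.length : ℤ) = s := congrArg Prod.fst hw
    have h2 : (wdeg w : ZMod 18) = g + 3 * s + eps j := congrArg Prod.snd hw
    refine wordProj_of_mem ?_
    have e : ((w.length : ℤ), (j : ℤ), (wdeg w : ZMod 18) - 3 * w.length - eps j) = (s, (j : ℤ), g) := by
      rw [h2, ← h1]
      refine Prod.ext rfl (Prod.ext rfl ?_)
      push_cast; ring
    rwa [e] at h
  · rw [homP, bProj_neg hw, map_zero]
    refine wordProj_of_disjoint (fun u hu hu' => hw ?_) h
    have e : ((w.length : ℤ), (j : ℤ), (wdeg w : ZMod 18) - 3 * w.length - eps j) = (s, (j : ℤ), g) :=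
      (show wordW u = _ from hu).symm.trans hu'
    simp only [Prod.mk.injEq] at e
    refine Prod.ext e.1 ?_
    simp only [bwt]
    rw [← e.2.2, ← e.1]; push_cast; ring

lemma countD_nonneg (u : List Letter) : 0 ≤ countD u := by
  rw [countD]
  induction u with
  | nil => simp [weight]
  | cons l u ih =>
    rw [weight_cons, Prod.snd_add, Prod.fst_add]
    have : letterJ l ≤ 1 := by rw [letterJ]; split_ifs <;> norm_num
    simp only [letterW]
    linarith

lemma wordProj_countD_neg {j : ℤ} (hj : j < 0) (x : Cobar) : wordProj {u | countD u = j} x = 0 :=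
  wordProj_of_disjoint (T := Set.univ) (fun u _ hu => by
    have := countD_nonneg u
    have hu : countD u = j := hu
    omega) (by rw [wordSpan_univ]; trivial)

lemma b10_wordProj (j : ℤ) (x : Cobar) :
    b10 * wordProj {u | countD u = j} x = wordProj {u | countD u = j + 2} (b10 * x) :=
  (mulLeft_shifts b10_mem_wordW).countD.wordProj j x

lemma exists_wordProj_per {p : Cobar} (hp : p ∈ per) (j : ℕ) :
    ∃ x, wordProj {u | countD u = j} p = tau j x := by
  have key : ∀ i x, ∃ y, wordProj {u | countD u = j} (tau i x) = tau j y := by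
    intro i x
    by_cases h : i = j
    · subst h; exact ⟨x, wordProj_of_mem (tau_mem_countD i x)⟩
    · refine ⟨0, ?_⟩
      rw [map_zero]
      refine wordProj_of_disjoint (fun u hu hu' => h ?_) (tau_mem_countD i x)
      exact_mod_cast (show countD u = i from hu).symm.trans hu'
  induction hp generalizing j with
  | iota x => exact key 0 x
  | sigma x => exact key 1 x
  | @b10_mul y _ ih =>
    have e : wordProj {u | countD u = j} (b10 * y) =
        b10 * wordProj {u | countD u = (j : ℤ) - 2} y := by
      rw [b10_wordProj, sub_add_cancel]
    rcases lt_or_ge j 2 with hj | hj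
    · exact ⟨0, by rw [e, wordProj_countD_neg (by omega), mul_zero, map_zero]⟩
    · obtain ⟨i, rfl⟩ := Nat.exists_eq_add_of_le' hj
      obtain ⟨x, hx⟩ := ih i (fun i' x => by
        by_cases h : i' = i
        · subst h; exact ⟨x, wordProj_of_mem (tau_mem_countD i' x)⟩
        · refine ⟨0, ?_⟩
          rw [map_zero]
          refine wordProj_of_disjoint (fun u hu hu' => h ?_) (tau_mem_countD i' x)
          exact_mod_cast (show countD u = i' from hu).symm.trans hu')
      refine ⟨x, ?_⟩
      rw [e, tau_add_two, ← hx]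
      push_cast
      rw [add_sub_cancel_right]
  | add _ _ h h' =>
    obtain ⟨x, hx⟩ := h j key
    obtain ⟨y, hy⟩ := h' j key
    exact ⟨x + y, by rw [map_add, hx, hy, map_add]⟩

lemma d0_wordProj (j : ℤ) (x : Cobar) :
    d0 (wordProj {u | countD u = j} x) = wordProj {u | countD u = j + 1} (d0 x) :=
  d0_shifts_wordW.countD.wordProj j x

lemma d1_wordProj (j : ℤ) (x : Cobar) :
    d1 (wordProj {u | countD u = j} x) = wordProj {u | countD u = j} (d1 x) := by
  have := d1_shifts_wordW.countD.wordProj j x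
  rwa [add_zero] at this

lemma exists_pdJ_of_tau {j : ℕ} {x : BWords} {z : Cobar} (h : tau j x = d0 z) :
    ∃ l, x = pdJ (j + 1) l := by
  obtain ⟨p, hp, w, rfl⟩ := exists_of_d0_mem_per (h ▸ tau_mem_per j x)
  rw [map_add, d0_d0, add_zero] at h
  have h1 := wordProj_of_mem (tau_mem_countD j x)
  rw [h, show (j : ℤ) = (j - 1 : ℤ) + 1 by ring, ← d0_wordProj] at h1
  rw [← h] at h1
  cases j with
  | zero =>
    rw [wordProj_countD_neg (by norm_num), map_zero] at h1
    refine ⟨0, tau_injective 0 ?_⟩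
    rw [← h1, map_zero, map_zero]
  | succ j =>
    obtain ⟨l, hl⟩ := exists_wordProj_per hp j
    refine ⟨l, tau_injective (j + 1) ?_⟩
    rw [← h1]
    push_cast
    rw [add_sub_cancel_right, hl, d0_tau]
    rfl

/-- The sums of a `d₀`-boundary and the `d₁`-boundary of a `d₀`-cycle. -/
def bdry : Submodule k Cobar := LinearMap.range d0 ⊔ (LinearMap.ker d0).map d1

lemma d0_mem_bdry (x : Cobar) : d0 x ∈ bdry := Submodule.mem_sup_left ⟨x, rfl⟩

lemma d1_mem_bdry {x : Cobar} (h : d0 x = 0) : d1 x ∈ bdry := Submodule.mem_sup_right ⟨x, h, rfl⟩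

lemma exists_of_mem_bdry {x : Cobar} (h : x ∈ bdry) : ∃ z y, d0 y = 0 ∧ x = d0 z + d1 y := by
  obtain ⟨_, ⟨z, rfl⟩, _, ⟨y, hy, rfl⟩, e⟩ := Submodule.mem_sup.1 h
  exact ⟨z, y, hy, e.symm⟩

lemma wordProj_mem_bdry {x : Cobar} (h : x ∈ bdry) (j : ℤ) : wordProj {u | countD u = j} x ∈ bdry := by
  obtain ⟨z, y, hy, rfl⟩ := exists_of_mem_bdry h
  obtain ⟨i, rfl⟩ : ∃ i, j = i + 1 := ⟨j - 1, by ring⟩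
  rw [map_add, ← d0_wordProj, ← d1_wordProj]
  exact add_mem (d0_mem_bdry _) (d1_mem_bdry (by rw [d0_wordProj, hy, map_zero]))

lemma exists_of_tau_mem_bdry {j : ℕ} {x : BWords} (h : tau j x ∈ bdry) :
    ∃ l c, pdJ j c = 0 ∧ x = pdJ (j + 1) l + deltaN c := by
  obtain ⟨z, y, hy, e⟩ := exists_of_mem_bdry h
  obtain ⟨p, hp, w, rfl⟩ := exists_of_d0_mem_per (c := y) (by rw [hy]; exact zero_mem _)
  rw [map_add, d0_d0, add_zero] at hy
  obtain ⟨c, hc⟩ := exists_wordProj_per hp j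
  have hc0 : pdJ j c = 0 := by
    apply tau_injective (j + 1)
    rw [← d0_tau, ← hc, d0_wordProj, hy, map_zero, map_zero]
  have e1 : tau j x = d0 (z - d1 w) + d1 p := by
    rw [e, map_add, map_sub, d0_d1]; abel
  have h1 := wordProj_of_mem (tau_mem_countD j x)
  rw [e1, map_add, show (j : ℤ) = (j - 1 : ℤ) + 1 by ring, ← d0_wordProj, sub_add_cancel,
    ← d1_wordProj, hc, d1_tau, ← e1] at h1
  obtain ⟨l, hl⟩ := exists_pdJ_of_tau (j := j) (x := x - (-1 : k) ^ j • deltaN c)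
    (by rw [map_sub, ← h1, add_sub_cancel_right])
  refine ⟨l, (-1 : k) ^ j • c, by rw [map_smul, hc0, smul_zero], ?_⟩
  rw [map_smul, ← hl, sub_add_cancel]

lemma tau_add_two_mem_bdry {j : ℕ} {l c : BWords} (hc : pdJ j c = 0) :
    tau (j + 2) (pdJ (j + 1) l + deltaN c) ∈ bdry := by
  rw [map_add]
  refine add_mem ?_ ?_
  · rw [← d0_tau]; exact d0_mem_bdry _
  · have h := d1_tau (j + 2) ((-1 : k) ^ (j + 2) • c)
    rw [map_smul deltaN, smul_smul, ← mul_pow, neg_one_mul, neg_neg, one_pow, one_smul] at h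
    rw [← h]
    refine d1_mem_bdry ?_
    rw [d0_tau, pdJ_add_two, map_smul, hc, smul_zero, map_zero]

lemma exists_tau {s : ℤ} {j : ℕ} {g : ZMod 18} {x : Cobar}
    (hx : x ∈ wordSpan {u | wordW u = (s, (j : ℤ), g)}) (h0 : d0 x = 0) (h1 : d1 x ∈ LinearMap.range d0) :
    ∃ F ∈ homB (s, g + 3 * s + eps j), pdJ j F = 0 ∧ (∃ G, deltaN F = pdJ (j + 1) G) ∧
      ∃ e, x = tau j F + d0 e := by
  obtain ⟨p, hp, e, he⟩ := exists_of_d0_mem_per (c := x) (by rw [h0]; exact zero_mem _)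
  obtain ⟨F, hF⟩ := exists_wordProj_per hp j
  have e1 : x = tau j (homP s (g + 3 * s + eps j) F) +
      d0 (wordProj {u | wordW u = (s, (j : ℤ) - 1, g + 3)} e) := by
    have h2 := wordProj_of_mem hx
    have hS : {u | wordW u = (s, (j : ℤ), g)} ∩ {u | countD u = j} = {u | wordW u = (s, (j : ℤ), g)} := by
      refine Set.inter_eq_left.2 fun u hu => ?_
      have hu : wordW u = _ := hu
      change (wordW u).2.1 = j
      rw [hu]
    have h3 := d0_shifts_wordW.wordProj (s, (j : ℤ) - 1, g + 3) e
    rw [show ((s, (j : ℤ) - 1, g + 3) : ℤ × ℤ × ZMod 18) + (0, 1, -3) = (s, (j : ℤ), g) by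
      simp] at h3
    rw [← wordProj_tau, ← hF, wordProj_wordProj, hS, h3, ← map_add, ← he, h2]
  refine ⟨_, homP_mem _ _ F, ?_, ?_, _, e1⟩
  · apply tau_injective (j + 1)
    rw [← d0_tau, map_zero, ← h0]
    conv_rhs => rw [e1, map_add, d0_d0, add_zero]
  · obtain ⟨z, hz⟩ := h1
    rw [e1, map_add, d1_tau] at hz
    obtain ⟨G, hG⟩ := exists_pdJ_of_tau (j := j)
      (x := (-1 : k) ^ j • deltaN (homP s (g + 3 * s + eps j) F))
      (z := z + d1 (wordProj {u | wordW u = (s, (j : ℤ) - 1, g + 3)} e))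
      (by rw [map_add, hz, d0_d1]; abel)
    refine ⟨(-1 : k) ^ j • G, ?_⟩
    rw [map_smul, ← hG, smul_smul, ← mul_pow, neg_one_mul, neg_neg, one_pow, one_smul]

lemma h10_mul_tau : ∀ {j : ℕ} {x : BWords}, pdJ j x = 0 →
    ∃ e, h10 * tau j x = tau (j + 1) (up j x) + d0 e
  | 0, x, h => ⟨0, by
    have h : pdN x = 0 := h
    change h10 * iota x = sigma x + d0 0
    rw [sigma_apply, h]; simp⟩
  | 1, x, h => ⟨-(q20 * iota x), by
    have h : pdN (pdN x) = 0 := h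
    change h10 * sigma x = b10 * iota (-pdN x) + d0 (-(q20 * iota x))
    rw [map_neg, map_neg, d0_q20_mul, d0_iota', sigma_apply, sigma_apply, h, b10_mul]
    simp only [map_zero, mul_zero, sub_zero]
    noncomm_ring⟩
  | j + 2, x, h => by
    obtain ⟨e, he⟩ := h10_mul_tau (j := j) h
    have h0 : d0 (tau j x) = 0 := by rw [d0_tau, show pdJ j x = 0 from h, map_zero]
    refine ⟨b10 * e - q20 * (q20 * tau j x), ?_⟩
    have e1 : h10 * (b10 * tau j x) = b10 * (h10 * tau j x) - d0 (q20 * (q20 * tau j x)) := by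
      rw [d0_q20_mul, d0_q20_mul, h0, b10_mul, b10_mul]
      noncomm_ring
    rw [tau_add_two, e1, he, map_sub, d0_b10_mul]
    change _ = b10 * tau (j + 1) (up j x) + _
    noncomm_ring

/-! Exactness on the `E₂`-page. -/

lemma exists_countD_lt (x : Cobar) : ∃ n : ℕ, x ∈ wordSpan {u | countD u < n} := by
  have hx : x ∈ wordSpan Set.univ := by rw [wordSpan_univ]; trivial
  have hmono : ∀ {m n : ℕ}, m ≤ n → {u | countD u < m} ⊆ {u | countD u < n} :=
    fun {m n} h u hu => lt_of_lt_of_le (show countD u < (m : ℤ) from hu) (by exact_mod_cast h)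
  induction hx using Submodule.span_induction with
  | mem y hy =>
    obtain ⟨u, -, rfl⟩ := hy
    refine ⟨(countD u).toNat + 1, wordBasis_mem ?_⟩
    change countD u < _
    push_cast
    omega
  | zero => exact ⟨0, zero_mem _⟩
  | add y z _ _ hy hz =>
    obtain ⟨m, hm⟩ := hy
    obtain ⟨n, hn⟩ := hz
    exact ⟨max m n, add_mem (wordSpan_mono (hmono (le_max_left _ _)) hm)
      (wordSpan_mono (hmono (le_max_right _ _)) hn)⟩
  | smul c y _ hy => obtain ⟨n, hn⟩ := hy; exact ⟨n, Submodule.smul_mem _ _ hn⟩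

lemma le_of_countD {Q N : Submodule k Cobar} (hQ : ∀ x ∈ Q, ∀ j : ℤ, wordProj {u | countD u = j} x ∈ Q)
    (hN : ∀ x ∈ Q, ∀ j : ℕ, x ∈ wordSpan {u | countD u = j} → x ∈ N) : Q ≤ N := by
  intro x hxQ
  obtain ⟨n, hx⟩ := exists_countD_lt x
  induction n generalizing x with
  | zero =>
    rw [← wordProj_of_mem hx, wordProj_of_disjoint (T := Set.univ) (fun u _ hu => ?_)
      (by rw [wordSpan_univ]; trivial)]
    · exact zero_mem _
    · have := countD_nonneg u
      have hu : countD u < (0 : ℕ) := hu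
      push_cast at hu
      omega
  | succ n ih =>
    have h1 := hQ x hxQ n
    rw [← add_sub_cancel (wordProj {u | countD u = n} x) x]
    have e : x - wordProj {u | countD u = n} x = wordProj {u | countD u = n}ᶜ x := by
      rw [sub_eq_iff_eq_add', wordProj_add_compl]
    refine add_mem (hN _ h1 n (wordProj_mem _ _)) (ih (sub_mem hxQ h1) ?_)
    rw [e]
    refine wordSpan_mono (fun u hu => ?_) (mem_wordSpan_inter (wordProj_mem _ _)
      (wordProj_mem_of_mem hx))
    obtain ⟨h1, h2⟩ := hu
    have h1 : countD u ≠ n := h1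
    have h2 : countD u < (n + 1 : ℕ) := h2
    change countD u < n
    push_cast at h2
    omega

/-- The homogeneous representatives of cycles on the `E₁`-page. -/
def cyc (s : ℤ) (g : ZMod 18) : Submodule k Cobar :=
  wordSpan {u | countJ u = s ∧ grade u = g} ⊓ LinearMap.ker d0 ⊓ (LinearMap.range d0).comap d1

lemma wordProj_mem_cyc {s : ℤ} {g : ZMod 18} {x : Cobar} (hx : x ∈ cyc s g) (j : ℤ) :
    wordProj {u | countD u = j} x ∈ cyc s g := by
  obtain ⟨⟨h1, h2⟩, z, hz⟩ := hx
  have h2 : d0 x = 0 := h2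
  refine ⟨⟨wordProj_mem_of_mem h1, ?_⟩, wordProj {u | countD u = j - 1} z, ?_⟩
  · change d0 _ = 0
    rw [d0_wordProj, h2, map_zero]
  · rw [d0_wordProj, sub_add_cancel, hz, d1_wordProj]

lemma b10_mul_mem_bdry_of_range (e : Cobar) : b10 * d0 e ∈ bdry := by
  rw [← d0_b10_mul]; exact d0_mem_bdry _

lemma h10_mul_mem_bdry_of_range (e : Cobar) : h10 * d0 e ∈ bdry := by
  rw [← neg_neg (h10 * d0 e), ← d0_h10_mul]; exact neg_mem (d0_mem_bdry _)

lemma exists_tau_of_cyc {s : ℤ} {j : ℕ} {g : ZMod 18} {x : Cobar} (hx : x ∈ cyc s g)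
    (hj : x ∈ wordSpan {u | countD u = j}) : ∃ F ∈ homB (s, g + 3 * s + eps j), pdJ j F = 0 ∧
      (∃ G, deltaN F = pdJ (j + 1) G) ∧ ∃ e, x = tau j F + d0 e := by
  refine exists_tau (wordSpan_mono (fun u hu => ?_) (mem_wordSpan_inter hx.1.1 hj)) hx.1.2 hx.2
  obtain ⟨⟨h1, h2⟩, h3⟩ := hu
  refine Prod.ext ?_ (Prod.ext h3 h2)
  rw [wordW_eq]; exact h1

lemma b10_mul_mem_bdry {j : ℕ} {F l c : BWords} {x e : Cobar} (he : x = tau j F + d0 e)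
    (hc : pdJ j c = 0) (hF : F = pdJ (j + 1) l + deltaN c) : b10 * x ∈ bdry := by
  rw [he, mul_add, ← tau_add_two, hF]
  exact add_mem (tau_add_two_mem_bdry hc) (b10_mul_mem_bdry_of_range e)

/-- Vanishing of the `E₂`-page. -/
lemma b10_mul_mem_bdry_of_cyc {s : ℤ} {g : ZMod 18} (h0 : g ≠ 4 * s) (h1 : g ≠ 4 * s - 1) {x : Cobar}
    (hx : x ∈ cyc s g) : b10 * x ∈ bdry := by
  refine le_of_countD (Q := cyc s g) (N := bdry.comap (LinearMap.mulLeft k b10))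
    (fun x hx => wordProj_mem_cyc hx) (fun x hx j hj => ?_) hx
  obtain ⟨F, hF, hF0, ⟨G, hG⟩, e, he⟩ := exists_tau_of_cyc hx hj
  rcases parity_cases j with ⟨p1, p2, p3, -⟩ | ⟨p1, p2, p3, -⟩
  · rw [p1] at hF0
    rw [p2] at hG
    rw [p3, add_zero] at hF
    obtain ⟨l, c, hc, e1⟩ := exists_even (fun h => h0 (by linear_combination h))
      (fun h => h1 (by linear_combination h)) hF hF0 hG
    exact b10_mul_mem_bdry he (by rw [p1, hc]) (by rw [p2, e1]; rfl)
  · rw [p1] at hF0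
    rw [p2] at hG
    rw [p3] at hF
    obtain ⟨l, c, hc, e1⟩ := exists_odd (fun h => h1 (by linear_combination h))
      (fun h => h0 (by linear_combination h)) hF hF0 hG
    exact b10_mul_mem_bdry he (by rw [p1]; exact hc) (by rw [p2, e1])

/-- Injectivity of `h₁₀` on the `E₂`-page. -/
lemma b10_mul_mem_bdry_of_h10_mul {s : ℤ} {x : Cobar} (hx : x ∈ cyc s (4 * s))
    (h : h10 * x ∈ bdry) : b10 * x ∈ bdry := by
  refine le_of_countD (Q := cyc s (4 * s) ⊓ bdry.comap (LinearMap.mulLeft k h10))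
    (N := bdry.comap (LinearMap.mulLeft k b10)) (fun x hx j => ⟨wordProj_mem_cyc hx.1 j, ?_⟩)
    (fun x hx j hj => ?_) ⟨hx, h⟩
  · have h1 := (mulLeft_shifts h10_mem_wordW).countD.wordProj j x
    have h2 := wordProj_mem_bdry hx.2 (j + 1)
    rw [← show _ = _ from h1] at h2
    exact h2
  obtain ⟨hx, hh⟩ := hx
  have hh : h10 * x ∈ bdry := hh
  obtain ⟨F, hF, hF0, ⟨G, hG⟩, e, he⟩ := exists_tau_of_cyc hx hj
  obtain ⟨e', he'⟩ := h10_mul_tau hF0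
  have h1 : tau (j + 1) (up j F) ∈ bdry := by
    rw [he, mul_add, he'] at hh
    rw [← add_sub_cancel_right (tau (j + 1) (up j F)) (d0 e' + h10 * d0 e), ← add_assoc]
    exact sub_mem hh (add_mem (d0_mem_bdry _) (h10_mul_mem_bdry_of_range e))
  obtain ⟨l, c, hc, e1⟩ := exists_of_tau_mem_bdry h1
  rw [pdJ_add_two] at e1
  rcases parity_cases j with ⟨p1, p2, p3, -, p5, -⟩ | ⟨p1, p2, p3, -, p5, -⟩
  · rw [p1] at hF0
    rw [p2] at hG hc
    rw [p3, add_zero] at hF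
    rw [p1, p5] at e1
    obtain ⟨l, c, hc, e1⟩ := exists_even_of_odd (by ring) hF hF0 hG hc e1
    exact b10_mul_mem_bdry he (by rw [p1, hc]) (by rw [p2, e1]; rfl)
  · rw [p2] at hG hc
    rw [p3] at hF
    rw [p1, p5] at e1
    obtain ⟨l, c, hc, e1⟩ := exists_odd_of_even (p := -l) (c := -c) (by ring) hF hG
      (by rw [map_neg, hc, neg_zero]) (by
        rw [map_neg, map_neg, map_neg, ← neg_add, ← neg_eq_iff_eq_neg]; exact e1)
    exact b10_mul_mem_bdry he (by rw [p1]; exact hc) (by rw [p2, e1])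

/-- Surjectivity of `h₁₀` on the `E₂`-page. -/
lemma exists_h10_mul_of_cyc {s : ℤ} {x : Cobar} (hx : x ∈ cyc s (4 * s - 1)) :
    ∃ y ∈ cyc s (4 * s), b10 * x - h10 * y ∈ bdry := by
  suffices h : cyc s (4 * s - 1) ≤
      (bdry ⊔ (cyc s (4 * s)).map (LinearMap.mulLeft k h10)).comap (LinearMap.mulLeft k b10) by
    obtain ⟨z, hz, _, ⟨y, hy, rfl⟩, e⟩ := Submodule.mem_sup.1 (h hx)
    refine ⟨y, hy, ?_⟩
    have e : z + h10 * y = b10 * x := e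
    rwa [← e, add_sub_cancel_right]
  refine le_of_countD (fun x hx => wordProj_mem_cyc hx) (fun x hx j hj => ?_)
  obtain ⟨F, hF, hF0, ⟨G, hG⟩, e, he⟩ := exists_tau_of_cyc hx hj
  obtain ⟨n, g', hn, hgs, hn0, x', hx', hup⟩ : ∃ n g', n ∈ homB (s, g') ∧
      g' - 3 * s - eps (j + 1) = 4 * s ∧ pdJ (j + 1) n = 0 ∧
      ∃ x', deltaN n = pdJ j x' ∧ b10 * tau j F - tau (j + 2) (up (j + 1) n) ∈ bdry := by
    rcases parity_cases j with ⟨p1, p2, p3, p4, -, p6⟩ | ⟨p1, p2, p3, p4, -, p6⟩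
    · rw [p1] at hF0
      rw [p2] at hG
      rw [p3, add_zero] at hF
      obtain ⟨n, hn, hn0, ⟨x', hx'⟩, c, hc, e1⟩ := exists_odd_mod_even (by ring) hF hF0 hG
      refine ⟨-n, _, neg_mem hn, by rw [p4]; ring, by rw [p2, map_neg]; exact neg_eq_zero.2 hn0,
        -x', by rw [p1, map_neg, map_neg, hx'], ?_⟩
      have h := tau_add_two_mem_bdry (j := j) (l := 0) (c := c) (by rw [p1, hc])
      rw [map_zero, zero_add] at h
      rw [← tau_add_two, ← map_sub, p6, e1]
      convert h using 2
      simp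
    · rw [p1] at hF0
      rw [p2] at hG
      rw [p3] at hF
      obtain ⟨c, hc, hc0, ⟨p, hp⟩, l, n, hn, e1⟩ := exists_even_mod_odd (by ring) hF hF0 hG
      refine ⟨c, _, hc, by rw [p4]; ring, by rw [p2, hc0], p, by rw [p1, hp]; rfl, ?_⟩
      have h := tau_add_two_mem_bdry (j := j) (l := l) (c := n) (by rw [p1]; exact hn)
      rw [← tau_add_two, ← map_sub, p6, e1]
      convert h using 2
      rw [p2, LinearMap.id_apply]
      abel
  obtain ⟨e', he'⟩ := h10_mul_tau hn0
  have hs : 0 ≤ s ∨ tau (j + 1) n = 0 := by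
    by_cases h : 0 ≤ s
    · exact Or.inl h
    · refine Or.inr ?_
      have : n = 0 := apply_eq_of_bwords (f := LinearMap.id) (g := 0) (fun w hw => by
        have : (w.length : ℤ) = s := congrArg Prod.fst hw
        omega) hn
      rw [this, map_zero]
  refine Submodule.mem_sup.2 ⟨b10 * x - h10 * tau (j + 1) n, ?_, h10 * tau (j + 1) n,
    ⟨tau (j + 1) n, ⟨⟨?_, ?_⟩, ?_⟩, rfl⟩, sub_add_cancel _ _⟩
  · rw [he', he, mul_add, add_comm, add_sub_assoc, ← sub_sub]
    exact add_mem (b10_mul_mem_bdry_of_range e) (sub_mem hup (d0_mem_bdry _))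
  · rcases hs with hs | hs
    · obtain ⟨m, rfl⟩ := Int.eq_ofNat_of_zero_le hs
      refine wordSpan_mono (fun u hu => ?_) (tau_mem_wordW hn (j + 1))
      have hu : wordW u = _ := hu
      have h1 : (wordW u).1 = countJ u := by rw [wordW_eq]
      refine ⟨?_, ?_⟩
      · rw [← h1, hu]
      · change (wordW u).2.2 = _
        rw [hu, ← hgs]
        push_cast
        rfl
    · rw [hs]; exact zero_mem _
  · change d0 _ = 0
    rw [d0_tau, hn0, map_zero]
  · refine ⟨tau j ((-1 : k) ^ (j + 1) • x'), ?_⟩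
    rw [d0_tau, d1_tau, hx', map_smul (pdJ j)]

/-! Exactness in the cobar complex. -/

lemma mem_F {s : ℕ} {x : Cobar} : x ∈ F s ↔ x ∈ wordSpan {u | (s : ℤ) ≤ countJ u} := by
  rw [← filt_eq]; rfl

/-- The boundaries on the `E₂`-page. -/
def bdryF (s : ℕ) : Submodule kb Cobar := F (s + 1) ⊔ (F (s - 1)).map dKb

lemma mem_bdryF {s : ℕ} {x : Cobar} : x ∈ bdryF s ↔ ∃ f ∈ F (s + 1), ∃ e ∈ F (s - 1), x = f + d e := by
  rw [bdryF, Submodule.mem_sup]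
  constructor
  · rintro ⟨f, hf, _, ⟨e, he, rfl⟩, h⟩
    exact ⟨f, hf, e, he, h.symm⟩
  · rintro ⟨f, hf, e, he, h⟩
    exact ⟨f, hf, _, ⟨e, he, rfl⟩, h.symm⟩

lemma d0_projJ (s : ℤ) (x : Cobar) :
    d0 (wordProj {u | countJ u = s} x) = wordProj {u | countJ u = s} (d0 x) := by
  have := d0_shifts_countJ.wordProj s x
  rwa [add_zero] at this

lemma d1_projJ (s : ℤ) (x : Cobar) :
    d1 (wordProj {u | countJ u = s - 1} x) = wordProj {u | countJ u = s} (d1 x) := by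
  have := d1_shifts_countJ.wordProj (s - 1) x
  rwa [sub_add_cancel] at this

lemma projJ_of_lt {s t : ℤ} (h : s < t) {x : Cobar} (hx : x ∈ wordSpan {u | t ≤ countJ u}) :
    wordProj {u | countJ u = s} x = 0 :=
  wordProj_of_disjoint (fun u hu hu' => by
    have hu : t ≤ countJ u := hu
    have hu' : countJ u = s := hu'
    omega) hx

lemma mem_F_of_countJ {s : ℕ} {t : ℤ} (h : (s : ℤ) ≤ t ∨ s = 0) {x : Cobar}
    (hx : x ∈ wordSpan {u | countJ u = t}) : x ∈ F s :=
  mem_F.2 (wordSpan_mono (fun u hu => by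
    have hu : countJ u = t := hu
    have := countJ_nonneg u
    change (s : ℤ) ≤ countJ u
    omega) hx)

lemma mem_bdryF_of_mem_bdry {s : ℕ} {x : Cobar} (hx : x ∈ wordSpan {u | countJ u = (s : ℤ)})
    (h : x ∈ bdry) : x ∈ bdryF s := by
  obtain ⟨z, y, hy, e⟩ := exists_of_mem_bdry h
  have h1 := wordProj_of_mem hx
  rw [e, map_add, ← d0_projJ, ← d1_projJ, ← e] at h1
  have hy' : d0 (wordProj {u | countJ u = (s : ℤ) - 1} y) = 0 := by rw [d0_projJ, hy, map_zero]
  refine mem_bdryF.2 ⟨-d1 (wordProj {u | countJ u = (s : ℤ)} z), ?_,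
    wordProj {u | countJ u = (s : ℤ)} z + wordProj {u | countJ u = (s : ℤ) - 1} y, ?_, ?_⟩
  · exact neg_mem (mem_F_of_countJ (Or.inl (by push_cast; rfl))
      (d1_shifts_countJ.mem (wordProj_mem _ _)))
  · exact add_mem (mem_F_of_countJ (Or.inl (by omega)) (wordProj_mem _ _))
      (mem_F_of_countJ (by omega) (wordProj_mem _ _))
  · rw [← h1, map_add, d_eq, d_eq, hy']
    abel

lemma mem_bdry_of_mem_bdryF {s : ℕ} {x : Cobar} (hx : x ∈ wordSpan {u | countJ u = (s : ℤ)})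
    (h : x ∈ bdryF s) : x ∈ bdry := by
  obtain ⟨f, hf, e, he, h⟩ := mem_bdryF.1 h
  have hf := mem_F.1 hf
  have he := mem_F.1 he
  push_cast at hf
  have h1 : wordProj {u | countJ u = (s : ℤ)} x = d0 (wordProj {u | countJ u = (s : ℤ)} e) +
      d1 (wordProj {u | countJ u = (s : ℤ) - 1} e) := by
    rw [h, d_eq, map_add, map_add, projJ_of_lt (by omega) hf, zero_add, d0_projJ, d1_projJ]
  have h2 : wordProj {u | countJ u = (s : ℤ) - 1} x = d0 (wordProj {u | countJ u = (s : ℤ) - 1} e) := by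
    have h3 : wordProj {u | countJ u = (s : ℤ) - 1 - 1} e = 0 := by
      rcases s with _ | s
      · exact wordProj_of_disjoint (T := Set.univ) (fun u _ hu => by
          have hu : countJ u = _ := hu
          have := countJ_nonneg u
          simp at hu
          omega) (by rw [wordSpan_univ]; trivial)
      · exact projJ_of_lt (by push_cast; simp) he
    rw [h, d_eq, map_add, map_add, projJ_of_lt (by omega) hf, zero_add, d0_projJ, ← d1_projJ, h3,
      map_zero, add_zero]
  rw [wordProj_of_mem hx] at h1
  rw [wordProj_of_disjoint (fun u hu hu' => by
    have hu : countJ u = _ := hu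
    have hu' : countJ u = _ := hu'
    omega) hx] at h2
  rw [h1]
  exact add_mem (d0_mem_bdry _) (d1_mem_bdry h2.symm)

/-- The leading component of a cochain. -/
lemma exists_leading {s : ℕ} {g : ZMod 18} {c : Cobar} (hc : c ∈ F s)
    (hg : c ∈ wordSpan {u | grade u = g}) (hd : d c ∈ F (s + 2)) :
    ∃ x ∈ cyc s g, c - x ∈ F (s + 1) := by
  have hc' := mem_F.1 hc
  have hd' := mem_F.1 hd
  push_cast at hd'
  refine ⟨wordProj {u | countJ u = (s : ℤ)} c, ⟨⟨?_, ?_⟩, ?_⟩, ?_⟩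
  · exact mem_wordSpan_inter (wordProj_mem _ _) (wordProj_mem_of_mem hg)
  · change d0 _ = 0
    have h := projJ_of_lt (s := s) (by omega) hd'
    rw [d_eq, map_add, ← d1_projJ, projJ_of_lt (by omega) hc', map_zero, add_zero] at h
    rw [d0_projJ, h]
  · refine ⟨-wordProj {u | countJ u = (s : ℤ) + 1} c, ?_⟩
    have h := projJ_of_lt (s := s + 1) (by omega) hd'
    rw [d_eq, map_add, ← d0_projJ, ← d1_projJ, add_sub_cancel_right] at h
    rw [map_neg]
    exact neg_eq_of_add_eq_zero_right h
  · have e : c - wordProj {u | countJ u = (s : ℤ)} c = wordProj {u | countJ u = (s : ℤ)}ᶜ c := by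
      rw [sub_eq_iff_eq_add', wordProj_add_compl]
    rw [e, mem_F]
    refine wordSpan_mono (fun u hu => ?_) (mem_wordSpan_inter (wordProj_mem _ _)
      (wordProj_mem_of_mem hc'))
    obtain ⟨h1, h2⟩ := hu
    have h1 : countJ u ≠ s := h1
    have h2 : (s : ℤ) ≤ countJ u := h2
    change ((s + 1 : ℕ) : ℤ) ≤ countJ u
    push_cast
    omega

lemma F_succ_le_bdryF (s : ℕ) : F (s + 1) ≤ bdryF s := le_sup_left

lemma mul_mem_F (c : Cobar) {s : ℕ} {x : Cobar} (hx : x ∈ F s) : c * x ∈ F s := mulKb_mem_F c s hx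

lemma mul_mem_countJ {c x : Cobar} {s : ℤ} (hc : c ∈ wordSpan {u | countJ u = 0})
    (hx : x ∈ wordSpan {u | countJ u = s}) : c * x ∈ wordSpan {u | countJ u = s} :=
  mul_mem_weight_of_eq (zero_add s) hc hx

lemma b10_mem_countJ : b10 ∈ wordSpan {u | countJ u = 0} := by
  rw [b10_eq]
  exact add_mem (mul_mem_countJ h10_mem_countJ q20_mem_countJ)
    (mul_mem_countJ q20_mem_countJ h10_mem_countJ)

lemma cyc_le (s : ℤ) (g : ZMod 18) : cyc s g ≤ wordSpan {u | countJ u = s} :=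
  fun _ hx => wordSpan_mono (fun _ hu => hu.1) hx.1.1

/-- Left and right multiplication by `b₁₀` agree on the `E₂`-page. -/
lemma X_smul_sub_mem_bdryF {s : ℕ} {c : Cobar} (hc : c ∈ F s) (hd : d c ∈ F (s + 2)) :
    (Polynomial.X : kb) • c - b10 * c ∈ bdryF s := by
  rw [X_smul, ← d_htpy, add_comm]
  exact mem_bdryF.2 ⟨_, F_anti (Nat.le_succ _) (htpy_mem_filt hd), _,
    F_anti (Nat.sub_le _ _) (htpy_mem_filt hc), rfl⟩

lemma X_smul_mem_bdryF_of {s : ℕ} {c x : Cobar} (hc : c ∈ F s) (hd : d c ∈ F (s + 2))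
    (hx : x ∈ wordSpan {u | countJ u = (s : ℤ)}) (hcx : c - x ∈ F (s + 1)) (h : b10 * x ∈ bdry) :
    (Polynomial.X : kb) • c ∈ bdryF s := by
  rw [← sub_add_cancel ((Polynomial.X : kb) • c) (b10 * c)]
  refine add_mem (X_smul_sub_mem_bdryF hc hd) ?_
  rw [← sub_add_cancel (b10 * c) (b10 * x), ← mul_sub]
  exact add_mem (F_succ_le_bdryF s (mul_mem_F _ hcx))
    (mem_bdryF_of_mem_bdry (mul_mem_countJ b10_mem_countJ hx) h)

lemma X_smul_mem_bdryF {s : ℕ} {g : ZMod 18} (h0 : g ≠ 4 * (s : ZMod 18))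
    (h1 : g ≠ 4 * (s : ZMod 18) - 1) {c : Cobar} (hc : c ∈ F s)
    (hg : c ∈ wordSpan {u | grade u = g}) (hd : d c ∈ F (s + 2)) :
    (Polynomial.X : kb) • c ∈ bdryF s := by
  obtain ⟨x, hx, hcx⟩ := exists_leading hc hg hd
  exact X_smul_mem_bdryF_of hc hd (cyc_le _ _ hx) hcx
    (b10_mul_mem_bdry_of_cyc (by exact_mod_cast h0) (by exact_mod_cast h1) hx)

lemma X_smul_mem_bdryF_of_h10_mul {s : ℕ} {c : Cobar} (hc : c ∈ F s)
    (hg : c ∈ wordSpan {u | grade u = 4 * (s : ZMod 18)}) (hd : d c ∈ F (s + 2))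
    (h : h10 * c ∈ bdryF s) : (Polynomial.X : kb) • c ∈ bdryF s := by
  obtain ⟨x, hx, hcx⟩ := exists_leading hc hg hd
  refine X_smul_mem_bdryF_of hc hd (cyc_le _ _ hx) hcx
    (b10_mul_mem_bdry_of_h10_mul (by exact_mod_cast hx) ?_)
  refine mem_bdry_of_mem_bdryF (mul_mem_countJ h10_mem_countJ (cyc_le _ _ hx)) ?_
  rw [← sub_sub_cancel (h10 * c) (h10 * x), ← mul_sub]
  exact sub_mem h (F_succ_le_bdryF s (mul_mem_F _ hcx))

lemma exists_X_smul_sub_mem_bdryF {s : ℕ} {c : Cobar} (hc : c ∈ F s)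
    (hg : c ∈ wordSpan {u | grade u = 4 * (s : ZMod 18) - 1}) (hd : d c ∈ F (s + 2)) :
    ∃ c' ∈ F s, c' ∈ wordSpan {u | grade u = 4 * (s : ZMod 18)} ∧ d c' ∈ F (s + 2) ∧
      (Polynomial.X : kb) • c - h10 * c' ∈ bdryF s := by
  obtain ⟨x, hx, hcx⟩ := exists_leading hc hg hd
  obtain ⟨y, hy, hxy⟩ := exists_h10_mul_of_cyc (s := s) (x := x) (by exact_mod_cast hx)
  have hyJ := cyc_le _ _ hy
  obtain ⟨⟨hyg, hy0⟩, z, hz⟩ := hy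
  have hy0 : d0 y = 0 := hy0
  have hyg : y ∈ wordSpan {u | grade u = 4 * (s : ZMod 18)} :=
    wordSpan_mono (fun u hu => by
      have h2 : grade u = 4 * ((s : ℤ) : ZMod 18) := hu.2
      rwa [Int.cast_natCast] at h2) hyg
  -- a correction term turns `y` into a cycle on the `E₂`-page
  obtain ⟨w, hwJ, hwg, hw⟩ : ∃ w, w ∈ wordSpan {u | countJ u = (s : ℤ) + 1} ∧
      w ∈ wordSpan {u | grade u = 4 * (s : ZMod 18)} ∧ d0 w = d1 y := by
    refine ⟨wordProj {u | countJ u = (s : ℤ) + 1} (wordProj {u | grade u = 4 * (s : ZMod 18)} z),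
      wordProj_mem _ _, wordProj_mem_of_mem (wordProj_mem _ _), ?_⟩
    have h1 := d0_shifts_wordW.grade.wordProj (4 * (s : ZMod 18)) z
    rw [d0_projJ, h1, hz, wordProj_of_mem (d1_shifts_wordW.grade.mem hyg),
      wordProj_of_mem (d1_shifts_countJ.mem hyJ)]
  have hwF : w ∈ F (s + 1) := mem_F_of_countJ (Or.inl (by push_cast; rfl)) hwJ
  have hyF : y ∈ F s := mem_F_of_countJ (Or.inl le_rfl) hyJ
  refine ⟨y - w, sub_mem hyF (F_anti (Nat.le_succ _) hwF), sub_mem hyg hwg, ?_, ?_⟩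
  · rw [map_sub, d_eq, d_eq, hy0, hw, zero_add, sub_add_cancel_left]
    refine neg_mem (mem_F_of_countJ (Or.inl ?_) (d1_shifts_countJ.mem hwJ))
    push_cast
    omega
  · have e : (Polynomial.X : kb) • c - h10 * (y - w) = ((Polynomial.X : kb) • c - b10 * c) +
        b10 * (c - x) + h10 * w + (b10 * x - h10 * y) := by noncomm_ring
    rw [e]
    exact add_mem (add_mem (add_mem (X_smul_sub_mem_bdryF hc hd)
      (F_succ_le_bdryF s (mul_mem_F _ hcx))) (F_succ_le_bdryF s (mul_mem_F _ hwF)))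
      (mem_bdryF_of_mem_bdry (sub_mem (mul_mem_countJ b10_mem_countJ (cyc_le _ _ hx))
        (mul_mem_countJ h10_mem_countJ hyJ)) hxy)

/-! The localized complex. -/

/-- The part of grade `g` of a cochain. -/
def gradeProj (g : ZMod 18) : Cobar →ₗ[kb] Cobar :=
  mapKb (wordProj {u | grade u = g}) fun x => by
    have h := (mulRight_shifts b10_mem_wordW).grade.wordProj g x
    rw [add_zero] at h
    exact h.symm

lemma gradeProj_apply (g : ZMod 18) (x : Cobar) : gradeProj g x = wordProj {u | grade u = g} x := rfl

lemma gradeProj_mem (g : ZMod 18) (x : Cobar) : gradeProj g x ∈ wordSpan {u | grade u = g} :=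
  wordProj_mem _ _

lemma gradeProj_mem_F (g : ZMod 18) {s : ℕ} {x : Cobar} (hx : x ∈ F s) : gradeProj g x ∈ F s := by
  rw [mem_F] at *
  exact wordProj_mem_of_mem hx

lemma gradeProj_gradeProj (g h : ZMod 18) (x : Cobar) :
    gradeProj g (gradeProj h x) = if g = h then gradeProj h x else 0 := by
  split_ifs with hgh
  · subst hgh
    exact wordProj_of_mem (gradeProj_mem _ _)
  · exact wordProj_of_disjoint (fun u hu hu' =>
      hgh ((show grade u = g from hu').symm.trans hu)) (gradeProj_mem h x)

lemma sum_gradeProj (x : Cobar) : ∑ g, gradeProj g x = x := by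
  have h : (∑ g, wordProj {u | grade u = g}) = LinearMap.id := wordBasis.ext fun w => by
    rw [LinearMap.sum_apply, Finset.sum_eq_single (grade w)]
    · exact wordProj_pos rfl
    · intro g _ hg
      exact wordProj_neg fun h => hg (show grade w = g from h).symm
    · simp
  have h' := LinearMap.congr_fun h x
  rwa [LinearMap.sum_apply] at h'

lemma d_gradeProj (g : ZMod 18) (x : Cobar) : d (gradeProj g x) = gradeProj (g - 3) (d x) := by
  have h0 := d0_shifts_wordW.grade.wordProj g x
  have h1 := d1_shifts_wordW.grade.wordProj g x
  rw [d_eq, gradeProj_apply, h0, h1, ← map_add, ← d_eq, sub_eq_add_neg]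
  rfl

lemma d_mem_F {s : ℕ} {x : Cobar} (hx : x ∈ F s) : d x ∈ F s := by
  rw [mem_F] at *
  rw [d_eq]
  refine add_mem (map_mem_of_words (fun w hw => ?_) hx) (map_mem_of_words (fun w hw => ?_) hx)
  · refine wordSpan_mono (fun u hu => ?_) (d0_shifts_countJ w)
    rw [add_zero] at hu
    exact le_of_le_of_eq hw (show countJ u = countJ w from hu).symm
  · refine wordSpan_mono (fun u hu => ?_) (d1_shifts_countJ w)
    have hu : countJ u = countJ w + 1 := hu
    have hw : (s : ℤ) ≤ countJ w := hw
    change (s : ℤ) ≤ countJ u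
    omega

lemma d_q20_mul (x : Cobar) : d (q20 * x) = -(h10 * (h10 * x)) - q20 * d x := by
  rw [d_eq, d_eq, d0_q20_mul, d1_q20_mul]; noncomm_ring

lemma locSub_mono {p q : Submodule kb Cobar} (h : p ≤ q) : locSub p ≤ locSub q := by
  intro x hx
  obtain ⟨c, hc, N, rfl⟩ := mem_locSub.1 hx
  exact mem_locSub.2 ⟨c, h hc, N, rfl⟩

lemma lmap_mem_locSub {p q : Submodule kb Cobar} {f : Cobar →ₗ[kb] Cobar} (h : ∀ x ∈ p, f x ∈ q)
    {x : LC} (hx : x ∈ locSub p) : lmap f x ∈ locSub q := by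
  obtain ⟨c, hc, N, rfl⟩ := mem_locSub.1 hx
  rw [lmap_frac]
  exact mem_locSub.2 ⟨_, h c hc, N, rfl⟩

lemma frac_mem_sup_map {s : ℕ} {c : Cobar} {N : ℕ} :
    frac c N ∈ locSub (F (s + 1)) ⊔ (locSub (F (s - 1))).map (lmap dKb) ↔
      ∃ u : ℕ, (Polynomial.X ^ u : kb) • c ∈ bdryF s := by
  constructor
  · intro h
    obtain ⟨_, hf, _, ⟨_, he, rfl⟩, h⟩ := Submodule.mem_sup.1 h
    obtain ⟨f, hf', M, rfl⟩ := mem_locSub.1 hf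
    obtain ⟨e, he', M', rfl⟩ := mem_locSub.1 he
    refine (frac_mem_locSub (N := N)).1 (mem_locSub.2 ⟨(Polynomial.X ^ M' : kb) • f +
      (Polynomial.X ^ M : kb) • dKb e, ?_, M + M', ?_⟩)
    · exact Submodule.add_mem_sup (Submodule.smul_mem _ _ hf')
        (Submodule.smul_mem _ _ (Submodule.mem_map_of_mem he'))
    · rw [← h, lmap_frac, ← frac_add, frac_smul, add_comm M M', frac_smul]
  · rintro ⟨u, hu⟩
    obtain ⟨f, hf, _, ⟨e, he, rfl⟩, h⟩ := Submodule.mem_sup.1 hu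
    rw [← frac_smul c N u, ← h, ← frac_add, ← lmap_frac]
    exact Submodule.add_mem_sup (mem_locSub.2 ⟨f, hf, _, rfl⟩)
      (Submodule.mem_map_of_mem (mem_locSub.2 ⟨e, he, _, rfl⟩))

lemma frac_mem_sup_map_of_X_smul {s : ℕ} {c : Cobar} {N : ℕ}
    (h : (Polynomial.X : kb) • c ∈ bdryF s) :
    frac c N ∈ locSub (F (s + 1)) ⊔ (locSub (F (s - 1))).map (lmap dKb) :=
  frac_mem_sup_map.2 ⟨1, by rwa [pow_one]⟩

lemma exists_homogeneous {s : ℕ} {g : ZMod 18} {x : LC} (hx : x ∈ locSub (F s))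
    (hg : lmap (gradeProj g) x = x) (hd : lmap dKb x ∈ locSub (F (s + 2))) :
    ∃ c ∈ F s, gradeProj g c = c ∧ d c ∈ F (s + 2) ∧ ∃ N, x = frac c N := by
  obtain ⟨c, hc, N, rfl⟩ := mem_locSub.1 hx
  rw [lmap_frac, frac_mem_locSub] at hd
  obtain ⟨u, hu⟩ := hd
  refine ⟨gradeProj g ((Polynomial.X ^ u : kb) • c), gradeProj_mem_F g (Submodule.smul_mem _ _ hc), ?_,
    ?_, N + u, ?_⟩
  · rw [gradeProj_gradeProj, if_pos rfl]
  · rw [d_gradeProj]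
    refine gradeProj_mem_F _ ?_
    change dKb _ ∈ _
    rwa [map_smul]
  · rw [map_smul, frac_smul, ← lmap_frac, hg]

/-- The localized cobar complex, graded by the degree minus three times the length. -/
def cobarComplex : GradedFilteredComplex kb LC where
  F s := locSub (F s)
  anti _ _ h := locSub_mono (F_anti h)
  d := lmap dKb
  d_d x := by
    obtain ⟨c, N, rfl⟩ := exists_frac x
    rw [lmap_frac, lmap_frac, dKb_dKb, frac_zero]
  d_mem hx := lmap_mem_locSub (fun _ => d_mem_F) hx
  pr g := lmap (gradeProj g)
  pr_mem hx := lmap_mem_locSub (fun _ => gradeProj_mem_F _) hx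
  pr_pr g h x := by
    obtain ⟨c, N, rfl⟩ := exists_frac x
    rw [lmap_frac, lmap_frac, gradeProj_gradeProj]
    split_ifs
    · rfl
    · exact frac_zero N
  sum_pr x := by
    obtain ⟨c, N, rfl⟩ := exists_frac x
    simp only [lmap_frac]
    rw [frac_sum, sum_gradeProj]
  d_pr g x := by
    obtain ⟨c, N, rfl⟩ := exists_frac x
    simp only [lmap_frac]
    exact congrArg (frac · N) (d_gradeProj g c)
  a := lmap (mulKb h10)
  q := lmap (mulKb q20)
  a_mem hx := lmap_mem_locSub (fun _ => mul_mem_F h10) hx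
  q_mem hx := lmap_mem_locSub (fun _ => mul_mem_F q20) hx
  d_a x := by
    obtain ⟨c, N, rfl⟩ := exists_frac x
    simp only [lmap_frac]
    rw [← frac_neg]
    exact congrArg (frac · N) (d_h10_mul c)
  d_q x := by
    obtain ⟨c, N, rfl⟩ := exists_frac x
    simp only [lmap_frac]
    rw [← frac_neg, frac_sub]
    exact congrArg (frac · N) (d_q20_mul c)
  a_pr g x := by
    obtain ⟨c, N, rfl⟩ := exists_frac x
    simp only [lmap_frac]
    have h := (mulLeft_shifts h10_mem_wordW).grade.wordProj g c
    refine congrArg (frac · N) (h.trans ?_)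
    rw [sub_eq_add_neg]
    rfl
  q_pr g x := by
    obtain ⟨c, N, rfl⟩ := exists_frac x
    simp only [lmap_frac]
    exact congrArg (frac · N) ((mulLeft_shifts q20_mem_wordW).grade.wordProj g c)
  vanish := by
    intro s g x h0 h1 hx hg hd
    obtain ⟨c, hc, hgc, hdc, N, rfl⟩ := exists_homogeneous hx hg hd
    exact frac_mem_sup_map_of_X_smul (X_smul_mem_bdryF h0 h1 hc (hgc ▸ gradeProj_mem g c) hdc)
  a_inj := by
    intro s x hx hg hd h
    obtain ⟨c, hc, hgc, hdc, N, rfl⟩ := exists_homogeneous hx hg hd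
    rw [lmap_frac] at h
    obtain ⟨u, hu⟩ := frac_mem_sup_map.1 h
    rw [← frac_smul c N u]
    refine frac_mem_sup_map_of_X_smul (X_smul_mem_bdryF_of_h10_mul (Submodule.smul_mem _ _ hc) ?_ ?_ ?_)
    · have h1 := gradeProj_mem (4 * (s : ZMod 18)) ((Polynomial.X ^ u : kb) • c)
      rwa [map_smul, hgc] at h1
    · change dKb _ ∈ _
      rw [map_smul]
      exact Submodule.smul_mem _ _ hdc
    · change mulKb h10 _ ∈ _
      rwa [map_smul]
  a_surj := by
    intro s x hx hg hd
    obtain ⟨c, hc, hgc, hdc, N, rfl⟩ := exists_homogeneous hx hg hd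
    obtain ⟨c', hc', hgc', hdc', h⟩ :=
      exists_X_smul_sub_mem_bdryF hc (hgc ▸ gradeProj_mem _ c) hdc
    refine ⟨frac c' (N + 1), mem_locSub.2 ⟨c', hc', _, rfl⟩, ?_, ?_, ?_⟩
    · rw [lmap_frac]
      exact congrArg (frac · (N + 1)) (wordProj_of_mem hgc')
    · rw [lmap_frac]
      exact mem_locSub.2 ⟨_, hdc', _, rfl⟩
    · rw [lmap_frac, ← frac_smul c N 1, frac_sub, pow_one]
      exact frac_mem_sup_map.2 ⟨0, by rw [pow_zero, one_smul]; exact h⟩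

/-! Parity. -/

lemma even_expoDeg (e : ℕ →₀ ℕ) : Even (expoDeg e) := by
  induction e using Finsupp.induction_linear with
  | zero => simp
  | add e f he hf => rw [map_add]; exact he.add hf
  | single i n =>
    rw [expoDeg_single]
    refine Even.mul_left ?_ n
    have h : Odd (3 ^ (i + 1)) := Odd.pow (by decide)
    obtain ⟨m, hm⟩ := h
    exact ⟨m, by omega⟩

/-- The reduction modulo `2`. -/
def parity : ZMod 18 →+* ZMod 2 := ZMod.castHom (by norm_num) (ZMod 2)

lemma parity_grade (u : List Letter) : parity (grade u) = (u.length : ZMod 2) := by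
  induction u with
  | nil => exact map_zero parity
  | cons l u ih =>
    rw [grade] at ih ⊢
    rw [weight_cons, Prod.snd_add, Prod.snd_add, map_add, ih, letterW, List.length_cons]
    obtain ⟨m, hm⟩ := even_expoDeg (expo l.1.1 l.1.2)
    rw [letterDeg, hm]
    simp only [map_sub, Int.cast_natCast, map_natCast]
    push_cast
    rw [show (m : ZMod 2) + m = 0 from CharTwo.add_self_eq_zero _, add_comm]
    congr 1

lemma parity_two_mul (t : ZMod 18) : parity (2 * t) = 0 := by
  rw [map_mul, show parity 2 = 0 by decide, zero_mul]

lemma letter_mem_wordSpan (a : Pbar) : letter a ∈ wordSpan {u | u.length = 1} := by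
  obtain ⟨S, c, h⟩ := bar_eq_sum (a : P)
  have e : proj a = a := Subtype.ext (by
    rw [proj_coe, show counit (a : P) = 0 from a.2, map_zero, sub_zero])
  rw [← e, show letter (proj a) = bar a from rfl, h]
  refine Submodule.sum_mem _ fun l _ => Submodule.smul_mem _ _ ?_
  have := wordBasis_mem (S := {u : List Letter | u.length = 1}) (w := [l]) rfl
  simpa using this

lemma range_letter_pow_le (n : ℕ) :
    LinearMap.range letter ^ n ≤ wordSpan {u | u.length = n} := by
  induction n with
  | zero =>
    rw [pow_zero, Submodule.one_le, ← wordBasis_nil]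
    exact wordBasis_mem rfl
  | succ n ih =>
    rw [pow_succ, Submodule.mul_le]
    rintro x hx _ ⟨a, rfl⟩
    exact mul_mem_wordSpan (fun u hu w hw => by
      rw [Set.mem_ofPred_eq, List.length_append, show u.length = n from hu,
        show w.length = 1 from hw]) (ih hx) (letter_mem_wordSpan a)

lemma wordBasis_mem_range_letter_pow (w : List Letter) :
    wordBasis w ∈ LinearMap.range letter ^ w.length := by
  induction w with
  | nil => rw [wordBasis_nil, List.length_nil, pow_zero]; exact Submodule.one_le.1 le_rfl
  | cons l w ih =>
    rw [wordBasis_cons, List.length_cons, pow_succ']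
    exact Submodule.mul_mem_mul ⟨_, rfl⟩ ih

lemma gradeProj_eq_zero_of_even (t : ZMod 18) (c : Cobar) (hc : c ∈ evenCobar) :
    gradeProj (2 * t + 1) c = 0 := by
  have h : evenCobar ≤ wordSpan {u | Even u.length} := iSup_le fun m =>
    (range_letter_pow_le (2 * m)).trans (wordSpan_mono fun u hu => by
      rw [Set.mem_ofPred_eq, show u.length = 2 * m from hu]; exact even_two_mul m)
  refine wordProj_of_disjoint (fun u hu hu' => ?_) (h hc)
  have h1 := parity_grade u
  rw [show grade u = 2 * t + 1 from hu', map_add, parity_two_mul, map_one, zero_add] at h1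
  have h2 : Even u.length := hu
  rw [(ZMod.natCast_eq_zero_iff_even).2 h2] at h1
  exact one_ne_zero h1

lemma gradeProj_mem_evenCobar (t : ZMod 18) (c : Cobar) : gradeProj (2 * t) c ∈ evenCobar := by
  have h : wordSpan {u | grade u = 2 * t} ≤ evenCobar := wordSpan_le.2 fun w hw => by
    have h1 := parity_grade w
    rw [show grade w = 2 * t from hw, parity_two_mul] at h1
    obtain ⟨m, hm⟩ := (ZMod.natCast_eq_zero_iff_even).1 h1.symm
    have h2 := wordBasis_mem_range_letter_pow w
    rw [hm, ← two_mul] at h2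
    exact Submodule.mem_iSup_of_mem m h2
  exact h (gradeProj_mem _ c)

end MPASS

end

theorem proposition6p1 :
    -- the differential on `h₁₀ x`
    (∀ (s r : ℕ) (x : MPASS.E 2 s) (y : MPASS.E 2 (s + r)) (z : MPASS.E 2 (s + r + 4)),
      2 ≤ r →
      (∀ r' : ℕ, 2 ≤ r' → r' < r → MPASS.DiffEq r' x 0) →
      y ∈ MPASS.WPlus (s + r) → MPASS.DiffEq r x (MPASS.hE 2 (s + r) y) →
      z ∈ MPASS.WPlus (s + r + 4) → MPASS.DiffEq 4 y (MPASS.hE 2 (s + r + 4) z) →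
      MPASS.DiffEq (r + 4) (MPASS.hE 2 s x) (MPASS.bE 2 (s + r + 4) z)) ∧
    -- all of `d_2, …, d_8` in terms of `d_4` on `W₊`
    (∀ r ∈ ({2, 3, 5, 6, 7} : Set ℕ), ∀ s : ℕ, MPASS.dE r s = 0) ∧
    (∀ (s : ℕ) (v : MPASS.E 2 s), ∃! p : MPASS.E 2 s × MPASS.E 2 s,
      p.1 ∈ MPASS.WPlus s ∧ p.2 ∈ MPASS.WPlus s ∧ v = p.1 + MPASS.hE 2 s p.2) ∧
    (∀ (s : ℕ), ∀ x ∈ MPASS.WPlus s,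
      MPASS.DiffEq 4 (MPASS.hE 2 s x) 0 ∧
      (MPASS.DiffEq 4 x 0 → MPASS.DiffEq 8 x 0) ∧
      (∃! y : MPASS.E 2 (s + 4), y ∈ MPASS.WPlus (s + 4) ∧
        MPASS.DiffEq 4 x (MPASS.hE 2 (s + 4) y)) ∧
      ∀ y ∈ MPASS.WPlus (s + 4), ∀ z ∈ MPASS.WPlus (s + 8),
        MPASS.DiffEq 4 x (MPASS.hE 2 (s + 4) y) →
        MPASS.DiffEq 4 y (MPASS.hE 2 (s + 8) z) →
        MPASS.DiffEq 8 (MPASS.hE 2 s x) (MPASS.bE 2 (s + 8) z)) :=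
  MPASS.proposition_of_model MPASS.cobarComplex (fun _ => rfl) rfl rfl rfl MPASS.gradeProj
    (fun _ => rfl) MPASS.gradeProj_eq_zero_of_even MPASS.gradeProj_mem_evenCobar
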